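/- Let $0<T\le\infty$. Consider triples $(u,P,d)$ on $\mathbb R^3\times[0,T)$ with values in $\mathbb R^3\times\mathbb R\times S^2$ such that $(u,d)\in C^\infty(\mathbb R^3\times[0,T),\mathbb R^3\times S^2)$, $u\in C([0,T),L^2(\mathbb R^3))$, $\nabla d\in C([0,T),L^2(\mathbb R^3))$, $P(t)$ is differentiable in $x$ for each $t\in(0,T)$, and in $\mathbb R^3\times(0,T)$ $$u_t+u\cdot\nabla u-\Delta u+\nabla P=-\nabla\cdot(\nabla d\odot\nabla d),\qquad \nabla\cdot u=0,\qquad d_t+u\cdot\nabla d=\Delta d+|\nabla d|^2d,$$ where $(\nabla d\odot\nabla d)_{ij}=\langle\partial_i d,\partial_j d\rangle$. Write $\operatorname{spt}\phi$ for the support of $\phi$ and $$D_\phi(t)=\int_{\mathbb R^3}\Big(\big|\nabla(|u(t)|^{3/2}\phi)\big|^2+\big|\nabla(|\nabla d(t)|^{3/2}\phi)\big|^2\Big).$$ There exists a universal constant $C>0$ such that for every $T\in(0,\infty]$, every such solution $(u,P,d)$, every $R>0$, $x_0\in\mathbb R^3$, every $\phi\in C_0^\infty(\mathbb R^3)$ with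 $0\le\phi\le1$, $\operatorname{spt}\phi\subset\overline{B_R(x_0)}$ and $|\nabla\phi|\le 4R^{-1}$, and every $t\in(0,T)$, the following hold (the suprema may be $+\infty$). (i) The function $t\mapsto\int_{\mathbb R^3}(|u|^3+|\nabla d|^3)\phi^2$ is differentiable at $t$, and at time $t$ $$\begin{aligned}\frac{d}{dt}\int_{\mathbb R^3}(|u|^3+|\nabla d|^3)\phi^2+D_\phi \le{}& C\int_{\mathbb R^3}(|u|^3+|\nabla d|^3)|\nabla\phi|^2 +CR^{-2}\sup_{y\in\mathbb R^3}\Big(\int_{B_R(y)}|u|^3+|\nabla d|^3\Big)^{5/3}\\ &+C\Big(\int_{\operatorname{spt}\phi}|u|^3+|\nabla d|^3\Big)^{2/3}D_\phi .\end{aligned}$$ (ii) There is $c(t)\in\mathbb R$ such that $$\Big(\int_{\mathbb R^3}|P(t)-c(t)|^3\phi^3\Big)^{1/3}\le C\Big(\int_{\operatorname{spt}\phi}|u(t)|^3+|\nabla d(t)|^3\Big)^{1/6}D_\phi(t)^{1/2} +CR^{-1}\sup_{y\in\mathbb R^3}\Big(\int_{B_R(y)}|u(t)|^3+|\nabla d(t)|^3\Big)^{2/3}.$$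 -/

import Mathlib

open MeasureTheory Filter Topology
open scoped ENNReal ContDiff

noncomputable section

namespace NematicFlow

/-- Three-dimensional Euclidean space. -/
abbrev E3 : Type := EuclideanSpace ℝ (Fin 3)

/-- The partial derivative `∂ᵢ f`. -/
def pd {F : Type*} [NormedAddCommGroup F] [NormedSpace ℝ F] (i : Fin 3) (f : E3 → F) (x : E3) : F :=
  fderiv ℝ f x (EuclideanSpace.single i 1)

/-- The divergence `∇ · v = ∑ᵢ ∂ᵢ vⁱ` of a vector field. -/
def divergence (v : E3 → E3) (x : E3) : ℝ := ∑ i, pd i v x i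

/-- The full gradient `∇ d = (∂ᵢ dʲ)ᵢⱼ`; its norm is the Frobenius norm. -/
def grad (d : E3 → E3) (x : E3) : EuclideanSpace ℝ (Fin 3 × Fin 3) :=
  WithLp.toLp 2 fun ij => pd ij.1 d x ij.2

/-- The matrix `(∇d ⊙ ∇d)ᵢⱼ = ⟨∂ᵢ d, ∂ⱼ d⟩`. -/
def odot (d : E3 → E3) (i j : Fin 3) (x : E3) : ℝ := inner ℝ (pd i d x) (pd j d x)

/-- The vector field `∇ · (∇d ⊙ ∇d)`, with `i`-th component `∑ⱼ ∂ⱼ (∇d ⊙ ∇d)ᵢⱼ`. -/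
def divOdot (d : E3 → E3) (x : E3) : E3 :=
  WithLp.toLp 2 fun i => ∑ j, pd j (odot d i j) x

/-- `f ∈ C([0,T), L²(ℝ³))`. -/
def ContinuousInL2 {F : Type*} [NormedAddCommGroup F] (T : EReal) (f : ℝ → E3 → F) : Prop :=
  (∀ t : ℝ, 0 ≤ t → (t : EReal) < T → MemLp (f t) 2 volume) ∧
  ∀ t : ℝ, 0 ≤ t → (t : EReal) < T →
    Tendsto (fun s => eLpNorm (f s - f t) 2 volume)
      (𝓝[{s : ℝ | 0 ≤ s ∧ (s : EReal) < T}] t) (𝓝 0)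

/-- `(u, P, d)` is a smooth solution on `ℝ³ × [0,T)`, `T ∈ (0,∞]`, of the nematic liquid crystal
flow (all physical constants equal to `1`), with `(u, d) ∈ C^∞(ℝ³ × [0,T), ℝ³ × S²)` and
`(u, ∇d) ∈ C([0,T), L²)`. No growth or integrability is required of the pressure. -/
structure IsSmoothSolution (T : EReal) (u : ℝ → E3 → E3) (P : ℝ → E3 → ℝ) (d : ℝ → E3 → E3) :
    Prop where
  smooth_u : ContDiffOn ℝ ∞ (fun p : ℝ × E3 => u p.1 p.2) {p | 0 ≤ p.1 ∧ (p.1 : EReal) < T}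
  smooth_d : ContDiffOn ℝ ∞ (fun p : ℝ × E3 => d p.1 p.2) {p | 0 ≤ p.1 ∧ (p.1 : EReal) < T}
  unit_d : ∀ (t : ℝ) (x : E3), 0 ≤ t → (t : EReal) < T → ‖d t x‖ = 1
  cont_u : ContinuousInL2 T u
  cont_grad_d : ContinuousInL2 T fun t => grad (d t)
  differentiable_P : ∀ t : ℝ, 0 < t → (t : EReal) < T → Differentiable ℝ (P t)
  momentum : ∀ (t : ℝ) (x : E3), 0 < t → (t : EReal) < T →
    deriv (fun s => u s x) t + fderiv ℝ (u t) x (u t x) - Laplacian.laplacian (u t) x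
      + gradient (P t) x = -divOdot (d t) x
  incompressible : ∀ (t : ℝ) (x : E3), 0 < t → (t : EReal) < T → divergence (u t) x = 0
  director : ∀ (t : ℝ) (x : E3), 0 < t → (t : EReal) < T →
    deriv (fun s => d s x) t + fderiv ℝ (d t) x (u t x)
      = Laplacian.laplacian (d t) x + ‖grad (d t) x‖ ^ 2 • d t x

/-- A cut-off function: `φ ∈ C₀^∞(ℝ³)`, `0 ≤ φ ≤ 1`, the support of `φ` lies in the closed ball
of radius `R` about `x₀`, and `|∇φ| ≤ 4 / R`. -/
structure IsCutoff (φ : E3 → ℝ) (x₀ : E3) (R : ℝ) : Prop where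
  smooth : ContDiff ℝ ∞ φ
  nonneg : ∀ x, 0 ≤ φ x
  le_one : ∀ x, φ x ≤ 1
  support_subset : tsupport φ ⊆ Metric.closedBall x₀ R
  grad_le : ∀ x, ‖gradient φ x‖ ≤ 4 / R

/-- The density `|v|³ + |∇e|³` at a fixed time. -/
def density (v e : E3 → E3) (x : E3) : ℝ := ‖v x‖ ^ 3 + ‖grad e x‖ ^ 3

/-- `∫ (|∇(|v|^{3/2} φ)|² + |∇(|∇e|^{3/2} φ)|²)`. -/
def dirichlet (v e : E3 → E3) (φ : E3 → ℝ) : ℝ :=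
  ∫ x, (‖gradient (fun y => ‖v y‖ ^ (3 / 2 : ℝ) * φ y) x‖ ^ 2
    + ‖gradient (fun y => ‖grad e y‖ ^ (3 / 2 : ℝ) * φ y) x‖ ^ 2)

/-- The uniform local energy `sup_y ∫_{B_R(y)} (|v|³ + |∇e|³)`, an element of `[0,∞]`. -/
def ulocEnergy (v e : E3 → E3) (R : ℝ) : ℝ≥0∞ :=
  ⨆ y : E3, ∫⁻ x in Metric.ball y R, ENNReal.ofReal (density v e x)

end NematicFlow

end

/-! The only nonlocal object is the pressure, and (i) follows from (ii). Test the momentum equation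
with 3φ²|u|u and the gradient of the director equation with 3φ²|∇d|∇d. Diffusion produces D_φ
together with |u||∇u|²φ² and |∇d||∇²d|²φ², at the cost of (|u|³ + |∇d|³)|∇φ|². Since |d| = 1, ∂ᵢd is
orthogonal to d, so the term |∇d|²d contributes only |∇d|⁵φ². Young's inequality absorbs every
remaining second-order factor and leaves (|u|⁵ + |∇d|⁵)φ² and |P - c|²|u|φ², for any constant c
(`IsSmoothSolution.energy_le`). Sobolev's inequality for |v|^{3/2}φ and Hölder's inequality
(`exists_interpolation`) bound the first by (∫_{spt φ} |v|³)^{2/3} D_φ; the second is at most ‖(P -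
c)φ‖₃² ‖u‖_{L³(spt φ)}, and (ii) applies.

For (ii), write f = u⊗u + ∇d⊙∇d. Formally -ΔP = ∂ᵢ∂ⱼfᵢⱼ, but P has no growth condition, so a
harmonic part must be excluded. This uses the evolution equation. For a test function ζ, let Φ be
its Newtonian potential cut off at radius r. Then e = ΔΦ + ζ is O(r⁻²) and lives in a ball of radius
O(r), so ∫ uₖ e tends to 0 because u is in L². Its time derivative converges, uniformly for times
near t, to minus ∫ ∂ₖP ζ + ∑ ∫ fᵢⱼ ∂ᵢ∂ⱼ∂ₖ(-Δ)⁻¹ζ, which therefore vanishes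
(`IsSmoothSolution.integral_pd_P_mul`). Hence the defect of the formula P = ∂ᵢ∂ⱼ(-Δ)⁻¹fᵢⱼ is a
functional that kills derivatives, so it is translation invariant, so it is a multiple of the
integral (`IsSmoothSolution.exists_pressure_eq`).

The local bound is proved by duality against φψ with ψ in L^{3/2} (`exists_pot_duality`). Inside the
ball of radius 2R, ∂ᵢ∂ⱼ(-Δ)⁻¹(φψ) is φ ∂ᵢ∂ⱼ(-Δ)⁻¹ψ plus a commutator with kernel O(R⁻¹|x - y|⁻²).
The former is paired with fφ in L³; the latter is bounded by the Hardy–Littlewood–Sobolev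
inequality. Outside that ball, freezing the kernel at x₀ costs O(R|x - x₀|⁻⁴), summable against a
uniform local bound, and the frozen part is a constant that goes into c(t).

The L³ boundedness of ∂ᵢ∂ⱼ(-Δ)⁻¹ comes from a Bellman function. Writing (-Δ)⁻¹ as a time integral of
the heat flow reduces the bilinear form to ∫∫ |∂ᵢe^{sΔ}f| |∂ⱼe^{sΔ}ψ|. A convex function comparable
to |a|³ + |b|^{3/2}, whose Hessian dominates 3|a'||b'|, is evaluated along the flow, and its
dissipation bounds this integral (`abs_integral_mul_pot_le_add`). -/

noncomputable section

namespace NematicFlow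

/-! ### Partial derivatives and test functions -/

section Calculus

variable {F : Type*} [NormedAddCommGroup F] [NormedSpace ℝ F]

/-- A compactly supported smooth function on `ℝ³`. -/
structure IsTest (η : E3 → ℝ) : Prop where
  smooth : ContDiff ℝ ∞ η
  compact : HasCompactSupport η

theorem contDiff_pd {f : E3 → F} (hf : ContDiff ℝ ∞ f) (i : Fin 3) : ContDiff ℝ ∞ (pd i f) :=
  (hf.fderiv_right (m := ∞) (by simp)).clm_apply contDiff_const

theorem continuous_pd {f : E3 → F} (hf : ContDiff ℝ 1 f) (i : Fin 3) : Continuous (pd i f) :=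
  (hf.continuous_fderiv one_ne_zero).clm_apply continuous_const

theorem hasCompactSupport_pd {f : E3 → F} (hf : HasCompactSupport f) (i : Fin 3) :
    HasCompactSupport (pd i f) :=
  hf.fderiv_apply (𝕜 := ℝ) _

theorem IsTest.pd {η : E3 → ℝ} (h : IsTest η) (i : Fin 3) : IsTest (pd i η) :=
  ⟨contDiff_pd h.smooth i, hasCompactSupport_pd h.compact i⟩

theorem IsTest.continuous {η : E3 → ℝ} (h : IsTest η) : Continuous η := h.smooth.continuous

theorem IsTest.differentiable {η : E3 → ℝ} (h : IsTest η) : Differentiable ℝ η :=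
  h.smooth.differentiable (by simp)

theorem IsTest.contDiff_one {η : E3 → ℝ} (h : IsTest η) : ContDiff ℝ 1 η :=
  h.smooth.of_le ENat.LEInfty.out

theorem IsTest.integrable {η : E3 → ℝ} (h : IsTest η) : Integrable η :=
  h.continuous.integrable_of_hasCompactSupport h.compact

theorem IsTest.mul_left {η g : E3 → ℝ} (h : IsTest η) (hg : ContDiff ℝ ∞ g) :
    IsTest (fun x => g x * η x) :=
  ⟨hg.mul h.smooth, h.compact.mul_left⟩

theorem IsTest.mul_right {η g : E3 → ℝ} (h : IsTest η) (hg : ContDiff ℝ ∞ g) :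
    IsTest (fun x => η x * g x) :=
  ⟨h.smooth.mul hg, h.compact.mul_right⟩

theorem IsTest.add {η g : E3 → ℝ} (h : IsTest η) (hg : IsTest g) :
    IsTest (fun x => η x + g x) :=
  ⟨h.smooth.add hg.smooth, h.compact.add hg.compact⟩

theorem isTest_zero : IsTest (fun _ => 0) := ⟨contDiff_const, HasCompactSupport.zero⟩

theorem IsTest.sum {ι : Type*} (s : Finset ι) {η : ι → E3 → ℝ} (h : ∀ i, IsTest (η i)) :
    IsTest (fun x => ∑ i ∈ s, η i x) := by
  classical
  induction s using Finset.induction_on with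
  | empty => simpa using isTest_zero
  | insert a s ha ih =>
    simp only [Finset.sum_insert ha]
    exact (h a).add ih

theorem IsTest.exists_bound {η : E3 → ℝ} (h : IsTest η) : ∃ C, 0 ≤ C ∧ ∀ x, |η x| ≤ C := by
  obtain ⟨C, hC⟩ := h.compact.exists_bound_of_continuous h.continuous
  exact ⟨C, (abs_nonneg _).trans (hC 0), hC⟩

theorem IsTest.exists_ball {η : E3 → ℝ} (h : IsTest η) :
    ∃ r, 0 < r ∧ ∀ x, r < ‖x‖ → η x = 0 := by
  obtain ⟨r, hr⟩ := h.compact.isCompact.isBounded.subset_closedBall 0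
  refine ⟨max r 1, by positivity, fun x hx => image_eq_zero_of_notMem_tsupport fun hm => ?_⟩
  have := hr hm
  simp only [Metric.mem_closedBall, dist_zero_right] at this
  exact absurd (lt_of_le_of_lt (le_max_left r 1) hx) (not_lt.2 this)

theorem pd_mul {f g : E3 → ℝ} {x : E3} (hf : DifferentiableAt ℝ f x)
    (hg : DifferentiableAt ℝ g x) (i : Fin 3) :
    pd i (fun y => f y * g y) x = pd i f x * g x + f x * pd i g x := by
  unfold pd
  rw [fderiv_fun_mul hf hg]
  simp
  ring

theorem pd_add {f g : E3 → F} {x : E3} (hf : DifferentiableAt ℝ f x)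
    (hg : DifferentiableAt ℝ g x) (i : Fin 3) :
    pd i (fun y => f y + g y) x = pd i f x + pd i g x := by
  unfold pd
  rw [fderiv_fun_add hf hg]
  simp

theorem pd_sub {f g : E3 → F} {x : E3} (hf : DifferentiableAt ℝ f x)
    (hg : DifferentiableAt ℝ g x) (i : Fin 3) :
    pd i (fun y => f y - g y) x = pd i f x - pd i g x := by
  unfold pd
  rw [fderiv_fun_sub hf hg]
  simp

theorem pd_sum {ι : Type*} (s : Finset ι) {f : ι → E3 → F} {x : E3}
    (hf : ∀ j, DifferentiableAt ℝ (f j) x) (i : Fin 3) :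
    pd i (fun y => ∑ j ∈ s, f j y) x = ∑ j ∈ s, pd i (f j) x := by
  unfold pd
  rw [fderiv_fun_sum fun j _ => hf j]
  simp

theorem pd_const_mul {f : E3 → ℝ} {x : E3} (hf : DifferentiableAt ℝ f x) (c : ℝ) (i : Fin 3) :
    pd i (fun y => c * f y) x = c * pd i f x := by
  unfold pd
  rw [fderiv_const_mul hf]
  simp

theorem pd_comm {f : E3 → F} (hf : ContDiff ℝ ∞ f) (i j : Fin 3) (x : E3) :
    pd i (pd j f) x = pd j (pd i f) x := by
  have h2 : ContDiffAt ℝ 2 f x := hf.contDiffAt.of_le ENat.LEInfty.out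
  have hsym := h2.isSymmSndFDerivAt (by simp)
  have hd : DifferentiableAt ℝ (fderiv ℝ f) x :=
    ((hf.fderiv_right (m := ∞) (by simp)).differentiable (by simp)).differentiableAt
  have key : ∀ k l, pd k (pd l f) x =
      fderiv ℝ (fderiv ℝ f) x (EuclideanSpace.single k 1) (EuclideanSpace.single l 1) := by
    intro k l
    unfold pd
    rw [fderiv_clm_apply hd (differentiableAt_const _)]
    simp
  rw [key, key]
  exact hsym.eq _ _

theorem pd_clm_comp {G : Type*} [NormedAddCommGroup G] [NormedSpace ℝ G] (L : F →L[ℝ] G)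
    {f : E3 → F} {x : E3} (hf : DifferentiableAt ℝ f x) (i : Fin 3) :
    pd i (fun y => L (f y)) x = L (pd i f x) := by
  unfold pd
  have h : HasFDerivAt (fun y => L (f y)) _ x := L.hasFDerivAt.comp x hf.hasFDerivAt
  rw [h.fderiv]
  simp

theorem pd_apply {ι : Type*} [Fintype ι] {f : E3 → EuclideanSpace ℝ ι} {x : E3}
    (hf : DifferentiableAt ℝ f x) (i : Fin 3) (j : ι) :
    pd i f x j = pd i (fun y => f y j) x :=
  (pd_clm_comp (EuclideanSpace.proj (𝕜 := ℝ) j) hf i).symm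

theorem fderiv_eq_sum_pd {f : E3 → F} (x v : E3) :
    fderiv ℝ f x v = ∑ i, v i • pd i f x := by
  have hv : v = ∑ i, v i • (EuclideanSpace.single i (1 : ℝ) : E3) := by
    ext j
    fin_cases j <;> simp [Fin.sum_univ_three]
  conv_lhs => rw [hv]
  simp [pd]

theorem pd_eq_gradient {f : E3 → ℝ} (x : E3) (i : Fin 3) : pd i f x = gradient f x i := by
  have : pd i f x = inner ℝ (gradient f x) (EuclideanSpace.single i 1) := by
    simp [pd, gradient, InnerProductSpace.toDual_symm_apply]
  rw [this, EuclideanSpace.inner_single_right]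
  simp

theorem norm_gradient_sq {f : E3 → ℝ} (x : E3) : ‖gradient f x‖ ^ 2 = ∑ i, pd i f x ^ 2 := by
  rw [EuclideanSpace.norm_sq_eq]
  simp [pd_eq_gradient]

theorem norm_gradient_eq_norm_fderiv {f : E3 → ℝ} (x : E3) : ‖gradient f x‖ = ‖fderiv ℝ f x‖ := by
  simp [gradient]

theorem laplacian_eq_sum_pd {f : E3 → F} (hf : ContDiff ℝ ∞ f) (x : E3) :
    Laplacian.laplacian f x = ∑ i, pd i (pd i f) x := by
  rw [InnerProductSpace.laplacian_eq_iteratedFDeriv_orthonormalBasis f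
    (EuclideanSpace.basisFun (Fin 3) ℝ)]
  have hd : DifferentiableAt ℝ (fderiv ℝ f) x :=
    ((hf.fderiv_right (m := ∞) (by simp)).differentiable (by simp)).differentiableAt
  refine Finset.sum_congr rfl fun i _ => ?_
  rw [iteratedFDeriv_two_apply]
  unfold pd
  rw [fderiv_clm_apply hd (differentiableAt_const _)]
  simp

/-- Integration by parts when the first factor is compactly supported. -/
theorem integral_mul_pd {f g : E3 → ℝ} (hf : ContDiff ℝ 1 f) (hg : ContDiff ℝ 1 g)
    (hc : HasCompactSupport f) (i : Fin 3) :
    ∫ x, f x * pd i g x = -∫ x, pd i f x * g x := by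
  have hcf := continuous_pd hf i
  have hcg := continuous_pd hg i
  unfold pd at *
  refine integral_mul_fderiv_eq_neg_fderiv_mul_of_integrable ?_ ?_ ?_ ?_ ?_
  · exact (hcf.mul hg.continuous).integrable_of_hasCompactSupport
      (hasCompactSupport_pd hc i).mul_right
  · exact (hf.continuous.mul hcg).integrable_of_hasCompactSupport hc.mul_right
  · exact (hf.continuous.mul hg.continuous).integrable_of_hasCompactSupport hc.mul_right
  · exact fun x _ => (hf.differentiable one_ne_zero).differentiableAt
  · exact fun x _ => (hg.differentiable one_ne_zero).differentiableAt

/-- Integration by parts when the second factor is compactly supported. -/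
theorem integral_mul_pd' {f g : E3 → ℝ} (hf : ContDiff ℝ 1 f) (hg : ContDiff ℝ 1 g)
    (hc : HasCompactSupport g) (i : Fin 3) :
    ∫ x, f x * pd i g x = -∫ x, pd i f x * g x := by
  have := integral_mul_pd hg hf hc i
  simp only [mul_comm (g _), mul_comm (pd i g _)] at this
  rw [this, neg_neg]

/-! ### Convolution with test functions -/

/-- The convolution `(k * η)(x) = ∫ k(z) η(x - z) dz`. -/
def cv (k η : E3 → ℝ) (x : E3) : ℝ := ∫ z, k z * η (x - z)

theorem cv_eq_convolution (k η : E3 → ℝ) :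
    cv k η = MeasureTheory.convolution k η (ContinuousLinearMap.mul ℝ ℝ) volume := by
  ext x
  simp [cv, convolution_def]

theorem cv_swap (k η : E3 → ℝ) (x : E3) : cv k η x = ∫ y, k (x - y) * η y := by
  rw [cv, ← integral_sub_left_eq_self _ volume x]
  simp

theorem integrable_cv {k η : E3 → ℝ} (hk : LocallyIntegrable k) (hη : Continuous η)
    (hc : HasCompactSupport η) (x : E3) : Integrable fun z => k z * η (x - z) := by
  have := hc.convolutionExists_right (ContinuousLinearMap.mul ℝ ℝ) hk hη x
  exact this

theorem integrable_cv_swap {k η : E3 → ℝ} (hk : LocallyIntegrable k) (hη : Continuous η)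
    (hc : HasCompactSupport η) (x : E3) : Integrable fun y => k (x - y) * η y := by
  have := (integrable_cv hk hη hc x).comp_sub_left x
  simpa using this

theorem contDiff_cv {k η : E3 → ℝ} (hk : LocallyIntegrable k) (hη : IsTest η) :
    ContDiff ℝ ∞ (cv k η) := by
  rw [cv_eq_convolution]
  exact hη.compact.contDiff_convolution_right _ hk (n := ⊤) hη.smooth

theorem pd_cv {k η : E3 → ℝ} (hk : LocallyIntegrable k) (hη : IsTest η) (i : Fin 3) (x : E3) :
    pd i (cv k η) x = cv k (pd i η) x := by
  have h := hη.compact.hasFDerivAt_convolution_right (ContinuousLinearMap.mul ℝ ℝ) hk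
    hη.contDiff_one x
  rw [← cv_eq_convolution] at h
  rw [pd, h.fderiv, convolution_precompR_apply _ hk (hη.compact.fderiv ℝ)
    (hη.contDiff_one.continuous_fderiv one_ne_zero)]
  simp [cv, convolution_def, pd]

theorem pd_cv_fun {k η : E3 → ℝ} (hk : LocallyIntegrable k) (hη : IsTest η) (i : Fin 3) :
    pd i (cv k η) = cv k (pd i η) :=
  funext fun x => pd_cv hk hη i x

/-- Derivatives may be moved from a test function to a smooth kernel. -/
theorem cv_pd {k η : E3 → ℝ} (hk : ContDiff ℝ 1 k) (hη : IsTest η) (i : Fin 3) (x : E3) :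
    cv k (pd i η) x = cv (pd i k) η x := by
  have hrefl : ∀ y, pd i (fun y => k (x - y)) y = -pd i k (x - y) := by
    intro y
    have h1 : HasFDerivAt k (fderiv ℝ k (x - y)) (x - y) :=
      (hk.differentiable one_ne_zero).differentiableAt.hasFDerivAt
    have h2 := h1.comp y ((hasFDerivAt_const x y).sub (hasFDerivAt_id y))
    have h3 : HasFDerivAt (fun y => k (x - y)) _ y := h2
    rw [pd, h3.fderiv]
    simp [pd]
  have hk' : ContDiff ℝ 1 fun y => k (x - y) := hk.comp (contDiff_const.sub contDiff_id)
  rw [cv_swap, cv_swap, integral_mul_pd' hk' hη.contDiff_one hη.compact, ← integral_neg]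
  refine integral_congr_ae (Eventually.of_forall fun y => ?_)
  have := hrefl y
  simp only [this]
  ring

end Calculus

end NematicFlow

end

noncomputable section

namespace NematicFlow

/-! ### The heat kernel -/

section HeatKernel

open Real

/-- The heat kernel on `ℝ³`. -/
def heatK (s : ℝ) (z : E3) : ℝ := (4 * π * s) ^ (-(3 / 2) : ℝ) * exp (-(4 * s)⁻¹ * ‖z‖ ^ 2)

theorem heatK_pos {s : ℝ} (hs : 0 < s) (z : E3) : 0 < heatK s z := by
  unfold heatK; positivity

theorem heatK_neg (s : ℝ) (z : E3) : heatK s (-z) = heatK s z := by simp [heatK]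

theorem contDiff_heatK (s : ℝ) : ContDiff ℝ ∞ (heatK s) := by
  unfold heatK
  exact contDiff_const.mul ((contDiff_const.mul (contDiff_norm_sq ℝ)).exp)

theorem continuous_heatK (s : ℝ) : Continuous (heatK s) := (contDiff_heatK s).continuous

theorem integral_heatK {s : ℝ} (hs : 0 < s) : ∫ z, heatK s z = 1 := by
  unfold heatK
  rw [integral_const_mul, GaussianFourier.integral_rexp_neg_mul_sq_norm (by positivity)]
  have : (π / (4 * s)⁻¹) = 4 * π * s := by field_simp
  rw [this]
  simp only [finrank_euclideanSpace, Fintype.card_fin, Nat.cast_ofNat]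
  rw [← rpow_add (by positivity)]
  norm_num

theorem integrable_heatK {s : ℝ} (hs : 0 < s) : Integrable (heatK s) := by
  by_contra h
  have := integral_heatK hs
  rw [integral_undef h] at this
  norm_num at this

theorem locallyIntegrable_heatK (s : ℝ) : LocallyIntegrable (heatK s) :=
  (continuous_heatK s).locallyIntegrable

theorem pd_coord (k i : Fin 3) (z : E3) :
    pd k (fun z : E3 => z i) z = if k = i then 1 else 0 := by
  have : (fun z : E3 => z i) = EuclideanSpace.proj (𝕜 := ℝ) i := rfl
  rw [pd, this, ContinuousLinearMap.fderiv]
  simp [eq_comm]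

theorem differentiable_coord (i : Fin 3) : Differentiable ℝ (fun z : E3 => z i) :=
  (EuclideanSpace.proj (𝕜 := ℝ) i : E3 →L[ℝ] ℝ).differentiable

theorem pd_heatK (s : ℝ) (i : Fin 3) (z : E3) :
    pd i (heatK s) z = -(2 * s)⁻¹ * z i * heatK s z := by
  have h1 : HasFDerivAt (fun z : E3 => ‖z‖ ^ 2) (2 • innerSL ℝ z) z :=
    (hasStrictFDerivAt_norm_sq z).hasFDerivAt
  have h2 := ((h1.const_mul (-(4 * s)⁻¹)).exp).const_mul ((4 * π * s) ^ (-(3 / 2) : ℝ))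
  have h3 : HasFDerivAt (heatK s) _ z := h2
  rw [pd, h3.fderiv]
  simp only [heatK, smul_apply, smul_eq_mul, innerSL_apply_apply,
    EuclideanSpace.inner_single_right, nsmul_eq_mul, mul_inv]
  simp
  ring

/-- The second derivatives of the heat kernel. -/
def heatK2 (i j : Fin 3) (s : ℝ) (z : E3) : ℝ :=
  ((4 * s ^ 2)⁻¹ * (z i * z j) - (2 * s)⁻¹ * (if i = j then 1 else 0)) * heatK s z

theorem differentiable_heatK (s : ℝ) : Differentiable ℝ (heatK s) :=
  (contDiff_heatK s).differentiable (by simp)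

theorem pd_pd_heatK (s : ℝ) (i j : Fin 3) (z : E3) :
    pd i (pd j (heatK s)) z = heatK2 i j s z := by
  have : pd j (heatK s) = fun z => (-(2 * s)⁻¹ * z j) * heatK s z :=
    funext fun z => pd_heatK s j z
  rw [this, pd_mul ((differentiable_coord j).differentiableAt.const_mul _)
    (differentiable_heatK s).differentiableAt, pd_const_mul (differentiable_coord j).differentiableAt,
    pd_coord, pd_heatK, heatK2]
  by_cases hs : s = 0
  · simp [hs]
  · field_simp
    ring

theorem pd_pd_heatK_fun (s : ℝ) (i j : Fin 3) : pd i (pd j (heatK s)) = heatK2 i j s :=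
  funext fun z => pd_pd_heatK s i j z

theorem contDiff_heatK2 (i j : Fin 3) (s : ℝ) : ContDiff ℝ ∞ (heatK2 i j s) := by
  rw [← pd_pd_heatK_fun]
  exact contDiff_pd (contDiff_pd (contDiff_heatK s) j) i

theorem pd_heatK2 (s : ℝ) (i j k : Fin 3) (z : E3) :
    pd k (heatK2 i j s) z = ((4 * s ^ 2)⁻¹ * ((if k = i then 1 else 0) * z j +
      z i * (if k = j then 1 else 0))) * heatK s z
      + ((4 * s ^ 2)⁻¹ * (z i * z j) - (2 * s)⁻¹ * (if i = j then 1 else 0)) *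
        (-(2 * s)⁻¹ * z k * heatK s z) := by
  have hd : Differentiable ℝ (fun z : E3 => z i * z j) :=
    (differentiable_coord i).mul (differentiable_coord j)
  have hd' : Differentiable ℝ (fun z : E3 => (4 * s ^ 2)⁻¹ * (z i * z j)) := hd.const_mul _
  have e : heatK2 i j s = fun z => ((4 * s ^ 2)⁻¹ * (z i * z j) -
    (2 * s)⁻¹ * (if i = j then 1 else 0)) * heatK s z := rfl
  have hd2 : Differentiable ℝ (fun z : E3 => (4 * s ^ 2)⁻¹ * (z i * z j) -
    (2 * s)⁻¹ * (if i = j then 1 else 0)) := hd'.sub_const _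
  rw [e, pd_mul hd2.differentiableAt (differentiable_heatK s).differentiableAt,
    pd_sub hd'.differentiableAt (differentiableAt_const _), pd_const_mul hd.differentiableAt,
    pd_mul (differentiable_coord i).differentiableAt (differentiable_coord j).differentiableAt,
    pd_coord, pd_coord, pd_heatK]
  simp [pd]

theorem hasDerivAt_heatK {s : ℝ} (hs : 0 < s) (z : E3) :
    HasDerivAt (fun s => heatK s z) (∑ i, heatK2 i i s z) s := by
  have h1 : HasDerivAt (fun s : ℝ => (4 * π * s) ^ (-(3 / 2) : ℝ))
      (4 * π * (-(3 / 2)) * (4 * π * s) ^ (-(3 / 2) - 1 : ℝ)) s := by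
    have h0 : HasDerivAt (fun s : ℝ => 4 * π * s) (4 * π) s := by
      simpa using (hasDerivAt_id s).const_mul (4 * π)
    exact h0.rpow_const (Or.inl (by positivity))
  have h2 : HasDerivAt (fun s : ℝ => -(4 * s)⁻¹ * ‖z‖ ^ 2) (4 * ((4 * s) ^ 2)⁻¹ * ‖z‖ ^ 2) s := by
    have h0 : HasDerivAt (fun s : ℝ => 4 * s) 4 s := by
      simpa using (hasDerivAt_id s).const_mul (4 : ℝ)
    exact ((h0.inv (by positivity)).neg.mul_const (‖z‖ ^ 2)).congr_deriv (by field_simp)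
  have h3 : HasDerivAt (fun s => heatK s z) _ s := h1.mul h2.exp
  convert h3 using 1
  rw [rpow_sub_one (by positivity)]
  simp only [heatK2, heatK, Fin.sum_univ_three, EuclideanSpace.norm_sq_eq, Real.norm_eq_abs, sq_abs,
    if_true]
  field_simp
  ring

/-- One term of the exponential series at (1 + x)/4 dominates the polynomial; the leftover factor
exp(1/4) is rounded up to exp 1. -/
theorem one_add_pow_mul_exp_le (n : ℕ) {x : ℝ} (hx : 0 ≤ x) :
    (1 + x) ^ n * exp (-x / 4) ≤ 4 ^ n * n.factorial * exp 1 := by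
  have h := pow_div_factorial_le_exp ((1 + x) / 4) (by positivity) n
  rw [div_pow, div_div, div_le_iff₀ (by positivity)] at h
  calc (1 + x) ^ n * exp (-x / 4) ≤
        (exp ((1 + x) / 4) * (4 ^ n * n.factorial)) * exp (-x / 4) := by gcongr
    _ = 4 ^ n * n.factorial * exp (1 / 4) := by
        have : exp ((1 + x) / 4) * exp (-x / 4) = exp (1 / 4) := by
          rw [← exp_add]; ring_nf
        rw [← this]; ring
    _ ≤ _ := by gcongr; norm_num

/-- Parabolic scaling. With x = ‖z‖²/s one has s + ‖z‖² = s(1 + x), so every negative power of s is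
the same power of s + ‖z‖² times a power of 1 + x, and the Gaussian exp(-x/4) swallows the latter.
-/
theorem heatK_mul_le (a b : ℕ) : ∃ C, 0 < C ∧ ∀ s : ℝ, 0 < s → ∀ z : E3,
    ‖z‖ ^ a * (s ^ b)⁻¹ * heatK s z ≤ C * (s + ‖z‖ ^ 2) ^ ((a - 2 * b - 3) / 2 : ℝ) := by
  refine ⟨4 ^ (b + 2) * (b + 2).factorial * exp 1, by positivity, fun s hs z => ?_⟩
  set w := s + ‖z‖ ^ 2 with hw
  have hw0 : 0 < w := by positivity
  set x := ‖z‖ ^ 2 / s with hx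
  have hx0 : 0 ≤ x := by positivity
  have hsx : w = s * (1 + x) := by rw [hw, hx]; field_simp
  have h1 : ‖z‖ ^ a ≤ w ^ (a / 2 : ℝ) := by
    have : ‖z‖ ^ a = (‖z‖ ^ 2) ^ (a / 2 : ℝ) := by
      rw [← rpow_natCast, ← rpow_natCast, ← rpow_mul (norm_nonneg _)]
      congr 1
      push_cast; ring
    rw [this]
    exact rpow_le_rpow (by positivity) (by rw [hw]; linarith) (by positivity)
  have h2 : (s ^ b)⁻¹ * (4 * π * s) ^ (-(3 / 2) : ℝ) ≤
      w ^ (-b - 3 / 2 : ℝ) * (1 + x) ^ (b + 2) := by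
    have e1 : (s ^ b)⁻¹ * s ^ (-(3 / 2) : ℝ) = s ^ (-b - 3 / 2 : ℝ) := by
      rw [← rpow_natCast, ← rpow_neg hs.le, ← rpow_add hs]; congr 1
    have e2 : (4 * π * s) ^ (-(3 / 2) : ℝ) ≤ s ^ (-(3 / 2) : ℝ) := by
      apply rpow_le_rpow_of_nonpos hs _ (by norm_num)
      nlinarith [pi_gt_three]
    have e3 : s ^ (-b - 3 / 2 : ℝ) = w ^ (-b - 3 / 2 : ℝ) * (1 + x) ^ (b + 3 / 2 : ℝ) := by
      rw [hsx, mul_rpow hs.le (by positivity), mul_assoc, ← rpow_add (by positivity)]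
      simp
    have e4 : (1 + x) ^ (b + 3 / 2 : ℝ) ≤ (1 + x) ^ (b + 2) := by
      rw [← rpow_natCast]
      apply rpow_le_rpow_of_exponent_le (by linarith)
      push_cast; linarith
    calc (s ^ b)⁻¹ * (4 * π * s) ^ (-(3 / 2) : ℝ) ≤ (s ^ b)⁻¹ * s ^ (-(3 / 2) : ℝ) := by gcongr
      _ = _ := e1.trans e3
      _ ≤ _ := by gcongr
  have h3 : exp (-(4 * s)⁻¹ * ‖z‖ ^ 2) = exp (-x / 4) := by
    congr 1; rw [hx]; field_simp
  calc ‖z‖ ^ a * (s ^ b)⁻¹ * heatK s z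
      = ‖z‖ ^ a * ((s ^ b)⁻¹ * (4 * π * s) ^ (-(3 / 2) : ℝ)) * exp (-x / 4) := by
        rw [heatK, h3]; ring
    _ ≤ w ^ (a / 2 : ℝ) * (w ^ (-b - 3 / 2 : ℝ) * (1 + x) ^ (b + 2)) * exp (-x / 4) := by gcongr
    _ = w ^ ((a - 2 * b - 3) / 2 : ℝ) * ((1 + x) ^ (b + 2) * exp (-x / 4)) := by
        have : w ^ ((a - 2 * b - 3) / 2 : ℝ) = w ^ (a / 2 : ℝ) * w ^ (-b - 3 / 2 : ℝ) := by
          rw [← rpow_add hw0]; congr 1; ring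
        rw [this]; ring
    _ ≤ w ^ ((a - 2 * b - 3) / 2 : ℝ) * (4 ^ (b + 2) * (b + 2).factorial * exp 1) := by
        exact mul_le_mul_of_nonneg_left (one_add_pow_mul_exp_le _ hx0) (by positivity)
    _ = _ := by ring

theorem abs_coord_le (z : E3) (i : Fin 3) : |z i| ≤ ‖z‖ := by
  simpa using PiLp.norm_apply_le z i

/-- The kernel and its second and third derivatives are sums of monomials in z and 1/s times the
kernel, and each monomial scales correctly. The bounds stay finite as s → 0 away from z = 0, so
integrating them in s gives the decay |z|⁻¹, |z|⁻³, |z|⁻⁴ of the corresponding elliptic kernels. -/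
theorem heatK_bounds : ∃ C, 0 < C ∧ ∀ s : ℝ, 0 < s → ∀ z : E3,
    heatK s z ≤ C * (s + ‖z‖ ^ 2) ^ (-(3 / 2) : ℝ) ∧
    (∀ i j, |heatK2 i j s z| ≤ C * (s + ‖z‖ ^ 2) ^ (-(5 / 2) : ℝ)) ∧
    (∀ i j k, |pd k (heatK2 i j s) z| ≤ C * (s + ‖z‖ ^ 2) ^ (-3 : ℝ)) := by
  obtain ⟨C0, h0, H0⟩ := heatK_mul_le 0 0
  obtain ⟨C2, h2, H2⟩ := heatK_mul_le 2 2
  obtain ⟨C3, h3, H3⟩ := heatK_mul_le 0 1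
  obtain ⟨C4, h4, H4⟩ := heatK_mul_le 3 3
  obtain ⟨C5, h5, H5⟩ := heatK_mul_le 1 2
  refine ⟨C0 + C2 + C3 + C4 + 2 * C5, by positivity, fun s hs z => ?_⟩
  have hK := (heatK_pos hs z).le
  specialize H0 s hs z
  specialize H2 s hs z
  specialize H3 s hs z
  specialize H4 s hs z
  specialize H5 s hs z
  have n := norm_nonneg z
  have e0 : (((0 : ℕ) : ℝ) - 2 * ((0 : ℕ) : ℝ) - 3) / 2 = -(3 / 2) := by norm_num
  have e2 : (((2 : ℕ) : ℝ) - 2 * ((2 : ℕ) : ℝ) - 3) / 2 = -(5 / 2) := by norm_num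
  have e3 : (((0 : ℕ) : ℝ) - 2 * ((1 : ℕ) : ℝ) - 3) / 2 = -(5 / 2) := by norm_num
  have e4 : (((3 : ℕ) : ℝ) - 2 * ((3 : ℕ) : ℝ) - 3) / 2 = -3 := by norm_num
  have e5 : (((1 : ℕ) : ℝ) - 2 * ((2 : ℕ) : ℝ) - 3) / 2 = -3 := by norm_num
  rw [e0] at H0
  rw [e2] at H2
  rw [e3] at H3
  rw [e4] at H4
  rw [e5] at H5
  simp only [pow_zero, pow_one, inv_one, one_mul, mul_one] at H0 H3 H5
  have w0 : 0 < s + ‖z‖ ^ 2 := by positivity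
  have p1 : 0 ≤ (s + ‖z‖ ^ 2) ^ (-(3 / 2) : ℝ) := by positivity
  have p2 : 0 ≤ (s + ‖z‖ ^ 2) ^ (-(5 / 2) : ℝ) := by positivity
  have p4 : 0 ≤ (s + ‖z‖ ^ 2) ^ (-3 : ℝ) := by positivity
  have ite_le : ∀ (p : Prop) [Decidable p], |(if p then 1 else 0 : ℝ)| ≤ 1 := by
    intro p _; split_ifs <;> simp
  have zz : ∀ i j : Fin 3, |z i * z j| ≤ ‖z‖ ^ 2 := fun i j => by
    rw [abs_mul, sq]; gcongr <;> exact abs_coord_le z _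
  have second : ∀ i j : Fin 3, |(4 * s ^ 2)⁻¹ * (z i * z j) -
      (2 * s)⁻¹ * (if i = j then 1 else 0)| ≤ ‖z‖ ^ 2 * (s ^ 2)⁻¹ + s⁻¹ := by
    intro i j
    refine (abs_sub _ _).trans ?_
    rw [abs_mul, abs_mul (2 * s)⁻¹, abs_of_pos (a := (4 * s ^ 2)⁻¹) (by positivity),
      abs_of_pos (a := (2 * s)⁻¹) (by positivity)]
    have a1 : (4 * s ^ 2)⁻¹ * |z i * z j| ≤ (1 * s ^ 2)⁻¹ * ‖z‖ ^ 2 := by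
      gcongr
      · norm_num
      · exact zz i j
    have a2 : (2 * s)⁻¹ * |(if i = j then 1 else 0 : ℝ)| ≤ (1 * s)⁻¹ * 1 := by
      gcongr
      · norm_num
      · exact ite_le _
    simp only [one_mul, mul_one] at a1 a2
    linarith
  refine ⟨?_, fun i j => ?_, fun i j k => ?_⟩
  · exact H0.trans (mul_le_mul_of_nonneg_right (by linarith) (by positivity))
  · rw [heatK2, abs_mul, abs_of_nonneg hK]
    calc _ ≤ (‖z‖ ^ 2 * (s ^ 2)⁻¹ + s⁻¹) * heatK s z := by gcongr; exact second i j
      _ = ‖z‖ ^ 2 * (s ^ 2)⁻¹ * heatK s z + s⁻¹ * heatK s z := by ring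
      _ ≤ C2 * (s + ‖z‖ ^ 2) ^ (-(5 / 2) : ℝ) + C3 * (s + ‖z‖ ^ 2) ^ (-(5 / 2) : ℝ) := by
          gcongr
      _ = (C2 + C3) * (s + ‖z‖ ^ 2) ^ (-(5 / 2) : ℝ) := by ring
      _ ≤ _ := mul_le_mul_of_nonneg_right (by linarith) (by positivity)
  · rw [pd_heatK2]
    have b1 : |((4 * s ^ 2)⁻¹ * ((if k = i then 1 else 0) * z j +
        z i * (if k = j then 1 else 0)))| ≤ ‖z‖ * (s ^ 2)⁻¹ := by
      rw [abs_mul, abs_of_pos (a := (4 * s ^ 2)⁻¹) (by positivity)]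
      have : |(if k = i then 1 else 0) * z j + z i * (if k = j then 1 else 0)| ≤ 2 * ‖z‖ := by
        refine (abs_add_le _ _).trans ?_
        rw [abs_mul, abs_mul]
        have := mul_le_mul (ite_le (k = i)) (abs_coord_le z j) (abs_nonneg _) zero_le_one
        have := mul_le_mul (abs_coord_le z i) (ite_le (k = j)) (abs_nonneg _) n
        linarith
      calc _ ≤ (4 * s ^ 2)⁻¹ * (2 * ‖z‖) := by gcongr
        _ = (1 / 2) * (‖z‖ * (s ^ 2)⁻¹) := by field_simp; ring
        _ ≤ _ := by
          have : 0 ≤ ‖z‖ * (s ^ 2)⁻¹ := by positivity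
          linarith
    have b2 : |-(2 * s)⁻¹ * z k * heatK s z| ≤ ‖z‖ * s⁻¹ * heatK s z := by
      rw [abs_mul, abs_mul, abs_neg, abs_of_pos (a := (2 * s)⁻¹) (by positivity),
        abs_of_nonneg hK]
      calc (2 * s)⁻¹ * |z k| * heatK s z ≤ (1 * s)⁻¹ * ‖z‖ * heatK s z := by
            gcongr
            · norm_num
            · exact abs_coord_le z k
        _ = _ := by ring
    refine (abs_add_le _ _).trans ?_
    rw [abs_mul _ (heatK s z), abs_mul _ (-(2 * s)⁻¹ * z k * heatK s z), abs_of_nonneg hK]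
    calc _ ≤ ‖z‖ * (s ^ 2)⁻¹ * heatK s z +
          (‖z‖ ^ 2 * (s ^ 2)⁻¹ + s⁻¹) * (‖z‖ * s⁻¹ * heatK s z) := by
          gcongr
          exact second i j
      _ = 2 * (‖z‖ * (s ^ 2)⁻¹ * heatK s z) + ‖z‖ ^ 3 * (s ^ 3)⁻¹ * heatK s z := by
          field_simp; ring
      _ ≤ 2 * (C5 * (s + ‖z‖ ^ 2) ^ (-3 : ℝ)) + C4 * (s + ‖z‖ ^ 2) ^ (-3 : ℝ) :=
          add_le_add (mul_le_mul_of_nonneg_left H5 zero_le_two) H4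
      _ = (2 * C5 + C4) * (s + ‖z‖ ^ 2) ^ (-3 : ℝ) := by ring
      _ ≤ _ := mul_le_mul_of_nonneg_right (by linarith) (by positivity)

end HeatKernel

end NematicFlow

end

noncomputable section

namespace NematicFlow

/-! ### The heat flow of a test function and its Newtonian potential -/

section Potential

open Real Set

theorem integrableOn_add_rpow {c a : ℝ} (hc : 0 < c) (ha : 1 < a) :
    IntegrableOn (fun s : ℝ => (s + c) ^ (-a)) (Ioi 0) :=
  integrableOn_add_rpow_Ioi_of_lt (by linarith) (by simpa using hc)

theorem integral_add_rpow {c a : ℝ} (hc : 0 < c) (ha : 1 < a) :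
    ∫ s in Ioi (0 : ℝ), (s + c) ^ (-a) = c ^ (1 - a) / (a - 1) := by
  have hd : ∀ s ∈ Ici (0 : ℝ), HasDerivAt (fun s => (s + c) ^ (1 - a) / (1 - a))
      ((s + c) ^ (-a)) s := by
    intro s hs
    have hs' : 0 < s + c := add_pos_of_nonneg_of_pos hs hc
    have h := (((hasDerivAt_id s).add_const c).rpow_const (p := 1 - a)
      (Or.inl hs'.ne')).div_const (1 - a)
    refine h.congr_deriv ?_
    have : 1 - a ≠ 0 := by linarith
    simp only [id, one_mul, sub_sub_cancel_left]
    field_simp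
  have ht : Tendsto (fun s : ℝ => (s + c) ^ (1 - a) / (1 - a)) atTop (𝓝 0) := by
    have h0 : Tendsto (fun s : ℝ => (s + c) ^ (-(a - 1))) atTop (𝓝 0) :=
      (tendsto_rpow_neg_atTop (by linarith)).comp (tendsto_atTop_add_const_right _ c tendsto_id)
    have h1 := h0.div_const (1 - a)
    simpa using h1
  rw [integral_Ioi_of_hasDerivAt_of_tendsto' hd (integrableOn_add_rpow hc ha) ht]
  have : 1 - a ≠ 0 := by linarith
  have : a - 1 ≠ 0 := by linarith
  simp only [zero_add, zero_sub]
  field_simp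
  ring

/-- The Newtonian kernel. -/
def newton (z : E3) : ℝ := ∫ s in Ioi (0 : ℝ), heatK s z

theorem measurable_heatK : Measurable fun p : ℝ × E3 => heatK p.1 p.2 := by
  unfold heatK
  fun_prop

theorem measurable_heatK2 (i j : Fin 3) : Measurable fun p : ℝ × E3 => heatK2 i j p.1 p.2 := by
  unfold heatK2
  exact Measurable.mul (by fun_prop) measurable_heatK

theorem newton_nonneg (z : E3) : 0 ≤ newton z :=
  setIntegral_nonneg measurableSet_Ioi fun _ hs => (heatK_pos hs z).le

theorem integrableOn_heatK {z : E3} (hz : z ≠ 0) : IntegrableOn (fun s => heatK s z) (Ioi 0) := by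
  obtain ⟨C, hC, H⟩ := heatK_bounds
  refine Integrable.mono' ((integrableOn_add_rpow (c := ‖z‖ ^ 2) (a := 3 / 2)
    (by positivity) (by norm_num)).const_mul C)
    (measurable_heatK.comp (measurable_id.prodMk measurable_const)).aestronglyMeasurable ?_
  filter_upwards [ae_restrict_mem measurableSet_Ioi] with s hs
  rw [norm_of_nonneg (heatK_pos hs z).le]
  exact (H s hs z).1

theorem exists_newton_le : ∃ C, 0 < C ∧ ∀ z : E3, z ≠ 0 → newton z ≤ C * ‖z‖⁻¹ := by
  obtain ⟨C, hC, H⟩ := heatK_bounds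
  refine ⟨C * 2, by positivity, fun z hz => ?_⟩
  have hz' : 0 < ‖z‖ := norm_pos_iff.2 hz
  calc newton z ≤ ∫ s in Ioi (0 : ℝ), C * (s + ‖z‖ ^ 2) ^ (-(3 / 2) : ℝ) := by
        refine setIntegral_mono_on (integrableOn_heatK hz)
          ((integrableOn_add_rpow (by positivity) (by norm_num)).const_mul C) measurableSet_Ioi ?_
        exact fun s hs => (H s hs z).1
    _ = _ := by
        rw [integral_const_mul, integral_add_rpow (by positivity) (by norm_num)]
        have : (‖z‖ ^ 2) ^ (1 - 3 / 2 : ℝ) = ‖z‖⁻¹ := by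
          rw [← rpow_natCast, ← rpow_mul hz'.le, ← rpow_neg_one]
          norm_num
        rw [this]
        ring

theorem stronglyMeasurable_newton : StronglyMeasurable newton := by
  have : StronglyMeasurable fun p : E3 × ℝ => heatK p.2 p.1 :=
    (measurable_heatK.comp measurable_swap).stronglyMeasurable
  exact this.integral_prod_right

theorem ae_ne_zero : ∀ᵐ z : E3, z ≠ 0 := by
  simp [ae_iff, measure_singleton]

theorem locallyIntegrable_newton : LocallyIntegrable newton := by
  obtain ⟨C, hC, H⟩ := exists_newton_le
  refine locallyIntegrable_of_norm_le_rpow (C := C) (α := 1) (by simp) (by simp) ?_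
    stronglyMeasurable_newton.aestronglyMeasurable
  filter_upwards [ae_ne_zero] with z hz
  rw [norm_of_nonneg (newton_nonneg z), rpow_neg_one]
  exact H z hz

/-- The heat flow. -/
def heat (s : ℝ) (η : E3 → ℝ) : E3 → ℝ := cv (heatK s) η

/-- The Newtonian potential, a solution of `-Δ Φ = η`. -/
def pot (η : E3 → ℝ) : E3 → ℝ := cv newton η

variable {η : E3 → ℝ}

theorem contDiff_pot (h : IsTest η) : ContDiff ℝ ∞ (pot η) := contDiff_cv locallyIntegrable_newton h

theorem pd_pot (h : IsTest η) (i : Fin 3) : pd i (pot η) = pot (pd i η) :=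
  pd_cv_fun locallyIntegrable_newton h i

theorem contDiff_heat (s : ℝ) (h : IsTest η) : ContDiff ℝ ∞ (heat s η) :=
  contDiff_cv (locallyIntegrable_heatK s) h

theorem pd_heat (s : ℝ) (h : IsTest η) (i : Fin 3) : pd i (heat s η) = heat s (pd i η) :=
  pd_cv_fun (locallyIntegrable_heatK s) h i

theorem heat_pd_pd (s : ℝ) (h : IsTest η) (i j : Fin 3) (x : E3) :
    heat s (pd i (pd j η)) x = ∫ y, heatK2 i j s (x - y) * η y := by
  rw [heat, cv_pd ((contDiff_heatK s).of_le ENat.LEInfty.out) (h.pd j),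
    cv_pd ((contDiff_pd (contDiff_heatK s) i).of_le ENat.LEInfty.out) h,
    show pd j (pd i (heatK s)) = pd i (pd j (heatK s)) from
      funext fun z => pd_comm (contDiff_heatK s) _ _ _, pd_pd_heatK_fun, cv_swap]

/-- The heat kernel is positive, so integrating the absolute value in time first yields exactly the
Newtonian kernel, which is locally integrable. -/
theorem integrable_heatK_mul (h : IsTest η) (x : E3) :
    Integrable (fun p : E3 × ℝ => heatK p.2 p.1 * η (x - p.1))
      (volume.prod (volume.restrict (Ioi 0))) := by
  rw [integrable_prod_iff]
  · constructor
    · filter_upwards [ae_ne_zero] with z hz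
      exact (integrableOn_heatK hz).mul_const _
    · have : (fun z : E3 => ∫ s in Ioi (0 : ℝ), ‖heatK s z * η (x - z)‖) =
          fun z => newton z * |η (x - z)| := by
        ext z
        rw [newton, ← integral_mul_const]
        refine setIntegral_congr_fun measurableSet_Ioi fun s hs => ?_
        simp [abs_of_pos (heatK_pos hs z)]
      simp only [this]
      exact integrable_cv (η := fun x => |η x|) locallyIntegrable_newton h.continuous.abs
        h.compact.abs x
  · refine AEStronglyMeasurable.mul ?_ ?_
    · exact (measurable_heatK.comp measurable_swap).aestronglyMeasurable
    · exact (h.continuous.comp (continuous_const.sub continuous_fst)).aestronglyMeasurable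

/-- This representation replaces principal values: second derivatives are taken at a fixed time s,
where the kernel is smooth, and only then integrated in s. -/
theorem pot_eq_integral_heat (h : IsTest η) (x : E3) :
    pot η x = ∫ s in Ioi (0 : ℝ), heat s η x := by
  have := integral_integral_swap (f := fun z s => heatK s z * η (x - z))
    (integrable_heatK_mul h x)
  simp only [heat, cv]
  rw [← this, pot, cv]
  refine integral_congr_ae (Eventually.of_forall fun z => ?_)
  simp only [newton]
  rw [integral_mul_const]

theorem integrableOn_heat (h : IsTest η) (x : E3) :
    IntegrableOn (fun s => heat s η x) (Ioi 0) :=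
  (integrable_heatK_mul h x).integral_prod_right

theorem pot_pd_pd (h : IsTest η) (i j : Fin 3) (x : E3) :
    pot (pd i (pd j η)) x = ∫ s in Ioi (0 : ℝ), ∫ y, heatK2 i j s (x - y) * η y := by
  rw [pot_eq_integral_heat ((h.pd j).pd i)]
  refine integral_congr_ae (Eventually.of_forall fun s => ?_)
  exact heat_pd_pd s h i j x

theorem abs_heat_le {s C : ℝ} (hs : 0 < s) (hη : ∀ x, |η x| ≤ C) (x : E3) :
    |heat s η x| ≤ C := by
  have hi : Integrable fun z => heatK s z * C := (integrable_heatK hs).mul_const C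
  have := norm_integral_le_of_norm_le (f := fun z => heatK s z * η (x - z)) hi
    (Eventually.of_forall fun z => by
      rw [norm_mul, norm_of_nonneg (heatK_pos hs z).le]
      exact mul_le_mul_of_nonneg_left (hη _) (heatK_pos hs z).le)
  rw [integral_mul_const, integral_heatK hs, one_mul] at this
  exact this

theorem tendsto_heat_atTop (h : IsTest η) (x : E3) :
    Tendsto (fun s => heat s η x) atTop (𝓝 0) := by
  obtain ⟨C, hC, H⟩ := heatK_bounds
  have hb : ∀ s : ℝ, 0 < s → |heat s η x| ≤ C * (∫ y, |η y|) * s ^ (-(3 / 2) : ℝ) := by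
    intro s hs
    have hi : Integrable fun y => C * s ^ (-(3 / 2) : ℝ) * |η y| := h.integrable.abs.const_mul _
    have := norm_integral_le_of_norm_le (f := fun y => heatK s (x - y) * η y) hi
      (Eventually.of_forall fun y => by
        rw [norm_mul, norm_of_nonneg (heatK_pos hs _).le, norm_eq_abs]
        gcongr
        refine (H s hs _).1.trans ?_
        gcongr ?_ * ?_
        exact rpow_le_rpow_of_nonpos hs (by nlinarith [norm_nonneg (x - y)]) (by norm_num))
    rw [integral_const_mul] at this
    rw [heat, cv_swap]
    refine this.trans (le_of_eq (by ring))
  have ht : Tendsto (fun s : ℝ => C * (∫ y, |η y|) * s ^ (-(3 / 2) : ℝ)) atTop (𝓝 0) := by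
    simpa using (tendsto_rpow_neg_atTop (y := 3 / 2) (by norm_num)).const_mul (C * (∫ y, |η y|))
  refine squeeze_zero_norm' ?_ ht
  filter_upwards [eventually_gt_atTop 0] with s hs using hb s hs

/-- After the change of variables the kernel no longer depends on s, so the initial trace follows
from dominated convergence. -/
theorem heat_eq_scaled {s : ℝ} (hs : 0 < s) (x : E3) :
    heat s η x = ∫ z, heatK 1 z * η (x - √s • z) := by
  have h := Measure.integral_comp_smul_of_nonneg (μ := (volume : Measure E3))
    (fun z => heatK s z * η (x - z)) (√s) (hR := sqrt_nonneg s)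
  have hs3 : (√s ^ 3)⁻¹ = s ^ (-(3 / 2) : ℝ) := by
    rw [sqrt_eq_rpow, ← rpow_natCast, ← rpow_mul hs.le, ← rpow_neg hs.le]
    norm_num
  have hk : ∀ z : E3, heatK 1 z = s ^ (3 / 2 : ℝ) * heatK s (√s • z) := by
    intro z
    unfold heatK
    rw [norm_smul, norm_of_nonneg (sqrt_nonneg s), mul_pow, sq_sqrt hs.le,
      mul_rpow (by positivity) hs.le]
    have e1 : s ^ (3 / 2 : ℝ) * s ^ (-(3 / 2) : ℝ) = 1 := by
      rw [← rpow_add hs]; norm_num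
    have e2 : -(4 * s)⁻¹ * (s * ‖z‖ ^ 2) = -(4 * 1)⁻¹ * ‖z‖ ^ 2 := by field_simp
    rw [e2]
    rw [mul_one (4 * π)]
    linear_combination (-(4 * π) ^ (-(3 / 2) : ℝ) * exp (-(4 * 1)⁻¹ * ‖z‖ ^ 2)) * e1
  simp only [hk, mul_assoc]
  rw [integral_const_mul, h]
  simp only [finrank_euclideanSpace, Fintype.card_fin, smul_eq_mul]
  rw [hs3, ← mul_assoc, ← rpow_add hs]
  norm_num
  rfl

theorem tendsto_heat_zero (h : IsTest η) (x : E3) :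
    Tendsto (fun s => heat s η x) (𝓝[>] 0) (𝓝 (η x)) := by
  obtain ⟨C, hC, hb⟩ := h.exists_bound
  have hlim : Tendsto (fun s : ℝ => ∫ z, heatK 1 z * η (x - √s • z)) (𝓝[>] 0)
      (𝓝 (∫ z, heatK 1 z * η x)) := by
    refine tendsto_integral_filter_of_dominated_convergence (fun z => heatK 1 z * C) ?_ ?_
      ((integrable_heatK one_pos).mul_const C) ?_
    · refine Eventually.of_forall fun s => Continuous.aestronglyMeasurable ?_
      exact (continuous_heatK 1).mul (h.continuous.comp (by fun_prop))
    · refine Eventually.of_forall fun s => Eventually.of_forall fun z => ?_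
      rw [norm_mul, norm_of_nonneg (heatK_pos one_pos z).le]
      exact mul_le_mul_of_nonneg_left (hb _) (heatK_pos one_pos z).le
    · refine Eventually.of_forall fun z => Tendsto.mono_left ?_ nhdsWithin_le_nhds
      have hc : Continuous fun s : ℝ => heatK 1 z * η (x - √s • z) :=
        continuous_const.mul (h.continuous.comp (by fun_prop))
      simpa using hc.tendsto 0
  rw [integral_mul_const, integral_heatK one_pos, one_mul] at hlim
  refine hlim.congr' ?_
  filter_upwards [self_mem_nhdsWithin] with s hs using (heat_eq_scaled hs x).symm

/-- The Laplacian as a sum of second partial derivatives. -/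
def lap (η : E3 → ℝ) (x : E3) : ℝ := ∑ i, pd i (pd i η) x

theorem IsTest.lap (h : IsTest η) : IsTest (lap η) :=
  IsTest.sum Finset.univ fun i => (h.pd i).pd i

theorem cv_sum {ι : Type*} (s : Finset ι) {k : E3 → ℝ} (hk : LocallyIntegrable k)
    {η : ι → E3 → ℝ} (h : ∀ i, IsTest (η i)) (x : E3) :
    cv k (fun y => ∑ i ∈ s, η i y) x = ∑ i ∈ s, cv k (η i) x := by
  simp only [cv, Finset.mul_sum]
  exact integral_finsetSum _ fun i _ => integrable_cv hk (h i).continuous (h i).compact x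

/-- The kernel solves the heat equation, and its second derivatives are bounded uniformly for times
above s/2, which allows differentiation under the integral. The derivatives are then moved back onto
η. -/
theorem hasDerivAt_heat (h : IsTest η) {s : ℝ} (hs : 0 < s) (x : E3) :
    HasDerivAt (fun s => heat s η x) (heat s (lap η) x) s := by
  obtain ⟨C, hC, H⟩ := heatK_bounds
  have hval : heat s (lap η) x = ∫ y, (∑ i, heatK2 i i s (x - y)) * η y := by
    have e : lap η = fun y => ∑ i, pd i (pd i η) y := rfl
    rw [heat, e, cv_sum _ (locallyIntegrable_heatK s) (fun i => (h.pd i).pd i)]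
    simp only [Finset.sum_mul]
    rw [integral_finsetSum]
    · exact Finset.sum_congr rfl fun i _ => heat_pd_pd s h i i x
    · intro i _
      exact integrable_cv_swap (contDiff_heatK2 i i s).continuous.locallyIntegrable
        h.continuous h.compact x
  have hswap : (fun s => heat s η x) = fun s => ∫ y, heatK s (x - y) * η y :=
    funext fun s => cv_swap _ _ _
  rw [hval, hswap]
  have hnb : Ioi (s / 2) ∈ 𝓝 s := Ioi_mem_nhds (by linarith)
  refine (hasDerivAt_integral_of_dominated_loc_of_deriv_le (μ := (volume : Measure E3))
    (F := fun s y => heatK s (x - y) * η y)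
    (F' := fun s y => (∑ i, heatK2 i i s (x - y)) * η y)
    (bound := fun y => 3 * (C * (s / 2) ^ (-(5 / 2) : ℝ)) * |η y|) hnb ?_ ?_ ?_ ?_ ?_ ?_).2
  · exact Eventually.of_forall fun s => (((continuous_heatK s).comp
      (continuous_const.sub continuous_id)).mul h.continuous).aestronglyMeasurable
  · exact integrable_cv_swap (locallyIntegrable_heatK s) h.continuous h.compact x
  · refine Continuous.aestronglyMeasurable (Continuous.mul ?_ h.continuous)
    exact continuous_finsetSum _ fun i _ => (contDiff_heatK2 i i s).continuous.comp
      (continuous_const.sub continuous_id)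
  · refine Eventually.of_forall fun y σ hσ => ?_
    have hs2 : 0 < s / 2 := by linarith
    have hσ0 : 0 < σ := hs2.trans hσ
    rw [norm_mul, norm_eq_abs, norm_eq_abs]
    refine mul_le_mul_of_nonneg_right ?_ (abs_nonneg _)
    refine (Finset.abs_sum_le_sum_abs _ _).trans ?_
    refine (Finset.sum_le_card_nsmul _ _ (C * (s / 2) ^ (-(5 / 2) : ℝ)) fun i _ => ?_).trans
      (by simp)
    refine ((H σ hσ0 (x - y)).2.1 i i).trans ?_
    refine mul_le_mul_of_nonneg_left ?_ hC.le
    refine rpow_le_rpow_of_nonpos hs2 ?_ (by norm_num)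
    have : s / 2 < σ := hσ
    nlinarith [norm_nonneg (x - y)]
  · exact h.integrable.abs.const_mul _
  · refine Eventually.of_forall fun y σ hσ => ?_
    have hs2 : 0 < s / 2 := by linarith
    exact (hasDerivAt_heatK (hs2.trans hσ) (x - y)).mul_const (η y)

/-- The integrand e^{sΔ}Δη is the time derivative of e^{sΔ}η, which runs from η at s = 0 to 0 at s =
∞. -/
theorem pot_lap (h : IsTest η) (x : E3) : pot (lap η) x = -η x := by
  rw [pot_eq_integral_heat h.lap]
  -- The formula for `heat` does not give the initial value at s = 0, so the primitive is redefined
  -- there to be right-continuous.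
  have hd : ∀ s ∈ Ioi (0 : ℝ), HasDerivAt (fun s => if s ≤ 0 then η x else heat s η x)
      (heat s (lap η) x) s := by
    intro s hs
    refine (hasDerivAt_heat h hs x).congr_of_eventuallyEq ?_
    filter_upwards [Ioi_mem_nhds hs] with σ hσ
    simp [not_le.2 (show 0 < σ from hσ)]
  rw [integral_Ioi_of_hasDerivAt_of_tendsto (m := 0) ?_ hd (integrableOn_heat h.lap x) ?_]
  · simp
  · rw [ContinuousWithinAt, ← Ioi_insert, nhdsWithin_insert, tendsto_sup]
    constructor
    · exact tendsto_pure_left.2 fun s hs => by simpa using mem_of_mem_nhds hs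
    · simp only [le_refl, if_true]
      refine (tendsto_heat_zero h x).congr' ?_
      filter_upwards [self_mem_nhdsWithin] with s hs
      simp [not_le.2 (show 0 < s from hs)]
  · refine (tendsto_heat_atTop h x).congr' ?_
    filter_upwards [eventually_gt_atTop 0] with s hs
    simp [not_le.2 hs]

theorem lap_pot (h : IsTest η) (x : E3) : lap (pot η) x = -η x := by
  have e : pot (lap η) x = ∑ i, pot (pd i (pd i η)) x :=
    cv_sum _ locallyIntegrable_newton (fun i => (h.pd i).pd i) x
  rw [← pot_lap h, e, lap]
  refine Finset.sum_congr rfl fun i _ => ?_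
  rw [pd_pot h, pd_pot (h.pd i)]

/-- Near the support, continuity bounds the potential; far away |x - y| ≥ |x|/2 on the support and
the kernel decays like 1/|x|. This decay later makes cut-off errors small. -/
theorem exists_pot_le (h : IsTest η) :
    ∃ C, 0 < C ∧ ∀ x, |pot η x| ≤ C * (1 + ‖x‖)⁻¹ := by
  obtain ⟨C, hC, H⟩ := exists_newton_le
  obtain ⟨r, hr, hη⟩ := h.exists_ball
  obtain ⟨M, hM⟩ := (isCompact_closedBall (0 : E3) (2 * r + 1)).exists_bound_of_continuousOn
    (contDiff_pot h).continuous.continuousOn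
  have hM0 : 0 ≤ M := (norm_nonneg _).trans (hM 0 (by simp; positivity))
  have hI : 0 ≤ ∫ y, |η y| := integral_nonneg fun _ => abs_nonneg _
  refine ⟨M * (2 * r + 2) + 4 * C * (∫ y, |η y|) + 1, by positivity, fun x => ?_⟩
  rw [← div_eq_mul_inv, le_div_iff₀ (by positivity)]
  rcases le_or_gt ‖x‖ (2 * r + 1) with hx | hx
  · have h1 := hM x (by simpa using hx)
    rw [norm_eq_abs] at h1
    have : 0 ≤ 4 * C * (∫ y, |η y|) := by positivity
    nlinarith [norm_nonneg x, abs_nonneg (pot η x)]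
  · have hi : Integrable fun y => 2 * C * ‖x‖⁻¹ * |η y| := h.integrable.abs.const_mul _
    have := norm_integral_le_of_norm_le (f := fun y => newton (x - y) * η y) hi
      (Eventually.of_forall fun y => by
        rw [norm_mul, norm_of_nonneg (newton_nonneg _), norm_eq_abs]
        rcases le_or_gt ‖y‖ r with hy | hy
        · refine mul_le_mul_of_nonneg_right ?_ (abs_nonneg _)
          have h1 : ‖x‖ / 2 ≤ ‖x - y‖ := by
            have := norm_sub_norm_le x y
            linarith
          have h2 : 0 < ‖x‖ := by linarith
          refine (H (x - y) (norm_pos_iff.1 (by linarith))).trans ?_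
          calc C * ‖x - y‖⁻¹ ≤ C * (‖x‖ / 2)⁻¹ := by gcongr
            _ = _ := by field_simp
        · simp [hη y hy])
    rw [integral_const_mul, ← cv_swap, norm_eq_abs] at this
    have hx0 : 0 < ‖x‖ := by linarith
    have h3 : |pot η x| * ‖x‖ ≤ 2 * C * ∫ y, |η y| := by
      calc |pot η x| * ‖x‖ ≤ (2 * C * ‖x‖⁻¹ * ∫ y, |η y|) * ‖x‖ := by gcongr; exact this
        _ = _ := by field_simp
    have h4 : |pot η x| ≤ |pot η x| * ‖x‖ := by
      have : 1 ≤ ‖x‖ := by linarith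
      nlinarith [abs_nonneg (pot η x)]
    have : 0 ≤ M * (2 * r + 2) := by positivity
    linarith

end Potential

end NematicFlow

end

noncomputable section

namespace NematicFlow

/-! ### A Bellman function for the pair of exponents `3` and `3/2` -/

section Bellman

open Real Set

/-- The fourth root of `b² + ε²`. -/
def rho (ε b : ℝ) : ℝ := √√(b ^ 2 + ε ^ 2)

/-- The square root of `a² + (b² + ε²)^{1/2}`. -/
def tee (ε a b : ℝ) : ℝ := √(a ^ 2 + rho ε b ^ 2)

/-- The Bellman function, normalised to vanish at the origin. -/
def bell (ε a b : ℝ) : ℝ := tee ε a b ^ 3 + rho ε b ^ 3 - 2 * √ε ^ 3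

/-- The derivative of `bell` in the first variable. -/
def bellA (ε a b : ℝ) : ℝ := 3 * tee ε a b * a

/-- The derivative of `bell` in the second variable. -/
def bellB (ε a b : ℝ) : ℝ := 3 / 2 * (tee ε a b + rho ε b) * b / rho ε b ^ 2

variable {ε : ℝ}

theorem rho_pos (hε : 0 < ε) (b : ℝ) : 0 < rho ε b := by unfold rho; positivity

theorem tee_pos (hε : 0 < ε) (a b : ℝ) : 0 < tee ε a b := by
  have := rho_pos hε b
  unfold tee; positivity

theorem rho_sq (b : ℝ) : rho ε b ^ 2 = √(b ^ 2 + ε ^ 2) := sq_sqrt (by positivity)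

theorem rho_pow_four (b : ℝ) : rho ε b ^ 4 = b ^ 2 + ε ^ 2 := by
  rw [show rho ε b ^ 4 = (rho ε b ^ 2) ^ 2 by ring, rho_sq, sq_sqrt (by positivity)]

theorem tee_sq (a b : ℝ) : tee ε a b ^ 2 = a ^ 2 + rho ε b ^ 2 := sq_sqrt (by positivity)

theorem rho_le_tee (a b : ℝ) : rho ε b ≤ tee ε a b := by
  apply le_sqrt_of_sq_le
  nlinarith [sq_nonneg a]

theorem sqrt_le_rho (b : ℝ) : √ε ≤ rho ε b := by
  apply sqrt_le_sqrt
  apply le_sqrt_of_sq_le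
  nlinarith [sq_nonneg b]

theorem rho_sq_le (hε : 0 < ε) (b : ℝ) : rho ε b ^ 2 ≤ |b| + √ε ^ 2 := by
  rw [rho_sq, sq_sqrt hε.le]
  apply sqrt_le_iff.2 ⟨by positivity, ?_⟩
  nlinarith [sq_abs b, abs_nonneg b]

theorem tee_sq_le (hε : 0 < ε) (a b : ℝ) : tee ε a b ^ 2 ≤ a ^ 2 + |b| + √ε ^ 2 := by
  rw [tee_sq]; linarith [rho_sq_le hε b]

theorem bell_nonneg (ε a b : ℝ) : 0 ≤ bell ε a b := by
  have h1 := sqrt_le_rho (ε := ε) b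
  have h2 := h1.trans (rho_le_tee (ε := ε) a b)
  have h0 := sqrt_nonneg ε
  have := pow_le_pow_left₀ h0 h1 3
  have := pow_le_pow_left₀ h0 h2 3
  unfold bell; linarith

theorem bell_zero (hε : 0 < ε) : bell ε 0 0 = 0 := by
  have h : rho ε 0 = √ε := by unfold rho; simp [sqrt_sq hε.le]
  have h2 : tee ε 0 0 = √ε := by unfold tee; simp [h]
  unfold bell
  rw [h, h2]; ring

theorem bell_le (hε : 0 < ε) (a b : ℝ) :
    bell ε a b ≤ 18 * (|a| ^ 3 + √|b| ^ 3 + √ε ^ 3) := by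
  have hb : √|b| ^ 2 = |b| := sq_sqrt (abs_nonneg b)
  have h0 : 0 ≤ √|b| := sqrt_nonneg _
  have he : 0 ≤ √ε := sqrt_nonneg _
  have ha : 0 ≤ |a| := abs_nonneg a
  have hT : tee ε a b ≤ |a| + √|b| + √ε := by
    apply abs_le_of_sq_le_sq' _ (by positivity) |>.2
    have := tee_sq_le hε a b
    rw [← hb, ← sq_abs a] at this
    nlinarith [mul_nonneg ha h0, mul_nonneg ha he, mul_nonneg h0 he]
  have hR := rho_le_tee (ε := ε) a b
  have h3 : (|a| + √|b| + √ε) ^ 3 ≤ 9 * (|a| ^ 3 + √|b| ^ 3 + √ε ^ 3) := by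
    nlinarith [mul_nonneg (add_nonneg ha h0) (sq_nonneg (|a| - √|b|)),
      mul_nonneg (add_nonneg ha he) (sq_nonneg (|a| - √ε)),
      mul_nonneg (add_nonneg h0 he) (sq_nonneg (√|b| - √ε)),
      mul_nonneg ha (sq_nonneg (√|b| - √ε)), mul_nonneg h0 (sq_nonneg (|a| - √ε)),
      mul_nonneg he (sq_nonneg (|a| - √|b|))]
  have h4 := pow_le_pow_left₀ (tee_pos hε a b).le hT 3
  have h5 := pow_le_pow_left₀ (rho_pos hε b).le hR 3
  have : 0 ≤ √ε ^ 3 := by positivity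
  unfold bell; linarith

/-- For bounded arguments the Bellman function is controlled by a² + |b| with no additive constant.
This makes it integrable along the flow of two test functions, although its first summands alone do
not vanish at the origin. -/
theorem bell_le_of_bound (hε : 0 < ε) {M : ℝ} {a b : ℝ} (hT : tee ε a b ≤ M) :
    bell ε a b ≤ 4 * M * (a ^ 2 + |b|) := by
  have h1 := sqrt_le_rho (ε := ε) b
  have h2 := rho_le_tee (ε := ε) a b
  have h0 := sqrt_nonneg ε
  have key : ∀ x : ℝ, √ε ≤ x → x ≤ M → x ^ 2 ≤ a ^ 2 + |b| + √ε ^ 2 →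
      x ^ 3 - √ε ^ 3 ≤ 2 * M * (a ^ 2 + |b|) := by
    intro x hx hxM hx2
    have hx0 : 0 ≤ x := h0.trans hx
    have e1 : x ^ 3 - √ε ^ 3 ≤ (x ^ 2 - √ε ^ 2) * (x + √ε) := by
      nlinarith [mul_nonneg (mul_nonneg hx0 h0) (sub_nonneg.2 hx)]
    have e2 : (x ^ 2 - √ε ^ 2) * (x + √ε) ≤ (a ^ 2 + |b|) * (2 * M) := by
      apply mul_le_mul (by linarith) (by linarith) (by positivity)
      positivity
    linarith
  have k1 := key _ (h1.trans h2) hT (tee_sq_le hε a b)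
  have k2 := key _ h1 (h2.trans hT) (by nlinarith [rho_sq_le hε b, sq_nonneg a])
  unfold bell; linarith

theorem hasDerivAt_rho (hε : 0 < ε) (b : ℝ) :
    HasDerivAt (rho ε) (b / (2 * rho ε b ^ 3)) b := by
  have h0 : HasDerivAt (fun b : ℝ => b ^ 2 + ε ^ 2) (2 * b) b := by
    simpa using (hasDerivAt_pow 2 b).add_const (ε ^ 2)
  have h1 := (h0.sqrt (by positivity)).sqrt (by positivity)
  refine HasDerivAt.congr_deriv h1 ?_
  rw [← rho_sq, show √(rho ε b ^ 2) = rho ε b from sqrt_sq (rho_pos hε b).le]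
  have := rho_pos hε b
  field_simp

theorem hasFDerivAt_tee (hε : 0 < ε) (p : ℝ × ℝ) :
    HasFDerivAt (fun p : ℝ × ℝ => tee ε p.1 p.2)
      ((p.1 / tee ε p.1 p.2) • ContinuousLinearMap.fst ℝ ℝ ℝ +
        (p.2 / (2 * rho ε p.2 ^ 2 * tee ε p.1 p.2)) • ContinuousLinearMap.snd ℝ ℝ ℝ) p := by
  have hr := rho_pos hε p.2
  have ht := tee_pos hε p.1 p.2
  have h1 : HasFDerivAt (fun p : ℝ × ℝ => rho ε p.2)
      ((p.2 / (2 * rho ε p.2 ^ 3)) • ContinuousLinearMap.snd ℝ ℝ ℝ) p :=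
    (hasDerivAt_rho hε p.2).comp_hasFDerivAt p hasFDerivAt_snd
  have h2 : HasFDerivAt (fun p : ℝ × ℝ => p.1 ^ 2 + rho ε p.2 ^ 2) _ p :=
    (hasFDerivAt_fst.pow 2).add (h1.pow 2)
  have h3 : HasFDerivAt (fun p : ℝ × ℝ => √(p.1 ^ 2 + rho ε p.2 ^ 2)) _ p :=
    h2.sqrt (by positivity)
  refine HasFDerivAt.congr_fderiv h3 ?_
  have e : √(p.1 ^ 2 + rho ε p.2 ^ 2) = tee ε p.1 p.2 := rfl
  rw [e]
  ext
  · simp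
    field_simp
  · simp
    field_simp

theorem hasFDerivAt_bell (hε : 0 < ε) (p : ℝ × ℝ) :
    HasFDerivAt (fun p : ℝ × ℝ => bell ε p.1 p.2)
      (bellA ε p.1 p.2 • ContinuousLinearMap.fst ℝ ℝ ℝ +
        bellB ε p.1 p.2 • ContinuousLinearMap.snd ℝ ℝ ℝ) p := by
  have hr := rho_pos hε p.2
  have ht := tee_pos hε p.1 p.2
  have h1 : HasFDerivAt (fun p : ℝ × ℝ => rho ε p.2)
      ((p.2 / (2 * rho ε p.2 ^ 3)) • ContinuousLinearMap.snd ℝ ℝ ℝ) p :=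
    (hasDerivAt_rho hε p.2).comp_hasFDerivAt p hasFDerivAt_snd
  have h2 : HasFDerivAt (fun p : ℝ × ℝ => bell ε p.1 p.2) _ p :=
    (((hasFDerivAt_tee hε p).pow 3).add (h1.pow 3)).sub_const _
  refine HasFDerivAt.congr_fderiv h2 ?_
  unfold bellA bellB
  ext
  · simp
    field_simp
  · simp
    field_simp

theorem contDiff_rho (hε : 0 < ε) : ContDiff ℝ ∞ (rho ε) := by
  unfold rho
  refine ContDiff.sqrt (ContDiff.sqrt (by fun_prop) fun b => ?_) fun b => ?_ <;> positivity

theorem contDiff_tee (hε : 0 < ε) : ContDiff ℝ ∞ (fun p : ℝ × ℝ => tee ε p.1 p.2) := by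
  unfold tee
  have h : ContDiff ℝ ∞ (fun p : ℝ × ℝ => rho ε p.2) := (contDiff_rho hε).comp contDiff_snd
  refine ContDiff.sqrt ((contDiff_fst.pow 2).add (h.pow 2)) fun p => ?_
  have := rho_pos hε p.2
  positivity

section Spatial

variable {F G : E3 → ℝ}

theorem pd_rho (hε : 0 < ε) (hG : ContDiff ℝ ∞ G) (i : Fin 3) (x : E3) :
    pd i (fun x => rho ε (G x)) x = G x * pd i G x / (2 * rho ε (G x) ^ 3) := by
  have hG' : HasFDerivAt G (fderiv ℝ G x) x :=
    (hG.differentiable (by simp)).differentiableAt.hasFDerivAt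
  have h : HasFDerivAt (fun x => rho ε (G x)) _ x :=
    (hasDerivAt_rho hε (G x)).comp_hasFDerivAt x hG'
  rw [pd, h.fderiv]
  simp [pd]
  ring

theorem pd_tee (hε : 0 < ε) (hF : ContDiff ℝ ∞ F) (hG : ContDiff ℝ ∞ G) (i : Fin 3) (x : E3) :
    pd i (fun x => tee ε (F x) (G x)) x =
      F x / tee ε (F x) (G x) * pd i F x
      + G x / (2 * rho ε (G x) ^ 2 * tee ε (F x) (G x)) * pd i G x := by
  have hF' : HasFDerivAt F (fderiv ℝ F x) x :=
    (hF.differentiable (by simp)).differentiableAt.hasFDerivAt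
  have hG' : HasFDerivAt G (fderiv ℝ G x) x :=
    (hG.differentiable (by simp)).differentiableAt.hasFDerivAt
  have h : HasFDerivAt (fun x => tee ε (F x) (G x)) _ x :=
    HasFDerivAt.comp (g := fun p : ℝ × ℝ => tee ε p.1 p.2) x
      (hasFDerivAt_tee hε (F x, G x)) (hF'.prodMk hG')
  rw [pd, h.fderiv]
  simp [pd]

theorem pd_bell (hε : 0 < ε) (hF : ContDiff ℝ ∞ F) (hG : ContDiff ℝ ∞ G) (i : Fin 3) (x : E3) :
    pd i (fun x => bell ε (F x) (G x)) x =
      bellA ε (F x) (G x) * pd i F x + bellB ε (F x) (G x) * pd i G x := by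
  have hF' : HasFDerivAt F (fderiv ℝ F x) x :=
    (hF.differentiable (by simp)).differentiableAt.hasFDerivAt
  have hG' : HasFDerivAt G (fderiv ℝ G x) x :=
    (hG.differentiable (by simp)).differentiableAt.hasFDerivAt
  have h := HasFDerivAt.comp (g := fun p : ℝ × ℝ => bell ε p.1 p.2) x
    (hasFDerivAt_bell hε (F x, G x)) (hF'.prodMk hG')
  rw [Function.comp_def] at h
  rw [pd, h.fderiv]
  simp [pd]

theorem contDiff_rho_comp (hε : 0 < ε) (hG : ContDiff ℝ ∞ G) :
    ContDiff ℝ ∞ fun x => rho ε (G x) := (contDiff_rho hε).comp hG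

theorem contDiff_tee_comp (hε : 0 < ε) (hF : ContDiff ℝ ∞ F) (hG : ContDiff ℝ ∞ G) :
    ContDiff ℝ ∞ fun x => tee ε (F x) (G x) := (contDiff_tee hε).comp (hF.prodMk hG)

theorem contDiff_bell_comp (hε : 0 < ε) (hF : ContDiff ℝ ∞ F) (hG : ContDiff ℝ ∞ G) :
    ContDiff ℝ ∞ fun x => bell ε (F x) (G x) :=
  (((contDiff_tee_comp hε hF hG).pow 3).add ((contDiff_rho_comp hε hG).pow 3)).sub contDiff_const

theorem contDiff_bellA_comp (hε : 0 < ε) (hF : ContDiff ℝ ∞ F) (hG : ContDiff ℝ ∞ G) :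
    ContDiff ℝ ∞ fun x => bellA ε (F x) (G x) :=
  (contDiff_const.mul (contDiff_tee_comp hε hF hG)).mul hF

theorem contDiff_bellB_comp (hε : 0 < ε) (hF : ContDiff ℝ ∞ F) (hG : ContDiff ℝ ∞ G) :
    ContDiff ℝ ∞ fun x => bellB ε (F x) (G x) :=
  ((contDiff_const.mul ((contDiff_tee_comp hε hF hG).add (contDiff_rho_comp hε hG))).mul hG).div
    ((contDiff_rho_comp hε hG).pow 2) fun x => by have := rho_pos hε (G x); positivity

/-- Convexity of the Bellman function. -/
theorem bell_convex (hε : 0 < ε) (hF : ContDiff ℝ ∞ F) (hG : ContDiff ℝ ∞ G) (i : Fin 3)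
    (x : E3) :
    3 * rho ε (G x) * pd i F x ^ 2 + 3 / 4 * pd i G x ^ 2 / rho ε (G x) ≤
      pd i (fun x => bellA ε (F x) (G x)) x * pd i F x
      + pd i (fun x => bellB ε (F x) (G x)) x * pd i G x := by
  have dF := (hF.differentiable (by simp)) x
  have dG := (hG.differentiable (by simp)) x
  have dT := ((contDiff_tee_comp hε hF hG).differentiable (by simp)) x
  have dR := ((contDiff_rho_comp hε hG).differentiable (by simp)) x
  set ρ := rho ε (G x) with hρ
  set T := tee ε (F x) (G x) with hT
  set a := pd i F x with ha
  set b := pd i G x with hb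
  set r := pd i (fun x => rho ε (G x)) x with hr
  set τ := pd i (fun x => tee ε (F x) (G x)) x with hτ
  have ρ0 : 0 < ρ := rho_pos hε _
  have T0 : 0 < T := tee_pos hε _ _
  have hr' : G x * b = 2 * ρ ^ 3 * r := by
    rw [hr, pd_rho hε hG]; rw [← hρ, ← hb]; field_simp
  have hτ' : T * τ = F x * a + ρ * r := by
    rw [hτ, pd_tee hε hF hG, hr, pd_rho hε hG]; rw [← hρ, ← hT, ← ha, ← hb]; field_simp
  have eA : pd i (fun x => bellA ε (F x) (G x)) x = 3 * τ * F x + 3 * T * a := by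
    have : (fun x => bellA ε (F x) (G x)) = fun x => (3 * tee ε (F x) (G x)) * F x := rfl
    rw [this, pd_mul (dT.const_mul 3) dF, pd_const_mul dT]
  -- The quotient is avoided: the identity `bellB` · ρ² = (3/2)(T + ρ)G is differentiated instead.
  have eB : pd i (fun x => bellB ε (F x) (G x)) x * ρ ^ 2 =
      3 / 2 * (τ + r) * G x + 3 / 2 * (T + ρ) * b - bellB ε (F x) (G x) * (2 * ρ * r) := by
    have dB := ((contDiff_bellB_comp hε hF hG).differentiable (by simp)) x
    have dR2 : DifferentiableAt ℝ (fun x => rho ε (G x) * rho ε (G x)) x := dR.mul dR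
    have h1 : (fun x => bellB ε (F x) (G x) * (rho ε (G x) * rho ε (G x))) =
        fun x => (3 / 2 * (tee ε (F x) (G x) + rho ε (G x))) * G x := by
      ext y
      have := rho_pos hε (G y)
      unfold bellB
      field_simp
    have h2 := pd_mul dB dR2 i
    have dTR : DifferentiableAt ℝ (fun x => tee ε (F x) (G x) + rho ε (G x)) x := dT.add dR
    rw [h1, pd_mul (dTR.const_mul _) dG, pd_const_mul dTR, pd_mul dR dR, pd_add dT dR] at h2
    linear_combination -h2
  have hBval : bellB ε (F x) (G x) * ρ ^ 2 = 3 / 2 * (T + ρ) * G x := by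
    unfold bellB
    rw [← hρ, ← hT]; field_simp
  -- Since ρ⁴ = G² + ε², the derivative r of ρ satisfies 4r²ρ² ≤ b²; this makes the last bracket of
  -- the quadratic form below nonnegative.
  have hG4 : G x ^ 2 ≤ ρ ^ 4 := by
    rw [hρ, rho_pow_four]; nlinarith
  have hr4 : 4 * r ^ 2 * ρ ^ 2 ≤ b ^ 2 := by
    have h1 : (2 * ρ ^ 3 * r) ^ 2 ≤ ρ ^ 4 * b ^ 2 := by
      rw [← hr', mul_pow]; exact mul_le_mul_of_nonneg_right hG4 (sq_nonneg b)
    have h2 : ρ ^ 4 * (4 * r ^ 2 * ρ ^ 2) ≤ ρ ^ 4 * b ^ 2 := by linarith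
    exact le_of_mul_le_mul_left h2 (by positivity)
  -- The exact quadratic form as a sum of nonnegative terms. The claim follows from T ≥ ρ, after
  -- keeping 3Ta²ρ² and half of (3/2)ρb², the other half offsetting part of the r² terms.
  have hq : (pd i (fun x => bellA ε (F x) (G x)) x * a
      + pd i (fun x => bellB ε (F x) (G x)) x * b) * ρ ^ 2 =
      (3 * T * τ ^ 2 + 3 * T * a ^ 2 + 3 * ρ * r ^ 2) * ρ ^ 2 +
        3 / 2 * (T + ρ) * (b ^ 2 - 4 * r ^ 2 * ρ ^ 2) := by
    rw [eA]
    have e2 : pd i (fun x => bellB ε (F x) (G x)) x * b * ρ ^ 2 * ρ ^ 2 =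
      (3 * (τ + r) * ρ ^ 3 * r + 3 / 2 * (T + ρ) * b ^ 2) * ρ ^ 2
        - 6 * (T + ρ) * ρ ^ 4 * r ^ 2 := by
      linear_combination (b * ρ ^ 2) * eB + (3 / 2 * (τ + r) * ρ ^ 2) * hr'
        - (2 * ρ * r * b) * hBval - (3 * (T + ρ) * ρ * r) * hr'
    have e3 : pd i (fun x => bellB ε (F x) (G x)) x * b * ρ ^ 2 =
      3 * (τ + r) * ρ ^ 3 * r + 3 / 2 * (T + ρ) * b ^ 2 - 6 * (T + ρ) * ρ ^ 2 * r ^ 2 := by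
      apply mul_right_cancel₀ (pow_ne_zero 2 ρ0.ne')
      linear_combination e2
    linear_combination e3 - (3 * τ * ρ ^ 2) * hτ'
  have hTρ : ρ ≤ T := rho_le_tee (ε := ε) _ _
  have goal2 : (3 * ρ * a ^ 2 + 3 / 4 * b ^ 2 / ρ) * ρ ^ 2 ≤
      (pd i (fun x => bellA ε (F x) (G x)) x * a
      + pd i (fun x => bellB ε (F x) (G x)) x * b) * ρ ^ 2 := by
    rw [hq]
    have e : (3 * ρ * a ^ 2 + 3 / 4 * b ^ 2 / ρ) * ρ ^ 2 =
      3 * ρ * a ^ 2 * ρ ^ 2 + 3 / 4 * b ^ 2 * ρ := by field_simp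
    rw [e]
    have t1 : 0 ≤ (T - ρ) * (a ^ 2 * ρ ^ 2) := mul_nonneg (by linarith) (by positivity)
    have t2 : 0 ≤ T * τ ^ 2 * ρ ^ 2 := by positivity
    have t3 : 0 ≤ T * (b ^ 2 - 4 * r ^ 2 * ρ ^ 2) := mul_nonneg T0.le (by linarith)
    have t4 : 0 ≤ ρ * (b ^ 2 - 4 * r ^ 2 * ρ ^ 2) := mul_nonneg ρ0.le (by linarith)
    nlinarith
  exact le_of_mul_le_mul_right goal2 (by positivity)

/-- The weights ρ and 1/ρ in the convexity bound are reciprocal, so the arithmetic-geometric mean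
inequality with coefficients 3 and 3/4 gives exactly the factor 3, independent of ε. -/
theorem bell_convex_sum (hε : 0 < ε) (hF : ContDiff ℝ ∞ F) (hG : ContDiff ℝ ∞ G) (i j : Fin 3)
    (x : E3) :
    3 * (|pd i F x| * |pd j G x|) ≤
      ∑ k, (pd k (fun x => bellA ε (F x) (G x)) x * pd k F x
      + pd k (fun x => bellB ε (F x) (G x)) x * pd k G x) := by
  have ρ0 : 0 < rho ε (G x) := rho_pos hε _
  have h1 : ∀ k, 3 * rho ε (G x) * pd k F x ^ 2 + 3 / 4 * pd k G x ^ 2 / rho ε (G x) ≤ _ :=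
    fun k => bell_convex hε hF hG k x
  refine le_trans ?_ (Finset.sum_le_sum fun k _ => h1 k)
  rw [Finset.sum_add_distrib]
  have h2 : 3 * rho ε (G x) * pd i F x ^ 2 ≤ ∑ k, 3 * rho ε (G x) * pd k F x ^ 2 :=
    Finset.single_le_sum (f := fun k => 3 * rho ε (G x) * pd k F x ^ 2)
      (fun k _ => by positivity) (Finset.mem_univ i)
  have h3 : 3 / 4 * pd j G x ^ 2 / rho ε (G x) ≤ ∑ k, 3 / 4 * pd k G x ^ 2 / rho ε (G x) :=
    Finset.single_le_sum (f := fun k => 3 / 4 * pd k G x ^ 2 / rho ε (G x))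
      (fun k _ => by positivity) (Finset.mem_univ j)
  refine le_trans ?_ (add_le_add h2 h3)
  rw [← sq_abs (pd i F x), ← sq_abs (pd j G x)]
  have e : 3 * rho ε (G x) * |pd i F x| ^ 2 + 3 / 4 * |pd j G x| ^ 2 / rho ε (G x)
    - 3 * (|pd i F x| * |pd j G x|) =
      3 / rho ε (G x) * (rho ε (G x) * |pd i F x| - |pd j G x| / 2) ^ 2 := by
    field_simp
    ring
  have : 0 ≤ 3 / rho ε (G x) * (rho ε (G x) * |pd i F x| - |pd j G x| / 2) ^ 2 := by positivity
  linarith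

/-- The localised dissipation inequality for the Bellman function. -/
theorem bell_dissipation (hε : 0 < ε) (hF : ContDiff ℝ ∞ F) (hG : ContDiff ℝ ∞ G)
    {χ : E3 → ℝ} (hχ : IsTest χ) (hχ0 : ∀ x, 0 ≤ χ x) (i j : Fin 3) :
    ∫ x, χ x * (bellA ε (F x) (G x) * lap F x + bellB ε (F x) (G x) * lap G x) ≤
      -(3 * ∫ x, χ x * (|pd i F x| * |pd j G x|)) + ∫ x, lap χ x * bell ε (F x) (G x) := by
  have cA := contDiff_bellA_comp hε hF hG
  have cB := contDiff_bellB_comp hε hF hG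
  have cW := contDiff_bell_comp hε hF hG
  have cF : ∀ k, ContDiff ℝ ∞ (pd k F) := fun k => contDiff_pd hF k
  have cG : ∀ k, ContDiff ℝ ∞ (pd k G) := fun k => contDiff_pd hG k
  have ibp : ∀ {f : E3 → ℝ}, ContDiff ℝ ∞ f → ∀ {g : E3 → ℝ}, ContDiff ℝ ∞ g → ∀ k,
      ∫ x, χ x * (f x * pd k g x) = -∫ x, (χ x * (pd k f x * g x) + pd k χ x * (f x * g x)) := by
    intro f hf g hg k
    have := integral_mul_pd (f := fun x => χ x * f x) (g := g)
      ((hχ.mul_right hf).contDiff_one) (hg.of_le ENat.LEInfty.out) (hχ.mul_right hf).compact k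
    simp only [mul_assoc] at this
    rw [this]
    congr 1
    refine integral_congr_ae (Eventually.of_forall fun x => ?_)
    simp only
    rw [pd_mul (hχ.differentiable x) (hf.differentiable (by simp) x)]
    ring
  have int : ∀ {η : E3 → ℝ}, IsTest η → ∀ {f : E3 → ℝ}, Continuous f →
      Integrable fun x => η x * f x := fun hη f hf =>
    (hη.continuous.mul hf).integrable_of_hasCompactSupport hη.compact.mul_right
  have c1 := cA.continuous
  have c2 := cB.continuous
  have c3 := fun k => (cF k).continuous
  have c4 := fun k => (cG k).continuous
  have c5 := fun k => (contDiff_pd cA k).continuous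
  have c6 := fun k => (contDiff_pd cB k).continuous
  have c7 := fun k => (contDiff_pd (cF k) k).continuous
  have c8 := fun k => (contDiff_pd (cG k) k).continuous
  have I1 : ∀ k, Integrable fun x => χ x * (bellA ε (F x) (G x) * pd k (pd k F) x) :=
    fun k => int hχ (c1.mul (c7 k))
  have I2 : ∀ k, Integrable fun x => χ x * (bellB ε (F x) (G x) * pd k (pd k G) x) :=
    fun k => int hχ (c2.mul (c8 k))
  have I3 : ∀ k, Integrable fun x => χ x * (pd k (fun x => bellA ε (F x) (G x)) x * pd k F x)
      + pd k χ x * (bellA ε (F x) (G x) * pd k F x) := fun k =>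
    (int hχ ((c5 k).mul (c3 k))).add (int (hχ.pd k) (c1.mul (c3 k)))
  have I4 : ∀ k, Integrable fun x => χ x * (pd k (fun x => bellB ε (F x) (G x)) x * pd k G x)
      + pd k χ x * (bellB ε (F x) (G x) * pd k G x) := fun k =>
    (int hχ ((c6 k).mul (c4 k))).add (int (hχ.pd k) (c2.mul (c4 k)))
  have I5 : ∀ k, Integrable fun x => χ x * (pd k (fun x => bellA ε (F x) (G x)) x * pd k F x
      + pd k (fun x => bellB ε (F x) (G x)) x * pd k G x) := fun k =>
    int hχ (((c5 k).mul (c3 k)).add ((c6 k).mul (c4 k)))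
  have I6 : ∀ k, Integrable fun x =>
      pd k χ x * (bellA ε (F x) (G x) * pd k F x + bellB ε (F x) (G x) * pd k G x) := fun k =>
    int (hχ.pd k) ((c1.mul (c3 k)).add (c2.mul (c4 k)))
  have I7 : ∀ k, Integrable fun x => χ x * (bellA ε (F x) (G x) * pd k (pd k F) x +
      bellB ε (F x) (G x) * pd k (pd k G) x) := fun k =>
    int hχ ((c1.mul (c7 k)).add (c2.mul (c8 k)))
  have I8 : Integrable fun x => χ x * (|pd i F x| * |pd j G x|) :=
    int hχ ((c3 i).abs.mul (c4 j).abs)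
  have step1 : ∫ x, χ x * (bellA ε (F x) (G x) * lap F x + bellB ε (F x) (G x) * lap G x) =
      ∑ k, ((∫ x, χ x * (bellA ε (F x) (G x) * pd k (pd k F) x)) +
        ∫ x, χ x * (bellB ε (F x) (G x) * pd k (pd k G) x)) := by
    have : ∀ k, ((∫ x, χ x * (bellA ε (F x) (G x) * pd k (pd k F) x)) +
        ∫ x, χ x * (bellB ε (F x) (G x) * pd k (pd k G) x)) =
        ∫ x, χ x * (bellA ε (F x) (G x) * pd k (pd k F) x +
          bellB ε (F x) (G x) * pd k (pd k G) x) := by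
      intro k
      rw [← integral_add (I1 k) (I2 k)]
      simp only [mul_add]
    simp only [this]
    rw [← integral_finsetSum _ fun k _ => I7 k]
    refine integral_congr_ae (Eventually.of_forall fun x => ?_)
    simp only [lap, ← Finset.mul_sum, Finset.sum_add_distrib]
  have step2 : ∀ k, ((∫ x, χ x * (bellA ε (F x) (G x) * pd k (pd k F) x)) +
        ∫ x, χ x * (bellB ε (F x) (G x) * pd k (pd k G) x)) =
      -(∫ x, χ x * (pd k (fun x => bellA ε (F x) (G x)) x * pd k F x
        + pd k (fun x => bellB ε (F x) (G x)) x * pd k G x))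
      + ∫ x, pd k (pd k χ) x * bell ε (F x) (G x) := by
    intro k
    have hw : ∫ x, pd k χ x * pd k (fun x => bell ε (F x) (G x)) x =
        -∫ x, pd k (pd k χ) x * bell ε (F x) (G x) :=
      integral_mul_pd (hχ.pd k).contDiff_one (cW.of_le ENat.LEInfty.out) (hχ.pd k).compact k
    rw [ibp cA (cF k), ibp cB (cG k),
      show ∀ a b : ℝ, -a + -b = -(a + b) by intros; ring, ← integral_add (I3 k) (I4 k)]
    have e : ∫ x, pd k (pd k χ) x * bell ε (F x) (G x) =
        -∫ x, pd k χ x * (bellA ε (F x) (G x) * pd k F x + bellB ε (F x) (G x) * pd k G x) := by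
      rw [← neg_eq_iff_eq_neg, ← hw]
      refine integral_congr_ae (Eventually.of_forall fun x => ?_)
      simp only [pd_bell hε hF hG]
    rw [e, ← neg_add, ← integral_add (I5 k) (I6 k)]
    congr 1
    refine integral_congr_ae (Eventually.of_forall fun x => ?_)
    simp only
    ring
  have step3 : ∑ k, ∫ x, pd k (pd k χ) x * bell ε (F x) (G x) =
      ∫ x, lap χ x * bell ε (F x) (G x) := by
    rw [← integral_finsetSum _ fun k _ => int ((hχ.pd k).pd k) cW.continuous]
    simp only [lap, Finset.sum_mul]
  have step4 : 3 * ∫ x, χ x * (|pd i F x| * |pd j G x|) ≤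
      ∑ k, ∫ x, χ x * (pd k (fun x => bellA ε (F x) (G x)) x * pd k F x
        + pd k (fun x => bellB ε (F x) (G x)) x * pd k G x) := by
    rw [← integral_finsetSum _ fun k _ => I5 k,
      ← integral_const_mul]
    refine integral_mono (I8.const_mul 3) (integrable_finsetSum _ fun k _ => I5 k) fun x => ?_
    have := mul_le_mul_of_nonneg_left (bell_convex_sum hε hF hG i j x) (hχ0 x)
    simp only [← Finset.mul_sum]
    linarith
  rw [step1, Finset.sum_congr rfl fun k _ => step2 k, Finset.sum_add_distrib, step3,
    Finset.sum_neg_distrib]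
  linarith

end Spatial

end Bellman

end NematicFlow

end

noncomputable section

namespace NematicFlow

/-! ### The `L³` bound for second derivatives of the potential -/

section CalderonZygmund

open Real Set

variable {η f ψ : E3 → ℝ}

theorem stronglyMeasurable_heat (h : Continuous η) :
    StronglyMeasurable fun p : ℝ × E3 => heat p.1 η p.2 := by
  have : StronglyMeasurable fun q : (ℝ × E3) × E3 => heatK q.1.1 q.2 * η (q.1.2 - q.2) := by
    refine StronglyMeasurable.mul ?_ ?_
    · exact (measurable_heatK.comp
        (measurable_fst.fst.prodMk measurable_snd)).stronglyMeasurable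
    · exact (h.comp (continuous_fst.snd.sub continuous_snd)).stronglyMeasurable
  exact this.integral_prod_right

theorem integrable_heat {s : ℝ} (hs : 0 < s) (h : Integrable η) : Integrable (heat s η) := by
  rw [heat, cv_eq_convolution]
  exact (integrable_heatK hs).integrable_convolution _ h

theorem integral_abs_heat_le {s : ℝ} (hs : 0 < s) (h : IsTest η) :
    ∫ x, |heat s η x| ≤ ∫ x, |η x| := by
  have h1 : ∫ x, heat s (fun y => |η y|) x = ∫ x, |η x| := by
    rw [heat, cv_eq_convolution, integral_convolution _ (integrable_heatK hs) h.integrable.abs]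
    simp [integral_heatK hs]
  rw [← h1]
  refine integral_mono (integrable_heat hs h.integrable).abs
    (integrable_heat hs h.integrable.abs) fun x => ?_
  refine (abs_integral_le_integral_abs).trans (le_of_eq ?_)
  refine integral_congr_ae (Eventually.of_forall fun z => ?_)
  simp only [abs_mul, abs_of_pos (heatK_pos hs z)]

/-- The maximum principle controls small times and the L¹ to L^∞ decay controls large ones; together
they give a majorant integrable in time on the whole half-line. -/
theorem exists_heat_le (h : IsTest η) :
    ∃ C, 0 < C ∧ ∀ s : ℝ, 0 < s → ∀ x, |heat s η x| ≤ C * (s + 1) ^ (-(3 / 2) : ℝ) := by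
  obtain ⟨C, hC, H⟩ := heatK_bounds
  obtain ⟨M, hM, hb⟩ := h.exists_bound
  have hI : 0 ≤ ∫ y, |η y| := integral_nonneg fun _ => abs_nonneg _
  refine ⟨2 ^ (3 / 2 : ℝ) * (C * (∫ y, |η y|) + M) + 1, by positivity, fun s hs x => ?_⟩
  have h1 : |heat s η x| ≤ C * (∫ y, |η y|) * s ^ (-(3 / 2) : ℝ) := by
    have hi : Integrable fun y => C * s ^ (-(3 / 2) : ℝ) * |η y| := h.integrable.abs.const_mul _
    have := norm_integral_le_of_norm_le (f := fun y => heatK s (x - y) * η y) hi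
      (Eventually.of_forall fun y => by
        rw [norm_mul, norm_of_nonneg (heatK_pos hs _).le, norm_eq_abs]
        gcongr
        refine (H s hs _).1.trans ?_
        gcongr ?_ * ?_
        exact rpow_le_rpow_of_nonpos hs (by nlinarith [norm_nonneg (x - y)]) (by norm_num))
    rw [integral_const_mul] at this
    rw [heat, cv_swap]
    exact this.trans (le_of_eq (by ring))
  have h2 := abs_heat_le hs hb x
  have h3 : |heat s η x| ≤ (2 ^ (3 / 2 : ℝ) * (C * (∫ y, |η y|) + M)) *
      (s + 1) ^ (-(3 / 2) : ℝ) := by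
    rcases le_or_gt s 1 with hs1 | hs1
    · have : 1 ≤ 2 ^ (3 / 2 : ℝ) * (s + 1) ^ (-(3 / 2) : ℝ) := by
        have := rpow_le_rpow_of_nonpos (by linarith : (0 : ℝ) < s + 1) (by linarith : s + 1 ≤ 2)
          (by norm_num : (-(3 / 2) : ℝ) ≤ 0)
        calc (1 : ℝ) = 2 ^ (3 / 2 : ℝ) * 2 ^ (-(3 / 2) : ℝ) := by
              rw [← rpow_add two_pos]; norm_num
          _ ≤ _ := by gcongr
      calc |heat s η x| ≤ (C * (∫ y, |η y|) + M) * 1 := by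
            have : 0 ≤ C * (∫ y, |η y|) := by positivity
            linarith
        _ ≤ (C * (∫ y, |η y|) + M) * (2 ^ (3 / 2 : ℝ) * (s + 1) ^ (-(3 / 2) : ℝ)) := by gcongr
        _ = _ := by ring
    · have : s ^ (-(3 / 2) : ℝ) ≤ 2 ^ (3 / 2 : ℝ) * (s + 1) ^ (-(3 / 2) : ℝ) := by
        have e : s ^ (-(3 / 2) : ℝ) = 2 ^ (3 / 2 : ℝ) * (2 * s) ^ (-(3 / 2) : ℝ) := by
          rw [mul_rpow two_pos.le hs.le, ← mul_assoc, ← rpow_add two_pos]; norm_num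
        rw [e]
        gcongr ?_ * ?_
        exact rpow_le_rpow_of_nonpos (by linarith) (by linarith) (by norm_num)
      calc |heat s η x| ≤ C * (∫ y, |η y|) * s ^ (-(3 / 2) : ℝ) := h1
        _ ≤ (C * (∫ y, |η y|) + M) * (2 ^ (3 / 2 : ℝ) * (s + 1) ^ (-(3 / 2) : ℝ)) := by
            gcongr
            linarith
        _ = _ := by ring
  refine h3.trans ?_
  gcongr
  linarith

/-- The semigroup property of the heat kernel. -/
theorem heatK_semigroup {s : ℝ} (hs : 0 < s) (x y : E3) :
    ∫ z, heatK s (x - z) * heatK s (z - y) = heatK (2 * s) (x - y) := by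
  have key : ∀ z, heatK s (x - z) * heatK s (z - y) =
      heatK (2 * s) (x - y) * heatK (s / 2) (z - (2⁻¹ : ℝ) • (x + y)) := by
    intro z
    unfold heatK
    have e1 : (4 * π * s) ^ (-(3 / 2) : ℝ) * (4 * π * s) ^ (-(3 / 2) : ℝ) =
        (4 * π * (2 * s)) ^ (-(3 / 2) : ℝ) * (4 * π * (s / 2)) ^ (-(3 / 2) : ℝ) := by
      rw [← mul_rpow (by positivity) (by positivity), ← mul_rpow (by positivity) (by positivity)]
      congr 1; ring
    -- The parallelogram law completes the square: the product of two Gaussians of time s is one of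
    -- time 2s in x - y and one of time s/2 centred at the midpoint.
    have par : ‖x - z‖ ^ 2 + ‖z - y‖ ^ 2 =
        ‖x - y‖ ^ 2 / 2 + 2 * ‖z - (2⁻¹ : ℝ) • (x + y)‖ ^ 2 := by
      simp only [EuclideanSpace.norm_sq_eq, Fin.sum_univ_three, PiLp.sub_apply, PiLp.smul_apply,
        PiLp.add_apply, smul_eq_mul, norm_eq_abs, sq_abs]
      ring
    have e2 : exp (-(4 * s)⁻¹ * ‖x - z‖ ^ 2) * exp (-(4 * s)⁻¹ * ‖z - y‖ ^ 2) =
        exp (-(4 * (2 * s))⁻¹ * ‖x - y‖ ^ 2) *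
          exp (-(4 * (s / 2))⁻¹ * ‖z - (2⁻¹ : ℝ) • (x + y)‖ ^ 2) := by
      rw [← exp_add, ← exp_add, ← mul_add, par]
      congr 1
      field_simp
      ring
    calc _ = ((4 * π * s) ^ (-(3 / 2) : ℝ) * (4 * π * s) ^ (-(3 / 2) : ℝ)) *
        (exp (-(4 * s)⁻¹ * ‖x - z‖ ^ 2) * exp (-(4 * s)⁻¹ * ‖z - y‖ ^ 2)) := by ring
      _ = _ := by rw [e1, e2]; ring
  simp only [key]
  rw [integral_const_mul, integral_sub_right_eq_self (fun z => heatK (s / 2) z),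
    integral_heatK (by positivity), mul_one]

theorem heat_heat {s : ℝ} (hs : 0 < s) (h : IsTest η) (x : E3) :
    heat (2 * s) η x = ∫ z, heatK s (x - z) * heat s η z := by
  obtain ⟨C, hC, H⟩ := heatK_bounds
  have hint1 : ∀ y, Integrable fun z => heatK s (x - z) * heatK s (z - y) := by
    intro y
    have hi : Integrable fun z => heatK s (z - y) := (integrable_heatK hs).comp_sub_right y
    refine hi.bdd_mul (c := C * s ^ (-(3 / 2) : ℝ))
      ((continuous_heatK s).comp (by fun_prop)).aestronglyMeasurable
      (Eventually.of_forall fun z => ?_)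
    rw [norm_of_nonneg (heatK_pos hs _).le]
    refine (H s hs _).1.trans ?_
    gcongr ?_ * ?_
    exact rpow_le_rpow_of_nonpos hs (by nlinarith [norm_nonneg (x - z)]) (by norm_num)
  have hint : Integrable (fun p : E3 × E3 => heatK s (x - p.2) * heatK s (p.2 - p.1) * η p.1)
      (volume.prod volume) := by
    rw [integrable_prod_iff]
    · refine ⟨Eventually.of_forall fun y => (hint1 y).mul_const (η y), ?_⟩
      have : (fun y => ∫ z, ‖heatK s (x - z) * heatK s (z - y) * η y‖) =
          fun y => heatK (2 * s) (x - y) * |η y| := by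
        ext y
        rw [← heatK_semigroup hs, ← integral_mul_const]
        refine integral_congr_ae (Eventually.of_forall fun z => ?_)
        simp [abs_of_pos (heatK_pos hs _)]
      simp only [this]
      exact integrable_cv_swap (η := fun y => |η y|) (locallyIntegrable_heatK _) h.continuous.abs
        h.compact.abs x
    · refine Continuous.aestronglyMeasurable ?_
      exact (((continuous_heatK s).comp (by fun_prop)).mul
        ((continuous_heatK s).comp (by fun_prop))).mul (h.continuous.comp continuous_fst)
  have := integral_integral_swap
    (f := fun y z => heatK s (x - z) * heatK s (z - y) * η y) hint
  rw [heat, cv_swap]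
  calc ∫ y, heatK (2 * s) (x - y) * η y
      = ∫ y, ∫ z, heatK s (x - z) * heatK s (z - y) * η y := by
        refine integral_congr_ae (Eventually.of_forall fun y => ?_)
        simp only [integral_mul_const, heatK_semigroup hs]
    _ = ∫ z, ∫ y, heatK s (x - z) * heatK s (z - y) * η y := this
    _ = _ := by
        refine integral_congr_ae (Eventually.of_forall fun z => ?_)
        simp only [heat, cv_swap, mul_assoc]
        rw [integral_const_mul]

theorem integral_mul_heat_two {s : ℝ} (hs : 0 < s) (hf : IsTest f) (hη : IsTest η) :
    ∫ x, f x * heat (2 * s) η x = ∫ x, heat s f x * heat s η x := by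
  obtain ⟨M, hM, hb⟩ := hη.exists_bound
  have hint1 : ∀ x, Integrable fun z => heatK s (x - z) * heat s η z := by
    intro x
    have hi : Integrable fun z => heatK s (x - z) := (integrable_heatK hs).comp_sub_left x
    exact hi.mul_bdd (c := M) (contDiff_heat s hη).continuous.aestronglyMeasurable
      (Eventually.of_forall fun z => abs_heat_le hs hb z)
  have hint : Integrable (fun p : E3 × E3 => f p.1 * (heatK s (p.1 - p.2) * heat s η p.2))
      (volume.prod volume) := by
    have hm : AEStronglyMeasurable (fun p : E3 × E3 =>
        f p.1 * (heatK s (p.1 - p.2) * heat s η p.2)) (volume.prod volume) :=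
      ((hf.continuous.comp continuous_fst).mul (((continuous_heatK s).comp (by fun_prop)).mul
        ((contDiff_heat s hη).continuous.comp continuous_snd))).aestronglyMeasurable
    rw [integrable_prod_iff hm]
    refine ⟨Eventually.of_forall fun x => (hint1 x).const_mul (f x), ?_⟩
    refine Integrable.mono' (g := fun x => |f x| * M) (hf.integrable.abs.mul_const M)
      hm.norm.integral_prod_right' (Eventually.of_forall fun x => ?_)
    rw [norm_of_nonneg (integral_nonneg fun _ => norm_nonneg _)]
    simp only [norm_mul]
    rw [integral_const_mul, norm_eq_abs]
    gcongr
    calc ∫ z, ‖heatK s (x - z)‖ * ‖heat s η z‖ ≤ ∫ z, heatK s (x - z) * M := by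
          refine integral_mono_of_nonneg (Eventually.of_forall fun z => by positivity)
            (((integrable_heatK hs).comp_sub_left x).mul_const M)
            (Eventually.of_forall fun z => ?_)
          simp only
          rw [norm_of_nonneg (heatK_pos hs _).le]
          exact mul_le_mul_of_nonneg_left (abs_heat_le hs hb z) (heatK_pos hs _).le
      _ = M := by
          rw [integral_mul_const, integral_sub_left_eq_self (fun z => heatK s z),
            integral_heatK hs, one_mul]
  have := integral_integral_swap
    (f := fun x z => f x * (heatK s (x - z) * heat s η z)) hint
  calc ∫ x, f x * heat (2 * s) η x
      = ∫ x, ∫ z, f x * (heatK s (x - z) * heat s η z) := by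
        refine integral_congr_ae (Eventually.of_forall fun x => ?_)
        simp only [heat_heat hs hη, integral_const_mul]
    _ = _ := this
    _ = _ := by
        refine integral_congr_ae (Eventually.of_forall fun z => ?_)
        simp only [heat, cv_swap _ f]
        rw [← integral_mul_const]
        refine integral_congr_ae (Eventually.of_forall fun x => ?_)
        simp only
        rw [← heatK_neg s (x - z), neg_sub]
        ring

/-- Splitting time 2s into two equal halves lets one derivative and one half of the flow fall on
each function. -/
theorem integral_mul_heat_pd_pd {s : ℝ} (hs : 0 < s) (hf : IsTest f) (hψ : IsTest ψ)
    (i j : Fin 3) :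
    ∫ x, f x * heat (2 * s) (pd i (pd j ψ)) x = -∫ x, heat s (pd i f) x * heat s (pd j ψ) x := by
  rw [← integral_mul_heat_two hs (hf.pd i) (hψ.pd j), ← pd_heat _ (hψ.pd j)]
  exact integral_mul_pd hf.contDiff_one ((contDiff_heat _ (hψ.pd j)).of_le ENat.LEInfty.out)
    hf.compact i

/-- The product `|∂ᵢ e^{sΔ} f| |∂ⱼ e^{sΔ} ψ|` is integrable in space-time. -/
theorem integrable_heat_mul_heat (hf : IsTest f) (hψ : IsTest ψ) :
    Integrable (fun p : ℝ × E3 => |heat p.1 f p.2| * |heat p.1 ψ p.2|)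
      ((volume.restrict (Ioi 0)).prod volume) := by
  obtain ⟨C, hC, H⟩ := exists_heat_le hf
  have hm : AEStronglyMeasurable (fun p : ℝ × E3 => |heat p.1 f p.2| * |heat p.1 ψ p.2|)
      ((volume.restrict (Ioi 0)).prod volume) :=
    ((stronglyMeasurable_heat hf.continuous).norm.mul
      (stronglyMeasurable_heat hψ.continuous).norm).aestronglyMeasurable
  have hi : ∀ s : ℝ, 0 < s → Integrable fun x => |heat s f x| * |heat s ψ x| := by
    intro s hs
    exact (integrable_heat hs hψ.integrable).abs.bdd_mul
      (c := C * (s + 1) ^ (-(3 / 2) : ℝ)) (contDiff_heat s hf).continuous.abs.aestronglyMeasurable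
      (Eventually.of_forall fun x => by
        rw [norm_eq_abs, abs_abs]; exact H s hs x)
  rw [integrable_prod_iff hm]
  constructor
  · filter_upwards [ae_restrict_mem measurableSet_Ioi] with s hs using hi s hs
  · refine Integrable.mono' (g := fun s => C * (s + 1) ^ (-(3 / 2) : ℝ) * ∫ x, |ψ x|)
      (((integrableOn_add_rpow one_pos (by norm_num)).const_mul C).mul_const _)
      hm.norm.integral_prod_right' ?_
    filter_upwards [ae_restrict_mem measurableSet_Ioi] with s hs
    rw [norm_of_nonneg (integral_nonneg fun _ => norm_nonneg _)]
    calc ∫ x, ‖|heat s f x| * |heat s ψ x|‖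
        ≤ ∫ x, C * (s + 1) ^ (-(3 / 2) : ℝ) * |heat s ψ x| := by
          refine integral_mono (hi s hs).norm
            ((integrable_heat hs hψ.integrable).abs.const_mul _) fun x => ?_
          simp only [norm_mul, norm_eq_abs, abs_abs]
          gcongr
          exact H s hs x
      _ ≤ _ := by
          rw [integral_const_mul]
          have : 0 < s := hs
          exact mul_le_mul_of_nonneg_left (integral_abs_heat_le hs hψ) (by positivity)

/-- Representing the potential by the heat flow and substituting 2s for s produces the factor 2; the
symmetric splitting of the flow does the rest. -/
theorem abs_integral_mul_pot_le (hf : IsTest f) (hψ : IsTest ψ) (i j : Fin 3) :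
    |∫ x, f x * pot (pd i (pd j ψ)) x| ≤
      2 * ∫ p, |heat p.1 (pd i f) p.2| * |heat p.1 (pd j ψ) p.2|
        ∂((volume.restrict (Ioi (0 : ℝ))).prod (volume : Measure E3)) := by
  have hg : IsTest (pd i (pd j ψ)) := (hψ.pd j).pd i
  obtain ⟨C, hC, H⟩ := exists_heat_le hg
  have hint : Integrable (fun p : E3 × ℝ => f p.1 * heat p.2 (pd i (pd j ψ)) p.1)
      (volume.prod (volume.restrict (Ioi 0))) := by
    refine Integrable.mono' (g := fun p : E3 × ℝ => |f p.1| * (C * (p.2 + 1) ^ (-(3 / 2) : ℝ)))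
      (hf.integrable.abs.mul_prod
        ((integrableOn_add_rpow one_pos (by norm_num)).const_mul C)) ?_ ?_
    · exact ((hf.continuous.comp continuous_fst).stronglyMeasurable.mul
        ((stronglyMeasurable_heat hg.continuous).comp_measurable
          measurable_swap)).aestronglyMeasurable
    · have hpos : ∀ᵐ p : E3 × ℝ ∂(volume.prod (volume.restrict (Ioi 0))), 0 < p.2 :=
        Measure.quasiMeasurePreserving_snd.ae (ae_restrict_mem measurableSet_Ioi)
      filter_upwards [hpos] with p hp
      rw [norm_mul, norm_eq_abs, norm_eq_abs]
      gcongr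
      exact H p.2 hp p.1
  have e1 : ∫ x, f x * pot (pd i (pd j ψ)) x =
      ∫ s in Ioi (0 : ℝ), ∫ x, f x * heat s (pd i (pd j ψ)) x := by
    rw [← integral_integral_swap (f := fun x s => f x * heat s (pd i (pd j ψ)) x) hint]
    refine integral_congr_ae (Eventually.of_forall fun x => ?_)
    simp only [pot_eq_integral_heat hg, integral_const_mul]
  have e2 : ∫ s in Ioi (0 : ℝ), ∫ x, f x * heat s (pd i (pd j ψ)) x =
      2 * ∫ s in Ioi (0 : ℝ), ∫ x, f x * heat (2 * s) (pd i (pd j ψ)) x := by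
    have := integral_comp_mul_left_Ioi (fun s => ∫ x, f x * heat s (pd i (pd j ψ)) x) 0
      (two_pos : (0 : ℝ) < 2)
    rw [this, mul_zero, smul_eq_mul]
    ring
  have hI := integrable_heat_mul_heat (hf.pd i) (hψ.pd j)
  rw [e1, e2, abs_mul, abs_two, integral_prod _ hI]
  gcongr
  have hle := norm_integral_le_of_norm_le (μ := volume.restrict (Ioi (0 : ℝ)))
    (f := fun s => ∫ x, f x * heat (2 * s) (pd i (pd j ψ)) x) hI.integral_prod_left ?_
  · exact hle
  · filter_upwards [ae_restrict_mem measurableSet_Ioi] with s hs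
    rw [integral_mul_heat_pd_pd hs hf hψ, norm_neg]
    refine (norm_integral_le_integral_norm _).trans (le_of_eq ?_)
    simp only [norm_mul, norm_eq_abs]

end CalderonZygmund

end NematicFlow

end

noncomputable section

namespace NematicFlow

/-! ### Rescaled cut-off functions -/

section Scaling

open Real Set

/-- The rescaled function `x ↦ χ(x / r)`. -/
def scale (r : ℝ) (χ : E3 → ℝ) (x : E3) : ℝ := χ (r⁻¹ • x)

theorem IsTest.scale {χ : E3 → ℝ} (h : IsTest χ) {r : ℝ} (hr : 0 < r) : IsTest (scale r χ) :=
  ⟨h.smooth.comp (contDiff_const_smul r⁻¹),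
    h.compact.comp_homeomorph (Homeomorph.smulOfNeZero r⁻¹ (inv_ne_zero hr.ne'))⟩

theorem pd_scale {χ : E3 → ℝ} (h : Differentiable ℝ χ) (r : ℝ) (i : Fin 3) (x : E3) :
    pd i (scale r χ) x = r⁻¹ * scale r (pd i χ) x := by
  have h1 : HasFDerivAt (fun x : E3 => r⁻¹ • x) (r⁻¹ • ContinuousLinearMap.id ℝ E3) x :=
    (hasFDerivAt_id x).const_smul r⁻¹
  have h2 : HasFDerivAt (scale r χ) _ x := (h (r⁻¹ • x)).hasFDerivAt.comp x h1
  rw [pd, h2.fderiv]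
  simp [scale, pd]

theorem pd_scale_fun {χ : E3 → ℝ} (h : Differentiable ℝ χ) (r : ℝ) (i : Fin 3) :
    pd i (scale r χ) = fun x => r⁻¹ * scale r (pd i χ) x :=
  funext fun x => pd_scale h r i x

theorem lap_scale {χ : E3 → ℝ} (h : IsTest χ) {r : ℝ} (hr : 0 < r) (x : E3) :
    lap (scale r χ) x = r⁻¹ ^ 2 * scale r (lap χ) x := by
  have : ∀ i, pd i (pd i (scale r χ)) x = r⁻¹ ^ 2 * scale r (pd i (pd i χ)) x := by
    intro i
    rw [pd_scale_fun h.differentiable, pd_const_mul (((h.pd i).scale hr).differentiable x),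
      pd_scale (h.pd i).differentiable]
    ring
  simp only [lap, this, scale, Finset.mul_sum]

/-- A smooth cut-off equal to one on the unit ball. -/
theorem exists_cutoff : ∃ χ : E3 → ℝ, IsTest χ ∧ (∀ x, 0 ≤ χ x) ∧ (∀ x, χ x ≤ 1) ∧
    (∀ x, ‖x‖ ≤ 1 → χ x = 1) ∧ (∀ x, 2 ≤ ‖x‖ → χ x = 0) := by
  let b : ContDiffBump (0 : E3) := ⟨1, 2, one_pos, by norm_num⟩
  refine ⟨b, ⟨b.contDiff, b.hasCompactSupport⟩, fun x => b.nonneg, fun x => b.le_one,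
    fun x hx => b.one_of_mem_closedBall (by simpa [b] using hx),
    fun x hx => b.zero_of_le_dist (by simpa [b] using hx)⟩

end Scaling

/-! ### The Bellman function along the heat flow -/

section CalderonZygmund

open Real Set

variable {η f ψ : E3 → ℝ} {ε : ℝ}

/-- The heat flow, extended to `s = 0` by the initial value. -/
def heat0 (s : ℝ) (η : E3 → ℝ) (x : E3) : ℝ := if s ≤ 0 then η x else heat s η x

theorem heat0_of_pos {s : ℝ} (hs : 0 < s) : heat0 s η = heat s η := by
  ext x; simp [heat0, not_le.2 hs]

theorem heat0_of_nonpos {s : ℝ} (hs : s ≤ 0) : heat0 s η = η := by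
  ext x; simp [heat0, hs]

theorem continuous_heat0_space (s : ℝ) (h : IsTest η) : Continuous (heat0 s η) := by
  rcases le_or_gt s 0 with hs | hs
  · rw [heat0_of_nonpos hs]; exact h.continuous
  · rw [heat0_of_pos hs]; exact (contDiff_heat s h).continuous

theorem abs_heat0_le {C : ℝ} (hη : ∀ x, |η x| ≤ C) (s : ℝ) (x : E3) : |heat0 s η x| ≤ C := by
  rcases le_or_gt s 0 with hs | hs
  · rw [heat0_of_nonpos hs]; exact hη x
  · rw [heat0_of_pos hs]; exact abs_heat_le hs hη x

theorem hasDerivAt_heat0 (h : IsTest η) {s : ℝ} (hs : 0 < s) (x : E3) :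
    HasDerivAt (fun s => heat0 s η x) (heat s (lap η) x) s := by
  refine (hasDerivAt_heat h hs x).congr_of_eventuallyEq ?_
  filter_upwards [Ioi_mem_nhds hs] with σ hσ
  rw [heat0_of_pos hσ]

theorem continuous_heat0_time (h : IsTest η) (x : E3) : Continuous fun s => heat0 s η x := by
  rw [continuous_iff_continuousAt]
  intro s
  rcases lt_trichotomy s 0 with hs | rfl | hs
  · refine (continuousAt_const (y := η x)).congr ?_
    filter_upwards [Iio_mem_nhds hs] with σ hσ
    rw [heat0_of_nonpos (le_of_lt hσ)]
  · rw [continuousAt_iff_continuous_left'_right']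
    constructor
    · refine Tendsto.congr' ?_ (tendsto_const_nhds (x := η x)) |>.trans ?_
      · filter_upwards [self_mem_nhdsWithin] with σ hσ
        rw [heat0_of_nonpos (le_of_lt hσ)]
      · simp [heat0]
    · rw [ContinuousWithinAt, heat0_of_nonpos le_rfl]
      refine (tendsto_heat_zero h x).congr' ?_
      filter_upwards [self_mem_nhdsWithin] with σ hσ
      rw [heat0_of_pos hσ]
  · exact (hasDerivAt_heat0 h hs x).continuousAt

theorem lap_heat (s : ℝ) (h : IsTest η) (x : E3) : lap (heat s η) x = heat s (lap η) x := by
  have e : heat s (lap η) x = ∑ i, heat s (pd i (pd i η)) x :=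
    cv_sum _ (locallyIntegrable_heatK s) (fun i => (h.pd i).pd i) x
  rw [e, lap]
  exact Finset.sum_congr rfl fun i _ => by rw [pd_heat s h, pd_heat s (h.pd i)]

theorem tee_le (hε : 0 < ε) {a b A B : ℝ} (ha : |a| ≤ A) (hb : |b| ≤ B) :
    tee ε a b ≤ A + √B + √ε := by
  have hA : 0 ≤ A := (abs_nonneg a).trans ha
  have hB : 0 ≤ B := (abs_nonneg b).trans hb
  apply abs_le_of_sq_le_sq' _ (by positivity) |>.2
  have h1 := tee_sq_le hε a b
  have h2 : a ^ 2 ≤ A ^ 2 := by rw [← sq_abs]; gcongr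
  nlinarith [sq_sqrt hB, sqrt_nonneg B, sqrt_nonneg ε, mul_nonneg hA (sqrt_nonneg B),
    mul_nonneg hA (sqrt_nonneg ε), mul_nonneg (sqrt_nonneg B) (sqrt_nonneg ε)]

theorem abs_bellA_le (hε : 0 < ε) {M A a b : ℝ} (hT : tee ε a b ≤ M) (ha : |a| ≤ A) :
    |bellA ε a b| ≤ 3 * M * A := by
  have := tee_pos hε a b
  rw [bellA, abs_mul, abs_of_pos (by positivity)]
  have : 0 ≤ M := by linarith
  gcongr

theorem abs_bellB_le (hε : 0 < ε) {M a b : ℝ} (hT : tee ε a b ≤ M) : |bellB ε a b| ≤ 3 * M := by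
  have hr := rho_pos hε b
  have ht := tee_pos hε a b
  have hrt := rho_le_tee (ε := ε) a b
  have hb : |b| ≤ rho ε b ^ 2 := by
    rw [rho_sq]
    apply le_sqrt_of_sq_le
    rw [sq_abs]; nlinarith
  rw [bellB, abs_div, abs_of_pos (pow_pos hr 2), div_le_iff₀ (by positivity), abs_mul,
    abs_of_pos (by positivity)]
  have h1 : 3 / 2 * (tee ε a b + rho ε b) ≤ 3 * M := by linarith
  exact mul_le_mul h1 hb (abs_nonneg _) (by linarith)

theorem continuous_bell_comp {X : Type*} [TopologicalSpace X] {a b : X → ℝ} (ha : Continuous a)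
    (hb : Continuous b) : Continuous fun x => bell ε (a x) (b x) := by
  unfold bell tee rho
  fun_prop

theorem continuous_tee_comp {X : Type*} [TopologicalSpace X] {a b : X → ℝ} (ha : Continuous a)
    (hb : Continuous b) : Continuous fun x => tee ε (a x) (b x) := by
  unfold tee rho
  fun_prop

theorem continuous_bellA_comp {X : Type*} [TopologicalSpace X] {a b : X → ℝ} (ha : Continuous a)
    (hb : Continuous b) : Continuous fun x => bellA ε (a x) (b x) :=
  (continuous_const.mul (continuous_tee_comp ha hb)).mul ha

theorem continuous_bellB_comp (hε : 0 < ε) {X : Type*} [TopologicalSpace X] {a b : X → ℝ}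
    (ha : Continuous a) (hb : Continuous b) : Continuous fun x => bellB ε (a x) (b x) := by
  have hr : Continuous fun x => rho ε (b x) := by unfold rho; fun_prop
  exact ((continuous_const.mul ((continuous_tee_comp ha hb).add hr)).mul hb).div (hr.pow 2)
    fun x => by have := rho_pos hε (b x); positivity

/-- The quantity ∫ χ B(e^{sΔ}f, e^{sΔ}ψ) is nonnegative, and its derivative is at most minus three
times the desired integral plus ∫ Δχ B. The last term is at most KL because B is dominated by a
multiple of |e^{sΔ}f| + |e^{sΔ}ψ|, whose integral does not grow. It matters that K does not depend
on χ, L or M. -/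
theorem bellman_flow (hε : 0 < ε) (hf : IsTest f) (hψ : IsTest ψ) (i j : Fin 3) :
    ∃ K, 0 ≤ K ∧ ∀ χ : E3 → ℝ, IsTest χ → (∀ x, 0 ≤ χ x) → ∀ L, 0 ≤ L →
      (∀ x, |lap χ x| ≤ L) → ∀ M : ℝ, 0 ≤ M →
      3 * ∫ s in (0 : ℝ)..M, ∫ x, χ x * (|heat s (pd i f) x| * |heat s (pd j ψ) x|) ≤
        (∫ x, χ x * bell ε (f x) (ψ x)) + K * L * M := by
  obtain ⟨A, hA, hfA⟩ := hf.exists_bound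
  obtain ⟨B, hB, hψB⟩ := hψ.exists_bound
  obtain ⟨A', hA', hfA'⟩ := hf.lap.exists_bound
  obtain ⟨B', hB', hψB'⟩ := hψ.lap.exists_bound
  obtain ⟨A1, hA1, hfA1⟩ := (hf.pd i).exists_bound
  obtain ⟨B1, hB1, hψB1⟩ := (hψ.pd j).exists_bound
  set τ := A + √B + √ε with hτ
  have hτ0 : 0 ≤ τ := by positivity
  have hI1 : 0 ≤ ∫ x, |f x| := integral_nonneg fun _ => abs_nonneg _
  have hI2 : 0 ≤ ∫ x, |ψ x| := integral_nonneg fun _ => abs_nonneg _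
  refine ⟨4 * τ * (A * (∫ x, |f x|) + ∫ x, |ψ x|), by positivity, ?_⟩
  intro χ hχ hχ0 L hL hlap M hM
  have hT : ∀ s x, tee ε (heat0 s f x) (heat0 s ψ x) ≤ τ := fun s x =>
    tee_le hε (abs_heat0_le hfA s x) (abs_heat0_le hψB s x)
  have hbell : ∀ s x, bell ε (heat0 s f x) (heat0 s ψ x) ≤ 4 * τ * (A ^ 2 + B) := by
    intro s x
    refine (bell_le_of_bound hε (hT s x)).trans ?_
    have h1 := abs_heat0_le hfA s x
    have h2 := abs_heat0_le hψB s x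
    rw [← sq_abs (heat0 s f x)]
    gcongr
  have cbell : ∀ s, Continuous fun x => bell ε (heat0 s f x) (heat0 s ψ x) := fun s =>
    continuous_bell_comp (continuous_heat0_space s hf) (continuous_heat0_space s hψ)
  set h : ℝ → ℝ := fun s => ∫ x, χ x * bell ε (heat0 s f x) (heat0 s ψ x) with hh
  set m : ℝ → ℝ := fun s => ∫ x, χ x * (|heat s (pd i f) x| * |heat s (pd j ψ) x|) with hm
  set e := 4 * τ * (A * (∫ x, |f x|) + ∫ x, |ψ x|) * L with he
  have hcont : Continuous h := by
    refine continuous_of_dominated (bound := fun x => χ x * (4 * τ * (A ^ 2 + B))) ?_ ?_ ?_ ?_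
    · exact fun s => (hχ.continuous.mul (cbell s)).aestronglyMeasurable
    · refine fun s => Eventually.of_forall fun x => ?_
      rw [norm_mul, norm_of_nonneg (hχ0 x), norm_of_nonneg (bell_nonneg ε _ _)]
      exact mul_le_mul_of_nonneg_left (hbell s x) (hχ0 x)
    · exact hχ.integrable.mul_const _
    · exact Eventually.of_forall fun x => continuous_const.mul
        (continuous_bell_comp (continuous_heat0_time hf x) (continuous_heat0_time hψ x))
  have hderiv : ∀ s, 0 < s → HasDerivAt h (∫ x, χ x *
      (bellA ε (heat s f x) (heat s ψ x) * heat s (lap f) x +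
        bellB ε (heat s f x) (heat s ψ x) * heat s (lap ψ) x)) s := by
    intro s hs
    have hnb : Ioi (0 : ℝ) ∈ 𝓝 s := Ioi_mem_nhds hs
    refine (hasDerivAt_integral_of_dominated_loc_of_deriv_le (μ := (volume : Measure E3))
      (F := fun s x => χ x * bell ε (heat0 s f x) (heat0 s ψ x))
      (F' := fun s x => χ x * (bellA ε (heat s f x) (heat s ψ x) * heat s (lap f) x +
        bellB ε (heat s f x) (heat s ψ x) * heat s (lap ψ) x))
      (bound := fun x => χ x * (3 * τ * A * A' + 3 * τ * B')) hnb ?_ ?_ ?_ ?_ ?_ ?_).2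
    · exact Eventually.of_forall fun s => (hχ.continuous.mul (cbell s)).aestronglyMeasurable
    · exact (hχ.continuous.mul (cbell s)).integrable_of_hasCompactSupport hχ.compact.mul_right
    · refine Continuous.aestronglyMeasurable (hχ.continuous.mul (Continuous.add ?_ ?_))
      · exact (continuous_bellA_comp (contDiff_heat s hf).continuous
          (contDiff_heat s hψ).continuous).mul (contDiff_heat s hf.lap).continuous
      · exact (continuous_bellB_comp hε (contDiff_heat s hf).continuous
          (contDiff_heat s hψ).continuous).mul (contDiff_heat s hψ.lap).continuous
    · refine Eventually.of_forall fun x σ hσ => ?_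
      have hTσ := hT σ x
      rw [heat0_of_pos hσ, heat0_of_pos hσ] at hTσ
      rw [norm_mul, norm_of_nonneg (hχ0 x)]
      refine mul_le_mul_of_nonneg_left ((abs_add_le _ _).trans ?_) (hχ0 x)
      rw [abs_mul, abs_mul]
      refine add_le_add ?_ ?_
      · exact mul_le_mul (abs_bellA_le hε hTσ (abs_heat_le hσ hfA x)) (abs_heat_le hσ hfA' x)
          (abs_nonneg _) (by positivity)
      · exact mul_le_mul (abs_bellB_le hε hTσ) (abs_heat_le hσ hψB' x)
          (abs_nonneg _) (by positivity)
    · exact hχ.integrable.mul_const _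
    · refine Eventually.of_forall fun x σ hσ => ?_
      have hb := (hasFDerivAt_bell hε (heat0 σ f x, heat0 σ ψ x)).comp_hasDerivAt σ
        ((hasDerivAt_heat0 hf hσ x).prodMk (hasDerivAt_heat0 hψ hσ x))
      have hb' := hb.const_mul (χ x)
      refine HasDerivAt.congr_deriv hb' ?_
      simp [heat0_of_pos hσ]
  have hbound : ∀ s, 0 < s → (∫ x, χ x *
      (bellA ε (heat s f x) (heat s ψ x) * heat s (lap f) x +
        bellB ε (heat s f x) (heat s ψ x) * heat s (lap ψ) x)) ≤ -(3 * m s) + e := by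
    intro s hs
    have hd := bell_dissipation hε (contDiff_heat s hf) (contDiff_heat s hψ) hχ hχ0 i j
    simp only [lap_heat s hf, lap_heat s hψ, pd_heat s hf, pd_heat s hψ] at hd
    refine hd.trans (add_le_add le_rfl ?_)
    have i1 : Integrable fun x => 4 * τ * (A * |heat s f x| + |heat s ψ x|) :=
      (((integrable_heat hs hf.integrable).abs.const_mul A).add
        (integrable_heat hs hψ.integrable).abs).const_mul _
    have pw : ∀ x, bell ε (heat s f x) (heat s ψ x) ≤
        4 * τ * (A * |heat s f x| + |heat s ψ x|) := by
      intro x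
      have hTs := hT s x
      rw [heat0_of_pos hs, heat0_of_pos hs] at hTs
      refine (bell_le_of_bound hε hTs).trans ?_
      have h1 := abs_heat_le hs hfA x
      rw [← sq_abs (heat s f x), sq]
      gcongr
    have cb : Continuous fun x => bell ε (heat s f x) (heat s ψ x) :=
      continuous_bell_comp (contDiff_heat s hf).continuous (contDiff_heat s hψ).continuous
    calc ∫ x, lap χ x * bell ε (heat s f x) (heat s ψ x)
        ≤ ∫ x, L * (4 * τ * (A * |heat s f x| + |heat s ψ x|)) := by
          refine integral_mono ((hχ.lap.continuous.mul cb).integrable_of_hasCompactSupport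
            hχ.lap.compact.mul_right) (i1.const_mul L) fun x => ?_
          exact mul_le_mul ((le_abs_self _).trans (hlap x)) (pw x) (bell_nonneg ε _ _) hL
      _ = L * (4 * τ * (A * (∫ x, |heat s f x|) + ∫ x, |heat s ψ x|)) := by
          rw [integral_const_mul, integral_const_mul, integral_add
            ((integrable_heat hs hf.integrable).abs.const_mul A)
            (integrable_heat hs hψ.integrable).abs, integral_const_mul]
      _ ≤ L * (4 * τ * (A * (∫ x, |f x|) + ∫ x, |ψ x|)) := by
          have := integral_abs_heat_le hs hf
          have := integral_abs_heat_le hs hψ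
          gcongr
      _ = e := by rw [he]; ring
  have hmint : IntegrableOn m (Icc 0 M) := by
    have hmeas : AEStronglyMeasurable m (volume.restrict (Icc 0 M)) := by
      have : StronglyMeasurable fun p : ℝ × E3 =>
          χ p.2 * (|heat p.1 (pd i f) p.2| * |heat p.1 (pd j ψ) p.2|) :=
        (hχ.continuous.comp continuous_snd).stronglyMeasurable.mul
          ((stronglyMeasurable_heat (hf.pd i).continuous).norm.mul
            (stronglyMeasurable_heat (hψ.pd j).continuous).norm)
      exact this.integral_prod_right.aestronglyMeasurable
    rw [integrableOn_Icc_iff_integrableOn_Ioc]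
    refine Integrable.mono' (g := fun _ => ∫ x, χ x * (A1 * B1))
      (integrableOn_const (hs := measure_Ioc_lt_top.ne))
      (hmeas.mono_set Ioc_subset_Icc_self) ?_
    filter_upwards [ae_restrict_mem measurableSet_Ioc] with s hs
    refine norm_integral_le_of_norm_le (hχ.integrable.mul_const _)
      (Eventually.of_forall fun x => ?_)
    rw [norm_mul, norm_of_nonneg (hχ0 x), norm_of_nonneg (by positivity)]
    have h1 := abs_heat_le hs.1 hfA1 x
    have h2 := abs_heat_le hs.1 hψB1 x
    have := hχ0 x
    gcongr
  have hφ : IntegrableOn (fun s => -(3 * m s) + e) (Icc 0 M) :=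
    (hmint.const_mul 3).neg.add (integrableOn_const (hs := measure_Icc_lt_top.ne))
  -- Only continuity is available at s = 0, so the differential inequality is integrated in the form
  -- that needs derivatives in the open interval only.
  have main := intervalIntegral.sub_le_integral_of_hasDeriv_right_of_le hM hcont.continuousOn
    (fun s hs => (hderiv s hs.1).hasDerivWithinAt) hφ (fun s hs => hbound s hs.1)
  have hm' : IntervalIntegrable m volume 0 M :=
    (intervalIntegrable_iff_integrableOn_Icc_of_le hM).2 hmint
  have hm3 : IntervalIntegrable (fun s => -(3 * m s)) volume 0 M := (hm'.const_mul 3).neg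
  rw [intervalIntegral.integral_add hm3 intervalIntegrable_const,
    intervalIntegral.integral_neg, intervalIntegral.integral_const_mul,
    intervalIntegral.integral_const] at main
  have h0 : h 0 = ∫ x, χ x * bell ε (f x) (ψ x) := by
    simp only [hh, heat0_of_nonpos le_rfl]
  have hMnn : 0 ≤ h M := integral_nonneg fun x => mul_nonneg (hχ0 x) (bell_nonneg ε _ _)
  rw [← h0]
  simp only [sub_zero, smul_eq_mul] at main
  have : e * M = M * e := mul_comm _ _
  linarith

theorem IsTest.integrable_abs_cube (hf : IsTest f) : Integrable fun x => |f x| ^ 3 := by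
  have hc : Continuous fun x => |f x| ^ 3 := hf.continuous.abs.pow 3
  exact hc.integrable_of_hasCompactSupport
    (hf.compact.comp_left (g := fun y : ℝ => |y| ^ 3) (by simp))

theorem IsTest.integrable_sqrt_cube (hψ : IsTest ψ) : Integrable fun x => √|ψ x| ^ 3 := by
  have hc : Continuous fun x => √|ψ x| ^ 3 := hψ.continuous.abs.sqrt.pow 3
  exact hc.integrable_of_hasCompactSupport
    (hψ.compact.comp_left (g := fun y : ℝ => √|y| ^ 3) (by simp))

/-- V is the volume of a ball containing both supports. Outside it the normalised Bellman function
is zero, so the regularisation ε contributes only on a fixed finite volume and vanishes in the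
limit. -/
theorem exists_integral_mul_bell_le (hf : IsTest f) (hψ : IsTest ψ) : ∃ V : ℝ, ∀ ε : ℝ, 0 < ε →
    ∀ χ : E3 → ℝ, IsTest χ → (∀ x, 0 ≤ χ x) → (∀ x, χ x ≤ 1) →
    ∫ x, χ x * bell ε (f x) (ψ x) ≤
      18 * ((∫ x, |f x| ^ 3) + (∫ x, √|ψ x| ^ 3) + √ε ^ 3 * V) := by
  obtain ⟨r, hr, hfr⟩ := hf.exists_ball
  obtain ⟨r', hr', hψr⟩ := hψ.exists_ball
  refine ⟨volume.real (Metric.closedBall (0 : E3) (max r r')), fun ε hε χ hχ hχ0 hχ1 => ?_⟩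
  have if3 := hf.integrable_abs_cube
  have iψ3 := hψ.integrable_sqrt_cube
  have ib : Integrable fun x => √ε ^ 3 *
      (Metric.closedBall (0 : E3) (max r r')).indicator (1 : E3 → ℝ) x :=
    ((integrable_indicator_iff Metric.isClosed_closedBall.measurableSet).2
      (integrableOn_const (hs := measure_closedBall_lt_top.ne))).const_mul _
  have i2 : Integrable fun x => |f x| ^ 3 + √|ψ x| ^ 3 := if3.add iψ3
  have i3 : Integrable fun x => 18 * (|f x| ^ 3 + √|ψ x| ^ 3 + √ε ^ 3 *
      (Metric.closedBall (0 : E3) (max r r')).indicator (1 : E3 → ℝ) x) :=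
    (i2.add ib).const_mul 18
  have e2 : ∫ x, 18 * (|f x| ^ 3 + √|ψ x| ^ 3 + √ε ^ 3 *
      (Metric.closedBall (0 : E3) (max r r')).indicator (1 : E3 → ℝ) x) =
      18 * ((∫ x, |f x| ^ 3) + (∫ x, √|ψ x| ^ 3) +
        √ε ^ 3 * volume.real (Metric.closedBall (0 : E3) (max r r'))) := by
    rw [integral_const_mul, integral_add i2 ib, integral_add if3 iψ3,
      integral_const_mul, integral_indicator_one Metric.isClosed_closedBall.measurableSet]
  rw [← e2]
  refine integral_mono ?_ i3 fun x => ?_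
  · exact (hχ.continuous.mul (continuous_bell_comp hf.continuous
      hψ.continuous)).integrable_of_hasCompactSupport hχ.compact.mul_right
  · have hb0 := bell_nonneg ε (f x) (ψ x)
    have hle : χ x * bell ε (f x) (ψ x) ≤ bell ε (f x) (ψ x) :=
      mul_le_of_le_one_left hb0 (hχ1 x)
    refine hle.trans ?_
    by_cases hx : x ∈ Metric.closedBall (0 : E3) (max r r')
    · simp only [hx, indicator_of_mem, Pi.one_apply, mul_one]
      exact bell_le hε _ _
    · have hx' : max r r' < ‖x‖ := by simpa using hx
      rw [hfr x ((le_max_left _ _).trans_lt hx'), hψr x ((le_max_right _ _).trans_lt hx'),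
        bell_zero hε]
      simp [hx]

theorem tendsto_integral_exhaustion {H : ℝ × E3 → ℝ}
    (hI : Integrable H ((volume.restrict (Ioi (0 : ℝ))).prod (volume : Measure E3)))
    {χ : E3 → ℝ} (hχ : Continuous χ) (hχ0 : ∀ x, 0 ≤ χ x) (hχ1 : ∀ x, χ x ≤ 1)
    (hχone : ∀ x, ‖x‖ ≤ 1 → χ x = 1) :
    Tendsto (fun n : ℕ => ∫ s in (0 : ℝ)..n, ∫ x, scale n χ x * H (s, x)) atTop
      (𝓝 (∫ p, H p ∂((volume.restrict (Ioi (0 : ℝ))).prod (volume : Measure E3)))) := by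
  have hmeas : ∀ n : ℕ, AEStronglyMeasurable
      (fun p : ℝ × E3 => (Iic (n : ℝ)).indicator (1 : ℝ → ℝ) p.1 * (scale n χ p.2 * H p))
      ((volume.restrict (Ioi (0 : ℝ))).prod (volume : Measure E3)) := by
    intro n
    have hs : Continuous (scale n χ) := hχ.comp (continuous_const_smul _)
    refine AEStronglyMeasurable.mul ?_ (AEStronglyMeasurable.mul ?_ hI.aestronglyMeasurable)
    · exact ((measurable_one.indicator measurableSet_Iic).comp
        measurable_fst).aestronglyMeasurable
    · exact (hs.comp continuous_snd).aestronglyMeasurable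
  have hbd : ∀ (n : ℕ) (p : ℝ × E3),
      ‖(Iic (n : ℝ)).indicator (1 : ℝ → ℝ) p.1 * (scale n χ p.2 * H p)‖ ≤ ‖H p‖ := by
    intro n p
    have h1 : ‖(Iic (n : ℝ)).indicator (1 : ℝ → ℝ) p.1‖ ≤ 1 := by
      by_cases hp : p.1 ∈ Iic (n : ℝ) <;> simp [hp]
    have h2 : ‖scale n χ p.2‖ ≤ 1 := by
      rw [scale, norm_of_nonneg (hχ0 _)]; exact hχ1 _
    rw [norm_mul, norm_mul]
    calc _ ≤ 1 * (1 * ‖H p‖) := by gcongr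
      _ = ‖H p‖ := by ring
  have hlim : Tendsto (fun n : ℕ => ∫ p : ℝ × E3,
      (Iic (n : ℝ)).indicator (1 : ℝ → ℝ) p.1 * (scale n χ p.2 * H p)
        ∂((volume.restrict (Ioi (0 : ℝ))).prod (volume : Measure E3))) atTop
      (𝓝 (∫ p, H p ∂((volume.restrict (Ioi (0 : ℝ))).prod (volume : Measure E3)))) := by
    refine tendsto_integral_of_dominated_convergence (fun p => ‖H p‖) hmeas hI.norm
      (fun n => Eventually.of_forall (hbd n)) (Eventually.of_forall fun p => ?_)
    refine tendsto_const_nhds.congr' ?_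
    have h1 : ∀ᶠ n : ℕ in atTop, p.1 ≤ n :=
      (tendsto_natCast_atTop_atTop (R := ℝ)).eventually_ge_atTop p.1
    have h2 : ∀ᶠ n : ℕ in atTop, ‖p.2‖ ≤ n :=
      (tendsto_natCast_atTop_atTop (R := ℝ)).eventually_ge_atTop ‖p.2‖
    filter_upwards [h1, h2, eventually_gt_atTop 0] with n hn1 hn2 hn
    have hn' : (0 : ℝ) < n := by exact_mod_cast hn
    have e1 : scale n χ p.2 = 1 := by
      refine hχone _ ?_
      rw [norm_smul, norm_inv, norm_of_nonneg hn'.le, inv_mul_le_iff₀ hn']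
      linarith
    have e2 : (Iic (n : ℝ)).indicator (1 : ℝ → ℝ) p.1 = 1 := by simp [hn1]
    rw [e1, e2, one_mul, one_mul]
  refine hlim.congr fun n => ?_
  rw [integral_prod _ (hI.mono (hmeas n) (Eventually.of_forall (hbd n))),
    intervalIntegral.integral_of_le n.cast_nonneg, ← Ioi_inter_Iic,
    ← setIntegral_indicator measurableSet_Iic]
  refine integral_congr_ae (Eventually.of_forall fun s => ?_)
  simp only [integral_const_mul]
  by_cases hs : s ∈ Iic (n : ℝ)
  · rw [indicator_of_mem hs, indicator_of_mem hs, Pi.one_apply, one_mul]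
  · rw [indicator_of_notMem hs, indicator_of_notMem hs, zero_mul]

/-- Cut off in space at scale n and in time at n: the Laplacian of the cut-off is O(n⁻²), so the
error over the time interval is O(1/n). Letting n → ∞ and then ε → 0 leaves 18/3 = 6. -/
theorem integral_heat_mul_heat_le (hf : IsTest f) (hψ : IsTest ψ) (i j : Fin 3) :
    ∫ p, |heat p.1 (pd i f) p.2| * |heat p.1 (pd j ψ) p.2|
        ∂((volume.restrict (Ioi (0 : ℝ))).prod (volume : Measure E3)) ≤
      6 * ((∫ x, |f x| ^ 3) + ∫ x, √|ψ x| ^ 3) := by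
  obtain ⟨χ, hχ, hχ0, hχ1, hχone, -⟩ := exists_cutoff
  obtain ⟨L, hL, hlap⟩ := hχ.lap.exists_bound
  obtain ⟨V, hV⟩ := exists_integral_mul_bell_le hf hψ
  have hI := integrable_heat_mul_heat (hf.pd i) (hψ.pd j)
  have hlim := tendsto_integral_exhaustion hI hχ.continuous hχ0 hχ1 hχone
  generalize ∫ p, |heat p.1 (pd i f) p.2| * |heat p.1 (pd j ψ) p.2|
        ∂((volume.restrict (Ioi (0 : ℝ))).prod (volume : Measure E3)) = X at hlim ⊢
  have bound : ∀ ε : ℝ, 0 < ε →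
      X ≤ 6 * ((∫ x, |f x| ^ 3) + (∫ x, √|ψ x| ^ 3) + √ε ^ 3 * V) := by
    intro ε hε
    obtain ⟨K, hK, hflow⟩ := bellman_flow hε hf hψ i j
    have hlim2 : Tendsto (fun n : ℕ => 6 * ((∫ x, |f x| ^ 3) + (∫ x, √|ψ x| ^ 3) + √ε ^ 3 * V) +
        K * L / 3 * (1 / (n : ℝ))) atTop
        (𝓝 (6 * ((∫ x, |f x| ^ 3) + (∫ x, √|ψ x| ^ 3) + √ε ^ 3 * V) + K * L / 3 * 0)) :=
      (tendsto_one_div_atTop_nhds_zero_nat.const_mul _).const_add _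
    rw [mul_zero, add_zero] at hlim2
    refine le_of_tendsto_of_tendsto hlim hlim2 ?_
    filter_upwards [eventually_gt_atTop 0] with n hn
    have hn' : (0 : ℝ) < n := by exact_mod_cast hn
    have hLn : ∀ x, |lap (scale n χ) x| ≤ (n : ℝ)⁻¹ ^ 2 * L := by
      intro x
      rw [lap_scale hχ hn', abs_mul, abs_of_nonneg (by positivity)]
      gcongr
      exact hlap _
    have h1 := hflow (scale n χ) (hχ.scale hn') (fun x => hχ0 _) _ (by positivity) hLn n hn'.le
    have h2 := hV ε hε (scale n χ) (hχ.scale hn') (fun x => hχ0 _) (fun x => hχ1 _)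
    have e3 : K * ((n : ℝ)⁻¹ ^ 2 * L) * n = K * L * (1 / n) := by field_simp
    rw [e3] at h1
    linarith
  have hc : Continuous fun ε : ℝ => 6 * ((∫ x, |f x| ^ 3) + (∫ x, √|ψ x| ^ 3) + √ε ^ 3 * V) := by
    fun_prop
  have hlim : Tendsto (fun ε : ℝ => 6 * ((∫ x, |f x| ^ 3) + (∫ x, √|ψ x| ^ 3) + √ε ^ 3 * V))
      (𝓝[>] 0) (𝓝 (6 * ((∫ x, |f x| ^ 3) + ∫ x, √|ψ x| ^ 3))) := by
    have := (hc.tendsto 0).mono_left (nhdsWithin_le_nhds (s := Ioi 0))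
    simpa using this
  refine ge_of_tendsto hlim ?_
  filter_upwards [self_mem_nhdsWithin] with ε hε using bound ε hε

/-- The bilinear Calderón–Zygmund estimate for the exponents `3` and `3/2`. -/
theorem abs_integral_mul_pot_le_add (hf : IsTest f) (hψ : IsTest ψ) (i j : Fin 3) :
    |∫ x, f x * pot (pd i (pd j ψ)) x| ≤ 12 * ((∫ x, |f x| ^ 3) + ∫ x, √|ψ x| ^ 3) := by
  have := abs_integral_mul_pot_le hf hψ i j
  have := integral_heat_mul_heat_le hf hψ i j
  linarith

end CalderonZygmund

end NematicFlow

end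

noncomputable section

namespace NematicFlow

/-! ### Product form of the L³ bound and the Hardy–Littlewood–Sobolev inequality -/

section SingularIntegrals

open Real Set

variable {η f ψ φ : E3 → ℝ}

theorem sqrt_div_sq_cube {a α : ℝ} (hα : 0 < α) : √(a / α ^ 2) ^ 3 = √a ^ 3 / α ^ 3 := by
  rw [sqrt_div' _ (sq_nonneg α), sqrt_sq hα.le, div_pow]

/-- The bilinear Calderón–Zygmund estimate for the exponents `3` and `3/2`, in product form. -/
theorem abs_integral_mul_pot_le_mul (hf : IsTest f) (hψ : IsTest ψ) (i j : Fin 3) {α β : ℝ}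
    (hα : 0 < α) (hβ : 0 < β) (hfα : ∫ x, |f x| ^ 3 ≤ α ^ 3) (hψβ : ∫ x, √|ψ x| ^ 3 ≤ β ^ 3) :
    |∫ x, f x * pot (pd i (pd j ψ)) x| ≤ 24 * α * β ^ 2 := by
  -- Normalising f by α and ψ by β² makes both integrals at most 1, so the additive bound becomes 12
  -- · 2 = 24.
  have h1 : IsTest fun x => α⁻¹ * f x := hf.mul_left contDiff_const
  have h2 : IsTest fun x => (β ^ 2)⁻¹ * ψ x := hψ.mul_left contDiff_const
  have h := abs_integral_mul_pot_le_add h1 h2 i j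
  have e1 : pd i (pd j fun x => (β ^ 2)⁻¹ * ψ x) = fun x => (β ^ 2)⁻¹ * pd i (pd j ψ) x := by
    have : pd j (fun x => (β ^ 2)⁻¹ * ψ x) = fun x => (β ^ 2)⁻¹ * pd j ψ x :=
      funext fun x => pd_const_mul (hψ.differentiable x) _ _
    rw [this]
    exact funext fun x => pd_const_mul ((hψ.pd j).differentiable x) _ _
  have e2 : ∀ x, pot (fun x => (β ^ 2)⁻¹ * pd i (pd j ψ) x) x =
      (β ^ 2)⁻¹ * pot (pd i (pd j ψ)) x := by
    intro x
    simp only [pot, cv]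
    rw [← integral_const_mul]
    refine integral_congr_ae (Eventually.of_forall fun z => ?_)
    simp only
    ring
  have e3 : ∫ x, α⁻¹ * f x * ((β ^ 2)⁻¹ * pot (pd i (pd j ψ)) x) =
      (α * β ^ 2)⁻¹ * ∫ x, f x * pot (pd i (pd j ψ)) x := by
    rw [← integral_const_mul]
    refine integral_congr_ae (Eventually.of_forall fun z => ?_)
    simp only [mul_inv]
    ring
  have e4 : ∫ x, |α⁻¹ * f x| ^ 3 = (α ^ 3)⁻¹ * ∫ x, |f x| ^ 3 := by
    rw [← integral_const_mul]
    refine integral_congr_ae (Eventually.of_forall fun z => ?_)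
    simp only [abs_mul, abs_inv, abs_of_pos hα, mul_pow, inv_pow]
  have e5 : ∫ x, √|(β ^ 2)⁻¹ * ψ x| ^ 3 = (β ^ 3)⁻¹ * ∫ x, √|ψ x| ^ 3 := by
    rw [← integral_const_mul]
    refine integral_congr_ae (Eventually.of_forall fun z => ?_)
    simp only
    rw [abs_mul, abs_inv, abs_of_pos (by positivity : 0 < β ^ 2), inv_mul_eq_div,
      sqrt_div_sq_cube hβ, inv_mul_eq_div]
  rw [e1] at h
  simp only [e2] at h
  rw [e3, e4, e5, abs_mul, abs_of_pos (by positivity), inv_mul_le_iff₀ (by positivity)] at h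
  have h3 : (α ^ 3)⁻¹ * ∫ x, |f x| ^ 3 ≤ 1 := by
    rw [inv_mul_le_iff₀ (by positivity)]; linarith
  have h4 : (β ^ 3)⁻¹ * ∫ x, √|ψ x| ^ 3 ≤ 1 := by
    rw [inv_mul_le_iff₀ (by positivity)]; linarith
  refine h.trans ?_
  have : 0 ≤ α * β ^ 2 := by positivity
  nlinarith

/-- An integrable majorant used in the Hardy–Littlewood–Sobolev inequality. -/
def hlsKernel (a : ℝ) (z : E3) : ℝ :=
  if a * ‖z‖ ^ 2 < 1 then a ^ 2 * ‖z‖⁻¹ ^ 2 else ‖z‖⁻¹ ^ 6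

theorem hlsKernel_nonneg (a : ℝ) (z : E3) : 0 ≤ hlsKernel a z := by
  unfold hlsKernel; split_ifs <;> positivity

theorem measurable_hlsKernel : Measurable fun p : ℝ × E3 => hlsKernel p.1 p.2 := by
  unfold hlsKernel
  refine Measurable.ite (measurableSet_lt (by fun_prop) measurable_const) ?_ ?_ <;> fun_prop

theorem young_cube {p q : ℝ} (hp : 0 ≤ p) (hq : 0 ≤ q) : p ^ 2 * q ≤ p ^ 3 + q ^ 3 := by
  rcases le_total p q with h | h
  · nlinarith [pow_nonneg hp 3, mul_le_mul_of_nonneg_right (pow_le_pow_left₀ hp h 2) hq]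
  · nlinarith [pow_nonneg hq 3, mul_le_mul_of_nonneg_left h (sq_nonneg p)]

/-- For |z|² < 1/a, replace b by the larger a. Otherwise split the product by Young's inequality
into (ab)^{3/2} and |z|⁻⁶, the latter now integrable because z stays away from 0. -/
theorem mul_le_hlsKernel_of_le {a b : ℝ} (hb : 0 ≤ b) (hab : b ≤ a) (z : E3) :
    a * b * ‖z‖⁻¹ ^ 2 ≤ hlsKernel a z + √a ^ 3 * √b ^ 3 := by
  have ha : 0 ≤ a := hb.trans hab
  unfold hlsKernel
  split_ifs with h
  · have : a * b * ‖z‖⁻¹ ^ 2 ≤ a ^ 2 * ‖z‖⁻¹ ^ 2 := by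
      rw [sq a]; gcongr
    have : 0 ≤ √a ^ 3 * √b ^ 3 := by positivity
    linarith
  · have h1 := young_cube (p := √a * √b) (q := ‖z‖⁻¹ ^ 2) (by positivity) (by positivity)
    have e : (√a * √b) ^ 2 = a * b := by rw [mul_pow, sq_sqrt ha, sq_sqrt hb]
    rw [e, mul_pow, ← pow_mul] at h1
    linarith

theorem mul_le_hlsKernel {a b : ℝ} (ha : 0 ≤ a) (hb : 0 ≤ b) (z : E3) :
    a * b * ‖z‖⁻¹ ^ 2 ≤ hlsKernel a z + hlsKernel b z + √a ^ 3 * √b ^ 3 := by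
  have h1 := hlsKernel_nonneg a z
  have h2 := hlsKernel_nonneg b z
  rcases le_total b a with h | h
  · linarith [mul_le_hlsKernel_of_le hb h z]
  · have := mul_le_hlsKernel_of_le ha h z
    rw [mul_comm b a, mul_comm (√b ^ 3)] at this
    linarith

theorem integrable_hlsKernel_one : Integrable (hlsKernel 1) := by
  have h1 : LocallyIntegrable fun z : E3 => ‖z‖⁻¹ ^ 2 := by
    refine locallyIntegrable_of_norm_le_rpow (C := 1) (α := 2) (by simp) (by simp; norm_num) ?_
      (by fun_prop)
    refine Eventually.of_forall fun z => ?_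
    rw [norm_of_nonneg (by positivity), one_mul, inv_pow, rpow_neg (norm_nonneg z), rpow_two]
  have h2 : Integrable fun z : E3 => (Metric.closedBall (0 : E3) 1).indicator
      (fun z => ‖z‖⁻¹ ^ 2) z :=
    (integrable_indicator_iff Metric.isClosed_closedBall.measurableSet).2
      (h1.integrableOn_isCompact (isCompact_closedBall _ _))
  have h3 : Integrable fun z : E3 => (2 : ℝ) ^ 6 * (1 + ‖z‖) ^ (-(6 : ℝ)) :=
    (integrable_one_add_norm (by simp; norm_num)).const_mul _
  refine Integrable.mono' (h2.add h3)
    (measurable_hlsKernel.comp measurable_prodMk_left).aestronglyMeasurable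
    (Eventually.of_forall fun z => ?_)
  rw [norm_of_nonneg (hlsKernel_nonneg _ _)]
  unfold hlsKernel
  simp only [Pi.add_apply]
  split_ifs with h
  · have hz : z ∈ Metric.closedBall (0 : E3) 1 := by
      rw [mem_closedBall_zero_iff]
      nlinarith [norm_nonneg z]
    rw [indicator_of_mem hz]
    have : 0 ≤ (2 : ℝ) ^ 6 * (1 + ‖z‖) ^ (-(6 : ℝ)) := by positivity
    linarith
  · have hz : 1 ≤ ‖z‖ := by
      by_contra! hlt
      apply h
      nlinarith [norm_nonneg z]
    have h0 : 0 ≤ (Metric.closedBall (0 : E3) 1).indicator (fun z => ‖z‖⁻¹ ^ 2) z :=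
      indicator_nonneg (fun _ _ => by positivity) _
    have : ‖z‖⁻¹ ^ 6 ≤ (2 : ℝ) ^ 6 * (1 + ‖z‖) ^ (-(6 : ℝ)) := by
      rw [rpow_neg (by positivity), show (6 : ℝ) = ((6 : ℕ) : ℝ) by norm_num, rpow_natCast,
        ← inv_pow, ← mul_pow]
      refine pow_le_pow_left₀ (by positivity) ?_ 6
      rw [← div_eq_mul_inv, le_div_iff₀ (by positivity), inv_mul_le_iff₀ (by positivity)]
      linarith
    linarith

theorem hlsKernel_scale {a : ℝ} (ha : 0 < a) (z : E3) :
    hlsKernel a z = a ^ 3 * hlsKernel 1 (√a • z) := by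
  unfold hlsKernel
  have e : ‖√a • z‖ = √a * ‖z‖ := by rw [norm_smul, norm_of_nonneg (sqrt_nonneg a)]
  have e2 : (1 : ℝ) * ‖√a • z‖ ^ 2 = a * ‖z‖ ^ 2 := by rw [e, mul_pow, sq_sqrt ha.le, one_mul]
  have e3 : ‖√a • z‖⁻¹ ^ 2 = a⁻¹ * ‖z‖⁻¹ ^ 2 := by
    rw [e, inv_pow, mul_pow, sq_sqrt ha.le, mul_inv, inv_pow]
  have e4 : ‖√a • z‖⁻¹ ^ 6 = (a⁻¹ * ‖z‖⁻¹ ^ 2) ^ 3 := by rw [← e3, ← pow_mul]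
  rw [e2, e3, e4]
  split_ifs
  · field_simp
  · field_simp

/-- By scaling, both pieces contribute a multiple of a^{3/2}. This turns the pointwise inequality
into a bound by the L^{3/2} integrals. -/
theorem lintegral_hlsKernel {a : ℝ} (ha : 0 ≤ a) :
    ∫⁻ z, ENNReal.ofReal (hlsKernel a z) =
      ENNReal.ofReal (∫ z, hlsKernel 1 z) * ENNReal.ofReal (√a ^ 3) := by
  rcases ha.eq_or_lt with rfl | ha
  · simp [hlsKernel]
  · have h1 : Integrable (hlsKernel a) := by
      have : hlsKernel a = fun z => a ^ 3 * hlsKernel 1 (√a • z) := funext (hlsKernel_scale ha)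
      rw [this]
      exact (integrable_hlsKernel_one.comp_smul (sqrt_pos.2 ha).ne').const_mul _
    rw [← ofReal_integral_eq_lintegral_ofReal h1 (Eventually.of_forall (hlsKernel_nonneg a)),
      ← ENNReal.ofReal_mul (integral_nonneg (hlsKernel_nonneg 1))]
    congr 1
    have : ∫ z, hlsKernel a z = ∫ z, a ^ 3 * hlsKernel 1 (√a • z) :=
      integral_congr_ae (Eventually.of_forall (hlsKernel_scale ha))
    rw [this, integral_const_mul, Measure.integral_comp_smul_of_nonneg _ _ _
      (hR := sqrt_nonneg a)]
    have e : Module.finrank ℝ E3 = 3 := by simp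
    rw [e, smul_eq_mul]
    have : a ^ 3 = √a ^ 3 * √a ^ 3 := by
      rw [← mul_pow, mul_self_sqrt ha.le]
    rw [this]
    have : √a ^ 3 ≠ 0 := (pow_pos (sqrt_pos.2 ha) 3).ne'
    field_simp

/-- The pointwise splitting is integrated with a = F(x), b = G(y), z = x - y: one majorant is
integrated in y first, the other in x first, and the last term factorises. -/
theorem hardy_littlewood_sobolev_add {F G : E3 → ℝ} (hF : Measurable F) (hG : Measurable G)
    (hF0 : ∀ x, 0 ≤ F x) (hG0 : ∀ x, 0 ≤ G x) :
    ∫⁻ x, ∫⁻ y, ENNReal.ofReal (F x * G y * ‖x - y‖⁻¹ ^ 2) ≤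
      ENNReal.ofReal (∫ z, hlsKernel 1 z) * ((∫⁻ x, ENNReal.ofReal (√(F x) ^ 3)) +
        ∫⁻ x, ENNReal.ofReal (√(G x) ^ 3)) +
      (∫⁻ x, ENNReal.ofReal (√(F x) ^ 3)) * ∫⁻ x, ENNReal.ofReal (√(G x) ^ 3) := by
  have mF : Measurable fun x => ENNReal.ofReal (√(F x) ^ 3) := by fun_prop
  have mG : Measurable fun x => ENNReal.ofReal (√(G x) ^ 3) := by fun_prop
  have mK1 : Measurable fun p : E3 × E3 => ENNReal.ofReal (hlsKernel (F p.1) (p.1 - p.2)) :=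
    (measurable_hlsKernel.comp ((hF.comp measurable_fst).prodMk
      (measurable_fst.sub measurable_snd))).ennreal_ofReal
  have mK2 : Measurable fun p : E3 × E3 => ENNReal.ofReal (hlsKernel (G p.2) (p.1 - p.2)) :=
    (measurable_hlsKernel.comp ((hG.comp measurable_snd).prodMk
      (measurable_fst.sub measurable_snd))).ennreal_ofReal
  have i1 : ∀ x, ∫⁻ y, ENNReal.ofReal (hlsKernel (F x) (x - y)) =
      ENNReal.ofReal (∫ z, hlsKernel 1 z) * ENNReal.ofReal (√(F x) ^ 3) := by
    intro x
    rw [lintegral_sub_left_eq_self (fun z => ENNReal.ofReal (hlsKernel (F x) z)) x,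
      lintegral_hlsKernel (hF0 x)]
  have i2 : ∀ y, ∫⁻ x, ENNReal.ofReal (hlsKernel (G y) (x - y)) =
      ENNReal.ofReal (∫ z, hlsKernel 1 z) * ENNReal.ofReal (√(G y) ^ 3) := by
    intro y
    rw [lintegral_sub_right_eq_self (fun z => ENNReal.ofReal (hlsKernel (G y) z)) y,
      lintegral_hlsKernel (hG0 y)]
  calc ∫⁻ x, ∫⁻ y, ENNReal.ofReal (F x * G y * ‖x - y‖⁻¹ ^ 2)
      ≤ ∫⁻ x, ∫⁻ y, (ENNReal.ofReal (hlsKernel (F x) (x - y)) +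
          ENNReal.ofReal (hlsKernel (G y) (x - y)) +
          ENNReal.ofReal (√(F x) ^ 3) * ENNReal.ofReal (√(G y) ^ 3)) := by
        refine lintegral_mono fun x => lintegral_mono fun y => ?_
        rw [← ENNReal.ofReal_mul (by positivity), ← ENNReal.ofReal_add
          (hlsKernel_nonneg _ _) (hlsKernel_nonneg _ _), ← ENNReal.ofReal_add
          (add_nonneg (hlsKernel_nonneg _ _) (hlsKernel_nonneg _ _)) (by positivity)]
        exact ENNReal.ofReal_le_ofReal (mul_le_hlsKernel (hF0 x) (hG0 y) _)
    _ = (∫⁻ x, ∫⁻ y, ENNReal.ofReal (hlsKernel (F x) (x - y))) +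
          (∫⁻ x, ∫⁻ y, ENNReal.ofReal (hlsKernel (G y) (x - y))) +
          ∫⁻ x, ∫⁻ y, ENNReal.ofReal (√(F x) ^ 3) * ENNReal.ofReal (√(G y) ^ 3) := by
        have n1 : Measurable fun x => ∫⁻ y, ENNReal.ofReal (hlsKernel (F x) (x - y)) :=
          mK1.lintegral_prod_right'
        have n2 : Measurable fun x => (∫⁻ y, ENNReal.ofReal (hlsKernel (F x) (x - y))) +
            ∫⁻ y, ENNReal.ofReal (hlsKernel (G y) (x - y)) := n1.add mK2.lintegral_prod_right'
        rw [← lintegral_add_left n1, ← lintegral_add_left n2]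
        refine lintegral_congr fun x => ?_
        have m1 : Measurable fun y => ENNReal.ofReal (hlsKernel (F x) (x - y)) :=
          mK1.comp measurable_prodMk_left
        have m2 : Measurable fun y => ENNReal.ofReal (hlsKernel (G y) (x - y)) :=
          mK2.comp measurable_prodMk_left
        have m3 : Measurable fun y => ENNReal.ofReal (hlsKernel (F x) (x - y)) +
            ENNReal.ofReal (hlsKernel (G y) (x - y)) := m1.add m2
        rw [lintegral_add_left m3, lintegral_add_left m1]
    _ = _ := by
        rw [lintegral_lintegral_swap (f := fun x y => ENNReal.ofReal (hlsKernel (G y) (x - y)))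
          mK2.aemeasurable]
        simp only [i1, i2, lintegral_const_mul _ mF, lintegral_const_mul _ mG,
          lintegral_mul_const _ mF]
        rw [mul_add]

/-- The Hardy–Littlewood–Sobolev inequality for the kernel `|x - y|⁻²` on `L^{3/2} × L^{3/2}`. -/
theorem exists_hardy_littlewood_sobolev : ∃ C : ℝ, 0 < C ∧ ∀ F G : E3 → ℝ, Measurable F →
    Measurable G → (∀ x, 0 ≤ F x) → (∀ x, 0 ≤ G x) → ∀ α β : ℝ, 0 < α → 0 < β →
    ∫⁻ x, ENNReal.ofReal (√(F x) ^ 3) ≤ ENNReal.ofReal (α ^ 3) →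
    ∫⁻ x, ENNReal.ofReal (√(G x) ^ 3) ≤ ENNReal.ofReal (β ^ 3) →
    ∫⁻ x, ∫⁻ y, ENNReal.ofReal (F x * G y * ‖x - y‖⁻¹ ^ 2) ≤
      ENNReal.ofReal (C * α ^ 2 * β ^ 2) := by
  have hk : 0 ≤ ∫ z, hlsKernel 1 z := integral_nonneg (hlsKernel_nonneg 1)
  refine ⟨2 * (∫ z, hlsKernel 1 z) + 1, by positivity, fun F G hF hG hF0 hG0 α β hα hβ hFα hGβ => ?_⟩
  have key : ∀ {F : E3 → ℝ} {α : ℝ}, Measurable F → 0 < α →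
      ∫⁻ x, ENNReal.ofReal (√(F x) ^ 3) ≤ ENNReal.ofReal (α ^ 3) →
      ∫⁻ x, ENNReal.ofReal (√(F x / α ^ 2) ^ 3) ≤ 1 := by
    intro F α hF hα h
    have e : ∀ x, ENNReal.ofReal (√(F x / α ^ 2) ^ 3) =
        ENNReal.ofReal ((α ^ 3)⁻¹) * ENNReal.ofReal (√(F x) ^ 3) := by
      intro x
      rw [sqrt_div_sq_cube hα, div_eq_inv_mul, ENNReal.ofReal_mul (by positivity)]
    simp only [e]
    rw [lintegral_const_mul _ (by fun_prop)]
    calc _ ≤ ENNReal.ofReal ((α ^ 3)⁻¹) * ENNReal.ofReal (α ^ 3) := by gcongr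
      _ = 1 := by
        rw [← ENNReal.ofReal_mul (by positivity), inv_mul_cancel₀ (by positivity),
          ENNReal.ofReal_one]
  have h1 := key hF hα hFα
  have h2 := key hG hβ hGβ
  have h := hardy_littlewood_sobolev_add (hF.div_const (α ^ 2)) (hG.div_const (β ^ 2))
    (fun x => div_nonneg (hF0 x) (sq_nonneg α)) (fun x => div_nonneg (hG0 x) (sq_nonneg β))
  have e : ∀ x y, ENNReal.ofReal (F x * G y * ‖x - y‖⁻¹ ^ 2) = ENNReal.ofReal (α ^ 2 * β ^ 2) *
      ENNReal.ofReal (F x / α ^ 2 * (G y / β ^ 2) * ‖x - y‖⁻¹ ^ 2) := by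
    intro x y
    rw [← ENNReal.ofReal_mul (by positivity)]
    congr 1
    field_simp
  simp only [e]
  have m : Measurable fun p : E3 × E3 =>
      ENNReal.ofReal (F p.1 / α ^ 2 * (G p.2 / β ^ 2) * ‖p.1 - p.2‖⁻¹ ^ 2) :=
    ((((hF.comp measurable_fst).div_const _).mul ((hG.comp measurable_snd).div_const _)).mul
      (by fun_prop)).ennreal_ofReal
  have m1 : ∀ x, Measurable fun y =>
      ENNReal.ofReal (F x / α ^ 2 * (G y / β ^ 2) * ‖x - y‖⁻¹ ^ 2) :=
    fun x => m.comp measurable_prodMk_left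
  simp only [lintegral_const_mul _ (m1 _)]
  rw [lintegral_const_mul _ m.lintegral_prod_right']
  calc _ ≤ ENNReal.ofReal (α ^ 2 * β ^ 2) *
        (ENNReal.ofReal (∫ z, hlsKernel 1 z) * (1 + 1) + 1 * 1) := by
        refine mul_le_mul_right (h.trans ?_) _
        gcongr
    _ = _ := by
        rw [one_mul, show (1 + 1 : ℝ≥0∞) = ENNReal.ofReal 2 by norm_num,
          ← ENNReal.ofReal_mul hk, ← ENNReal.ofReal_one, ← ENNReal.ofReal_add (by positivity)
          zero_le_one, ← ENNReal.ofReal_mul (by positivity)]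
        congr 1
        ring

end SingularIntegrals

end NematicFlow

end

noncomputable section

namespace NematicFlow

/-! ### Commutators and far-field expansion of ∂ᵢ∂ⱼ(-Δ)⁻¹ -/

section SecondDerivatives

open Real Set

variable {η f ψ φ : E3 → ℝ}

/-- The kernel of `∂ᵢ∂ⱼ (-Δ)⁻¹` away from the origin. -/
def rieszK (i j : Fin 3) (z : E3) : ℝ := ∫ s in Ioi (0 : ℝ), heatK2 i j s z

theorem stronglyMeasurable_rieszK (i j : Fin 3) : StronglyMeasurable (rieszK i j) := by
  have : StronglyMeasurable fun p : E3 × ℝ => heatK2 i j p.2 p.1 :=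
    ((measurable_heatK2 i j).comp measurable_swap).stronglyMeasurable
  exact this.integral_prod_right

theorem integrableOn_heatK2 (i j : Fin 3) {z : E3} (hz : z ≠ 0) :
    IntegrableOn (fun s => heatK2 i j s z) (Ioi 0) := by
  obtain ⟨C, hC, H⟩ := heatK_bounds
  refine Integrable.mono' ((integrableOn_add_rpow (c := ‖z‖ ^ 2) (a := 5 / 2)
    (by positivity) (by norm_num)).const_mul C)
    ((measurable_heatK2 i j).comp (measurable_id.prodMk measurable_const)).aestronglyMeasurable ?_
  filter_upwards [ae_restrict_mem measurableSet_Ioi] with s hs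
  exact (H s hs z).2.1 i j

/-- Integrating (s + |z|²)^{-5/2} in time gives |z|⁻³. The absolute value is inside the integral, so
Tonelli applies once an extra factor |z| is gained. -/
theorem exists_lintegral_heatK2_le : ∃ C, 0 < C ∧ ∀ (i j : Fin 3) (z : E3), z ≠ 0 →
    ∫⁻ s in Ioi (0 : ℝ), ENNReal.ofReal |heatK2 i j s z| ≤ ENNReal.ofReal (C * ‖z‖⁻¹ ^ 3) := by
  obtain ⟨C, hC, H⟩ := heatK_bounds
  refine ⟨C, by positivity, fun i j z hz => ?_⟩
  have hz' : 0 < ‖z‖ := norm_pos_iff.2 hz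
  have hI := (integrableOn_add_rpow (c := ‖z‖ ^ 2) (a := 5 / 2)
    (by positivity) (by norm_num)).const_mul C
  calc ∫⁻ s in Ioi (0 : ℝ), ENNReal.ofReal |heatK2 i j s z|
      ≤ ∫⁻ s in Ioi (0 : ℝ), ENNReal.ofReal (C * (s + ‖z‖ ^ 2) ^ (-(5 / 2) : ℝ)) := by
        refine setLIntegral_mono' measurableSet_Ioi fun s hs => ?_
        exact ENNReal.ofReal_le_ofReal ((H s hs z).2.1 i j)
    _ = ENNReal.ofReal (∫ s in Ioi (0 : ℝ), C * (s + ‖z‖ ^ 2) ^ (-(5 / 2) : ℝ)) := by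
        refine (ofReal_integral_eq_lintegral_ofReal hI ?_).symm
        filter_upwards [ae_restrict_mem measurableSet_Ioi] with s hs
        have : (0 : ℝ) < s := hs
        positivity
    _ ≤ _ := by
        refine ENNReal.ofReal_le_ofReal ?_
        rw [integral_const_mul, integral_add_rpow (by positivity) (by norm_num)]
        have e : (‖z‖ ^ 2) ^ (1 - 5 / 2 : ℝ) = ‖z‖⁻¹ ^ 3 := by
          rw [← rpow_natCast, ← rpow_mul hz'.le, inv_pow, ← rpow_natCast, ← rpow_neg hz'.le]
          norm_num
        rw [e]
        have : 0 ≤ ‖z‖⁻¹ ^ 3 := by positivity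
        have : ‖z‖⁻¹ ^ 3 / (5 / 2 - 1) ≤ ‖z‖⁻¹ ^ 3 := div_le_self this (by norm_num)
        gcongr

theorem exists_abs_rieszK_le : ∃ C, 0 < C ∧ ∀ (i j : Fin 3) (z : E3), z ≠ 0 →
    |rieszK i j z| ≤ C * ‖z‖⁻¹ ^ 3 := by
  obtain ⟨C, hC, H⟩ := exists_lintegral_heatK2_le
  refine ⟨C, hC, fun i j z hz => ?_⟩
  have h1 : ‖rieszK i j z‖ₑ ≤ ENNReal.ofReal (C * ‖z‖⁻¹ ^ 3) := by
    refine (enorm_integral_le_lintegral_enorm _).trans ?_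
    simpa only [← ofReal_norm, norm_eq_abs] using H i j z hz
  rw [← ofReal_norm] at h1
  exact (ENNReal.ofReal_le_ofReal_iff (by positivity)).1 h1

theorem integrable_heatK2_mul (i j : Fin 3) (s : ℝ) (h : Continuous η)
    (hc : HasCompactSupport η) (x : E3) : Integrable fun y => heatK2 i j s (x - y) * η y :=
  (((contDiff_heatK2 i j s).continuous.comp (continuous_const.sub continuous_id)).mul
    h).integrable_of_hasCompactSupport hc.mul_left

theorem integrableOn_integral_heatK2_mul (h : IsTest η) (i j : Fin 3) (x : E3) :
    IntegrableOn (fun s => ∫ y, heatK2 i j s (x - y) * η y) (Ioi 0) := by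
  simp only [← heat_pd_pd _ h]
  exact integrableOn_heat ((h.pd j).pd i) x

/-- Commuting `∂ᵢ∂ⱼ (-Δ)⁻¹` with multiplication by a Lipschitz function gains one derivative. -/
theorem exists_commutator_le : ∃ C, 0 < C ∧ ∀ (i j : Fin 3) (φ ψ : E3 → ℝ) (L : ℝ),
    ContDiff ℝ ∞ φ → IsTest ψ → (∀ x y, |φ x - φ y| ≤ L * ‖x - y‖) → ∀ x,
    ENNReal.ofReal |pot (pd i (pd j fun y => φ y * ψ y)) x - φ x * pot (pd i (pd j ψ)) x| ≤
      ENNReal.ofReal (C * L) * ∫⁻ y, ENNReal.ofReal (|ψ y| * ‖x - y‖⁻¹ ^ 2) := by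
  obtain ⟨C, hC, H⟩ := exists_lintegral_heatK2_le
  refine ⟨C, hC, fun i j φ ψ L hφ hψ hL x => ?_⟩
  have hφψ : IsTest fun y => φ y * ψ y := hψ.mul_left hφ
  -- At each fixed time s the kernel is smooth, so the difference has the factor φ(y) - φ(x) under
  -- an ordinary integral; no principal value appears.
  have e : pot (pd i (pd j fun y => φ y * ψ y)) x - φ x * pot (pd i (pd j ψ)) x =
      ∫ s in Ioi (0 : ℝ), ∫ y, heatK2 i j s (x - y) * ((φ y - φ x) * ψ y) := by
    rw [pot_pd_pd hφψ, pot_pd_pd hψ, ← integral_const_mul, ← integral_sub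
      (integrableOn_integral_heatK2_mul hφψ i j x)
      ((integrableOn_integral_heatK2_mul hψ i j x).const_mul _)]
    refine integral_congr_ae (Eventually.of_forall fun s => ?_)
    simp only
    rw [← integral_const_mul, ← integral_sub
      (integrable_heatK2_mul i j s hφψ.continuous hφψ.compact x)
      ((integrable_heatK2_mul i j s hψ.continuous hψ.compact x).const_mul _)]
    refine integral_congr_ae (Eventually.of_forall fun y => ?_)
    simp only
    ring
  have hmeas : Measurable fun p : ℝ × E3 => ENNReal.ofReal
      |heatK2 i j p.1 (x - p.2) * ((φ p.2 - φ x) * ψ p.2)| := by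
    have m1 : Measurable fun p : ℝ × E3 => heatK2 i j p.1 (x - p.2) :=
      (measurable_heatK2 i j).comp (measurable_fst.prodMk (measurable_const.sub measurable_snd))
    have m2 : Measurable fun p : ℝ × E3 => (φ p.2 - φ x) * ψ p.2 :=
      (((hφ.continuous.sub continuous_const).mul hψ.continuous).comp continuous_snd).measurable
    exact (m1.mul m2).norm.ennreal_ofReal
  rw [← norm_eq_abs, ofReal_norm, e]
  calc ‖∫ s in Ioi (0 : ℝ), ∫ y, heatK2 i j s (x - y) * ((φ y - φ x) * ψ y)‖ₑ
      ≤ ∫⁻ s in Ioi (0 : ℝ), ∫⁻ y, ENNReal.ofReal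
          |heatK2 i j s (x - y) * ((φ y - φ x) * ψ y)| := by
        refine (enorm_integral_le_lintegral_enorm _).trans (lintegral_mono fun s => ?_)
        refine (enorm_integral_le_lintegral_enorm _).trans (lintegral_mono fun y => ?_)
        rw [← ofReal_norm, norm_eq_abs]
    _ = ∫⁻ y, ∫⁻ s in Ioi (0 : ℝ), ENNReal.ofReal
          |heatK2 i j s (x - y) * ((φ y - φ x) * ψ y)| :=
        lintegral_lintegral_swap hmeas.aemeasurable
    _ ≤ ∫⁻ y, ENNReal.ofReal (C * L) * ENNReal.ofReal (|ψ y| * ‖x - y‖⁻¹ ^ 2) := by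
        have hne : ∀ᵐ y : E3, y ≠ x := by simp [ae_iff, measure_singleton]
        refine lintegral_mono_ae ?_
        filter_upwards [hne] with y hy
        have hz : x - y ≠ 0 := sub_ne_zero.2 hy.symm
        have hz' : 0 < ‖x - y‖ := norm_pos_iff.2 hz
        have e1 : ∀ s, ENNReal.ofReal |heatK2 i j s (x - y) * ((φ y - φ x) * ψ y)| =
            ENNReal.ofReal |(φ y - φ x) * ψ y| * ENNReal.ofReal |heatK2 i j s (x - y)| := by
          intro s
          rw [abs_mul, mul_comm, ENNReal.ofReal_mul (abs_nonneg _)]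
        simp only [e1]
        have m1 : Measurable fun s => ENNReal.ofReal |heatK2 i j s (x - y)| :=
          ((measurable_heatK2 i j).comp
            (measurable_id.prodMk measurable_const)).norm.ennreal_ofReal
        rw [lintegral_const_mul _ m1]
        have hL0 : 0 ≤ L := by
          have := (abs_nonneg _).trans (hL x y)
          exact nonneg_of_mul_nonneg_left this hz'
        calc _ ≤ ENNReal.ofReal (L * ‖x - y‖ * |ψ y|) * ENNReal.ofReal (C * ‖x - y‖⁻¹ ^ 3) := by
              refine mul_le_mul' (ENNReal.ofReal_le_ofReal ?_) (H i j _ hz)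
              rw [abs_mul]
              have := hL y x
              rw [norm_sub_rev] at this
              gcongr
          _ = _ := by
              rw [← ENNReal.ofReal_mul (by positivity), ← ENNReal.ofReal_mul (by positivity)]
              congr 1
              field_simp
    _ = _ := lintegral_const_mul _ (by
        have := hψ.continuous.measurable
        fun_prop)

/-- Mean value inequality on the ball of radius R about x - x₀, where every point has norm at least
‖x - x₀‖/2; the three partial derivatives account for the factor 3. -/
theorem exists_heatK2_sub_le : ∃ C, 0 < C ∧ ∀ (i j : Fin 3) (s R : ℝ) (x x₀ y : E3), 0 < s →
    0 < R → 2 * R ≤ ‖x - x₀‖ → ‖y - x₀‖ ≤ R →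
    |heatK2 i j s (x - y) - heatK2 i j s (x - x₀)| ≤
      C * R * (s + (‖x - x₀‖ / 2) ^ 2) ^ (-3 : ℝ) := by
  obtain ⟨C, hC, H⟩ := heatK_bounds
  refine ⟨3 * C, by positivity, fun i j s R x x₀ y hs hR hx hy => ?_⟩
  set ρ := ‖x - x₀‖ with hρ
  have hb : ∀ z ∈ Metric.closedBall (x - x₀) R,
      ‖fderiv ℝ (heatK2 i j s) z‖ ≤ 3 * C * (s + (ρ / 2) ^ 2) ^ (-3 : ℝ) := by
    intro z hz
    have hz1 : ρ / 2 ≤ ‖z‖ := by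
      rw [Metric.mem_closedBall, dist_eq_norm] at hz
      have : ρ ≤ ‖z‖ + ‖z - (x - x₀)‖ := by
        rw [hρ, norm_sub_rev z]
        have := norm_add_le z (x - x₀ - z)
        simpa using this
      linarith
    have hpd : ∀ k, |pd k (heatK2 i j s) z| ≤ C * (s + (ρ / 2) ^ 2) ^ (-3 : ℝ) := by
      intro k
      refine ((H s hs z).2.2 i j k).trans ?_
      refine mul_le_mul_of_nonneg_left ?_ hC.le
      exact rpow_le_rpow_of_nonpos (by positivity) (by gcongr) (by norm_num)
    refine ContinuousLinearMap.opNorm_le_bound _ (by positivity) fun v => ?_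
    rw [fderiv_eq_sum_pd]
    refine (norm_sum_le _ _).trans ?_
    calc _ ≤ ∑ k : Fin 3, ‖v‖ * (C * (s + (ρ / 2) ^ 2) ^ (-3 : ℝ)) := by
          refine Finset.sum_le_sum fun k _ => ?_
          rw [norm_smul]
          exact mul_le_mul (PiLp.norm_apply_le v k) (hpd k) (norm_nonneg _) (norm_nonneg _)
      _ = _ := by simp; ring
  have hd : ∀ z ∈ Metric.closedBall (x - x₀) R, DifferentiableAt ℝ (heatK2 i j s) z :=
    fun z _ => ((contDiff_heatK2 i j s).differentiable (by simp)) z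
  have h1 : x - y ∈ Metric.closedBall (x - x₀) R := by
    rw [Metric.mem_closedBall, dist_eq_norm, norm_sub_rev]
    simpa using hy
  have := (convex_closedBall (x - x₀) R).norm_image_sub_le_of_norm_fderiv_le hd hb
    (Metric.mem_closedBall_self hR.le) h1
  rw [norm_eq_abs] at this
  refine this.trans ?_
  have e : ‖x - y - (x - x₀)‖ ≤ R := by
    rw [norm_sub_rev]; simpa using hy
  calc _ ≤ 3 * C * (s + (ρ / 2) ^ 2) ^ (-3 : ℝ) * R := by gcongr
    _ = _ := by ring

/-- Away from the support, `∂ᵢ∂ⱼ (-Δ)⁻¹ η` is a multiple of the mean of `η` up to an error of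
higher order. -/
theorem exists_abs_pot_sub_le : ∃ C, 0 < C ∧ ∀ (i j : Fin 3) (η : E3 → ℝ) (x₀ x : E3) (R : ℝ),
    IsTest η → 0 < R → (∀ y, R < ‖y - x₀‖ → η y = 0) → 2 * R ≤ ‖x - x₀‖ →
    |pot (pd i (pd j η)) x - rieszK i j (x - x₀) * ∫ y, η y| ≤
      C * R * ‖x - x₀‖⁻¹ ^ 4 * ∫ y, |η y| := by
  obtain ⟨C, hC, H⟩ := exists_heatK2_sub_le
  -- 8 = 16/2: integrating (s + c)⁻³ gives c⁻²/2, and c = (‖x - x₀‖/2)² gives c⁻² = 16‖x - x₀‖⁻⁴.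
  refine ⟨C * 8, by positivity, fun i j η x₀ x R hη hR hs hx => ?_⟩
  have hρ : 0 < ‖x - x₀‖ := by linarith
  have hz : x - x₀ ≠ 0 := norm_pos_iff.1 hρ
  set c := (‖x - x₀‖ / 2) ^ 2 with hc
  have hc0 : 0 < c := by positivity
  have e : pot (pd i (pd j η)) x - rieszK i j (x - x₀) * ∫ y, η y =
      ∫ s in Ioi (0 : ℝ), ∫ y, (heatK2 i j s (x - y) - heatK2 i j s (x - x₀)) * η y := by
    rw [pot_pd_pd hη, rieszK, ← integral_mul_const, ← integral_sub
      (integrableOn_integral_heatK2_mul hη i j x) ((integrableOn_heatK2 i j hz).mul_const _)]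
    refine integral_congr_ae (Eventually.of_forall fun s => ?_)
    simp only
    rw [← integral_const_mul, ← integral_sub
      (integrable_heatK2_mul i j s hη.continuous hη.compact x) (hη.integrable.const_mul _)]
    refine integral_congr_ae (Eventually.of_forall fun y => ?_)
    simp only
    ring
  have hI : IntegrableOn (fun s : ℝ => C * R * (∫ y, |η y|) * (s + c) ^ (-3 : ℝ)) (Ioi 0) :=
    (integrableOn_add_rpow hc0 (by norm_num)).const_mul _
  rw [e, ← norm_eq_abs]
  refine (norm_integral_le_of_norm_le hI ?_).trans ?_
  · filter_upwards [ae_restrict_mem measurableSet_Ioi] with s hs'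
    have : C * R * (∫ y, |η y|) * (s + c) ^ (-3 : ℝ) =
        ∫ y, C * R * (s + c) ^ (-3 : ℝ) * |η y| := by
      rw [integral_const_mul]; ring
    rw [this]
    refine norm_integral_le_of_norm_le (hη.integrable.abs.const_mul _)
      (Eventually.of_forall fun y => ?_)
    rw [norm_mul, norm_eq_abs, norm_eq_abs]
    by_cases hy : R < ‖y - x₀‖
    · simp [hs y hy]
    · exact mul_le_mul_of_nonneg_right (H i j s R x x₀ y hs' hR hx (not_lt.1 hy)) (abs_nonneg _)
  · rw [integral_const_mul, integral_add_rpow hc0 (by norm_num)]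
    have e1 : c ^ (1 - 3 : ℝ) = 16 * ‖x - x₀‖⁻¹ ^ 4 := by
      rw [show (1 - 3 : ℝ) = -((2 : ℕ) : ℝ) by norm_num, rpow_neg hc0.le, rpow_natCast, hc]
      field_simp
      norm_num
    rw [e1]
    apply le_of_eq
    ring

end SecondDerivatives

end NematicFlow

end

noncomputable section

namespace NematicFlow

/-! ### Joint smoothness in time and space -/

section SpaceTime

variable {F : Type*} [NormedAddCommGroup F] [NormedSpace ℝ F] {J : Set ℝ} {U : ℝ → E3 → F}

/-- `U` is jointly smooth at all times in `J`. -/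
def SmoothIn (J : Set ℝ) (U : ℝ → E3 → F) : Prop :=
  ∀ t ∈ J, ∀ x, ContDiffAt ℝ ∞ (fun p : ℝ × E3 => U p.1 p.2) (t, x)

theorem SmoothIn.slice (h : SmoothIn J U) {t : ℝ} (ht : t ∈ J) : ContDiff ℝ ∞ (U t) := by
  refine contDiff_iff_contDiffAt.2 fun x => ?_
  exact (h t ht x).comp x (contDiff_prodMk_right t).contDiffAt

theorem SmoothIn.hasDerivAt (h : SmoothIn J U) {t : ℝ} (ht : t ∈ J) (x : E3) :
    HasDerivAt (fun s => U s x) (fderiv ℝ (fun p : ℝ × E3 => U p.1 p.2) (t, x) (1, 0)) t := by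
  have h1 := ((h t ht x).differentiableAt (by simp)).hasFDerivAt
  have h2 : HasDerivAt (fun s : ℝ => (s, x)) ((1 : ℝ), (0 : E3)) t :=
    (hasDerivAt_id t).prodMk (hasDerivAt_const t x)
  exact h1.comp_hasDerivAt t h2

theorem SmoothIn.pd_eq (h : SmoothIn J U) {t : ℝ} (ht : t ∈ J) (i : Fin 3) (x : E3) :
    pd i (U t) x =
      fderiv ℝ (fun p : ℝ × E3 => U p.1 p.2) (t, x) (0, EuclideanSpace.single i 1) := by
  have h1 := ((h t ht x).differentiableAt (by simp)).hasFDerivAt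
  have h2 : HasFDerivAt (fun y : E3 => (t, y)) (ContinuousLinearMap.inr ℝ ℝ E3) x :=
    hasFDerivAt_prodMk_right t x
  have h3 : HasFDerivAt (U t) _ x := h1.comp x h2
  rw [pd, h3.fderiv]
  simp

theorem eventually_fst_mem (hJ : IsOpen J) {t : ℝ} (ht : t ∈ J) (x : E3) :
    ∀ᶠ p : ℝ × E3 in 𝓝 (t, x), p.1 ∈ J :=
  continuous_fst.continuousAt.eventually (hJ.mem_nhds ht)

theorem SmoothIn.fderiv_apply (h : SmoothIn J U) (v : ℝ × E3) :
    SmoothIn J fun t x => fderiv ℝ (fun p : ℝ × E3 => U p.1 p.2) (t, x) v := fun t ht x =>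
  ((h t ht x).fderiv_right (m := ∞) (by simp)).clm_apply contDiffAt_const

theorem SmoothIn.congr (hJ : IsOpen J) {V : ℝ → E3 → F} (h : SmoothIn J U)
    (hV : ∀ t ∈ J, ∀ x, V t x = U t x) : SmoothIn J V := fun t ht x =>
  (h t ht x).congr_of_eventuallyEq <| by
    filter_upwards [eventually_fst_mem hJ ht x] with p hp using hV _ hp _

theorem SmoothIn.pd (hJ : IsOpen J) (h : SmoothIn J U) (i : Fin 3) :
    SmoothIn J fun t => pd i (U t) :=
  (h.fderiv_apply (0, EuclideanSpace.single i 1)).congr hJ fun _ ht x => h.pd_eq ht i x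

theorem SmoothIn.deriv (hJ : IsOpen J) (h : SmoothIn J U) :
    SmoothIn J fun t x => deriv (fun s => U s x) t :=
  (h.fderiv_apply (1, 0)).congr hJ fun _ ht x => (h.hasDerivAt ht x).deriv

theorem SmoothIn.hasDerivAt' (h : SmoothIn J U) {t : ℝ} (ht : t ∈ J) (x : E3) :
    HasDerivAt (fun s => U s x) (_root_.deriv (fun s => U s x) t) t :=
  (h.hasDerivAt ht x).differentiableAt.hasDerivAt

theorem SmoothIn.clm {G : Type*} [NormedAddCommGroup G] [NormedSpace ℝ G] (L : F →L[ℝ] G)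
    (h : SmoothIn J U) : SmoothIn J fun t x => L (U t x) := fun t ht x =>
  L.contDiff.contDiffAt.comp (t, x) (h t ht x)

theorem SmoothIn.continuousAt (h : SmoothIn J U) {t : ℝ} (ht : t ∈ J) (x : E3) :
    ContinuousAt (fun p : ℝ × E3 => U p.1 p.2) (t, x) := (h t ht x).continuousAt

/-- Both mixed derivatives are values of the second Fréchet derivative on space-time, which is
symmetric. -/
theorem pd_deriv_comm (hJ : IsOpen J) (h : SmoothIn J U) {t : ℝ} (ht : t ∈ J) (i : Fin 3)
    (x : E3) : HasDerivAt (fun s => pd i (U s) x)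
      (pd i (fun y => _root_.deriv (fun s => U s y) t) x) t := by
  have h1 := (h.pd hJ i).hasDerivAt ht x
  refine h1.congr_deriv ?_
  rw [(h.deriv hJ).pd_eq ht i x]
  set G : ℝ × E3 → F := fun p => U p.1 p.2 with hG
  have hs : ContDiffAt ℝ ∞ G (t, x) := h t ht x
  have e1 : (fun p : ℝ × E3 => pd i (U p.1) p.2) =ᶠ[𝓝 (t, x)]
      fun p => fderiv ℝ G p (0, EuclideanSpace.single i 1) := by
    filter_upwards [eventually_fst_mem hJ ht x] with p hp using h.pd_eq hp i p.2
  have e2 : (fun p : ℝ × E3 => _root_.deriv (fun s => U s p.2) p.1) =ᶠ[𝓝 (t, x)]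
      fun p => fderiv ℝ G p (1, 0) := by
    filter_upwards [eventually_fst_mem hJ ht x] with p hp using (h.hasDerivAt hp p.2).deriv
  rw [e1.fderiv_eq, e2.fderiv_eq]
  have hd : DifferentiableAt ℝ (fderiv ℝ G) (t, x) :=
    (hs.fderiv_right (m := 1) (by norm_cast)).differentiableAt (by simp)
  rw [fderiv_clm_apply hd (differentiableAt_const _), fderiv_clm_apply hd (differentiableAt_const _)]
  have hsymm : IsSymmSndFDerivAt ℝ G (t, x) := by
    refine hs.isSymmSndFDerivAt ?_
    simp only [minSmoothness_of_isRCLikeNormedField]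
    exact ENat.LEInfty.out
  simpa using hsymm (1, 0) (0, EuclideanSpace.single i 1)

/-- Differentiation under the integral sign against a compactly supported weight. -/
theorem hasDerivAt_integral_mul {J : Set ℝ} (hJ : IsOpen J) {g g' : ℝ → E3 → ℝ} {η : E3 → ℝ}
    (hg : ∀ s ∈ J, Continuous (g s))
    (hd : ∀ s ∈ J, ∀ x, HasDerivAt (fun s => g s x) (g' s x) s)
    (hg' : ∀ s ∈ J, ∀ x, ContinuousAt (fun p : ℝ × E3 => g' p.1 p.2) (s, x))
    (hη : Continuous η) (hc : HasCompactSupport η) {t : ℝ} (ht : t ∈ J) :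
    HasDerivAt (fun s => ∫ x, g s x * η x) (∫ x, g' t x * η x) t := by
  obtain ⟨δ, hδ, hball⟩ := Metric.isOpen_iff.1 hJ t ht
  have hsub : Metric.closedBall t (δ / 2) ⊆ J :=
    (Metric.closedBall_subset_ball (by linarith)).trans hball
  have hK : IsCompact (Metric.closedBall t (δ / 2) ×ˢ tsupport η) :=
    (isCompact_closedBall _ _).prod hc
  obtain ⟨M, hM⟩ := hK.exists_bound_of_continuousOn (f := fun p : ℝ × E3 => g' p.1 p.2)
    fun p hp => (hg' p.1 (hsub hp.1) p.2).continuousWithinAt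
  have cg' : ∀ s ∈ J, Continuous (g' s) := fun s hs => continuous_iff_continuousAt.2 fun x =>
    ContinuousAt.comp (f := fun y : E3 => (s, y)) (hg' s hs x) (Continuous.prodMk_right s).continuousAt
  refine (hasDerivAt_integral_of_dominated_loc_of_deriv_le (μ := (volume : Measure E3))
    (F := fun s x => g s x * η x) (F' := fun s x => g' s x * η x)
    (bound := fun x => M * |η x|) (Metric.closedBall_mem_nhds t (half_pos hδ))
    ?_ ?_ ?_ ?_ ?_ ?_).2
  · filter_upwards [hJ.mem_nhds ht] with s hs using ((hg s hs).mul hη).aestronglyMeasurable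
  · exact ((hg t ht).mul hη).integrable_of_hasCompactSupport hc.mul_left
  · exact ((cg' t ht).mul hη).aestronglyMeasurable
  · refine Eventually.of_forall fun x s hs => ?_
    rw [norm_mul, Real.norm_eq_abs (η x)]
    by_cases hx : x ∈ tsupport η
    · exact mul_le_mul_of_nonneg_right (hM (s, x) ⟨hs, hx⟩) (abs_nonneg _)
    · simp [image_eq_zero_of_notMem_tsupport hx]
  · exact ((hη.integrable_of_hasCompactSupport hc).abs).const_mul M
  · exact Eventually.of_forall fun x s hs => (hd s (hsub hs) x).mul_const _

end SpaceTime

/-! ### The equations in components and smoothness of the pressure -/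

section Solution

variable {T : EReal} {u d : ℝ → E3 → E3} {P : ℝ → E3 → ℝ}

/-- The open interval `(0, T)`. -/
def times (T : EReal) : Set ℝ := {t | 0 < t ∧ (t : EReal) < T}

theorem isOpen_times (T : EReal) : IsOpen (times T) :=
  (isOpen_lt continuous_const continuous_id).inter
    (isOpen_lt continuous_coe_real_ereal continuous_const)

theorem smoothIn_of_contDiffOn {U : ℝ → E3 → E3}
    (h : ContDiffOn ℝ ∞ (fun p : ℝ × E3 => U p.1 p.2) {p | 0 ≤ p.1 ∧ (p.1 : EReal) < T}) :
    SmoothIn (times T) U := by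
  intro t ht x
  refine h.contDiffAt ?_
  filter_upwards [eventually_fst_mem (isOpen_times T) ht x] with p hp using ⟨hp.1.le, hp.2⟩

theorem IsSmoothSolution.smoothIn_u (S : IsSmoothSolution T u P d) : SmoothIn (times T) u :=
  smoothIn_of_contDiffOn S.smooth_u

theorem IsSmoothSolution.smoothIn_d (S : IsSmoothSolution T u P d) : SmoothIn (times T) d :=
  smoothIn_of_contDiffOn S.smooth_d

/-- The stress `vᵢ vⱼ + ⟨∂ᵢ e, ∂ⱼ e⟩`. -/
def stress (v e : E3 → E3) (i j : Fin 3) (x : E3) : ℝ := v x i * v x j + odot e i j x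

theorem odot_comm (e : E3 → E3) (i j : Fin 3) : odot e i j = odot e j i :=
  funext fun _ => real_inner_comm _ _

theorem contDiff_odot {e : E3 → E3} (he : ContDiff ℝ ∞ e) (i j : Fin 3) :
    ContDiff ℝ ∞ (odot e i j) := (contDiff_pd he i).inner ℝ (contDiff_pd he j)

theorem contDiff_comp_apply {v : E3 → E3} (hv : ContDiff ℝ ∞ v) (i : Fin 3) :
    ContDiff ℝ ∞ fun x => v x i := contDiff_euclidean.1 hv i

theorem contDiff_stress {v e : E3 → E3} (hv : ContDiff ℝ ∞ v) (he : ContDiff ℝ ∞ e)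
    (i j : Fin 3) : ContDiff ℝ ∞ (stress v e i j) :=
  ((contDiff_comp_apply hv i).mul (contDiff_comp_apply hv j)).add (contDiff_odot he i j)

theorem pd_comp_apply {v : E3 → E3} (hv : ContDiff ℝ ∞ v) (i k : Fin 3) (x : E3) :
    pd i (fun y => v y k) x = pd i v x k := by
  have := pd_clm_comp (f := v) (x := x) (EuclideanSpace.proj k : E3 →L[ℝ] ℝ)
    ((hv.differentiable (by simp)) x) i
  exact this

theorem norm_grad_sq (e : E3 → E3) (x : E3) : ‖grad e x‖ ^ 2 = ∑ i, ‖pd i e x‖ ^ 2 := by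
  simp [EuclideanSpace.norm_sq_eq, grad, Fintype.sum_prod_type]

theorem abs_stress_le (v e : E3 → E3) (i j : Fin 3) (x : E3) :
    |stress v e i j x| ≤ ‖v x‖ ^ 2 + ‖grad e x‖ ^ 2 := by
  have h1 : |v x i * v x j| ≤ ‖v x‖ ^ 2 := by
    rw [abs_mul, sq]
    exact mul_le_mul (PiLp.norm_apply_le (v x) i) (PiLp.norm_apply_le (v x) j) (abs_nonneg _)
      (norm_nonneg _)
  have h2 : ∀ k, ‖pd k e x‖ ≤ ‖grad e x‖ := by
    intro k
    refine le_of_sq_le_sq ?_ (norm_nonneg _)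
    rw [norm_grad_sq]
    exact Finset.single_le_sum (f := fun k => ‖pd k e x‖ ^ 2) (fun _ _ => sq_nonneg _)
      (Finset.mem_univ k)
  have h3 : |odot e i j x| ≤ ‖grad e x‖ ^ 2 := by
    refine (abs_real_inner_le_norm _ _).trans ?_
    rw [sq]
    exact mul_le_mul (h2 i) (h2 j) (norm_nonneg _) (norm_nonneg _)
  exact (abs_add_le _ _).trans (add_le_add h1 h3)

theorem contDiff_grad {e : E3 → E3} (he : ContDiff ℝ ∞ e) : ContDiff ℝ ∞ (grad e) :=
  contDiff_euclidean.2 fun ij => contDiff_comp_apply (contDiff_pd he ij.1) ij.2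

/-- The momentum equation in divergence form, componentwise. -/
theorem IsSmoothSolution.deriv_u (S : IsSmoothSolution T u P d) {t : ℝ} (ht : t ∈ times T)
    (k : Fin 3) (x : E3) :
    deriv (fun s => u s x) t k = -(∑ i, pd i (stress (u t) (d t) i k) x)
      + lap (fun y => u t y k) x - pd k (P t) x := by
  have hu : ContDiff ℝ ∞ (u t) := S.smoothIn_u.slice ht
  have hd : ContDiff ℝ ∞ (d t) := S.smoothIn_d.slice ht
  have hm := congrArg (fun v : E3 => v k) (S.momentum t x ht.1 ht.2)
  have hi := S.incompressible t x ht.1 ht.2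
  -- Incompressibility puts the transport term in divergence form.
  have e1 : fderiv ℝ (u t) x (u t x) k = ∑ i, pd i (fun y => u t y i * u t y k) x := by
    rw [fderiv_eq_sum_pd]
    have : ∀ i, pd i (fun y => u t y i * u t y k) x =
        u t x i * pd i (u t) x k + pd i (u t) x i * u t x k := by
      intro i
      rw [pd_mul ((contDiff_comp_apply hu i).differentiable (by simp) x)
        ((contDiff_comp_apply hu k).differentiable (by simp) x), pd_comp_apply hu,
        pd_comp_apply hu]
      ring
    simp only [this, Finset.sum_add_distrib, ← Finset.sum_mul]
    rw [show ∑ i, pd i (u t) x i = 0 from hi]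
    simp
  have e2 : Laplacian.laplacian (u t) x k = lap (fun y => u t y k) x := by
    rw [laplacian_eq_sum_pd (hu.of_le ENat.LEInfty.out)]
    simp only [lap, WithLp.ofLp_sum, Finset.sum_apply]
    refine Finset.sum_congr rfl fun i _ => ?_
    rw [show pd i (fun y => u t y k) = fun y => pd i (u t) y k from
      funext fun y => pd_comp_apply hu i k y, pd_comp_apply (contDiff_pd hu i)]
  have e3 : gradient (P t) x k = pd k (P t) x := (pd_eq_gradient ..).symm
  have e4 : divOdot (d t) x k = ∑ i, pd i (odot (d t) i k) x := by
    simp only [divOdot]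
    refine Finset.sum_congr rfl fun i _ => ?_
    rw [odot_comm]
  have e5 : ∑ i, pd i (stress (u t) (d t) i k) x =
      ∑ i, pd i (fun y => u t y i * u t y k) x + ∑ i, pd i (odot (d t) i k) x := by
    rw [← Finset.sum_add_distrib]
    refine Finset.sum_congr rfl fun i _ => ?_
    exact pd_add (((contDiff_comp_apply hu i).mul (contDiff_comp_apply hu k)).differentiable
      (by simp) x) ((contDiff_odot hd i k).differentiable (by simp) x) i
  simp only [PiLp.add_apply, PiLp.sub_apply, PiLp.neg_apply] at hm
  rw [e1, e2, e3, e4] at hm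
  rw [e5]
  linarith

/-- The pressure is assumed only differentiable, but the momentum equation expresses its gradient
through smooth fields. -/
theorem IsSmoothSolution.contDiff_P (S : IsSmoothSolution T u P d) {t : ℝ} (ht : t ∈ times T) :
    ContDiff ℝ ∞ (P t) := by
  have hu : ContDiff ℝ ∞ (u t) := S.smoothIn_u.slice ht
  have hd : ContDiff ℝ ∞ (d t) := S.smoothIn_d.slice ht
  have hdt : ContDiff ℝ ∞ fun x => deriv (fun s => u s x) t :=
    (S.smoothIn_u.deriv (isOpen_times T)).slice ht
  have hlap : ∀ k, ContDiff ℝ ∞ (lap fun y => u t y k) := fun k =>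
    ContDiff.sum fun i _ => contDiff_pd (contDiff_pd (contDiff_comp_apply hu k) i) i
  have h1 : ∀ k, ContDiff ℝ ∞ (pd k (P t)) := by
    intro k
    have : pd k (P t) = fun x => -(∑ i, pd i (stress (u t) (d t) i k) x)
      + lap (fun y => u t y k) x - deriv (fun s => u s x) t k := by
      funext x
      rw [S.deriv_u ht k x]
      ring
    rw [this]
    exact ((ContDiff.sum fun i _ => contDiff_pd (contDiff_stress hu hd i k) i).neg.add
      (hlap k)).sub (contDiff_comp_apply hdt k)
  rw [contDiff_infty_iff_fderiv]
  refine ⟨S.differentiable_P t ht.1 ht.2, ?_⟩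
  refine contDiff_clm_apply_iff.2 fun y => ?_
  simp only [fderiv_eq_sum_pd]
  have h2 : ∀ k, ContDiff ℝ ∞ fun x => y k • pd k (P t) x := fun k =>
    (contDiff_const_smul (y k)).comp (h1 k)
  exact ContDiff.sum fun k _ => h2 k

end Solution

end NematicFlow

end

noncomputable section

namespace NematicFlow

/-! ### Weak momentum and pressure equations -/

section WeakForm

variable {T : EReal} {u d : ℝ → E3 → E3} {P : ℝ → E3 → ℝ} {f η ζ χ Φ : E3 → ℝ}

theorem IsTest.integrable_mul (hη : IsTest η) (hf : Continuous f) :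
    Integrable fun x => f x * η x :=
  (hf.mul hη.continuous).integrable_of_hasCompactSupport hη.compact.mul_left

theorem integral_pd_mul (hf : ContDiff ℝ ∞ f) (hη : IsTest η) (i : Fin 3) :
    ∫ x, pd i f x * η x = -∫ x, f x * pd i η x := by
  rw [integral_mul_pd' (hf.of_le ENat.LEInfty.out) hη.contDiff_one hη.compact, neg_neg]

theorem contDiff_lap (hf : ContDiff ℝ ∞ f) : ContDiff ℝ ∞ (lap f) :=
  ContDiff.sum fun i _ => contDiff_pd (contDiff_pd hf i) i

theorem integral_lap_mul (hf : ContDiff ℝ ∞ f) (hη : IsTest η) :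
    ∫ x, lap f x * η x = ∫ x, f x * lap η x := by
  simp only [lap, Finset.sum_mul, Finset.mul_sum]
  rw [integral_finsetSum _ fun i _ =>
      hη.integrable_mul (contDiff_pd (contDiff_pd hf i) i).continuous,
    integral_finsetSum _ fun i _ => ((hη.pd i).pd i).integrable_mul hf.continuous]
  refine Finset.sum_congr rfl fun i _ => ?_
  rw [integral_pd_mul (contDiff_pd hf i) hη, integral_pd_mul hf (hη.pd i), neg_neg]

theorem IsSmoothSolution.hasDerivAt_integral_u (S : IsSmoothSolution T u P d) {t : ℝ}
    (ht : t ∈ times T) (k : Fin 3) (hη : IsTest η) :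
    HasDerivAt (fun s => ∫ x, u s x k * η x)
      ((∑ i, ∫ x, stress (u t) (d t) i k x * pd i η x) + (∫ x, u t x k * lap η x)
        - ∫ x, pd k (P t) x * η x) t := by
  have hu : ContDiff ℝ ∞ (u t) := S.smoothIn_u.slice ht
  have hd : ContDiff ℝ ∞ (d t) := S.smoothIn_d.slice ht
  have hJ := isOpen_times T
  let L : E3 →L[ℝ] ℝ := EuclideanSpace.proj k
  have hs : SmoothIn (times T) fun s x => u s x k := S.smoothIn_u.clm L
  have hs' : SmoothIn (times T) fun s x => deriv (fun s => u s x) s k :=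
    (S.smoothIn_u.deriv hJ).clm L
  have h := hasDerivAt_integral_mul (g := fun s x => u s x k)
    (g' := fun s x => deriv (fun s => u s x) s k) hJ
    (fun s hs0 => (hs.slice hs0).continuous)
    (fun s hs0 x => L.hasFDerivAt.comp_hasDerivAt s (S.smoothIn_u.hasDerivAt' hs0 x))
    (fun s hs0 x => hs'.continuousAt hs0 x) hη.continuous hη.compact ht
  refine h.congr_deriv ?_
  have i1 : ∀ i, Integrable fun x => pd i (stress (u t) (d t) i k) x * η x := fun i =>
    hη.integrable_mul (contDiff_pd (contDiff_stress hu hd i k) i).continuous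
  have i2 : Integrable fun x => lap (fun y => u t y k) x * η x :=
    hη.integrable_mul (contDiff_lap (contDiff_comp_apply hu k)).continuous
  have i3 : Integrable fun x => pd k (P t) x * η x :=
    hη.integrable_mul (contDiff_pd (S.contDiff_P ht) k).continuous
  have i4 : Integrable fun x => -(∑ i, pd i (stress (u t) (d t) i k) x * η x) :=
    (integrable_finsetSum _ fun i _ => i1 i).neg
  have i5 : Integrable fun x => -(∑ i, pd i (stress (u t) (d t) i k) x * η x) +
    lap (fun y => u t y k) x * η x := i4.add i2
  have e : ∀ x, deriv (fun s => u s x) t k * η x =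
      -(∑ i, pd i (stress (u t) (d t) i k) x * η x) + lap (fun y => u t y k) x * η x
        - pd k (P t) x * η x := by
    intro x
    rw [S.deriv_u ht k x, ← Finset.sum_mul]
    ring
  simp only [e]
  rw [integral_sub i5 i3, integral_add i4 i2, integral_neg, integral_finsetSum _ fun i _ => i1 i,
    integral_lap_mul (contDiff_comp_apply hu k) hη, ← Finset.sum_neg_distrib]
  congr 2
  refine Finset.sum_congr rfl fun i _ => ?_
  rw [integral_pd_mul (contDiff_stress hu hd i k) hη, neg_neg]

theorem IsSmoothSolution.sum_integral_u_mul_pd (S : IsSmoothSolution T u P d) {t : ℝ}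
    (ht : t ∈ times T) (hη : IsTest η) : ∑ k, ∫ x, u t x k * pd k η x = 0 := by
  have hu : ContDiff ℝ ∞ (u t) := S.smoothIn_u.slice ht
  have e : ∀ k, ∫ x, u t x k * pd k η x = -∫ x, pd k (u t) x k * η x := by
    intro k
    have := integral_pd_mul (contDiff_comp_apply hu k) hη k
    simp only [pd_comp_apply hu] at this
    rw [this, neg_neg]
  have i1 : ∀ k, Integrable fun x => pd k (u t) x k * η x := fun k =>
    hη.integrable_mul (contDiff_comp_apply (contDiff_pd hu k) k).continuous
  simp only [e, Finset.sum_neg_distrib]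
  rw [← integral_finsetSum _ fun k _ => i1 k]
  have : ∀ x, ∑ k, pd k (u t) x k * η x = 0 := by
    intro x
    rw [← Finset.sum_mul, show ∑ k, pd k (u t) x k = 0 from S.incompressible t x ht.1 ht.2,
      zero_mul]
  simp [this]

theorem pd_lap (hη : ContDiff ℝ ∞ η) (k : Fin 3) (x : E3) : pd k (lap η) x = lap (pd k η) x := by
  unfold lap
  rw [pd_sum _ fun i => (contDiff_pd (contDiff_pd hη i) i).differentiable (by simp) x]
  refine Finset.sum_congr rfl fun i _ => ?_
  rw [pd_comm (contDiff_pd hη i) k i, show pd k (pd i η) = pd i (pd k η) from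
    funext fun y => pd_comm hη k i y]

/-- The weak form of the pressure equation `-Δ P = ∑ ∂ᵢ∂ⱼ fᵢⱼ`. -/
theorem IsSmoothSolution.weak_poisson (S : IsSmoothSolution T u P d) {t : ℝ} (ht : t ∈ times T)
    (hχ : IsTest χ) : ∑ k, ∫ x, pd k (P t) x * pd k χ x =
      ∑ k, ∑ i, ∫ x, stress (u t) (d t) i k x * pd i (pd k χ) x := by
  -- The pressure equation comes from differentiating in time the weak statement ∇·u = 0; the
  -- diffusion term drops out because Δ commutes with ∂ₖ.
  have h1 := HasDerivAt.fun_sum (u := Finset.univ) fun k _ =>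
    S.hasDerivAt_integral_u ht k (hχ.pd k)
  have h2 : HasDerivAt (fun s => ∑ k, ∫ x, u s x k * pd k χ x) 0 t := by
    refine (hasDerivAt_const t (0 : ℝ)).congr_of_eventuallyEq ?_
    filter_upwards [(isOpen_times T).mem_nhds ht] with s hs
    exact S.sum_integral_u_mul_pd hs hχ
  have h3 := h1.unique h2
  have h4 : ∑ k, ∫ x, u t x k * lap (pd k χ) x = 0 := by
    rw [← S.sum_integral_u_mul_pd ht hχ.lap]
    simp only [pd_lap hχ.smooth]
  simp only [Finset.sum_sub_distrib, Finset.sum_add_distrib, h4] at h3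
  linarith

/-- Two integrations by parts exchange derivatives, ∫ ∂ₖP ∂ⱼ∂ⱼΦ = ∫ ∂ⱼP ∂ⱼ∂ₖΦ, after which the weak
pressure equation applies with ∂ₖΦ as test function. -/
theorem IsSmoothSolution.integral_pd_P_mul_lap (S : IsSmoothSolution T u P d) {t : ℝ}
    (ht : t ∈ times T) (k : Fin 3) (hΦ : IsTest Φ) : ∫ x, pd k (P t) x * lap Φ x =
      ∑ j, ∑ i, ∫ x, stress (u t) (d t) i j x * pd i (pd j (pd k Φ)) x := by
  have hP := S.contDiff_P ht
  rw [← S.weak_poisson ht (hΦ.pd k)]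
  simp only [lap, Finset.mul_sum]
  rw [integral_finsetSum _ fun j _ =>
    ((hΦ.pd j).pd j).integrable_mul (contDiff_pd hP k).continuous]
  refine Finset.sum_congr rfl fun j _ => ?_
  have e1 := integral_pd_mul (contDiff_pd hP k) (hΦ.pd j) j
  have e2 := integral_pd_mul (contDiff_pd hP j) (hΦ.pd j) k
  simp only [pd_comm hP k j] at e2
  rw [e1] at e2
  simp only [pd_comm hΦ.smooth j k]
  linarith

end WeakForm

/-! ### Error terms created by cutting off a Newtonian potential -/

section Tails

/-- Families of functions arising from derivatives of a cut-off at scale `r` applied to a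
Newtonian potential. -/
inductive Tail : (ℝ → E3 → ℝ) → Prop
  | zero : Tail fun _ _ => 0
  | term (m : ℕ) {α h : E3 → ℝ} (hα : IsTest α) (hα0 : ∀ x, ‖x‖ < 1 → α x = 0) (hh : IsTest h) :
      Tail fun r x => r⁻¹ ^ (m + 1) * (scale r α x * pot h x)
  | add {g g' : ℝ → E3 → ℝ} (hg : Tail g) (hg' : Tail g') : Tail fun r x => g r x + g' r x

theorem Tail.isTest {g : ℝ → E3 → ℝ} (hg : Tail g) {r : ℝ} (hr : 0 < r) : IsTest (g r) := by
  induction hg with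
  | zero => exact isTest_zero
  | term m hα hα0 hh =>
    exact ((hα.scale hr).mul_right (contDiff_pot hh)).mul_left contDiff_const
  | add _ _ ih ih' => exact ih.add ih'

theorem pd_eq_zero_of_norm_lt_one {α : E3 → ℝ} {c : ℝ} (hα0 : ∀ x, ‖x‖ < 1 → α x = c) (i : Fin 3)
    (x : E3) (hx : ‖x‖ < 1) : pd i α x = 0 := by
  have : α =ᶠ[𝓝 x] fun _ => c := by
    filter_upwards [continuous_norm.continuousAt.eventually_lt continuousAt_const hx] with y hy
      using hα0 y hy
  rw [pd, this.fderiv_eq]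
  simp

theorem pd_scale_mul_pot {α h : E3 → ℝ} (hα : IsTest α) (hh : IsTest h) {r : ℝ} (hr : 0 < r)
    (i : Fin 3) (x : E3) : pd i (fun y => scale r α y * pot h y) x =
      r⁻¹ * (scale r (pd i α) x * pot h x) + scale r α x * pot (pd i h) x := by
  rw [pd_mul ((hα.scale hr).differentiable x) ((contDiff_pot hh).differentiable (by simp) x),
    pd_scale hα.differentiable, pd_pot hh]
  ring

theorem Tail.pd {g : ℝ → E3 → ℝ} (hg : Tail g) (i : Fin 3) :
    ∃ g', Tail g' ∧ ∀ r, 0 < r → pd i (g r) = g' r := by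
  induction hg with
  | zero => exact ⟨_, Tail.zero, fun r _ => by funext x; simp [NematicFlow.pd]⟩
  | @term m α h hα hα0 hh =>
    refine ⟨_, (Tail.term (m + 1) (hα.pd i) (pd_eq_zero_of_norm_lt_one hα0 i) hh).add
      (Tail.term m hα hα0 (hh.pd i)), fun r hr => ?_⟩
    funext x
    have hd : DifferentiableAt ℝ (fun y => scale r α y * pot h y) x :=
      ((hα.scale hr).mul_right (contDiff_pot hh)).differentiable x
    rw [pd_const_mul hd, pd_scale_mul_pot hα hh hr]
    ring
  | add hg hg' ih ih' =>
    obtain ⟨a, ha, ha'⟩ := ih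
    obtain ⟨b, hb, hb'⟩ := ih'
    refine ⟨_, ha.add hb, fun r hr => ?_⟩
    funext x
    rw [pd_add ((hg.isTest hr).differentiable x) ((hg'.isTest hr).differentiable x), ha' r hr,
      hb' r hr]

theorem Tail.sum {g : Fin 3 → ℝ → E3 → ℝ} (hg : ∀ i, Tail (g i)) :
    Tail fun r x => ∑ i, g i r x := by
  simp only [Fin.sum_univ_three]
  exact ((hg 0).add (hg 1)).add (hg 2)

theorem Tail.lap {g : ℝ → E3 → ℝ} (hg : Tail g) :
    ∃ g', Tail g' ∧ ∀ r, 0 < r → lap (g r) = g' r := by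
  have : ∀ i, ∃ g', Tail g' ∧ ∀ r, 0 < r → NematicFlow.pd i (NematicFlow.pd i (g r)) = g' r := by
    intro i
    obtain ⟨a, ha, ha'⟩ := hg.pd i
    obtain ⟨b, hb, hb'⟩ := ha.pd i
    exact ⟨b, hb, fun r hr => by rw [ha' r hr, hb' r hr]⟩
  choose b hb hb' using this
  refine ⟨_, Tail.sum hb, fun r hr => ?_⟩
  funext x
  simp only [NematicFlow.lap, hb' _ r hr]

/-- Each term carries at least one explicit factor 1/r from a derivative of the cut-off, and
vanishes for |x| < r, where the potential is not yet O(1/r); the second factor 1/r is the decay of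
the potential. -/
theorem Tail.exists_bound {g : ℝ → E3 → ℝ} (hg : Tail g) : ∃ C M : ℝ, 0 ≤ C ∧ 0 ≤ M ∧
    ∀ r, 1 ≤ r → ∀ x, |g r x| ≤ C * r⁻¹ ^ 2 ∧ (M * r < ‖x‖ → g r x = 0) := by
  induction hg with
  | zero => exact ⟨0, 0, le_rfl, le_rfl, fun r _ x => by simp⟩
  | @term m α h hα hα0 hh =>
    obtain ⟨A, hA, hαA⟩ := hα.exists_bound
    obtain ⟨M, hM, hαM⟩ := hα.exists_ball
    obtain ⟨B, hB, hpot⟩ := exists_pot_le hh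
    refine ⟨A * B, M, by positivity, hM.le, fun r hr x => ?_⟩
    have hr0 : 0 < r := by linarith
    have en : ‖r⁻¹ • x‖ = r⁻¹ * ‖x‖ := by rw [norm_smul, norm_inv, Real.norm_of_nonneg hr0.le]
    constructor
    · by_cases hx : ‖x‖ < r
      · have : scale r α x = 0 := hα0 _ (by rw [en, inv_mul_lt_iff₀ hr0]; linarith)
        beta_reduce
        rw [this, zero_mul, mul_zero, abs_zero]
        positivity
      · have hx' : r ≤ ‖x‖ := not_lt.1 hx
        have h1 : r⁻¹ ^ (m + 1) ≤ r⁻¹ := by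
          rw [pow_succ]
          exact mul_le_of_le_one_left (by positivity)
            (pow_le_one₀ (by positivity) (inv_le_one_of_one_le₀ hr))
        have h2 : |pot h x| ≤ B * r⁻¹ := by
          refine (hpot x).trans ?_
          gcongr
          linarith
        rw [abs_mul, abs_mul, abs_of_nonneg (by positivity)]
        calc _ ≤ r⁻¹ * (A * (B * r⁻¹)) := by
              gcongr
              exact hαA _
          _ = _ := by ring
    · intro hx
      have : scale r α x = 0 := hαM _ (by rw [en, lt_inv_mul_iff₀ hr0]; linarith)
      beta_reduce
      rw [this, zero_mul, mul_zero]
  | add _ _ ih ih' =>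
    obtain ⟨C, M, hC, hM, H⟩ := ih
    obtain ⟨C', M', hC', hM', H'⟩ := ih'
    refine ⟨C + C', max M M', by positivity, by positivity, fun r hr x => ⟨?_, fun hx => ?_⟩⟩
    · refine (abs_add_le _ _).trans ?_
      linarith [(H r hr x).1, (H' r hr x).1]
    · have hr0 : 0 ≤ r := by linarith
      beta_reduce
      rw [(H r hr x).2 ((mul_le_mul_of_nonneg_right (le_max_left _ _) hr0).trans_lt hx),
        (H' r hr x).2 ((mul_le_mul_of_nonneg_right (le_max_right _ _) hr0).trans_lt hx), add_zero]

/-- Leibniz rule: a derivative on the cut-off creates a new tail, because the cut-off is constant on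
the unit ball; a derivative on the potential keeps the form. This is the induction step for higher
derivatives. -/
theorem Tail.pd_add_cutoff {χ h : E3 → ℝ} (hχ : IsTest χ) (hχone : ∀ x, ‖x‖ ≤ 1 → χ x = 1)
    (hh : IsTest h) {g : ℝ → E3 → ℝ} (hg : Tail g) (i : Fin 3) : ∃ g', Tail g' ∧ ∀ r, 0 < r →
      NematicFlow.pd i (fun x => g r x + scale r χ x * pot h x) =
        fun x => g' r x + scale r χ x * pot (NematicFlow.pd i h) x := by
  obtain ⟨a, ha, ha'⟩ := hg.pd i
  refine ⟨_, ha.add (Tail.term 0 (hχ.pd i)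
    (pd_eq_zero_of_norm_lt_one (fun x hx => hχone x hx.le) i) hh), fun r hr => ?_⟩
  funext x
  rw [pd_add ((hg.isTest hr).differentiable x)
    (((hχ.scale hr).mul_right (contDiff_pot hh)).differentiable x), ha' r hr,
    pd_scale_mul_pot hχ hh hr]
  ring

end Tails

end NematicFlow

end

noncomputable section

namespace NematicFlow

/-! ### Energy bounds near a fixed time and size of the cut-off errors -/

section PressureGradient

open Set

variable {T : EReal} {u d : ℝ → E3 → E3} {P : ℝ → E3 → ℝ} {f η ζ χ h : E3 → ℝ}

theorem integral_norm_sq_eq {F : Type*} [NormedAddCommGroup F] {f : E3 → F}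
    (hf : MemLp f 2 volume) : ∫ x, ‖f x‖ ^ 2 = (eLpNorm f 2 volume).toReal ^ 2 := by
  have h := eLpNorm_nnreal_pow_eq_lintegral (f := f) (μ := (volume : Measure E3)) (p := 2)
    two_ne_zero
  have hm : AEStronglyMeasurable (fun x => ‖f x‖ ^ 2) volume := hf.aestronglyMeasurable.norm.pow 2
  rw [integral_eq_lintegral_of_nonneg_ae (Eventually.of_forall fun x => by positivity) hm, ← ENNReal.toReal_pow]
  congr 1
  have e : ∀ x, ENNReal.ofReal (‖f x‖ ^ 2) = ‖f x‖ₑ ^ ((2 : NNReal) : ℝ) := by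
    intro x
    rw [ENNReal.ofReal_pow (norm_nonneg _), ofReal_norm, NNReal.coe_ofNat, ENNReal.rpow_two]
  simp only [e]
  rw [← h, NNReal.coe_ofNat, ENNReal.rpow_two]
  rfl

theorem ContinuousInL2.integrable {F : Type*} [NormedAddCommGroup F] {f : ℝ → E3 → F}
    (hf : ContinuousInL2 T f) {t : ℝ} (ht : t ∈ times T) : Integrable fun x => ‖f t x‖ ^ 2 := by
  have h := hf.1 t ht.1.le ht.2
  exact (memLp_two_iff_integrable_sq_norm h.aestronglyMeasurable).1 h

/-- Continuity in L² is used here: a bound uniform for times near t is what permits interchanging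
the limit r → ∞ with the time derivative. -/
theorem ContinuousInL2.eventually_le {F : Type*} [NormedAddCommGroup F] {f : ℝ → E3 → F}
    (hf : ContinuousInL2 T f) {t : ℝ} (ht : t ∈ times T) :
    ∃ B : ℝ, ∀ᶠ s in 𝓝 t, ∫ x, ‖f s x‖ ^ 2 ≤ B := by
  have hmem := hf.1 t ht.1.le ht.2
  have hnb : {s : ℝ | 0 ≤ s ∧ (s : EReal) < T} ∈ 𝓝 t := by
    filter_upwards [(isOpen_times T).mem_nhds ht] with s hs using ⟨hs.1.le, hs.2⟩
  have hlim := hf.2 t ht.1.le ht.2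
  rw [nhdsWithin_eq_nhds.2 hnb] at hlim
  refine ⟨(1 + (eLpNorm (f t) 2 volume).toReal) ^ 2, ?_⟩
  filter_upwards [hlim.eventually_lt_const one_pos, hnb] with s hs hs'
  have hms := hf.1 s hs'.1 hs'.2
  rw [integral_norm_sq_eq hms]
  refine pow_le_pow_left₀ ENNReal.toReal_nonneg ?_ 2
  have h1 : eLpNorm (f s) 2 volume ≤ 1 + eLpNorm (f t) 2 volume := by
    have := eLpNorm_add_le (hms.sub hmem).aestronglyMeasurable hmem.aestronglyMeasurable
      (p := 2) (by norm_num)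
    rw [sub_add_cancel] at this
    exact this.trans (add_le_add_left hs.le _)
  have h2 := ENNReal.toReal_mono (by simp [hmem.eLpNorm_lt_top.ne]) h1
  rwa [ENNReal.toReal_add ENNReal.one_ne_top hmem.eLpNorm_lt_top.ne, ENNReal.toReal_one] at h2

theorem IsSmoothSolution.integrable_stress (S : IsSmoothSolution T u P d) {t : ℝ}
    (ht : t ∈ times T) (i j : Fin 3) : Integrable (stress (u t) (d t) i j) := by
  have hu : ContDiff ℝ ∞ (u t) := S.smoothIn_u.slice ht
  have hd : ContDiff ℝ ∞ (d t) := S.smoothIn_d.slice ht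
  exact Integrable.mono' ((S.cont_u.integrable ht).add (S.cont_grad_d.integrable ht))
    (contDiff_stress hu hd i j).continuous.aestronglyMeasurable
    (Eventually.of_forall fun x => abs_stress_le _ _ i j x)

theorem IsSmoothSolution.integrable_u_sq (S : IsSmoothSolution T u P d) {t : ℝ}
    (ht : t ∈ times T) (k : Fin 3) : Integrable fun x => u t x k ^ 2 := by
  have hu : ContDiff ℝ ∞ (u t) := S.smoothIn_u.slice ht
  refine Integrable.mono' (S.cont_u.integrable ht)
    ((contDiff_comp_apply hu k).continuous.pow 2).aestronglyMeasurable
    (Eventually.of_forall fun x => ?_)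
  rw [Real.norm_of_nonneg (sq_nonneg _), ← sq_abs]
  exact pow_le_pow_left₀ (abs_nonneg _) (PiLp.norm_apply_le (u t x) k) 2

theorem IsSmoothSolution.eventually_energy_le (S : IsSmoothSolution T u P d) {t : ℝ}
    (ht : t ∈ times T) : ∃ B : ℝ, 0 ≤ B ∧ ∀ᶠ s in 𝓝 t,
      (∀ k, ∫ x, u s x k ^ 2 ≤ B) ∧ ∀ i j, ∫ x, |stress (u s) (d s) i j x| ≤ B := by
  obtain ⟨B, hB⟩ := S.cont_u.eventually_le ht
  obtain ⟨B', hB'⟩ := S.cont_grad_d.eventually_le ht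
  refine ⟨|B| + |B'|, by positivity, ?_⟩
  filter_upwards [hB, hB', (isOpen_times T).mem_nhds ht] with s hs hs' hst
  have i1 := S.cont_u.integrable hst
  have i2 := S.cont_grad_d.integrable hst
  have b1 := le_abs_self B
  have b2 := le_abs_self B'
  refine ⟨fun k => ?_, fun i j => ?_⟩
  · have : ∫ x, u s x k ^ 2 ≤ ∫ x, ‖u s x‖ ^ 2 := by
      refine integral_mono (S.integrable_u_sq hst k) i1 fun x => ?_
      simp only
      rw [← sq_abs]
      exact pow_le_pow_left₀ (abs_nonneg _) (PiLp.norm_apply_le (u s x) k) 2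
    linarith [abs_nonneg B']
  · have : ∫ x, |stress (u s) (d s) i j x| ≤ ∫ x, (‖u s x‖ ^ 2 + ‖grad (d s) x‖ ^ 2) :=
      integral_mono (S.integrable_stress hst i j).abs (i1.add i2)
        fun x => abs_stress_le _ _ i j x
    rw [integral_add i1 i2] at this
    linarith

/-- A tail at radius r has L² norm of order r⁻² · r^{3/2} = r^{-1/2}. Writing r = ρ² keeps all
powers integral. -/
theorem Tail.exists_abs_integral_mul_le {g : ℝ → E3 → ℝ} (hg : Tail g) : ∃ C : ℝ, 0 ≤ C ∧
    ∀ ρ : ℝ, 1 ≤ ρ → ∀ v : E3 → ℝ, Integrable (fun x => v x ^ 2) →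
      |∫ x, v x * g (ρ ^ 2) x| ≤ C * ρ⁻¹ * (1 + ∫ x, v x ^ 2) := by
  obtain ⟨C, M, hC, hM, H⟩ := hg.exists_bound
  set V := volume.real (Metric.ball (0 : E3) 1) with hV
  refine ⟨C * (1 + M ^ 3 * V), by positivity, fun ρ hρ v hv => ?_⟩
  have hρ0 : 0 < ρ := by linarith
  have hb := measure_closedBall_lt_top (μ := (volume : Measure E3)) (x := 0) (r := M * ρ ^ 2)
  have i1 : Integrable fun x => C * (ρ⁻¹ * v x ^ 2) := (hv.const_mul _).const_mul _
  have i2 : Integrable fun x => C * (ρ⁻¹ ^ 7 *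
      (Metric.closedBall (0 : E3) (M * ρ ^ 2)).indicator (1 : E3 → ℝ) x) :=
    (((integrable_indicator_iff Metric.isClosed_closedBall.measurableSet).2
      (integrableOn_const (hs := hb.ne))).const_mul _).const_mul _
  have i3 : Integrable fun x => C * (ρ⁻¹ * v x ^ 2) + C * (ρ⁻¹ ^ 7 *
      (Metric.closedBall (0 : E3) (M * ρ ^ 2)).indicator (1 : E3 → ℝ) x) := i1.add i2
  have hvol : volume.real (Metric.closedBall (0 : E3) (M * ρ ^ 2)) = (M * ρ ^ 2) ^ 3 * V := by
    rw [measureReal_def, Measure.addHaar_closedBall _ _ (by positivity), ENNReal.toReal_mul,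
      ENNReal.toReal_ofReal (by positivity)]
    simp [hV, measureReal_def]
  have hI : 0 ≤ ∫ x, v x ^ 2 := integral_nonneg fun x => sq_nonneg _
  rw [← Real.norm_eq_abs]
  refine (norm_integral_le_of_norm_le i3 (Eventually.of_forall fun x => ?_)).trans ?_
  · have hr : 1 ≤ ρ ^ 2 := one_le_pow₀ hρ
    rw [norm_mul, Real.norm_eq_abs, Real.norm_eq_abs]
    by_cases hx : x ∈ Metric.closedBall (0 : E3) (M * ρ ^ 2)
    · simp only [hx, indicator_of_mem, Pi.one_apply, mul_one]
      -- Young's inequality in place of Cauchy–Schwarz; on a ball of volume of order ρ⁶ the constant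
      -- ρ⁻⁷ integrates to ρ⁻¹.
      have h1 : |v x| * ρ⁻¹ ^ 4 ≤ ρ⁻¹ * v x ^ 2 + ρ⁻¹ ^ 7 := by
        have h2 : 0 ≤ ρ⁻¹ * (|v x| - ρ⁻¹ ^ 3) ^ 2 := by positivity
        have h3 : 0 ≤ |v x| * ρ⁻¹ ^ 4 := by positivity
        have e : ρ⁻¹ * (|v x| - ρ⁻¹ ^ 3) ^ 2 = ρ⁻¹ * |v x| ^ 2 + ρ⁻¹ ^ 7
          - 2 * (|v x| * ρ⁻¹ ^ 4) := by ring
        rw [sq_abs] at e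
        linarith
      calc |v x| * |g (ρ ^ 2) x| ≤ |v x| * (C * (ρ ^ 2)⁻¹ ^ 2) := by
            gcongr
            exact (H _ hr x).1
        _ = C * (|v x| * ρ⁻¹ ^ 4) := by
            rw [← inv_pow]
            ring
        _ ≤ C * (ρ⁻¹ * v x ^ 2 + ρ⁻¹ ^ 7) := by gcongr
        _ = _ := by ring
    · have hx' : M * ρ ^ 2 < ‖x‖ := by simpa using hx
      rw [(H _ hr x).2 hx', abs_zero, mul_zero]
      have : 0 ≤ C * (ρ⁻¹ * v x ^ 2) := by positivity
      simpa [hx] using this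
  · rw [integral_add i1 i2, integral_const_mul, integral_const_mul, integral_const_mul,
      integral_const_mul, integral_indicator_one Metric.isClosed_closedBall.measurableSet, hvol]
    have e : C * (ρ⁻¹ * ∫ x, v x ^ 2) + C * (ρ⁻¹ ^ 7 * ((M * ρ ^ 2) ^ 3 * V)) =
        C * ρ⁻¹ * ((∫ x, v x ^ 2) + M ^ 3 * V) := by
      field_simp
    rw [e]
    have h1 : 0 ≤ M ^ 3 * V := by positivity
    have h2 : (∫ x, v x ^ 2) + M ^ 3 * V ≤ (1 + M ^ 3 * V) * (1 + ∫ x, v x ^ 2) := by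
      nlinarith [mul_nonneg h1 hI]
    calc _ ≤ C * ρ⁻¹ * ((1 + M ^ 3 * V) * (1 + ∫ x, v x ^ 2)) := by gcongr
      _ = _ := by ring

theorem abs_integral_mul_le_of_abs_le {F g : E3 → ℝ} {C : ℝ} (hF : Integrable F)
    (hg : ∀ x, |g x| ≤ C) : |∫ x, F x * g x| ≤ C * ∫ x, |F x| := by
  rw [← integral_const_mul, ← Real.norm_eq_abs]
  refine norm_integral_le_of_norm_le (hF.abs.const_mul C) (Eventually.of_forall fun x => ?_)
  rw [norm_mul, mul_comm]
  exact mul_le_mul_of_nonneg_right (hg x) (abs_nonneg _)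

theorem Tail.exists_abs_integral_mul_le' {g : ℝ → E3 → ℝ} (hg : Tail g) : ∃ C : ℝ, 0 ≤ C ∧
    ∀ ρ : ℝ, 1 ≤ ρ → ∀ F : E3 → ℝ, Integrable F →
      |∫ x, F x * g (ρ ^ 2) x| ≤ C * ρ⁻¹ * ∫ x, |F x| := by
  obtain ⟨C, M, hC, hM, H⟩ := hg.exists_bound
  refine ⟨C, hC, fun ρ hρ F hF => abs_integral_mul_le_of_abs_le hF fun x => ?_⟩
  refine ((H _ (one_le_pow₀ hρ) x).1).trans ?_
  have h1 : (ρ ^ 2)⁻¹ ^ 2 ≤ ρ⁻¹ := by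
    rw [← inv_pow, ← pow_mul]
    exact pow_le_of_le_one (by positivity) (inv_le_one_of_one_le₀ hρ) (by norm_num)
  gcongr

theorem exists_pd_cutoff (hχ : IsTest χ) (hχone : ∀ x, ‖x‖ ≤ 1 → χ x = 1) (hζ : IsTest ζ)
    (i : Fin 3) : ∃ g, Tail g ∧ ∀ r, 0 < r → pd i (fun x => scale r χ x * pot ζ x) =
      fun x => g r x + scale r χ x * pot (pd i ζ) x := by
  obtain ⟨g, hg, H⟩ := Tail.pd_add_cutoff hχ hχone hζ Tail.zero i
  refine ⟨g, hg, fun r hr => ?_⟩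
  rw [← H r hr]
  simp

theorem exists_pd_pd_cutoff (hχ : IsTest χ) (hχone : ∀ x, ‖x‖ ≤ 1 → χ x = 1) (hζ : IsTest ζ)
    (i j : Fin 3) : ∃ g, Tail g ∧ ∀ r, 0 < r → pd i (pd j (fun x => scale r χ x * pot ζ x)) =
      fun x => g r x + scale r χ x * pot (pd i (pd j ζ)) x := by
  obtain ⟨a, ha, ha'⟩ := exists_pd_cutoff hχ hχone hζ j
  obtain ⟨g, hg, H⟩ := Tail.pd_add_cutoff hχ hχone (hζ.pd j) ha i
  exact ⟨g, hg, fun r hr => by rw [ha' r hr, H r hr]⟩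

theorem exists_pd_pd_pd_cutoff (hχ : IsTest χ) (hχone : ∀ x, ‖x‖ ≤ 1 → χ x = 1) (hζ : IsTest ζ)
    (i j k : Fin 3) : ∃ g, Tail g ∧ ∀ r, 0 < r →
      pd i (pd j (pd k (fun x => scale r χ x * pot ζ x))) =
      fun x => g r x + scale r χ x * pot (pd i (pd j (pd k ζ))) x := by
  obtain ⟨a, ha, ha'⟩ := exists_pd_pd_cutoff hχ hχone hζ j k
  obtain ⟨g, hg, H⟩ := Tail.pd_add_cutoff hχ hχone ((hζ.pd k).pd j) ha i
  exact ⟨g, hg, fun r hr => by rw [ha' r hr, H r hr]⟩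

/-- The potential solves ΔΦ = -ζ. Once the cut-off equals one on the support of ζ, only tails
survive in the sum with ζ. -/
theorem exists_lap_cutoff (hχ : IsTest χ) (hχone : ∀ x, ‖x‖ ≤ 1 → χ x = 1) (hζ : IsTest ζ) :
    ∃ g, Tail g ∧ ∃ r₀, ∀ r, 0 < r → r₀ ≤ r →
      ∀ x, lap (fun x => scale r χ x * pot ζ x) x + ζ x = g r x := by
  choose g hg H using fun i => exists_pd_pd_cutoff hχ hχone hζ i i
  obtain ⟨r₀, hr₀, hζr⟩ := hζ.exists_ball
  refine ⟨_, Tail.sum hg, r₀, fun r hr hle x => ?_⟩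
  have e : ∑ i, pot (pd i (pd i ζ)) x = -ζ x := by
    rw [← lap_pot hζ, lap]
    refine Finset.sum_congr rfl fun i _ => ?_
    rw [pd_pot hζ, pd_pot (hζ.pd i)]
  simp only [lap, H _ r hr, Finset.sum_add_distrib, ← Finset.mul_sum, e]
  by_cases hx : r₀ < ‖x‖
  · simp [hζr x hx]
  · have : scale r χ x = 1 := by
      refine hχone _ ?_
      rw [norm_smul, norm_inv, Real.norm_of_nonneg hr.le, inv_mul_le_iff₀ hr]
      linarith
    rw [this]
    ring

/-- The difference is a tail plus (1 - χ_r) times a decaying potential, both uniformly small; this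
suffices because the stress is only in L¹. -/
theorem exists_abs_integral_pot_sub_le (hχ : IsTest χ) (hχ0 : ∀ x, 0 ≤ χ x) (hχ1 : ∀ x, χ x ≤ 1)
    (hχone : ∀ x, ‖x‖ ≤ 1 → χ x = 1) (hζ : IsTest ζ) (i j k : Fin 3) : ∃ C : ℝ, 0 ≤ C ∧
    ∀ ρ : ℝ, 1 ≤ ρ → ∀ F : E3 → ℝ, Integrable F →
      |∫ x, F x * (pot (pd i (pd j (pd k ζ))) x -
        pd i (pd j (pd k (fun x => scale (ρ ^ 2) χ x * pot ζ x))) x)| ≤ C * ρ⁻¹ * ∫ x, |F x| := by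
  obtain ⟨g, hg, H⟩ := exists_pd_pd_pd_cutoff hχ hχone hζ i j k
  obtain ⟨C, M, hC, hM, hb⟩ := hg.exists_bound
  obtain ⟨B, hB, hpot⟩ := exists_pot_le (((hζ.pd k).pd j).pd i)
  refine ⟨C + B, by positivity, fun ρ hρ F hF => abs_integral_mul_le_of_abs_le hF fun x => ?_⟩
  have hρ0 : 0 < ρ := by linarith
  have hr : 1 ≤ ρ ^ 2 := one_le_pow₀ hρ
  rw [H _ (by positivity)]
  have h1 : (ρ ^ 2)⁻¹ ^ 2 ≤ ρ⁻¹ := by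
    rw [← inv_pow, ← pow_mul]
    exact pow_le_of_le_one (by positivity) (inv_le_one_of_one_le₀ hρ) (by norm_num)
  have h2 : |g (ρ ^ 2) x| ≤ C * ρ⁻¹ := (hb _ hr x).1.trans (by gcongr)
  have h3 : |(1 - scale (ρ ^ 2) χ x) * pot (pd i (pd j (pd k ζ))) x| ≤ B * ρ⁻¹ := by
    by_cases hx : ‖x‖ ≤ ρ ^ 2
    · have : scale (ρ ^ 2) χ x = 1 := by
        refine hχone _ ?_
        rw [norm_smul, norm_inv, Real.norm_of_nonneg (by positivity), inv_mul_le_iff₀ (by positivity)]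
        linarith
      rw [this]
      simp
      positivity
    · have hx' : ρ ^ 2 < ‖x‖ := not_le.1 hx
      have hs0 : 0 ≤ scale (ρ ^ 2) χ x := hχ0 _
      have hs1 : scale (ρ ^ 2) χ x ≤ 1 := hχ1 _
      rw [abs_mul]
      have h4 : |1 - scale (ρ ^ 2) χ x| ≤ 1 := by
        rw [abs_le]; constructor <;> linarith
      calc _ ≤ 1 * (B * (1 + ‖x‖)⁻¹) := by
            gcongr
            exact hpot x
        _ ≤ B * ρ⁻¹ := by
            rw [one_mul]
            gcongr
            nlinarith
  have e : pot (pd i (pd j (pd k ζ))) x -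
      (g (ρ ^ 2) x + scale (ρ ^ 2) χ x * pot (pd i (pd j (pd k ζ))) x) =
      (1 - scale (ρ ^ 2) χ x) * pot (pd i (pd j (pd k ζ))) x - g (ρ ^ 2) x := by ring
  rw [e]
  refine (abs_sub _ _).trans ?_
  linarith

end PressureGradient

end NematicFlow

end

noncomputable section

namespace NematicFlow

/-! ### The pressure gradient determined by the stress -/

section PressureRepresentation

open Set

variable {T : EReal} {u d : ℝ → E3 → E3} {P : ℝ → E3 → ℝ} {f η ζ χ h : E3 → ℝ}

theorem integrable_mul_pot {F : E3 → ℝ} (hF : Integrable F) (hη : IsTest η) :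
    Integrable fun x => F x * pot η x := by
  obtain ⟨B, hB, hpot⟩ := exists_pot_le hη
  refine hF.mul_bdd (c := B) (contDiff_pot hη).continuous.aestronglyMeasurable
    (Eventually.of_forall fun x => (hpot x).trans ?_)
  exact mul_le_of_le_one_right hB.le (inv_le_one_of_one_le₀ (by linarith [norm_nonneg x]))

/-- The pressure gradient is determined by the stress. -/
theorem IsSmoothSolution.integral_pd_P_mul (S : IsSmoothSolution T u P d) {t : ℝ}
    (ht : t ∈ times T) (k : Fin 3) (hζ : IsTest ζ) :
    (∫ x, pd k (P t) x * ζ x) +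
      ∑ j, ∑ i, ∫ x, stress (u t) (d t) i j x * pot (pd i (pd j (pd k ζ))) x = 0 := by
  obtain ⟨χ, hχ, hχ0, hχ1, hχone, -⟩ := exists_cutoff
  obtain ⟨e, he, r₀, hr₀⟩ := exists_lap_cutoff hχ hχone hζ
  obtain ⟨el, hel, hel'⟩ := he.lap
  choose ep hep hep' using fun i => he.pd i
  obtain ⟨C₁, hC₁, H₁⟩ := he.exists_abs_integral_mul_le
  obtain ⟨C₂, hC₂, H₂⟩ := hel.exists_abs_integral_mul_le
  choose C₃ hC₃ H₃ using fun i => (hep i).exists_abs_integral_mul_le'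
  choose C₄ hC₄ H₄ using fun i j => exists_abs_integral_pot_sub_le hχ hχ0 hχ1 hχone hζ i j k
  obtain ⟨B, hB, hev⟩ := S.eventually_energy_le ht
  -- All estimates are made uniform over an open set U of times around t.
  obtain ⟨U, hU, hUo, htU⟩ := eventually_nhds_iff.1 (hev.and ((isOpen_times T).mem_nhds ht))
  set K := (∑ i, C₃ i * B) + C₂ * (1 + B) + ∑ j, ∑ i, C₄ i j * B with hK
  set ρ : ℕ → ℝ := fun n => n + 1 with hρ
  have hρ1 : ∀ n, 1 ≤ ρ n := fun n => by simp [hρ]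
  have hρ0 : ∀ n, 0 < ρ n := fun n => zero_lt_one.trans_le (hρ1 n)
  set a : ℝ → ℝ := fun s => (∫ x, pd k (P s) x * ζ x) +
      ∑ j, ∑ i, ∫ x, stress (u s) (d s) i j x * pot (pd i (pd j (pd k ζ))) x with ha
  set F' : ℕ → ℝ → ℝ := fun n s =>
      (∑ i, ∫ x, stress (u s) (d s) i k x * pd i (e (ρ n ^ 2)) x)
        + (∫ x, u s x k * lap (e (ρ n ^ 2)) x) - ∫ x, pd k (P s) x * e (ρ n ^ 2) x with hF'
  have hinv : Tendsto (fun n => (ρ n)⁻¹) atTop (𝓝 0) := by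
    have : Tendsto (fun n : ℕ => 1 / ((n : ℝ) + 1)) atTop (𝓝 0) :=
      tendsto_one_div_add_atTop_nhds_zero_nat
    simpa [hρ] using this
  have hlarge : ∀ᶠ n in atTop, r₀ ≤ ρ n ^ 2 := by
    have : Tendsto (fun n : ℕ => (n : ℝ)) atTop atTop := tendsto_natCast_atTop_atTop
    filter_upwards [this.eventually_ge_atTop r₀] with n hn
    have : (0 : ℝ) ≤ n := n.cast_nonneg
    simp only [hρ]
    nlinarith
  -- F' is the time derivative of ∫ uₖ e. Its pressure term splits into ∫ ∂ₖP ζ and ∫ ∂ₖP ΔΦ; the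
  -- latter is rewritten through the stress, so no term with an uncontrolled P remains in the error.
  have hdiff : ∀ᶠ n in atTop, ∀ s ∈ U, |F' n s - (-a s)| ≤ K * (ρ n)⁻¹ := by
    filter_upwards [hlarge] with n hn s hs
    obtain ⟨⟨hb1, hb2⟩, hsT⟩ := hU s hs
    have hst := S.integrable_stress hsT
    set Φ : E3 → ℝ := fun x => scale (ρ n ^ 2) χ x * pot ζ x with hΦ
    have hr : 0 < ρ n ^ 2 := by have := hρ0 n; positivity
    have tΦ : IsTest Φ := (hχ.scale hr).mul_right (contDiff_pot hζ)
    have hP := contDiff_pd (S.contDiff_P hsT) k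
    have e1 : ∫ x, pd k (P s) x * e (ρ n ^ 2) x =
        (∑ j, ∑ i, ∫ x, stress (u s) (d s) i j x * pd i (pd j (pd k Φ)) x) +
        ∫ x, pd k (P s) x * ζ x := by
      rw [← S.integral_pd_P_mul_lap hsT k tΦ, ← integral_add
        (tΦ.lap.integrable_mul hP.continuous) (hζ.integrable_mul hP.continuous)]
      refine integral_congr_ae (Eventually.of_forall fun x => ?_)
      simp only
      rw [← hr₀ _ hr hn x, mul_add]
    have e2 : ∀ i j, ∫ x, stress (u s) (d s) i j x * (pot (pd i (pd j (pd k ζ))) x -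
        pd i (pd j (pd k Φ)) x) =
        (∫ x, stress (u s) (d s) i j x * pot (pd i (pd j (pd k ζ))) x) -
        ∫ x, stress (u s) (d s) i j x * pd i (pd j (pd k Φ)) x := by
      intro i j
      rw [← integral_sub (integrable_mul_pot (hst i j) (((hζ.pd k).pd j).pd i))
        ((((tΦ.pd k).pd j).pd i).integrable_mul (contDiff_stress (S.smoothIn_u.slice hsT)
          (S.smoothIn_d.slice hsT) i j).continuous)]
      simp only [mul_sub]
    have e3 : F' n s - (-a s) = (∑ i, ∫ x, stress (u s) (d s) i k x * pd i (e (ρ n ^ 2)) x)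
        + (∫ x, u s x k * lap (e (ρ n ^ 2)) x) +
        ∑ j, ∑ i, ∫ x, stress (u s) (d s) i j x * (pot (pd i (pd j (pd k ζ))) x -
          pd i (pd j (pd k Φ)) x) := by
      simp only [hF', ha, e1, e2, Finset.sum_sub_distrib]
      ring
    have hi : 0 ≤ (ρ n)⁻¹ := (inv_pos.2 (hρ0 n)).le
    have b1 : |∑ i, ∫ x, stress (u s) (d s) i k x * pd i (e (ρ n ^ 2)) x| ≤
        ∑ i, C₃ i * B * (ρ n)⁻¹ := by
      refine (Finset.abs_sum_le_sum_abs _ _).trans (Finset.sum_le_sum fun i _ => ?_)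
      rw [hep' i _ hr, mul_right_comm]
      exact (H₃ i _ (hρ1 n) _ (hst i k)).trans
        (mul_le_mul_of_nonneg_left (hb2 i k) (mul_nonneg (hC₃ i) hi))
    have b2 : |∫ x, u s x k * lap (e (ρ n ^ 2)) x| ≤ C₂ * (1 + B) * (ρ n)⁻¹ := by
      rw [hel' _ hr, mul_right_comm]
      exact (H₂ _ (hρ1 n) _ (S.integrable_u_sq hsT k)).trans
        (mul_le_mul_of_nonneg_left (by linarith [hb1 k]) (mul_nonneg hC₂ hi))
    have b3 : |∑ j, ∑ i, ∫ x, stress (u s) (d s) i j x * (pot (pd i (pd j (pd k ζ))) x -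
          pd i (pd j (pd k Φ)) x)| ≤ ∑ j, ∑ i, C₄ i j * B * (ρ n)⁻¹ := by
      refine (Finset.abs_sum_le_sum_abs _ _).trans (Finset.sum_le_sum fun j _ => ?_)
      refine (Finset.abs_sum_le_sum_abs _ _).trans (Finset.sum_le_sum fun i _ => ?_)
      rw [mul_right_comm]
      exact (H₄ i j _ (hρ1 n) _ (hst i j)).trans
        (mul_le_mul_of_nonneg_left (hb2 i j) (mul_nonneg (hC₄ i j) hi))
    rw [e3, hK, add_mul, add_mul, Finset.sum_mul, Finset.sum_mul]
    simp only [Finset.sum_mul]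
    exact (abs_add_three _ _ _).trans (add_le_add (add_le_add b1 b2) b3)
  have hunif : TendstoUniformlyOn F' (fun s => -a s) atTop U := by
    rw [Metric.tendstoUniformlyOn_iff]
    intro ε hε
    have hKlim : Tendsto (fun n => K * (ρ n)⁻¹) atTop (𝓝 0) := by
      simpa using hinv.const_mul K
    filter_upwards [hdiff, hKlim.eventually_lt_const hε] with n hn hlt s hs
    rw [dist_comm, Real.dist_eq]
    exact (hn s hs).trans_lt hlt
  have hderiv : ∀ᶠ n in atTop, ∀ s ∈ U,
      HasDerivAt (fun s => ∫ x, u s x k * e (ρ n ^ 2) x) (F' n s) s := by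
    refine Eventually.of_forall fun n s hs => ?_
    have hr : 0 < ρ n ^ 2 := by have := hρ0 n; positivity
    exact S.hasDerivAt_integral_u (hU s hs).2 k (he.isTest hr)
  have hlim : ∀ s ∈ U, Tendsto (fun n => ∫ x, u s x k * e (ρ n ^ 2) x) atTop (𝓝 0) := by
    intro s hs
    have hsT := (hU s hs).2
    refine squeeze_zero_norm (a := fun n => C₁ * (1 + ∫ x, u s x k ^ 2) * (ρ n)⁻¹) (fun n => ?_) ?_
    · rw [mul_right_comm]
      exact H₁ _ (hρ1 n) _ (S.integrable_u_sq hsT k)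
    · simpa using hinv.const_mul (C₁ * (1 + ∫ x, u s x k ^ 2))
  -- The functions ∫ uₖ e tend to 0 while their derivatives tend uniformly to -a, so -a(t) is the
  -- derivative of the zero function.
  have h1 := hasDerivAt_of_tendstoUniformlyOn hUo hunif hderiv hlim htU
  have h2 := h1.unique (hasDerivAt_const t (0 : ℝ))
  have h3 : a t = 0 := by simpa using h2
  exact h3

/-- The defect in the representation of the pressure as a singular integral of the stress. -/
def pressureDefect (p : E3 → ℝ) (f : Fin 3 → Fin 3 → E3 → ℝ) (η : E3 → ℝ) : ℝ :=
  (∫ x, p x * η x) - ∑ j, ∑ i, ∫ x, f i j x * pot (pd i (pd j η)) x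

theorem IsSmoothSolution.pressureDefect_pd (S : IsSmoothSolution T u P d) {t : ℝ}
    (ht : t ∈ times T) (k : Fin 3) (hζ : IsTest ζ) :
    pressureDefect (P t) (stress (u t) (d t)) (pd k ζ) = 0 := by
  have h := S.integral_pd_P_mul ht k hζ
  rw [integral_pd_mul (S.contDiff_P ht) hζ] at h
  rw [pressureDefect]
  linarith

end PressureRepresentation

end NematicFlow

end

noncomputable section

namespace NematicFlow

/-! ### Translation invariance of the defect and the additive constant -/

section Translation

open Set

variable {T : EReal} {u d : ℝ → E3 → E3} {P : ℝ → E3 → ℝ} {η ζ θ p F : E3 → ℝ}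
  {f : Fin 3 → Fin 3 → E3 → ℝ}

theorem IsTest.comp_sub (hη : IsTest η) (y : E3) : IsTest fun x => η (x - y) :=
  ⟨hη.smooth.comp (contDiff_id.sub contDiff_const),
    hη.compact.comp_homeomorph (Homeomorph.subRight y)⟩

theorem pd_comp_sub (η : E3 → ℝ) (y : E3) (i : Fin 3) :
    pd i (fun x => η (x - y)) = fun x => pd i η (x - y) := by
  funext x
  rw [pd, pd, fderiv_comp_sub]

theorem pot_comp_sub (η : E3 → ℝ) (y x : E3) : pot (fun x => η (x - y)) x = pot η (x - y) := by
  simp only [pot, cv, sub_right_comm]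

theorem hasDerivAt_integral_translate {Ψ : E3 → ℝ} {C B : ℝ} (hF : Integrable F)
    (hΨ : ContDiff ℝ ∞ Ψ) (hC : ∀ x, |Ψ x| ≤ C) (hB : ∀ k x, |pd k Ψ x| ≤ B) (v : E3) (s : ℝ) :
    HasDerivAt (fun s : ℝ => ∫ x, F x * Ψ (x - s • v))
      (-∑ k, v k * ∫ x, F x * pd k Ψ (x - s • v)) s := by
  have hcs : ∀ s : ℝ, Continuous fun x : E3 => x - s • v := fun s => continuous_id.sub continuous_const
  have ib : ∀ k, Integrable fun x => F x * pd k Ψ (x - s • v) := fun k =>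
    hF.mul_bdd (c := B) ((continuous_pd (hΨ.of_le ENat.LEInfty.out) k).comp
      (hcs s)).aestronglyMeasurable (Eventually.of_forall fun x => hB k _)
  have e : (-∑ k, v k * ∫ x, F x * pd k Ψ (x - s • v)) =
      ∫ x, F x * -(∑ k, v k * pd k Ψ (x - s • v)) := by
    simp only [← integral_const_mul]
    rw [← integral_finsetSum _ fun k _ => (ib k).const_mul (v k), ← integral_neg]
    refine integral_congr_ae (Eventually.of_forall fun x => ?_)
    simp only [mul_neg, Finset.mul_sum]
    congr 1
    refine Finset.sum_congr rfl fun k _ => ?_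
    ring
  rw [e]
  have hcd : ∀ s : ℝ, Continuous fun x : E3 => -(∑ k, v k * pd k Ψ (x - s • v)) := by
    intro s
    refine (continuous_finsetSum _ fun k _ => continuous_const.mul ?_).neg
    exact (continuous_pd (hΨ.of_le ENat.LEInfty.out) k).comp (hcs s)
  refine (hasDerivAt_integral_of_dominated_loc_of_deriv_le (μ := (volume : Measure E3))
    (F := fun s x => F x * Ψ (x - s • v))
    (F' := fun s x => F x * -(∑ k, v k * pd k Ψ (x - s • v)))
    (bound := fun x => |F x| * ∑ k, |v k| * B) univ_mem ?_ ?_ ?_ ?_ ?_ ?_).2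
  · exact Eventually.of_forall fun s =>
      hF.aestronglyMeasurable.mul (hΨ.continuous.comp (hcs s)).aestronglyMeasurable
  · exact hF.mul_bdd (c := C) (hΨ.continuous.comp (hcs s)).aestronglyMeasurable
      (Eventually.of_forall fun x => hC _)
  · exact hF.aestronglyMeasurable.mul (hcd s).aestronglyMeasurable
  · refine Eventually.of_forall fun x s _ => ?_
    rw [norm_mul, norm_neg, Real.norm_eq_abs]
    refine mul_le_mul_of_nonneg_left ((norm_sum_le _ _).trans ?_) (abs_nonneg _)
    refine Finset.sum_le_sum fun k _ => ?_
    rw [norm_mul]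
    exact mul_le_mul_of_nonneg_left (hB k _) (abs_nonneg _)
  · exact hF.abs.mul_const _
  · refine Eventually.of_forall fun x s _ => ?_
    have h1 : HasDerivAt (fun s : ℝ => x - s • v) (-v) s := by
      have := ((hasDerivAt_id s).smul_const v).const_sub x
      simpa using this
    have h2 := ((hΨ.differentiable (by simp) (x - s • v)).hasFDerivAt).comp_hasDerivAt s h1
    have h3 := h2.const_mul (F x)
    refine HasDerivAt.congr_deriv h3 ?_
    rw [map_neg, fderiv_eq_sum_pd]
    simp

theorem exists_pot_bound (hη : IsTest η) : ∃ B : ℝ, 0 < B ∧ ∀ x, |pot η x| ≤ B := by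
  obtain ⟨B, hB, hpot⟩ := exists_pot_le hη
  refine ⟨B, hB, fun x => (hpot x).trans ?_⟩
  exact mul_le_of_le_one_right hB.le (inv_le_one_of_one_le₀ (by linarith [norm_nonneg x]))

theorem integrable_indicator_mul {k : E3 → ℝ} (hk : LocallyIntegrable k) (M : ℝ) :
    Integrable ((Metric.closedBall (0 : E3) M).indicator k) :=
  (integrable_indicator_iff Metric.isClosed_closedBall.measurableSet).2
    (hk.integrableOn_isCompact (isCompact_closedBall _ _))

/-- Here p need not be integrable. It is truncated to a ball of radius M containing the supports of
all translates with |σ| ≤ |s| + 1, which changes nothing for parameters near s. -/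
theorem hasDerivAt_integral_translate_of_isTest (hp : Continuous p) (hη : IsTest η) (v : E3)
    (s : ℝ) : HasDerivAt (fun s : ℝ => ∫ x, p x * η (x - s • v))
      (-∑ k, v k * ∫ x, p x * pd k η (x - s • v)) s := by
  obtain ⟨r, hr, hηr⟩ := hη.exists_ball
  obtain ⟨C, hC, hηC⟩ := hη.exists_bound
  choose B hB hηB using fun k => (hη.pd k).exists_bound
  set M := r + (|s| + 1) * ‖v‖ + 1 with hM
  have key : ∀ ζ : E3 → ℝ, (∀ x, r + 1 < ‖x‖ → ζ x = 0) → ∀ σ : ℝ, |σ| ≤ |s| + 1 → ∀ x,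
      (Metric.closedBall (0 : E3) M).indicator p x * ζ (x - σ • v) = p x * ζ (x - σ • v) := by
    intro ζ hζ σ hσ x
    by_cases hx : x ∈ Metric.closedBall (0 : E3) M
    · rw [indicator_of_mem hx]
    · have hx' : M < ‖x‖ := by simpa using hx
      have h1 : ‖x‖ ≤ ‖x - σ • v‖ + ‖σ • v‖ := by
        simpa using norm_add_le (x - σ • v) (σ • v)
      have h2 : ‖σ • v‖ ≤ (|s| + 1) * ‖v‖ := by
        rw [norm_smul]
        exact mul_le_mul_of_nonneg_right hσ (norm_nonneg v)
      rw [hζ _ (by linarith), mul_zero, mul_zero]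
  have hpd : ∀ k x, r + 1 < ‖x‖ → pd k η x = 0 := by
    intro k x hx
    have : η =ᶠ[𝓝 x] fun _ => 0 := by
      filter_upwards [continuousAt_const.eventually_lt continuous_norm.continuousAt
        (show r < ‖x‖ by linarith)] with y hy using hηr y hy
    rw [pd, this.fderiv_eq]
    simp
  have h := hasDerivAt_integral_translate (integrable_indicator_mul hp.locallyIntegrable M)
    hη.smooth hηC (B := ∑ k, B k)
    (fun k x => (hηB k x).trans (Finset.single_le_sum (fun i _ => hB i) (Finset.mem_univ k))) v s
  have hs : |s| ≤ |s| + 1 := by linarith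
  simp only [key _ (hpd _) s hs] at h
  refine h.congr_of_eventuallyEq ?_
  filter_upwards [Metric.ball_mem_nhds s one_pos] with σ hσ
  have : |σ| ≤ |s| + 1 := by
    rw [Metric.mem_ball, Real.dist_eq] at hσ
    linarith [abs_sub_abs_le_abs_sub σ s]
  simp only [key η (fun x hx => hηr x (by linarith)) σ this]

/-- Along the translates by sv, the derivative of the defect is minus the defect of a directional
derivative, hence zero. -/
theorem pressureDefect_translate (hp : Continuous p) (hf : ∀ i j, Integrable (f i j))
    (h0 : ∀ k ζ, IsTest ζ → pressureDefect p f (pd k ζ) = 0) (hη : IsTest η) (v : E3) :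
    pressureDefect p f (fun x => η (x - v)) = pressureDefect p f η := by
  have hd : ∀ s : ℝ, HasDerivAt (fun s : ℝ => pressureDefect p f fun x => η (x - s • v)) 0 s := by
    intro s
    have h1 := hasDerivAt_integral_translate_of_isTest hp hη v s
    have h2 : ∀ i j, HasDerivAt
        (fun s : ℝ => ∫ x, f i j x * pot (pd i (pd j η)) (x - s • v))
        (-∑ k, v k * ∫ x, f i j x * pot (pd i (pd j (pd k η))) (x - s • v)) s := by
      intro i j
      have ht := (hη.pd j).pd i
      obtain ⟨C, hC, hC'⟩ := exists_pot_bound ht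
      choose B hB hB' using fun k => exists_pot_bound (ht.pd k)
      have := hasDerivAt_integral_translate (hf i j) (contDiff_pot ht) hC' (B := ∑ k, B k)
        (fun k x => by
          rw [pd_pot ht]
          exact (hB' k x).trans (Finset.single_le_sum (fun i _ => (hB i).le) (Finset.mem_univ k)))
        v s
      refine this.congr_deriv ?_
      congr 1
      refine Finset.sum_congr rfl fun k _ => ?_
      have e : pd k (pd i (pd j η)) = pd i (pd j (pd k η)) := by
        funext x
        rw [pd_comm (hη.pd j).smooth k i, show pd k (pd j η) = pd j (pd k η) from
          funext fun y => pd_comm hη.smooth k j y]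
      rw [pd_pot ht, e]
    have h3 := h1.sub (HasDerivAt.fun_sum (u := Finset.univ) fun j _ =>
      HasDerivAt.fun_sum (u := Finset.univ) fun i _ => h2 i j)
    have e1 : (fun s : ℝ => pressureDefect p f fun x => η (x - s • v)) =
        (fun s : ℝ => ∫ x, p x * η (x - s • v)) - fun s : ℝ =>
          ∑ j, ∑ i, ∫ x, f i j x * pot (pd i (pd j η)) (x - s • v) := by
      funext s
      simp only [pressureDefect, pd_comp_sub, pot_comp_sub, Pi.sub_apply]
    rw [e1]
    refine h3.congr_deriv ?_
    have e2 : ∀ k, (∫ x, p x * pd k η (x - s • v)) -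
        ∑ j, ∑ i, ∫ x, f i j x * pot (pd i (pd j (pd k η))) (x - s • v) = 0 := by
      intro k
      have := h0 k _ (hη.comp_sub (s • v))
      simpa only [pressureDefect, pd_comp_sub, pot_comp_sub] using this
    have e3 : ∑ j, ∑ i, -∑ k, v k * ∫ x, f i j x * pot (pd i (pd j (pd k η))) (x - s • v) =
        -∑ k, v k * ∑ j, ∑ i, ∫ x, f i j x * pot (pd i (pd j (pd k η))) (x - s • v) := by
      simp only [Fin.sum_univ_three]
      ring
    rw [e3]
    simp only [← sub_eq_zero.1 (e2 _)]
    ring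
  have h := is_const_of_deriv_eq_zero (fun s => (hd s).differentiableAt) (fun s => (hd s).deriv) 1 0
  simpa using h

theorem integral_integral_mul_swap {K : E3 → E3 → ℝ} {C : ℝ} (hF : Integrable F)
    (hθ : Integrable θ) (hK : Continuous fun q : E3 × E3 => K q.1 q.2) (hC : ∀ x y, |K x y| ≤ C) :
    (Integrable fun y => θ y * ∫ x, F x * K x y) ∧
      ∫ x, F x * ∫ y, θ y * K x y = ∫ y, θ y * ∫ x, F x * K x y := by
  have hI : Integrable (fun q : E3 × E3 => F q.1 * θ q.2 * K q.1 q.2) (volume.prod volume) :=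
    (hF.mul_prod hθ).mul_bdd (c := C) hK.aestronglyMeasurable
      (Eventually.of_forall fun q => hC _ _)
  have e1 : ∀ y, ∫ x, F x * θ y * K x y = θ y * ∫ x, F x * K x y := by
    intro y
    rw [← integral_const_mul]
    refine integral_congr_ae (Eventually.of_forall fun x => ?_)
    simp only
    ring
  have e2 : ∀ x, ∫ y, F x * θ y * K x y = F x * ∫ y, θ y * K x y := by
    intro x
    simp only [mul_assoc, integral_const_mul]
  have h1 := hI.integral_prod_right
  have h2 := integral_integral_swap (f := fun x y => F x * θ y * K x y) hI
  simp only [e1] at h1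
  simp only [e1, e2] at h2
  exact ⟨h1, h2⟩

theorem integral_integral_mul_swap_of_locallyIntegrable {K : E3 → E3 → ℝ} {C M : ℝ}
    (hF : LocallyIntegrable F) (hθ : Integrable θ)
    (hK : Continuous fun q : E3 × E3 => K q.1 q.2) (hC : ∀ x y, |K x y| ≤ C)
    (hM : ∀ x, M < ‖x‖ → ∀ y, θ y = 0 ∨ K x y = 0) :
    (Integrable fun y => θ y * ∫ x, F x * K x y) ∧
      ∫ x, F x * ∫ y, θ y * K x y = ∫ y, θ y * ∫ x, F x * K x y := by
  have h := integral_integral_mul_swap (integrable_indicator_mul hF M) hθ hK hC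
  have e1 : ∀ x, (Metric.closedBall (0 : E3) M).indicator F x * ∫ y, θ y * K x y =
      F x * ∫ y, θ y * K x y := by
    intro x
    by_cases hx : x ∈ Metric.closedBall (0 : E3) M
    · rw [indicator_of_mem hx]
    · have hx' : M < ‖x‖ := by simpa using hx
      have : ∀ y, θ y * K x y = 0 := fun y => mul_eq_zero.2 (hM x hx' y)
      simp [this]
  have e2 : ∀ y, θ y * ∫ x, (Metric.closedBall (0 : E3) M).indicator F x * K x y =
      θ y * ∫ x, F x * K x y := by
    intro y
    by_cases hy : θ y = 0
    · simp [hy]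
    · congr 1
      refine integral_congr_ae (Eventually.of_forall fun x => ?_)
      simp only
      by_cases hx : x ∈ Metric.closedBall (0 : E3) M
      · rw [indicator_of_mem hx]
      · have hx' : M < ‖x‖ := by simpa using hx
        rw [(hM x hx' y).resolve_left hy, mul_zero, mul_zero]
  simpa only [e1, e2] using h

theorem pot_cv (hθ : IsTest θ) (hη : IsTest η) (x : E3) :
    pot (cv θ η) x = ∫ y, θ y * pot η (x - y) := by
  obtain ⟨r, hr, hθr⟩ := hθ.exists_ball
  obtain ⟨r', hr', hηr⟩ := hη.exists_ball
  obtain ⟨C, hC, hηC⟩ := hη.exists_bound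
  have h := (integral_integral_mul_swap_of_locallyIntegrable (K := fun z y => η (x - z - y))
    (M := ‖x‖ + r + r') locallyIntegrable_newton hθ.integrable
    (hη.continuous.comp (by fun_prop)) (fun _ _ => hηC _) (fun z hz y => ?_)).2
  · simp only [pot, NematicFlow.cv, h]
    refine integral_congr_ae (Eventually.of_forall fun y => ?_)
    simp only [sub_right_comm]
  · by_cases hy : r < ‖y‖
    · exact Or.inl (hθr y hy)
    · refine Or.inr (hηr _ ?_)
      have h1 : ‖z‖ ≤ ‖x‖ + ‖x - z‖ := by
        simpa using norm_sub_le x (x - z)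
      have h2 : ‖x - z‖ ≤ ‖x - z - y‖ + ‖y‖ := by
        simpa using norm_add_le (x - z - y) y
      linarith

/-- A convolution is a superposition of translates; Fubini moves the defect inside, where
translation invariance makes it constant. -/
theorem pressureDefect_cv (hp : Continuous p) (hf : ∀ i j, Integrable (f i j))
    (h0 : ∀ k ζ, IsTest ζ → pressureDefect p f (pd k ζ) = 0) (hθ : IsTest θ) (hη : IsTest η) :
    pressureDefect p f (cv θ η) = (∫ y, θ y) * pressureDefect p f η := by
  obtain ⟨r, hr, hθr⟩ := hθ.exists_ball
  obtain ⟨r', hr', hηr⟩ := hη.exists_ball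
  obtain ⟨C, hC, hηC⟩ := hη.exists_bound
  obtain ⟨i1, e1⟩ := integral_integral_mul_swap_of_locallyIntegrable
    (K := fun x y => η (x - y)) (M := r + r') hp.locallyIntegrable hθ.integrable
    (hη.continuous.comp (by fun_prop)) (fun _ _ => hηC _) (fun x hx y => by
      by_cases hy : r < ‖y‖
      · exact Or.inl (hθr y hy)
      · refine Or.inr (hηr _ ?_)
        have h2 : ‖x‖ ≤ ‖x - y‖ + ‖y‖ := by simpa using norm_add_le (x - y) y
        linarith)
  have H : ∀ i j, (Integrable fun y => θ y * ∫ x, f i j x * pot (pd i (pd j η)) (x - y)) ∧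
      ∫ x, f i j x * pot (pd i (pd j (cv θ η))) x =
        ∫ y, θ y * ∫ x, f i j x * pot (pd i (pd j η)) (x - y) := by
    intro i j
    have ht := (hη.pd j).pd i
    obtain ⟨B, hB, hB'⟩ := exists_pot_bound ht
    obtain ⟨a, b⟩ := integral_integral_mul_swap (K := fun x y => pot (pd i (pd j η)) (x - y))
      (hf i j) hθ.integrable ((contDiff_pot ht).continuous.comp (by fun_prop)) (fun _ _ => hB' _)
    refine ⟨a, ?_⟩
    rw [← b, pd_cv_fun hθ.continuous.locallyIntegrable hη,
      pd_cv_fun hθ.continuous.locallyIntegrable (hη.pd j)]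
    simp only [pot_cv hθ ht]
  have i2 : Integrable fun y => ∑ j, ∑ i, θ y * ∫ x, f i j x * pot (pd i (pd j η)) (x - y) :=
    integrable_finsetSum _ fun j _ => integrable_finsetSum _ fun i _ => (H i j).1
  have e2 : pressureDefect p f (cv θ η) =
      ∫ y, θ y * pressureDefect p f (fun x => η (x - y)) := by
    have : ∀ y, θ y * pressureDefect p f (fun x => η (x - y)) =
        θ y * (∫ x, p x * η (x - y)) -
          ∑ j, ∑ i, θ y * ∫ x, f i j x * pot (pd i (pd j η)) (x - y) := by
      intro y
      simp only [pressureDefect, pd_comp_sub, pot_comp_sub, mul_sub, Finset.mul_sum]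
    simp only [this]
    rw [integral_sub i1 i2, integral_finsetSum _ fun j _ =>
      integrable_finsetSum _ fun i _ => (H i j).1, pressureDefect]
    congr 1
    refine Finset.sum_congr rfl fun j _ => ?_
    rw [integral_finsetSum _ fun i _ => (H i j).1]
    exact Finset.sum_congr rfl fun i _ => (H i j).2
  rw [e2]
  simp only [pressureDefect_translate hp hf h0 hη]
  rw [integral_mul_const]

/-- The pressure is, up to a constant, the singular integral of the stress. -/
theorem IsSmoothSolution.exists_pressure_eq (S : IsSmoothSolution T u P d) {t : ℝ}
    (ht : t ∈ times T) : ∃ c : ℝ, ∀ η, IsTest η → ∫ x, (P t x - c) * η x =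
      ∑ j, ∑ i, ∫ x, stress (u t) (d t) i j x * pot (pd i (pd j η)) x := by
  obtain ⟨χ, hχ, hχ0, hχ1, hχone, -⟩ := exists_cutoff
  have hP := (S.contDiff_P ht).continuous
  have hst := S.integrable_stress ht
  have h0 := fun k ζ (hζ : IsTest ζ) => S.pressureDefect_pd ht k hζ
  have hpos : 0 < ∫ x, χ x := by
    refine hχ.continuous.integral_pos_of_hasCompactSupport_nonneg_nonzero hχ.compact hχ0
      (x := 0) ?_
    rw [hχone 0 (by simp)]
    exact one_ne_zero
  refine ⟨pressureDefect (P t) (stress (u t) (d t)) χ / ∫ x, χ x, fun η hη => ?_⟩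
  -- Convolution commutes, so (∫ χ) · defect(η) = (∫ η) · defect(χ). The defect is thus a constant
  -- times the integral, the constant being its value at χ divided by ∫ χ.
  have h1 := pressureDefect_cv hP hst h0 hχ hη
  have h2 := pressureDefect_cv hP hst h0 hη hχ
  have e : NematicFlow.cv χ η = NematicFlow.cv η χ := by
    funext x
    rw [cv_swap]
    simp only [NematicFlow.cv, mul_comm]
  rw [e, h2] at h1
  have i1 : Integrable fun x => P t x * η x := hη.integrable_mul hP
  simp only [sub_mul]
  rw [integral_sub i1 (hη.integrable.const_mul _), integral_const_mul]
  have e3 : pressureDefect (P t) (stress (u t) (d t)) η = (∫ x, P t x * η x) -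
      ∑ j, ∑ i, ∫ x, stress (u t) (d t) i j x * pot (pd i (pd j η)) x := rfl
  have e4 : pressureDefect (P t) (stress (u t) (d t)) χ / (∫ x, χ x) * ∫ x, η x =
      pressureDefect (P t) (stress (u t) (d t)) η := by
    rw [div_mul_eq_mul_div, div_eq_iff hpos.ne']
    linarith
  rw [e4, e3]
  ring

end Translation

end NematicFlow

end

noncomputable section

namespace NematicFlow

/-! ### Averaging over balls of radius R -/

section Averaging

open Real Set

/-- Averaging over balls of radius `R`. -/
theorem lintegral_mul_le_average {g w w' : E3 → ℝ≥0∞} (hg : Measurable g) (hw : Measurable w)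
    (hw' : Measurable w') {R : ℝ} {A : ℝ≥0∞} (hA : ∀ y, ∫⁻ x in Metric.ball y R, g x ≤ A)
    (hww : ∀ x y, ‖x - y‖ < R → w x ≤ w' y) :
    volume (Metric.ball (0 : E3) R) * ∫⁻ x, g x * w x ≤ A * ∫⁻ y, w' y := by
  have hms : MeasurableSet {q : E3 × E3 | ‖q.1 - q.2‖ < R} :=
    (isOpen_lt (by fun_prop) continuous_const).measurableSet
  have hgw : Measurable fun x => g x * w x := hg.mul hw
  calc volume (Metric.ball (0 : E3) R) * ∫⁻ x, g x * w x
      = ∫⁻ x, ∫⁻ y, g x * w x * {q : E3 × E3 | ‖q.1 - q.2‖ < R}.indicator 1 (x, y) := by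
        rw [← lintegral_const_mul _ hgw]
        refine lintegral_congr fun x => ?_
        have m1 : Measurable fun y => {q : E3 × E3 | ‖q.1 - q.2‖ < R}.indicator
            (1 : E3 × E3 → ℝ≥0∞) (x, y) :=
          (measurable_one.indicator hms).comp measurable_prodMk_left
        rw [lintegral_const_mul _ m1, mul_comm]
        congr 1
        have e : (fun y => {q : E3 × E3 | ‖q.1 - q.2‖ < R}.indicator
            (1 : E3 × E3 → ℝ≥0∞) (x, y)) = (Metric.ball x R).indicator 1 := by
          funext y
          simp only [indicator, mem_ofPred_eq, Metric.mem_ball, dist_eq_norm, norm_sub_rev x y]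
          rfl
        rw [e, lintegral_indicator_one Metric.isOpen_ball.measurableSet]
        exact (Measure.addHaar_ball_center volume x R).symm
    _ = ∫⁻ y, ∫⁻ x, g x * w x * {q : E3 × E3 | ‖q.1 - q.2‖ < R}.indicator 1 (x, y) :=
        lintegral_lintegral_swap (((hgw.comp measurable_fst).mul
          (measurable_one.indicator hms)).aemeasurable)
    _ ≤ ∫⁻ y, A * w' y := by
        refine lintegral_mono fun y => ?_
        calc ∫⁻ x, g x * w x * {q : E3 × E3 | ‖q.1 - q.2‖ < R}.indicator 1 (x, y)
            ≤ ∫⁻ x, (Metric.ball y R).indicator g x * w' y := by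
              refine lintegral_mono fun x => ?_
              by_cases hx : ‖x - y‖ < R
              · have h1 : x ∈ Metric.ball y R := by simpa [dist_eq_norm] using hx
                have h2 : (x, y) ∈ {q : E3 × E3 | ‖q.1 - q.2‖ < R} := hx
                simp only [indicator_of_mem h1, indicator_of_mem h2, Pi.one_apply, mul_one]
                gcongr
                exact hww x y hx
              · have h2 : (x, y) ∉ {q : E3 × E3 | ‖q.1 - q.2‖ < R} := hx
                simp [indicator_of_notMem h2]
          _ = (∫⁻ x in Metric.ball y R, g x) * w' y := by
              rw [lintegral_mul_const _ (hg.indicator Metric.isOpen_ball.measurableSet),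
                lintegral_indicator Metric.isOpen_ball.measurableSet]
          _ ≤ A * w' y := by
              gcongr
              exact hA y
    _ = _ := lintegral_const_mul _ hw'

theorem volume_ball_eq {R : ℝ} (hR : 0 ≤ R) (x : E3) :
    volume (Metric.ball x R) = ENNReal.ofReal (R ^ 3) * volume (Metric.ball (0 : E3) 1) := by
  rw [Measure.addHaar_ball _ _ hR]
  simp

/-- The centres of R-balls meeting the ball of radius 2R lie in the ball of radius 3R, and 27 =
(3R)³/R³ is the volume ratio. -/
theorem setLIntegral_closedBall_two_mul_le {g : E3 → ℝ≥0∞} (hg : Measurable g) {R : ℝ}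
    (hR : 0 < R) {A : ℝ≥0∞} (hA : ∀ y, ∫⁻ x in Metric.ball y R, g x ≤ A) (x₀ : E3) :
    ∫⁻ x in Metric.closedBall x₀ (2 * R), g x ≤ 27 * A := by
  have mB : MeasurableSet (Metric.closedBall x₀ (2 * R)) := Metric.isClosed_closedBall.measurableSet
  have mB' : MeasurableSet (Metric.ball x₀ (3 * R)) := Metric.isOpen_ball.measurableSet
  have h := lintegral_mul_le_average (R := R) (A := A) hg
    (measurable_one.indicator mB : Measurable ((Metric.closedBall x₀ (2 * R)).indicator
      (1 : E3 → ℝ≥0∞)))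
    (measurable_one.indicator mB' : Measurable ((Metric.ball x₀ (3 * R)).indicator
      (1 : E3 → ℝ≥0∞))) hA (fun x y hxy => by
      by_cases hx : x ∈ Metric.closedBall x₀ (2 * R)
      · have hy : y ∈ Metric.ball x₀ (3 * R) := by
          rw [Metric.mem_closedBall, dist_eq_norm] at hx
          rw [Metric.mem_ball, dist_eq_norm]
          have h1 : ‖y - x₀‖ ≤ ‖y - x‖ + ‖x - x₀‖ := by
            simpa using norm_add_le (y - x) (x - x₀)
          rw [norm_sub_rev y x] at h1
          linarith
        rw [indicator_of_mem hx, indicator_of_mem hy]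
        rfl
      · rw [indicator_of_notMem hx]
        exact bot_le)
  have e : ∫⁻ x, g x * (Metric.closedBall x₀ (2 * R)).indicator (1 : E3 → ℝ≥0∞) x =
      ∫⁻ x in Metric.closedBall x₀ (2 * R), g x := by
    rw [← lintegral_indicator mB]
    refine lintegral_congr fun x => ?_
    by_cases hx : x ∈ Metric.closedBall x₀ (2 * R) <;> simp [hx]
  have h27 : volume (Metric.ball x₀ (3 * R)) = 27 * volume (Metric.ball (0 : E3) R) := by
    rw [volume_ball_eq (by positivity), volume_ball_eq hR.le, mul_pow,
      ENNReal.ofReal_mul (by positivity), mul_assoc]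
    norm_num
  rw [e, lintegral_indicator_one mB', h27, ← mul_assoc, mul_comm (volume _),
    mul_comm A 27] at h
  have hpos : volume (Metric.ball (0 : E3) R) ≠ 0 := (Metric.measure_ball_pos _ _ hR).ne'
  have hfin : volume (Metric.ball (0 : E3) R) ≠ ⊤ := measure_ball_lt_top.ne
  exact (ENNReal.mul_le_mul_iff_left hpos hfin).1 h

/-- Outside radius 2R the weight |x - x₀|⁻⁴ varies by a bounded factor over R-balls and is
comparable to (R + |y - x₀|)⁻⁴, with integral of order R⁻¹. Dividing by the ball volume of order R³
gives R⁻⁴. -/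
theorem exists_lintegral_far_le : ∃ C : ℝ, 0 < C ∧ ∀ (g : E3 → ℝ≥0∞) (R : ℝ) (A : ℝ≥0∞) (x₀ : E3),
    Measurable g → 0 < R → (∀ y, ∫⁻ x in Metric.ball y R, g x ≤ A) →
    ∫⁻ x in (Metric.closedBall x₀ (2 * R))ᶜ, g x * ENNReal.ofReal (‖x - x₀‖⁻¹ ^ 4) ≤
      ENNReal.ofReal (C * R⁻¹ ^ 4) * A := by
  have hI : Integrable fun z : E3 => (1 + ‖z‖) ^ (-(4 : ℝ)) :=
    integrable_one_add_norm (by simp; norm_num)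
  set J := ∫ z : E3, (1 + ‖z‖) ^ (-(4 : ℝ)) with hJ
  have hJ0 : 0 ≤ J := integral_nonneg fun z => by positivity
  set V := volume.real (Metric.ball (0 : E3) 1) with hV
  have hV0 : 0 < V := 
    ENNReal.toReal_pos (Metric.measure_ball_pos _ _ one_pos).ne' measure_ball_lt_top.ne
  refine ⟨16 * (J + 1) / V, by positivity, fun g R A x₀ hg hR hA => ?_⟩
  have mB : MeasurableSet (Metric.closedBall x₀ (2 * R))ᶜ :=
    Metric.isClosed_closedBall.measurableSet.compl
  have m1 : Measurable fun x : E3 => ENNReal.ofReal (‖x - x₀‖⁻¹ ^ 4) := by fun_prop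
  have m2 : Measurable fun y : E3 => ENNReal.ofReal (16 * (R + ‖y - x₀‖)⁻¹ ^ 4) := by fun_prop
  have h := lintegral_mul_le_average (R := R) (A := A) hg (m1.indicator mB) m2 hA
    (fun x y hxy => by
      by_cases hx : x ∈ (Metric.closedBall x₀ (2 * R))ᶜ
      · rw [indicator_of_mem hx]
        have hx' : 2 * R < ‖x - x₀‖ := by simpa [dist_eq_norm] using hx
        refine ENNReal.ofReal_le_ofReal ?_
        have h1 : ‖y - x₀‖ ≤ ‖y - x‖ + ‖x - x₀‖ := by
          simpa using norm_add_le (y - x) (x - x₀)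
        rw [norm_sub_rev y x] at h1
        have h2 : R + ‖y - x₀‖ ≤ 2 * ‖x - x₀‖ := by linarith
        have h3 : ‖x - x₀‖⁻¹ ≤ 2 * (R + ‖y - x₀‖)⁻¹ := by
          rw [← div_eq_mul_inv, le_div_iff₀ (by positivity),
            inv_mul_le_iff₀ (by linarith)]
          linarith
        calc ‖x - x₀‖⁻¹ ^ 4 ≤ (2 * (R + ‖y - x₀‖)⁻¹) ^ 4 := by gcongr
          _ = _ := by ring
      · rw [indicator_of_notMem hx]
        exact bot_le)
  have e : ∫⁻ x, g x * (Metric.closedBall x₀ (2 * R))ᶜ.indicator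
      (fun x => ENNReal.ofReal (‖x - x₀‖⁻¹ ^ 4)) x =
      ∫⁻ x in (Metric.closedBall x₀ (2 * R))ᶜ, g x * ENNReal.ofReal (‖x - x₀‖⁻¹ ^ 4) := by
    rw [← lintegral_indicator mB]
    refine lintegral_congr fun x => ?_
    by_cases hx : x ∈ (Metric.closedBall x₀ (2 * R))ᶜ
    · rw [indicator_of_mem hx, indicator_of_mem hx]
    · rw [indicator_of_notMem hx, indicator_of_notMem hx, mul_zero]
  have e2 : ∫⁻ y : E3, ENNReal.ofReal (16 * (R + ‖y - x₀‖)⁻¹ ^ 4) =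
      ENNReal.ofReal (16 * R⁻¹ * J) := by
    rw [lintegral_sub_right_eq_self (fun z : E3 => ENNReal.ofReal (16 * (R + ‖z‖)⁻¹ ^ 4)) x₀]
    have pw : ∀ z : E3, 16 * (R + ‖z‖)⁻¹ ^ 4 =
        16 * R⁻¹ ^ 4 * (1 + ‖R⁻¹ • z‖) ^ (-(4 : ℝ)) := by
      intro z
      rw [norm_smul, norm_inv, norm_of_nonneg hR.le, rpow_neg (by positivity),
        show (4 : ℝ) = ((4 : ℕ) : ℝ) by norm_num, rpow_natCast]
      have : 1 + R⁻¹ * ‖z‖ = R⁻¹ * (R + ‖z‖) := by field_simp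
      rw [this, mul_pow]
      field_simp
    simp only [pw]
    rw [← ofReal_integral_eq_lintegral_ofReal
      ((hI.comp_smul (inv_ne_zero hR.ne')).const_mul _)
      (Eventually.of_forall fun z => by positivity)]
    congr 1
    rw [integral_const_mul, Measure.integral_comp_inv_smul_of_nonneg _
      (fun z : E3 => (1 + ‖z‖) ^ (-(4 : ℝ))) hR.le, ← hJ]
    simp only [finrank_euclideanSpace, Fintype.card_fin, smul_eq_mul]
    field_simp
  rw [e, e2, volume_ball_eq hR.le] at h
  have hVe : volume (Metric.ball (0 : E3) 1) = ENNReal.ofReal V := by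
    rw [hV, ofReal_measureReal measure_ball_lt_top.ne]
  rw [hVe, ← ENNReal.ofReal_mul (by positivity)] at h
  have h2 := mul_le_mul_right h (ENNReal.ofReal ((R ^ 3 * V)⁻¹))
  rw [← mul_assoc, ← ENNReal.ofReal_mul (by positivity), inv_mul_cancel₀ (by positivity),
    ENNReal.ofReal_one, one_mul, mul_comm A, ← mul_assoc, ← ENNReal.ofReal_mul (by positivity)] at h2
  refine h2.trans (mul_le_mul_left (ENNReal.ofReal_le_ofReal ?_) _)
  have e4 : (R ^ 3 * V)⁻¹ * (16 * R⁻¹ * J) = 16 * J / V * R⁻¹ ^ 4 := by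
    field_simp
  rw [e4]
  gcongr
  linarith

theorem sqrt_cube_le {a b s : ℝ} (ha : 0 ≤ a) (hb : 0 ≤ b) (hs : s ≤ a ^ 2 + b ^ 2) :
    √s ^ 3 ≤ 2 * (a ^ 3 + b ^ 3) := by
  have h1 : √s ≤ √(a ^ 2 + b ^ 2) := sqrt_le_sqrt hs
  have h2 : √(a ^ 2 + b ^ 2) ≤ a + b := by
    rw [sqrt_le_left (by positivity)]
    nlinarith [mul_nonneg ha hb]
  calc √s ^ 3 ≤ √(a ^ 2 + b ^ 2) ^ 3 := by gcongr
    _ = √(a ^ 2 + b ^ 2) * (a ^ 2 + b ^ 2) := by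
        rw [pow_succ', sq_sqrt (by positivity)]
    _ ≤ (a + b) * (a ^ 2 + b ^ 2) := by gcongr
    _ ≤ _ := by nlinarith [mul_nonneg (add_nonneg ha hb) (sq_nonneg (a - b))]

/-- A pointwise substitute for Hölder between L¹ and L^{3/2}: compare √s with the free threshold m,
which is optimised afterwards. -/
theorem le_sqrt_cube_div_add {s m : ℝ} (hs : 0 ≤ s) (hm : 0 < m) : s ≤ √s ^ 3 / m + m ^ 2 := by
  have e : s = √s ^ 2 := (sq_sqrt hs).symm
  have h0 := sqrt_nonneg s
  rcases le_total (√s) m with h | h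
  · have : s ≤ m ^ 2 := by rw [e]; gcongr
    have : 0 ≤ √s ^ 3 / m := by positivity
    linarith
  · have : s ≤ √s ^ 3 / m := by
      rw [le_div_iff₀ hm]
      calc s * m ≤ s * √s := by gcongr
        _ = √s ^ 3 := by nlinarith
    nlinarith

/-- The threshold m = κ/R balances the two contributions: κ³R/κ and (κ/R)²R³ are both κ²R. -/
theorem setLIntegral_ball_le {g : E3 → ℝ} (hg : Measurable g) (hg0 : ∀ x, 0 ≤ g x) {R κ a : ℝ}
    (hR : 0 < R) (hκ : 0 < κ) (ha : 0 ≤ a) (y : E3)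
    (h : ∫⁻ x in Metric.ball y R, ENNReal.ofReal (√(g x) ^ 3) ≤ ENNReal.ofReal (a * κ ^ 3)) :
    ∫⁻ x in Metric.ball y R, ENNReal.ofReal (g x) ≤
      ENNReal.ofReal ((a + volume.real (Metric.ball (0 : E3) 1)) * κ ^ 2 * R) := by
  set V := volume.real (Metric.ball (0 : E3) 1) with hV
  have hV0 : 0 ≤ V := measureReal_nonneg
  have hVe : volume (Metric.ball (0 : E3) 1) = ENNReal.ofReal V := by
    rw [hV, ofReal_measureReal measure_ball_lt_top.ne]
  have hm : 0 < κ / R := by positivity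
  calc ∫⁻ x in Metric.ball y R, ENNReal.ofReal (g x)
      ≤ ∫⁻ x in Metric.ball y R, (ENNReal.ofReal (R / κ) * ENNReal.ofReal (√(g x) ^ 3) +
          ENNReal.ofReal ((κ / R) ^ 2)) := by
        refine lintegral_mono fun x => ?_
        rw [← ENNReal.ofReal_mul (by positivity), ← ENNReal.ofReal_add (by positivity)
          (by positivity)]
        refine ENNReal.ofReal_le_ofReal ((le_sqrt_cube_div_add (hg0 x) hm).trans (le_of_eq ?_))
        field_simp
    _ = ENNReal.ofReal (R / κ) * (∫⁻ x in Metric.ball y R, ENNReal.ofReal (√(g x) ^ 3)) +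
          ENNReal.ofReal ((κ / R) ^ 2) * volume (Metric.ball y R) := by
        rw [lintegral_add_right _ measurable_const, lintegral_const_mul _ (by fun_prop),
          lintegral_const, Measure.restrict_apply_univ]
    _ ≤ ENNReal.ofReal (R / κ) * ENNReal.ofReal (a * κ ^ 3) +
          ENNReal.ofReal ((κ / R) ^ 2) * (ENNReal.ofReal (R ^ 3) * ENNReal.ofReal V) := by
        rw [volume_ball_eq hR.le, hVe]
        gcongr
    _ = _ := by
        rw [← ENNReal.ofReal_mul (by positivity), ← ENNReal.ofReal_mul (by positivity),
          ← ENNReal.ofReal_mul (by positivity), ← ENNReal.ofReal_add (by positivity)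
          (by positivity)]
        congr 1
        field_simp

end Averaging

end NematicFlow

end

noncomputable section

namespace NematicFlow

/-! ### Dual estimate for the localised pressure -/

section Duality

open Real Set

variable {f φ ψ : E3 → ℝ} {x₀ : E3} {R : ℝ}

theorem IsCutoff.isTest (hφ : IsCutoff φ x₀ R) : IsTest φ :=
  ⟨hφ.smooth, HasCompactSupport.intro (isCompact_closedBall x₀ R) fun _ hx =>
    image_eq_zero_of_notMem_tsupport fun h => hx (hφ.support_subset h)⟩

theorem IsCutoff.eq_zero (hφ : IsCutoff φ x₀ R) {x : E3} (hx : R < ‖x - x₀‖) : φ x = 0 :=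
  image_eq_zero_of_notMem_tsupport fun h => by
    have := hφ.support_subset h
    rw [Metric.mem_closedBall, dist_eq_norm] at this
    linarith

theorem IsCutoff.abs_sub_le (hφ : IsCutoff φ x₀ R) (x y : E3) :
    |φ x - φ y| ≤ 4 / R * ‖x - y‖ := by
  have := convex_univ.norm_image_sub_le_of_norm_fderiv_le (f := φ) (C := 4 / R) (x := y) (y := x)
    (fun z _ => hφ.isTest.differentiable z)
    (fun z _ => by rw [← norm_gradient_eq_norm_fderiv]; exact hφ.grad_le z) (mem_univ _) (mem_univ _)
  exact this

theorem ofReal_abs_setIntegral_le {F : E3 → ℝ} (s : Set E3) :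
    ENNReal.ofReal |∫ x in s, F x| ≤ ∫⁻ x in s, ENNReal.ofReal |F x| := by
  have := enorm_integral_le_lintegral_enorm (μ := volume.restrict s) F
  simpa only [← ofReal_norm, norm_eq_abs] using this

/-- The cut-off has Lipschitz constant 4/R, so the commutator costs R⁻¹ times the kernel |x - y|⁻².
Hardy–Littlewood–Sobolev then pairs f on the ball of radius 2R with ψ, both in L^{3/2}. -/
theorem exists_commutator_integral_le : ∃ C : ℝ, 0 < C ∧ ∀ (i j : Fin 3) (f φ ψ : E3 → ℝ)
    (x₀ : E3) (R κ β : ℝ), 0 < R → 0 < κ → 0 < β → Continuous f → IsCutoff φ x₀ R → IsTest ψ →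
    (∀ y, ∫⁻ x in Metric.ball y R, ENNReal.ofReal (√|f x| ^ 3) ≤ ENNReal.ofReal (2 * κ ^ 3)) →
    ∫ x, √|ψ x| ^ 3 ≤ β ^ 3 →
    |∫ x in Metric.closedBall x₀ (2 * R), f x * (pot (pd i (pd j fun y => φ y * ψ y)) x -
      φ x * pot (pd i (pd j ψ)) x)| ≤ C * (κ ^ 2 * R⁻¹) * β ^ 2 := by
  obtain ⟨C₁, hC₁, H₁⟩ := exists_commutator_le
  obtain ⟨C₂, hC₂, H₂⟩ := exists_hardy_littlewood_sobolev
  refine ⟨C₁ * C₂ * 64, by positivity, fun i j f φ ψ x₀ R κ β hR hκ hβ hf hφ hψ hK hψβ => ?_⟩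
  set N := Metric.closedBall x₀ (2 * R) with hN
  have mN : MeasurableSet N := Metric.isClosed_closedBall.measurableSet
  set G : E3 → ℝ := N.indicator fun x => |f x| with hG
  have mG : Measurable G := hf.abs.measurable.indicator mN
  have mψ : Measurable fun x => |ψ x| := hψ.continuous.abs.measurable
  have hG0 : ∀ x, 0 ≤ G x := fun x => indicator_nonneg (fun _ _ => abs_nonneg _) x
  -- Covering by R-balls gives 27 · 2κ³ = 54κ³, rounded up to the cube (4κ)³.
  have h1 : ∫⁻ x, ENNReal.ofReal (√(G x) ^ 3) ≤ ENNReal.ofReal ((4 * κ) ^ 3) := by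
    have e : ∫⁻ x, ENNReal.ofReal (√(G x) ^ 3) = ∫⁻ x in N, ENNReal.ofReal (√|f x| ^ 3) := by
      rw [← lintegral_indicator mN]
      refine lintegral_congr fun x => ?_
      by_cases hx : x ∈ N <;> simp [hG, hx]
    have m : Measurable fun x => ENNReal.ofReal (√|f x| ^ 3) :=
      (hf.abs.sqrt.pow 3).measurable.ennreal_ofReal
    rw [e]
    refine (setLIntegral_closedBall_two_mul_le m hR hK x₀).trans ?_
    rw [show (27 : ℝ≥0∞) = ENNReal.ofReal 27 by simp, ← ENNReal.ofReal_mul (by norm_num)]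
    refine ENNReal.ofReal_le_ofReal ?_
    have : 0 < κ ^ 3 := by positivity
    nlinarith
  have h2 : ∫⁻ x, ENNReal.ofReal (√|ψ x| ^ 3) ≤ ENNReal.ofReal (β ^ 3) := by
    rw [← ofReal_integral_eq_lintegral_ofReal hψ.integrable_sqrt_cube
      (Eventually.of_forall fun x => by positivity)]
    exact ENNReal.ofReal_le_ofReal hψβ
  have h3 := H₂ G (fun x => |ψ x|) mG mψ hG0 (fun x => abs_nonneg _) (4 * κ) β (by positivity) hβ
    h1 h2
  have hb : ENNReal.ofReal |∫ x in N, f x * (pot (pd i (pd j fun y => φ y * ψ y)) x -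
      φ x * pot (pd i (pd j ψ)) x)| ≤
      ENNReal.ofReal (C₁ * (4 / R)) * ENNReal.ofReal (C₂ * (4 * κ) ^ 2 * β ^ 2) := by
    refine (ofReal_abs_setIntegral_le N).trans ?_
    refine le_trans ?_ (mul_le_mul_right h3 (ENNReal.ofReal (C₁ * (4 / R))))
    have mm : Measurable fun x => ∫⁻ y, ENNReal.ofReal (G x * |ψ y| * ‖x - y‖⁻¹ ^ 2) := by
      have : Measurable fun q : E3 × E3 =>
          ENNReal.ofReal (G q.1 * |ψ q.2| * ‖q.1 - q.2‖⁻¹ ^ 2) :=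
        (((mG.comp measurable_fst).mul (mψ.comp measurable_snd)).mul
          (by fun_prop)).ennreal_ofReal
      exact this.lintegral_prod_right'
    rw [← lintegral_const_mul _ mm, ← lintegral_indicator mN]
    refine lintegral_mono fun x => ?_
    by_cases hx : x ∈ N
    · rw [indicator_of_mem hx, abs_mul, ENNReal.ofReal_mul (abs_nonneg _)]
      have e : ∀ y, ENNReal.ofReal (G x * |ψ y| * ‖x - y‖⁻¹ ^ 2) =
          ENNReal.ofReal |f x| * ENNReal.ofReal (|ψ y| * ‖x - y‖⁻¹ ^ 2) := by
        intro y
        rw [hG, indicator_of_mem hx, mul_assoc, ENNReal.ofReal_mul (abs_nonneg _)]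
      simp only [e]
      have m3 : Measurable fun y => ENNReal.ofReal (|ψ y| * ‖x - y‖⁻¹ ^ 2) :=
        (mψ.mul (by fun_prop)).ennreal_ofReal
      rw [lintegral_const_mul _ m3, mul_left_comm]
      gcongr
      exact H₁ i j φ ψ (4 / R) hφ.smooth hψ hφ.abs_sub_le x
    · rw [indicator_of_notMem hx]
      exact bot_le
  rw [← ENNReal.ofReal_mul (by positivity),
    ENNReal.ofReal_le_ofReal_iff (by positivity)] at hb
  refine hb.trans (le_of_eq ?_)
  field_simp
  ring

theorem integral_abs_cutoff_mul_le (hR : 0 < R) (hφ : IsCutoff φ x₀ R) (hψ : IsTest ψ) {β : ℝ}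
    (hβ : 0 < β) (hψβ : ∫ x, √|ψ x| ^ 3 ≤ β ^ 3) : ∫ x, |φ x * ψ x| ≤
      (1 + volume.real (Metric.ball (0 : E3) 1)) * β ^ 2 * R := by
  set V := volume.real (Metric.ball (0 : E3) 1) with hV
  have hvol : volume.real (Metric.closedBall x₀ R) = R ^ 3 * V := by
    rw [measureReal_def, Measure.addHaar_closedBall _ _ hR.le, ENNReal.toReal_mul,
      ENNReal.toReal_ofReal (by positivity)]
    simp [hV, measureReal_def]
  have hm : 0 < β / R := by positivity
  have i1 : Integrable fun x => √|ψ x| ^ 3 / (β / R) := hψ.integrable_sqrt_cube.div_const _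
  have i2 : Integrable fun x =>
      (β / R) ^ 2 * (Metric.closedBall x₀ R).indicator (1 : E3 → ℝ) x :=
    ((integrable_indicator_iff Metric.isClosed_closedBall.measurableSet).2
      (integrableOn_const (hs := measure_closedBall_lt_top.ne))).const_mul _
  have i3 : Integrable fun x => √|ψ x| ^ 3 / (β / R) +
      (β / R) ^ 2 * (Metric.closedBall x₀ R).indicator (1 : E3 → ℝ) x := i1.add i2
  have i4 : Integrable fun x => |φ x * ψ x| := (hψ.mul_left hφ.smooth).integrable.abs
  calc ∫ x, |φ x * ψ x| ≤ ∫ x, (√|ψ x| ^ 3 / (β / R) +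
        (β / R) ^ 2 * (Metric.closedBall x₀ R).indicator (1 : E3 → ℝ) x) := by
        refine integral_mono i4 i3 fun x => ?_
        simp only
        by_cases hx : x ∈ Metric.closedBall x₀ R
        · rw [indicator_of_mem hx, Pi.one_apply, mul_one, abs_mul]
          have h1 : |φ x| ≤ 1 := by rw [abs_of_nonneg (hφ.nonneg x)]; exact hφ.le_one x
          exact (mul_le_of_le_one_left (abs_nonneg _) h1).trans
            (le_sqrt_cube_div_add (abs_nonneg _) hm)
        · have hx' : R < ‖x - x₀‖ := by simpa [dist_eq_norm] using hx
          rw [hφ.eq_zero hx', indicator_of_notMem hx]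
          simp
          positivity
    _ = (∫ x, √|ψ x| ^ 3) / (β / R) + (β / R) ^ 2 * (R ^ 3 * V) := by
        rw [integral_add i1 i2, integral_div, integral_const_mul,
          integral_indicator_one Metric.isClosed_closedBall.measurableSet, hvol]
    _ ≤ β ^ 3 / (β / R) + (β / R) ^ 2 * (R ^ 3 * V) := by gcongr
    _ = _ := by field_simp

/-- Powers of R: the frozen-kernel error R|x - x₀|⁻⁴ ‖φψ‖₁ with ‖φψ‖₁ of order β²R, against R⁻⁴
times a local L¹ mass of order κ²R, gives κ²β²R⁻¹. -/
theorem exists_far_integral_le : ∃ C : ℝ, 0 < C ∧ ∀ (i j : Fin 3) (f φ ψ : E3 → ℝ)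
    (x₀ : E3) (R κ β : ℝ), 0 < R → 0 < κ → 0 < β → Continuous f → IsCutoff φ x₀ R → IsTest ψ →
    (∀ y, ∫⁻ x in Metric.ball y R, ENNReal.ofReal (√|f x| ^ 3) ≤ ENNReal.ofReal (2 * κ ^ 3)) →
    ∫ x, √|ψ x| ^ 3 ≤ β ^ 3 →
    |∫ x in (Metric.closedBall x₀ (2 * R))ᶜ, f x * (pot (pd i (pd j fun y => φ y * ψ y)) x -
      rieszK i j (x - x₀) * ∫ y, φ y * ψ y)| ≤ C * (κ ^ 2 * R⁻¹) * β ^ 2 := by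
  obtain ⟨C₁, hC₁, H₁⟩ := exists_abs_pot_sub_le
  obtain ⟨C₂, hC₂, H₂⟩ := exists_lintegral_far_le
  set V := volume.real (Metric.ball (0 : E3) 1) with hV
  have hV0 : 0 ≤ V := measureReal_nonneg
  refine ⟨C₁ * C₂ * (2 + V) * (1 + V), by positivity,
    fun i j f φ ψ x₀ R κ β hR hκ hβ hf hφ hψ hK hψβ => ?_⟩
  have hφψ : IsTest fun y => φ y * ψ y := hψ.mul_left hφ.smooth
  have mN : MeasurableSet (Metric.closedBall x₀ (2 * R))ᶜ :=
    Metric.isClosed_closedBall.measurableSet.compl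
  have hA : ∀ y, ∫⁻ x in Metric.ball y R, ENNReal.ofReal |f x| ≤
      ENNReal.ofReal ((2 + V) * κ ^ 2 * R) := fun y =>
    setLIntegral_ball_le hf.abs.measurable (fun x => abs_nonneg _) hR hκ (by norm_num) y (hK y)
  have h1 := H₂ (fun x => ENNReal.ofReal |f x|) R _ x₀ hf.abs.measurable.ennreal_ofReal hR hA
  have h2 := integral_abs_cutoff_mul_le hR hφ hψ hβ hψβ
  have hI : 0 ≤ ∫ x, |φ x * ψ x| := integral_nonneg fun x => abs_nonneg _
  have hb : ENNReal.ofReal |∫ x in (Metric.closedBall x₀ (2 * R))ᶜ,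
      f x * (pot (pd i (pd j fun y => φ y * ψ y)) x - rieszK i j (x - x₀) * ∫ y, φ y * ψ y)| ≤
      ENNReal.ofReal (C₁ * R * ∫ x, |φ x * ψ x|) *
        (ENNReal.ofReal (C₂ * R⁻¹ ^ 4) * ENNReal.ofReal ((2 + V) * κ ^ 2 * R)) := by
    refine (ofReal_abs_setIntegral_le _).trans ?_
    refine le_trans ?_ (mul_le_mul_right h1 _)
    have mm : Measurable fun x => ENNReal.ofReal |f x| * ENNReal.ofReal (‖x - x₀‖⁻¹ ^ 4) :=
      hf.abs.measurable.ennreal_ofReal.mul (by fun_prop)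
    rw [← lintegral_const_mul _ mm]
    refine setLIntegral_mono' mN fun x hx => ?_
    have hx' : 2 * R < ‖x - x₀‖ := by simpa [dist_eq_norm] using hx
    rw [← ENNReal.ofReal_mul (abs_nonneg _), ← ENNReal.ofReal_mul (by positivity), abs_mul]
    refine ENNReal.ofReal_le_ofReal ?_
    have := H₁ i j _ x₀ x R hφψ hR (fun y hy => by simp [hφ.eq_zero hy]) hx'.le
    calc _ ≤ |f x| * (C₁ * R * ‖x - x₀‖⁻¹ ^ 4 * ∫ y, |φ y * ψ y|) := by gcongr
      _ = _ := by ring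
  rw [← ENNReal.ofReal_mul (by positivity), ← ENNReal.ofReal_mul (by positivity),
    ENNReal.ofReal_le_ofReal_iff (by positivity)] at hb
  refine hb.trans ?_
  calc _ ≤ C₁ * R * ((1 + V) * β ^ 2 * R) * (C₂ * R⁻¹ ^ 4 * ((2 + V) * κ ^ 2 * R)) := by gcongr
    _ = _ := by field_simp

theorem integrableOn_mul_rieszK (hf : Integrable f) (hR : 0 < R) (i j : Fin 3) (x₀ : E3) :
    IntegrableOn (fun x => f x * rieszK i j (x - x₀)) (Metric.closedBall x₀ (2 * R))ᶜ := by
  obtain ⟨C, hC, H⟩ := exists_abs_rieszK_le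
  refine hf.integrableOn.mul_bdd (c := C * (2 * R)⁻¹ ^ 3)
    ((stronglyMeasurable_rieszK i j).comp_measurable
      (measurable_id.sub_const x₀)).aestronglyMeasurable ?_
  filter_upwards [ae_restrict_mem Metric.isClosed_closedBall.measurableSet.compl] with x hx
  have hx' : 2 * R < ‖x - x₀‖ := by simpa [dist_eq_norm] using hx
  have h0 : 0 < ‖x - x₀‖ := by linarith
  refine (H i j _ (norm_pos_iff.1 h0)).trans ?_
  gcongr

/-- Three contributions: the singular integral of ψ paired with fφ (the L³ bound, giving α), the
commutator near x₀, and the far field with the kernel frozen at x₀ (each giving κ²/R). The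
subtracted term depends on ψ only through ∫ φψ. -/
theorem exists_pot_duality : ∃ C : ℝ, 0 < C ∧ ∀ (i j : Fin 3) (f φ ψ : E3 → ℝ)
    (x₀ : E3) (R α κ β : ℝ), 0 < R → 0 < α → 0 < κ → 0 < β → ContDiff ℝ ∞ f → Integrable f →
    IsCutoff φ x₀ R → IsTest ψ → ∫ x, |f x * φ x| ^ 3 ≤ α ^ 3 →
    (∀ y, ∫⁻ x in Metric.ball y R, ENNReal.ofReal (√|f x| ^ 3) ≤ ENNReal.ofReal (2 * κ ^ 3)) →
    ∫ x, √|ψ x| ^ 3 ≤ β ^ 3 →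
    |(∫ x, f x * pot (pd i (pd j fun y => φ y * ψ y)) x) -
      (∫ x in (Metric.closedBall x₀ (2 * R))ᶜ, f x * rieszK i j (x - x₀)) * ∫ y, φ y * ψ y| ≤
      C * (α + κ ^ 2 * R⁻¹) * β ^ 2 := by
  obtain ⟨C₁, hC₁, H₁⟩ := exists_commutator_integral_le
  obtain ⟨C₂, hC₂, H₂⟩ := exists_far_integral_le
  refine ⟨24 + C₁ + C₂, by positivity,
    fun i j f φ ψ x₀ R α κ β hR hα hκ hβ hf hfi hφ hψ hfα hK hψβ => ?_⟩
  set N := Metric.closedBall x₀ (2 * R) with hN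
  have mN : MeasurableSet N := Metric.isClosed_closedBall.measurableSet
  have hφψ : IsTest fun y => φ y * ψ y := hψ.mul_left hφ.smooth
  have i1 : Integrable fun x => f x * pot (pd i (pd j fun y => φ y * ψ y)) x :=
    integrable_mul_pot hfi ((hφψ.pd j).pd i)
  have hfφ : IsTest fun x => f x * φ x := hφ.isTest.mul_left hf
  have i2 : Integrable fun x => f x * φ x * pot (pd i (pd j ψ)) x :=
    (hfφ.mul_right (contDiff_pot ((hψ.pd j).pd i))).integrable
  have h1 := H₁ i j f φ ψ x₀ R κ β hR hκ hβ hf.continuous hφ hψ hK hψβ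
  have h2 := H₂ i j f φ ψ x₀ R κ β hR hκ hβ hf.continuous hφ hψ hK hψβ
  have h3 := abs_integral_mul_pot_le_mul hfφ hψ i j hα hβ hfα hψβ
  have e1 : ∫ x in N, f x * (pot (pd i (pd j fun y => φ y * ψ y)) x -
      φ x * pot (pd i (pd j ψ)) x) =
      (∫ x in N, f x * pot (pd i (pd j fun y => φ y * ψ y)) x) -
        ∫ x, f x * φ x * pot (pd i (pd j ψ)) x := by
    have : ∫ x in N, f x * φ x * pot (pd i (pd j ψ)) x =
        ∫ x, f x * φ x * pot (pd i (pd j ψ)) x := by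
      refine setIntegral_eq_integral_of_forall_compl_eq_zero fun x hx => ?_
      have hx' : 2 * R < ‖x - x₀‖ := by simpa [hN, dist_eq_norm] using hx
      rw [hφ.eq_zero (by linarith)]
      ring
    rw [← this, ← integral_sub i1.integrableOn i2.integrableOn]
    refine integral_congr_ae (Eventually.of_forall fun x => ?_)
    simp only
    ring
  have e2 : ∫ x in Nᶜ, f x * (pot (pd i (pd j fun y => φ y * ψ y)) x -
      rieszK i j (x - x₀) * ∫ y, φ y * ψ y) =
      (∫ x in Nᶜ, f x * pot (pd i (pd j fun y => φ y * ψ y)) x) -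
        (∫ x in Nᶜ, f x * rieszK i j (x - x₀)) * ∫ y, φ y * ψ y := by
    rw [← integral_mul_const, ← integral_sub i1.integrableOn
      ((integrableOn_mul_rieszK hfi hR i j x₀).mul_const _)]
    refine integral_congr_ae (Eventually.of_forall fun x => ?_)
    simp only
    ring
  rw [e1] at h1
  rw [e2] at h2
  rw [← integral_add_compl mN i1]
  have hαβ : 0 ≤ α * β ^ 2 := by positivity
  have hκβ : 0 ≤ κ ^ 2 * R⁻¹ * β ^ 2 := by positivity
  have key : ∀ {a b c X Y : ℝ}, |a - b| ≤ X → |c| ≤ Y → |b| ≤ 24 * α * β ^ 2 →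
      |a + c| ≤ 24 * α * β ^ 2 + X + Y := by
    intro a b c X Y h1 h2 h3
    rw [abs_le] at *
    constructor <;> linarith [h1.1, h1.2, h2.1, h2.2, h3.1, h3.2]
  rw [add_sub_assoc]
  refine (key h1 h2 h3).trans ?_
  nlinarith [mul_nonneg hC₁.le hαβ, mul_nonneg hC₂.le hαβ]

/-- The frozen far-field integrals are added to c. The resulting constant is chosen before ψ, as
duality requires. -/
theorem exists_pressure_duality : ∃ C : ℝ, 0 < C ∧ ∀ (f : Fin 3 → Fin 3 → E3 → ℝ) (p : E3 → ℝ)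
    (c : ℝ) (φ : E3 → ℝ) (x₀ : E3) (R : ℝ), 0 < R → IsCutoff φ x₀ R → Continuous p →
    (∀ i j, ContDiff ℝ ∞ (f i j)) → (∀ i j, Integrable (f i j)) →
    (∀ η, IsTest η → ∫ x, (p x - c) * η x = ∑ j, ∑ i, ∫ x, f i j x * pot (pd i (pd j η)) x) →
    ∃ c' : ℝ, ∀ (ψ : E3 → ℝ) (α κ β : ℝ), 0 < α → 0 < κ → 0 < β → IsTest ψ →
      (∀ i j, ∫ x, |f i j x * φ x| ^ 3 ≤ α ^ 3) →
      (∀ i j y, ∫⁻ x in Metric.ball y R, ENNReal.ofReal (√|f i j x| ^ 3) ≤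
        ENNReal.ofReal (2 * κ ^ 3)) →
      ∫ x, √|ψ x| ^ 3 ≤ β ^ 3 →
      |∫ x, (p x - c') * (φ x * ψ x)| ≤ C * (α + κ ^ 2 * R⁻¹) * β ^ 2 := by
  obtain ⟨C, hC, H⟩ := exists_pot_duality
  refine ⟨9 * C, by positivity, fun f p c φ x₀ R hR hφ hp hf hfi hrep => ?_⟩
  refine ⟨c + ∑ j, ∑ i, ∫ x in (Metric.closedBall x₀ (2 * R))ᶜ, f i j x * rieszK i j (x - x₀),
    fun ψ α κ β hα hκ hβ hψ hfα hK hψβ => ?_⟩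
  have hφψ : IsTest fun y => φ y * ψ y := hψ.mul_left hφ.smooth
  set s := ∑ j, ∑ i, ∫ x in (Metric.closedBall x₀ (2 * R))ᶜ, f i j x * rieszK i j (x - x₀) with hs
  have e : ∫ x, (p x - (c + s)) * (φ x * ψ x) = ∑ j, ∑ i,
      ((∫ x, f i j x * pot (pd i (pd j fun y => φ y * ψ y)) x) -
      (∫ x in (Metric.closedBall x₀ (2 * R))ᶜ, f i j x * rieszK i j (x - x₀)) *
        ∫ y, φ y * ψ y) := by
    have i1 : Integrable fun x => (p x - c) * (φ x * ψ x) :=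
      hφψ.integrable_mul (hp.sub continuous_const)
    simp only [Finset.sum_sub_distrib, ← Finset.sum_mul, ← hs]
    rw [← hrep _ hφψ, ← integral_const_mul, ← integral_sub i1 (hφψ.integrable.const_mul s)]
    refine integral_congr_ae (Eventually.of_forall fun x => ?_)
    simp only
    ring
  rw [e]
  refine (Finset.abs_sum_le_sum_abs _ _).trans ?_
  calc _ ≤ ∑ j : Fin 3, ∑ i : Fin 3, C * (α + κ ^ 2 * R⁻¹) * β ^ 2 := by
        refine Finset.sum_le_sum fun j _ => (Finset.abs_sum_le_sum_abs _ _).trans ?_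
        exact Finset.sum_le_sum fun i _ => H i j (f i j) φ ψ x₀ R α κ β hR hα hκ hβ (hf i j)
          (hfi i j) hφ hψ (hfα i j) (hK i j) hψβ
    _ = _ := by
        simp only [Finset.sum_const, Finset.card_univ, Fintype.card_fin, nsmul_eq_mul]
        push_cast
        ring

end Duality

end NematicFlow

end

noncomputable section

namespace NematicFlow

/-! ### Sobolev inequality and interpolation for |v|^{3/2}φ -/

section Interpolation

open Real Set

theorem exists_sobolev : ∃ S : ℝ, 0 < S ∧ ∀ h : E3 → ℝ, ContDiff ℝ 1 h → HasCompactSupport h →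
    ∫ x, h x ^ 6 ≤ S * (∫ x, ‖gradient h x‖ ^ 2) ^ 3 := by
  set C : NNReal := SNormLESNormFDerivOfEqConst ℝ (volume : Measure E3) ((2 : NNReal) : ℝ) with hCdef
  refine ⟨(C : ℝ) ^ 6 + 1, by positivity, fun h hh hc => ?_⟩
  have h1 := eLpNorm_le_eLpNorm_fderiv_of_eq (volume : Measure E3) hh hc (p := 2) (p' := 6)
    (by norm_num) (by simp) (by simp; norm_num)
  rw [← hCdef] at h1
  have c6 : Continuous fun x => h x ^ 6 := hh.continuous.pow 6
  have hc6 : HasCompactSupport fun x => h x ^ 6 :=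
    hc.comp_left (g := fun y : ℝ => y ^ 6) (by simp)
  have i6 : Integrable fun x => h x ^ 6 := c6.integrable_of_hasCompactSupport hc6
  have c2 : Continuous fun x => ‖fderiv ℝ h x‖ ^ 2 := (hh.continuous_fderiv one_ne_zero).norm.pow 2
  have i2 : Integrable fun x => ‖fderiv ℝ h x‖ ^ 2 := c2.integrable_of_hasCompactSupport
    ((hc.fderiv ℝ).comp_left (g := fun L : E3 →L[ℝ] ℝ => ‖L‖ ^ 2) (by simp))
  have e6 : eLpNorm h (6 : NNReal) volume ^ 6 = ENNReal.ofReal (∫ x, h x ^ 6) := by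
    have h2 := eLpNorm_nnreal_pow_eq_lintegral (f := h) (μ := (volume : Measure E3)) (p := 6)
      (by norm_num)
    rw [ofReal_integral_eq_lintegral_ofReal i6 (Eventually.of_forall fun x => by positivity)]
    have e : ∀ x, ENNReal.ofReal (h x ^ 6) = ‖h x‖ₑ ^ ((6 : NNReal) : ℝ) := by
      intro x
      rw [← Even.pow_abs (by decide : Even 6), ENNReal.ofReal_pow (abs_nonneg _), ← norm_eq_abs,
        ofReal_norm, NNReal.coe_ofNat, ENNReal.rpow_ofNat]
    simp only [e]
    rw [← h2, NNReal.coe_ofNat, ENNReal.rpow_ofNat]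
  have e2 : eLpNorm (fderiv ℝ h) (2 : NNReal) volume ^ 2 =
      ENNReal.ofReal (∫ x, ‖fderiv ℝ h x‖ ^ 2) := by
    have h2 := eLpNorm_nnreal_pow_eq_lintegral (f := fderiv ℝ h) (μ := (volume : Measure E3))
      (p := 2) (by norm_num)
    rw [ofReal_integral_eq_lintegral_ofReal i2 (Eventually.of_forall fun x => by positivity)]
    have e : ∀ x, ENNReal.ofReal (‖fderiv ℝ h x‖ ^ 2) = ‖fderiv ℝ h x‖ₑ ^ ((2 : NNReal) : ℝ) := by
      intro x
      rw [ENNReal.ofReal_pow (norm_nonneg _), ofReal_norm, NNReal.coe_ofNat, ENNReal.rpow_ofNat]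
    simp only [e]
    rw [← h2, NNReal.coe_ofNat, ENNReal.rpow_ofNat]
  have hI2 : 0 ≤ ∫ x, ‖fderiv ℝ h x‖ ^ 2 := integral_nonneg fun x => by positivity
  have h3 : ENNReal.ofReal (∫ x, h x ^ 6) ≤
      ENNReal.ofReal ((C : ℝ) ^ 6 * (∫ x, ‖fderiv ℝ h x‖ ^ 2) ^ 3) := by
    rw [← e6, ENNReal.ofReal_mul (by positivity), ENNReal.ofReal_pow hI2, ← e2, ← pow_mul,
      ENNReal.ofReal_pow C.coe_nonneg, ENNReal.ofReal_coe_nnreal, ← mul_pow]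
    exact pow_le_pow_left₀ bot_le h1 6
  have h4 := (ENNReal.ofReal_le_ofReal_iff (by positivity)).1 h3
  simp only [norm_gradient_eq_norm_fderiv]
  refine h4.trans ?_
  gcongr
  linarith

theorem setIntegral_mul_le_Lp_mul_Lq {K : Set E3} (hK : IsCompact K) {f g : E3 → ℝ}
    (hf : Continuous f) (hg : Continuous g) (hf0 : ∀ x, 0 ≤ f x) (hg0 : ∀ x, 0 ≤ g x) {p q : ℝ}
    (hpq : p.HolderConjugate q) : ∫ x in K, f x * g x ≤
      (∫ x in K, f x ^ p) ^ (1 / p) * (∫ x in K, g x ^ q) ^ (1 / q) := by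
  have : IsFiniteMeasure (volume.restrict K) := ⟨by simpa using hK.measure_lt_top⟩
  have key : ∀ {f : E3 → ℝ}, Continuous f → ∀ r : ℝ≥0∞, MemLp f r (volume.restrict K) := by
    intro f hf r
    obtain ⟨C, hC⟩ := hK.exists_bound_of_continuousOn hf.continuousOn
    refine MemLp.of_bound hf.aestronglyMeasurable C ?_
    filter_upwards [ae_restrict_mem hK.measurableSet] with x hx using hC x hx
  exact integral_mul_le_Lp_mul_Lq_of_nonneg hpq (Eventually.of_forall hf0)
    (Eventually.of_forall hg0) (key hf _) (key hg _)

variable {F : Type*} [NormedAddCommGroup F] {v : E3 → F} {φ : E3 → ℝ}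
  {x₀ : E3} {R : ℝ}

/-- The truncated power `|v|^{3/2} φ`. -/
def cutPow (v : E3 → F) (φ : E3 → ℝ) (x : E3) : ℝ := ‖v x‖ ^ (3 / 2 : ℝ) * φ x

theorem rpow_three_halves_sq {a : ℝ} (ha : 0 ≤ a) : (a ^ (3 / 2 : ℝ)) ^ 2 = a ^ 3 := by
  rw [← rpow_natCast, ← rpow_mul ha, ← rpow_natCast]
  norm_num

theorem contDiff_cutPow [InnerProductSpace ℝ F] (hv : ContDiff ℝ 1 v) (hφ : ContDiff ℝ 1 φ) :
    ContDiff ℝ 1 (cutPow v φ) := (hv.norm_rpow (by norm_num)).mul hφ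

theorem cutPow_nonneg (hφ : ∀ x, 0 ≤ φ x) (x : E3) : 0 ≤ cutPow v φ x :=
  mul_nonneg (by positivity) (hφ x)

theorem cutPow_sq (x : E3) : cutPow v φ x ^ 2 = ‖v x‖ ^ 3 * φ x ^ 2 := by
  rw [cutPow, mul_pow, rpow_three_halves_sq (norm_nonneg _)]

theorem cutPow_eq_zero {x : E3} (hx : x ∉ tsupport φ) : cutPow v φ x = 0 := by
  rw [cutPow, image_eq_zero_of_notMem_tsupport hx, mul_zero]

theorem hasCompactSupport_cutPow (hφ : HasCompactSupport φ) : HasCompactSupport (cutPow v φ) :=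
  hφ.mul_left

/-- With A = |v|^{3/2}φ one has |v|⁶φ³ = |v|^{3/2}A³ and |v|⁵φ² = |v|²A². Hölder with exponents (2,
2) and (3/2, 3) leaves ∫ |v|³ over the support and ∫ A⁶, and Sobolev bounds the latter by the cube
of ∫ |∇A|². -/
theorem exists_interpolation : ∃ S : ℝ, 0 < S ∧ ∀ {F : Type} [NormedAddCommGroup F]
    [InnerProductSpace ℝ F] (v : E3 → F) (φ : E3 → ℝ), ContDiff ℝ 1 v → IsTest φ →
    (∀ x, 0 ≤ φ x) →
    (∫ x, ‖v x‖ ^ 6 * φ x ^ 3 ≤ S * (∫ x in tsupport φ, ‖v x‖ ^ 3) ^ (1 / 2 : ℝ) *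
      (∫ x, ‖gradient (cutPow v φ) x‖ ^ 2) ^ (3 / 2 : ℝ)) ∧
    (∫ x, ‖v x‖ ^ 5 * φ x ^ 2 ≤ S * (∫ x in tsupport φ, ‖v x‖ ^ 3) ^ (2 / 3 : ℝ) *
      ∫ x, ‖gradient (cutPow v φ) x‖ ^ 2) := by
  obtain ⟨S, hS, H⟩ := exists_sobolev
  refine ⟨S ^ (1 / 2 : ℝ) + S ^ (1 / 3 : ℝ), by positivity, fun {F} _ _ v φ hv hφ hφ0 => ?_⟩
  set K := tsupport φ with hK
  have hKc : IsCompact K := hφ.compact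
  set A := cutPow v φ with hA
  have hAc : ContDiff ℝ 1 A := contDiff_cutPow hv hφ.contDiff_one
  have hA0 : ∀ x, 0 ≤ A x := cutPow_nonneg hφ0
  have hG0 : 0 ≤ ∫ x, ‖gradient A x‖ ^ 2 := integral_nonneg fun x => by positivity
  set G := ∫ x, ‖gradient A x‖ ^ 2 with hG
  have hM0 : 0 ≤ ∫ x in K, ‖v x‖ ^ 3 := setIntegral_nonneg hKc.measurableSet fun x _ => by positivity
  set M := ∫ x in K, ‖v x‖ ^ 3 with hM
  have h6 : ∫ x in K, A x ^ 6 ≤ S * G ^ 3 := by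
    rw [setIntegral_eq_integral_of_forall_compl_eq_zero fun x hx => by
      rw [hA, cutPow_eq_zero hx]; norm_num]
    exact H A hAc (hasCompactSupport_cutPow hφ.compact)
  have h60 : 0 ≤ ∫ x in K, A x ^ 6 := setIntegral_nonneg hKc.measurableSet fun x _ => by positivity
  have hvc : Continuous fun x => ‖v x‖ := hv.continuous.norm
  constructor
  · have h := setIntegral_mul_le_Lp_mul_Lq hKc (f := fun x => ‖v x‖ ^ (3 / 2 : ℝ))
      (g := fun x => A x ^ 3) (hv.norm_rpow (by norm_num)).continuous (hAc.continuous.pow 3)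
      (fun x => by positivity) (fun x => pow_nonneg (hA0 x) 3) (p := 2) (q := 2)
      (Real.holderConjugate_iff.2 ⟨by norm_num, by norm_num⟩)
    have e1 : ∫ x in K, ‖v x‖ ^ (3 / 2 : ℝ) * A x ^ 3 = ∫ x, ‖v x‖ ^ 6 * φ x ^ 3 := by
      rw [setIntegral_eq_integral_of_forall_compl_eq_zero fun x hx => by
        rw [hA, cutPow_eq_zero hx]; ring]
      refine integral_congr_ae (Eventually.of_forall fun x => ?_)
      simp only [hA, cutPow]
      have e := rpow_three_halves_sq (norm_nonneg (v x))
      calc _ = ((‖v x‖ ^ (3 / 2 : ℝ)) ^ 2) ^ 2 * φ x ^ 3 := by ring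
        _ = _ := by rw [e]; ring
    have e2 : ∀ x, (‖v x‖ ^ (3 / 2 : ℝ)) ^ (2 : ℝ) = ‖v x‖ ^ 3 := fun x => by
      rw [rpow_two, rpow_three_halves_sq (norm_nonneg _)]
    have e3 : ∀ x, (A x ^ 3) ^ (2 : ℝ) = A x ^ 6 := fun x => by
      rw [rpow_two, ← pow_mul]
    simp only [e2, e3] at h
    rw [e1] at h
    refine h.trans ?_
    have h7 : (∫ x in K, A x ^ 6) ^ (1 / 2 : ℝ) ≤ S ^ (1 / 2 : ℝ) * G ^ (3 / 2 : ℝ) := by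
      refine (rpow_le_rpow h60 h6 (by norm_num)).trans (le_of_eq ?_)
      rw [mul_rpow hS.le (by positivity), ← rpow_natCast, ← rpow_mul hG0]
      norm_num
    calc _ ≤ M ^ (1 / 2 : ℝ) * (S ^ (1 / 2 : ℝ) * G ^ (3 / 2 : ℝ)) := by gcongr
      _ = S ^ (1 / 2 : ℝ) * M ^ (1 / 2 : ℝ) * G ^ (3 / 2 : ℝ) := by ring
      _ ≤ _ := by
        gcongr
        exact le_add_of_nonneg_right (by positivity)
  · have h := setIntegral_mul_le_Lp_mul_Lq hKc (f := fun x => ‖v x‖ ^ 2)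
      (g := fun x => A x ^ 2) (hvc.pow 2) (hAc.continuous.pow 2)
      (fun x => by positivity) (fun x => pow_nonneg (hA0 x) 2) (p := 3 / 2) (q := 3)
      (Real.holderConjugate_iff.2 ⟨by norm_num, by norm_num⟩)
    have e1 : ∫ x in K, ‖v x‖ ^ 2 * A x ^ 2 = ∫ x, ‖v x‖ ^ 5 * φ x ^ 2 := by
      rw [setIntegral_eq_integral_of_forall_compl_eq_zero fun x hx => by
        rw [hA, cutPow_eq_zero hx]; ring]
      refine integral_congr_ae (Eventually.of_forall fun x => ?_)
      simp only [hA, cutPow_sq]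
      ring
    have e2 : ∀ x, (‖v x‖ ^ 2) ^ (3 / 2 : ℝ) = ‖v x‖ ^ 3 := fun x => by
      rw [← rpow_natCast, ← rpow_mul (norm_nonneg _), ← rpow_natCast]
      norm_num
    have e3 : ∀ x, (A x ^ 2) ^ (3 : ℝ) = A x ^ 6 := fun x => by
      rw [show (3 : ℝ) = ((3 : ℕ) : ℝ) by norm_num, rpow_natCast, ← pow_mul]
    simp only [e2, e3] at h
    rw [e1, show (1 / (3 / 2) : ℝ) = 2 / 3 by norm_num] at h
    refine h.trans ?_
    have h7 : (∫ x in K, A x ^ 6) ^ (1 / 3 : ℝ) ≤ S ^ (1 / 3 : ℝ) * G := by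
      refine (rpow_le_rpow h60 h6 (by norm_num)).trans (le_of_eq ?_)
      rw [mul_rpow hS.le (by positivity), ← rpow_natCast G, ← rpow_mul hG0]
      norm_num
    calc _ ≤ M ^ (2 / 3 : ℝ) * (S ^ (1 / 3 : ℝ) * G) := by gcongr
      _ = S ^ (1 / 3 : ℝ) * M ^ (2 / 3 : ℝ) * G := by ring
      _ ≤ _ := by
        gcongr
        exact le_add_of_nonneg_left (by positivity)

end Interpolation

/-! ### From duality to the L³ norm of (P - c)φ -/

section PressureL3

open Real Set

/-- Test the dual estimate with ψ close to q|q|, where q = (p - c')φ: the pairing is at least ∫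
|q|³, while the L^{3/2} norm of ψ is comparable to ‖q‖₃². -/
theorem exists_pressure_cube_le : ∃ C : ℝ, 0 < C ∧ ∀ (f : Fin 3 → Fin 3 → E3 → ℝ) (p : E3 → ℝ)
    (c : ℝ) (φ : E3 → ℝ) (x₀ : E3) (R : ℝ), 0 < R → IsCutoff φ x₀ R → ContDiff ℝ ∞ p →
    (∀ i j, ContDiff ℝ ∞ (f i j)) → (∀ i j, Integrable (f i j)) →
    (∀ η, IsTest η → ∫ x, (p x - c) * η x = ∑ j, ∑ i, ∫ x, f i j x * pot (pd i (pd j η)) x) →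
    ∃ c' : ℝ, ∀ (α κ : ℝ), 0 < α → 0 < κ →
      (∀ i j, ∫ x, |f i j x * φ x| ^ 3 ≤ α ^ 3) →
      (∀ i j y, ∫⁻ x in Metric.ball y R, ENNReal.ofReal (√|f i j x| ^ 3) ≤
        ENNReal.ofReal (2 * κ ^ 3)) →
      (∫ x, |p x - c'| ^ 3 * φ x ^ 3) ^ (1 / 3 : ℝ) ≤ C * (α + κ ^ 2 * R⁻¹) := by
  obtain ⟨C, hC, H⟩ := exists_pressure_duality
  refine ⟨4 * C, by positivity, fun f p c φ x₀ R hR hφ hp hf hfi hrep => ?_⟩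
  obtain ⟨c', hc'⟩ := H f p c φ x₀ R hR hφ hp.continuous hf hfi hrep
  refine ⟨c', fun α κ hα hκ hfα hK => ?_⟩
  set q : E3 → ℝ := fun x => (p x - c') * φ x with hq
  have tq : IsTest q := hφ.isTest.mul_left (hp.sub contDiff_const)
  have eQ : ∫ x, |p x - c'| ^ 3 * φ x ^ 3 = ∫ x, |q x| ^ 3 := by
    refine integral_congr_ae (Eventually.of_forall fun x => ?_)
    simp only [hq, abs_mul, abs_of_nonneg (hφ.nonneg x), mul_pow]
  rw [eQ]
  set Q := ∫ x, |q x| ^ 3 with hQ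
  have hQ0 : 0 ≤ Q := integral_nonneg fun x => by positivity
  have hA0 : 0 < 4 * C * (α + κ ^ 2 * R⁻¹) := by positivity
  rcases hQ0.eq_or_lt with h0 | hpos
  · rw [← h0, zero_rpow (by norm_num)]
    exact hA0.le
  set Q' := ∫ x, √|q x| ^ 3 with hQ'
  have hQ'0 : 0 ≤ Q' := integral_nonneg fun x => by positivity
  set b := Q ^ (1 / 3 : ℝ) with hb
  have hb0 : 0 < b := by positivity
  have hb3 : b ^ 3 = Q := by
    rw [hb, ← rpow_natCast, ← rpow_mul hQ0]
    norm_num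
  -- The regularisation must be small relative to Q but need not tend to 0: with this δ the
  -- 3/2-power integral of ψ is at most 4Q ≤ (2b)³.
  obtain ⟨δ, hδ, hδQ⟩ : ∃ δ : ℝ, 0 < δ ∧ δ ^ 3 * Q' ≤ Q := by
    refine ⟨(Q / (Q' + 1)) ^ (1 / 3 : ℝ), by positivity, ?_⟩
    rw [← rpow_natCast, ← rpow_mul (by positivity)]
    norm_num
    rw [div_mul_eq_mul_div, div_le_iff₀ (by positivity)]
    nlinarith
  -- A smooth substitute for q|q|, larger in absolute value and of the same sign, so the pairing
  -- with q still dominates ∫ |q|³.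
  set ψ : E3 → ℝ := fun x => q x * √(q x ^ 2 + (δ ^ 2) ^ 2) with hψ
  have tψ : IsTest ψ := by
    refine tq.mul_right (ContDiff.sqrt ((tq.smooth.pow 2).add contDiff_const) fun x => ?_)
    positivity
  have pw1 : ∀ x, √|ψ x| ^ 3 ≤ 2 * (|q x| ^ 3 + δ ^ 3 * √|q x| ^ 3) := by
    intro x
    have h1 : |ψ x| ≤ |q x| ^ 2 + (δ * √|q x|) ^ 2 := by
      have h2 : √(q x ^ 2 + (δ ^ 2) ^ 2) ≤ |q x| + δ ^ 2 := by
        rw [sqrt_le_left (by positivity), ← sq_abs (q x)]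
        nlinarith [mul_nonneg (abs_nonneg (q x)) (sq_nonneg δ)]
      rw [hψ, abs_mul, abs_of_nonneg (sqrt_nonneg _), mul_pow δ, sq_sqrt (abs_nonneg _)]
      calc _ ≤ |q x| * (|q x| + δ ^ 2) := by gcongr
        _ = _ := by ring
    have := sqrt_cube_le (abs_nonneg (q x)) (by positivity) h1
    rwa [mul_pow] at this
  have hψβ : ∫ x, √|ψ x| ^ 3 ≤ (2 * b) ^ 3 := by
    have i1 := tq.integrable_abs_cube
    have i2 : Integrable fun x => δ ^ 3 * √|q x| ^ 3 := tq.integrable_sqrt_cube.const_mul _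
    have i3 : Integrable fun x => 2 * (|q x| ^ 3 + δ ^ 3 * √|q x| ^ 3) := (i1.add i2).const_mul _
    have := integral_mono tψ.integrable_sqrt_cube i3 pw1
    rw [integral_const_mul, integral_add i1 i2, integral_const_mul] at this
    refine this.trans ?_
    rw [mul_pow, hb3]
    linarith
  have h1 := hc' ψ α κ (2 * b) hα hκ (by positivity) tψ hfα hK hψβ
  have h2 : Q ≤ ∫ x, (p x - c') * (φ x * ψ x) := by
    have i1 : Integrable fun x => (p x - c') * (φ x * ψ x) :=
      (tψ.mul_left hφ.smooth).integrable_mul (hp.continuous.sub continuous_const)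
    refine integral_mono tq.integrable_abs_cube i1 fun x => ?_
    have e : (p x - c') * (φ x * ψ x) = |q x| ^ 2 * √(q x ^ 2 + (δ ^ 2) ^ 2) := by
      rw [sq_abs, hψ, hq]
      ring
    simp only
    rw [e, pow_succ]
    have : |q x| ≤ √(q x ^ 2 + (δ ^ 2) ^ 2) := by
      rw [← sqrt_sq_eq_abs]
      exact sqrt_le_sqrt (by nlinarith [sq_nonneg (δ ^ 2)])
    gcongr
  have h3 : b ^ 3 ≤ C * (α + κ ^ 2 * R⁻¹) * (2 * b) ^ 2 := by
    rw [hb3]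
    exact h2.trans ((le_abs_self _).trans h1)
  have h4 : b * b ^ 2 ≤ 4 * C * (α + κ ^ 2 * R⁻¹) * b ^ 2 := by linarith
  exact le_of_mul_le_mul_right h4 (by positivity)

end PressureL3

end NematicFlow

end

noncomputable section

namespace NematicFlow

/-! ### The local pressure estimate -/

section PressureEstimate

open Real Set

variable {T : EReal} {u d : ℝ → E3 → E3} {P : ℝ → E3 → ℝ} {v e : E3 → E3} {φ : E3 → ℝ}
  {x₀ : E3} {R : ℝ}

theorem integrable_gradient_cutPow {F : Type*} [NormedAddCommGroup F] [InnerProductSpace ℝ F]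
    {v : E3 → F} (hv : ContDiff ℝ 1 v) (hφ : IsTest φ) :
    Integrable fun x => ‖gradient (cutPow v φ) x‖ ^ 2 := by
  simp only [norm_gradient_eq_norm_fderiv]
  have hA := contDiff_cutPow hv hφ.contDiff_one
  have c2 : Continuous fun x => ‖fderiv ℝ (cutPow v φ) x‖ ^ 2 :=
    (hA.continuous_fderiv one_ne_zero).norm.pow 2
  exact c2.integrable_of_hasCompactSupport
    (((hasCompactSupport_cutPow hφ.compact).fderiv ℝ).comp_left
      (g := fun L : E3 →L[ℝ] ℝ => ‖L‖ ^ 2) (by simp))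

theorem dirichlet_eq (hv : ContDiff ℝ ∞ v) (he : ContDiff ℝ ∞ e) (hφ : IsTest φ) :
    dirichlet v e φ = (∫ x, ‖gradient (cutPow v φ) x‖ ^ 2) +
      ∫ x, ‖gradient (cutPow (grad e) φ) x‖ ^ 2 :=
  integral_add (integrable_gradient_cutPow (hv.of_le ENat.LEInfty.out) hφ)
    (integrable_gradient_cutPow ((contDiff_grad he).of_le ENat.LEInfty.out) hφ)

theorem continuous_density (hv : ContDiff ℝ ∞ v) (he : ContDiff ℝ ∞ e) :
    Continuous (density v e) :=
  (hv.continuous.norm.pow 3).add ((contDiff_grad he).continuous.norm.pow 3)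

theorem density_nonneg (v e : E3 → E3) (x : E3) : 0 ≤ density v e x := by
  unfold density; positivity

theorem setIntegral_le_density (hv : ContDiff ℝ ∞ v) (he : ContDiff ℝ ∞ e) {K : Set E3}
    (hK : IsCompact K) : ∫ x in K, ‖v x‖ ^ 3 ≤ ∫ x in K, density v e x ∧
      ∫ x in K, ‖grad e x‖ ^ 3 ≤ ∫ x in K, density v e x := by
  have c1 : Continuous fun x => ‖v x‖ ^ 3 := hv.continuous.norm.pow 3
  have c2 : Continuous fun x => ‖grad e x‖ ^ 3 := (contDiff_grad he).continuous.norm.pow 3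
  have i3 := (continuous_density hv he).continuousOn.integrableOn_compact (μ := volume) hK
  constructor
  · refine setIntegral_mono (c1.continuousOn.integrableOn_compact hK) i3 fun x => ?_
    exact le_add_of_nonneg_right (by positivity)
  · refine setIntegral_mono (c2.continuousOn.integrableOn_compact hK) i3 fun x => ?_
    exact le_add_of_nonneg_left (by positivity)

/-- The stress is quadratic, so its cube is controlled by the sixth powers of |v| and |∇e|;
interpolation is applied to each separately and the results are combined by monotonicity. -/
theorem exists_integral_stress_cube_le : ∃ S : ℝ, 0 < S ∧ ∀ (v e : E3 → E3) (φ : E3 → ℝ),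
    ContDiff ℝ ∞ v → ContDiff ℝ ∞ e → IsTest φ → (∀ x, 0 ≤ φ x) →
    (∀ i j, ∫ x, |stress v e i j x * φ x| ^ 3 ≤
      (S * (∫ x in tsupport φ, density v e x) ^ (1 / 6 : ℝ) * dirichlet v e φ ^ (1 / 2 : ℝ)) ^ 3) ∧
    (∫ x, (‖v x‖ ^ 5 + ‖grad e x‖ ^ 5) * φ x ^ 2 ≤
      S * (∫ x in tsupport φ, density v e x) ^ (2 / 3 : ℝ) * dirichlet v e φ) := by
  obtain ⟨S, hS, H⟩ := exists_interpolation
  refine ⟨2 * S ^ (1 / 3 : ℝ) + 2 * S, by positivity, fun v e φ hv he hφ hφ0 => ?_⟩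
  have hw := contDiff_grad he
  obtain ⟨a1, a2⟩ := H v φ (hv.of_le ENat.LEInfty.out) hφ hφ0
  obtain ⟨b1, b2⟩ := H (grad e) φ (hw.of_le ENat.LEInfty.out) hφ hφ0
  obtain ⟨m1, m2⟩ := setIntegral_le_density hv he hφ.compact
  have hG1 : 0 ≤ ∫ x, ‖gradient (cutPow v φ) x‖ ^ 2 := integral_nonneg fun x => by positivity
  have hG2 : 0 ≤ ∫ x, ‖gradient (cutPow (grad e) φ) x‖ ^ 2 :=
    integral_nonneg fun x => by positivity
  have hms : MeasurableSet (tsupport φ) := (isClosed_tsupport φ).measurableSet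
  have hM1 : 0 ≤ ∫ x in tsupport φ, ‖v x‖ ^ 3 := setIntegral_nonneg hms fun x _ => by positivity
  have hM2 : 0 ≤ ∫ x in tsupport φ, ‖grad e x‖ ^ 3 :=
    setIntegral_nonneg hms fun x _ => by positivity
  rw [dirichlet_eq hv he hφ]
  set G1 := ∫ x, ‖gradient (cutPow v φ) x‖ ^ 2
  set G2 := ∫ x, ‖gradient (cutPow (grad e) φ) x‖ ^ 2
  set M1 := ∫ x in tsupport φ, ‖v x‖ ^ 3
  set M2 := ∫ x in tsupport φ, ‖grad e x‖ ^ 3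
  set m := ∫ x in tsupport φ, density v e x
  have hm : 0 ≤ m := hM1.trans m1
  have itest : ∀ {g : E3 → ℝ}, Continuous g → ∀ n : ℕ, n ≠ 0 →
      Integrable fun x => g x * φ x ^ n := by
    intro g hg n hn
    have hc : Continuous fun x => g x * φ x ^ n := hg.mul (hφ.continuous.pow n)
    exact hc.integrable_of_hasCompactSupport
      ((hφ.compact.comp_left (g := fun y : ℝ => y ^ n) (by simp [hn])).mul_left)
  constructor
  · intro i j
    have i1 : Integrable fun x => ‖v x‖ ^ 6 * φ x ^ 3 :=
      itest (hv.continuous.norm.pow 6) 3 (by norm_num)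
    have i2 : Integrable fun x => ‖grad e x‖ ^ 6 * φ x ^ 3 :=
      itest (hw.continuous.norm.pow 6) 3 (by norm_num)
    have i3 : Integrable fun x => 4 * (‖v x‖ ^ 6 * φ x ^ 3 + ‖grad e x‖ ^ 6 * φ x ^ 3) :=
      (i1.add i2).const_mul 4
    have h1 : ∫ x, |stress v e i j x * φ x| ^ 3 ≤
        ∫ x, 4 * (‖v x‖ ^ 6 * φ x ^ 3 + ‖grad e x‖ ^ 6 * φ x ^ 3) := by
      refine integral_mono (hφ.mul_left (contDiff_stress hv he i j)).integrable_abs_cube i3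
        fun x => ?_
      simp only [abs_mul, abs_of_nonneg (hφ0 x), mul_pow]
      have h2 : |stress v e i j x| ^ 3 ≤ (‖v x‖ ^ 2 + ‖grad e x‖ ^ 2) ^ 3 :=
        pow_le_pow_left₀ (abs_nonneg _) (abs_stress_le v e i j x) 3
      have h3 : (‖v x‖ ^ 2 + ‖grad e x‖ ^ 2) ^ 3 ≤ 4 * (‖v x‖ ^ 6 + ‖grad e x‖ ^ 6) := by
        have hp : 0 ≤ ‖v x‖ ^ 2 := sq_nonneg _
        have hq : 0 ≤ ‖grad e x‖ ^ 2 := sq_nonneg _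
        nlinarith [mul_nonneg (add_nonneg hp hq) (sq_nonneg (‖v x‖ ^ 2 - ‖grad e x‖ ^ 2))]
      calc _ ≤ 4 * (‖v x‖ ^ 6 + ‖grad e x‖ ^ 6) * φ x ^ 3 :=
            mul_le_mul_of_nonneg_right (h2.trans h3) (pow_nonneg (hφ0 x) 3)
        _ = _ := by ring
    refine h1.trans ?_
    rw [integral_const_mul, integral_add i1 i2]
    have hx : S * M1 ^ (1 / 2 : ℝ) * G1 ^ (3 / 2 : ℝ) ≤
        S * m ^ (1 / 2 : ℝ) * (G1 + G2) ^ (3 / 2 : ℝ) := by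
      gcongr
      linarith
    have hy : S * M2 ^ (1 / 2 : ℝ) * G2 ^ (3 / 2 : ℝ) ≤
        S * m ^ (1 / 2 : ℝ) * (G1 + G2) ^ (3 / 2 : ℝ) := by
      gcongr
      linarith
    have e1 : (2 * S ^ (1 / 3 : ℝ) * m ^ (1 / 6 : ℝ) * (G1 + G2) ^ (1 / 2 : ℝ)) ^ 3 =
        8 * (S * m ^ (1 / 2 : ℝ) * (G1 + G2) ^ (3 / 2 : ℝ)) := by
      rw [mul_pow, mul_pow, mul_pow, ← rpow_natCast (S ^ (1 / 3 : ℝ)), ← rpow_mul hS.le,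
        ← rpow_natCast (m ^ (1 / 6 : ℝ)), ← rpow_mul hm,
        ← rpow_natCast ((G1 + G2) ^ (1 / 2 : ℝ)), ← rpow_mul (by positivity)]
      norm_num
      ring
    calc _ ≤ 8 * (S * m ^ (1 / 2 : ℝ) * (G1 + G2) ^ (3 / 2 : ℝ)) := by linarith
      _ = _ := e1.symm
      _ ≤ _ := by
        gcongr
        linarith
  · have i1 : Integrable fun x => ‖v x‖ ^ 5 * φ x ^ 2 :=
      itest (hv.continuous.norm.pow 5) 2 (by norm_num)
    have i2 : Integrable fun x => ‖grad e x‖ ^ 5 * φ x ^ 2 :=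
      itest (hw.continuous.norm.pow 5) 2 (by norm_num)
    simp only [add_mul]
    rw [integral_add i1 i2]
    have hx : S * M1 ^ (2 / 3 : ℝ) * G1 ≤ S * m ^ (2 / 3 : ℝ) * (G1 + G2) := by
      gcongr
      linarith
    have hy : S * M2 ^ (2 / 3 : ℝ) * G2 ≤ S * m ^ (2 / 3 : ℝ) * (G1 + G2) := by
      gcongr
      linarith
    have h0 : 0 ≤ 2 * S ^ (1 / 3 : ℝ) * m ^ (2 / 3 : ℝ) * (G1 + G2) := by positivity
    linarith

/-- The local pressure estimate, when the uniform local energy is finite. -/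
theorem exists_pressure_estimate : ∃ C : ℝ, 0 < C ∧ ∀ (T : EReal) (u : ℝ → E3 → E3)
    (P : ℝ → E3 → ℝ) (d : ℝ → E3 → E3), IsSmoothSolution T u P d →
    ∀ (φ : E3 → ℝ) (x₀ : E3) (R : ℝ), 0 < R → IsCutoff φ x₀ R → ∀ t ∈ times T,
    ulocEnergy (u t) (d t) R ≠ ⊤ → ∃ c : ℝ,
      (∫ x, |P t x - c| ^ 3 * φ x ^ 3) ^ (1 / 3 : ℝ) ≤
        C * (∫ x in tsupport φ, density (u t) (d t) x) ^ (1 / 6 : ℝ)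
          * dirichlet (u t) (d t) φ ^ (1 / 2 : ℝ)
        + C * R⁻¹ * (ulocEnergy (u t) (d t) R).toReal ^ (2 / 3 : ℝ) := by
  obtain ⟨C, hC, H⟩ := exists_pressure_cube_le
  obtain ⟨S, hS, HS⟩ := exists_integral_stress_cube_le
  refine ⟨C * S + C, by positivity, fun T u P d Sol φ x₀ R hR hφ t ht hfin => ?_⟩
  have hu : ContDiff ℝ ∞ (u t) := Sol.smoothIn_u.slice ht
  have hd : ContDiff ℝ ∞ (d t) := Sol.smoothIn_d.slice ht
  obtain ⟨c₀, hc₀⟩ := Sol.exists_pressure_eq ht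
  obtain ⟨c, hc⟩ := H (stress (u t) (d t)) (P t) c₀ φ x₀ R hR hφ (Sol.contDiff_P ht)
    (contDiff_stress hu hd) (Sol.integrable_stress ht) hc₀
  refine ⟨c, ?_⟩
  obtain ⟨hst, -⟩ := HS (u t) (d t) φ hu hd hφ.isTest hφ.nonneg
  have hm : 0 ≤ ∫ x in tsupport φ, density (u t) (d t) x :=
    setIntegral_nonneg (isClosed_tsupport φ).measurableSet fun x _ => density_nonneg _ _ x
  have hD : 0 ≤ dirichlet (u t) (d t) φ := integral_nonneg fun x => by positivity
  set m := ∫ x in tsupport φ, density (u t) (d t) x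
  set D := dirichlet (u t) (d t) φ
  set K := (ulocEnergy (u t) (d t) R).toReal with hK
  have hK0 : 0 ≤ K := ENNReal.toReal_nonneg
  set α := S * m ^ (1 / 6 : ℝ) * D ^ (1 / 2 : ℝ) with hα
  have hα0 : 0 ≤ α := by positivity
  set κ := K ^ (1 / 3 : ℝ) with hκ
  have hκ0 : 0 ≤ κ := by positivity
  have hκ3 : κ ^ 3 = K := by
    rw [hκ, ← rpow_natCast, ← rpow_mul hK0]
    norm_num
  have hκ2 : κ ^ 2 = K ^ (2 / 3 : ℝ) := by
    rw [hκ, ← rpow_natCast, ← rpow_mul hK0]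
    norm_num
  -- The dual estimate needs positive α and κ, which may vanish here. Since c does not depend on
  -- them, one may perturb by ε and let ε → 0.
  have key : ∀ ε : ℝ, 0 < ε → (∫ x, |P t x - c| ^ 3 * φ x ^ 3) ^ (1 / 3 : ℝ) ≤
      C * ((α + ε) + (κ + ε) ^ 2 * R⁻¹) := by
    intro ε hε
    refine hc (α + ε) (κ + ε) (by positivity) (by positivity) (fun i j => ?_) (fun i j y => ?_)
    · refine (hst i j).trans ?_
      gcongr
      linarith
    · have h1 : ∫⁻ x in Metric.ball y R, ENNReal.ofReal (√|stress (u t) (d t) i j x| ^ 3) ≤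
          ∫⁻ x in Metric.ball y R, 2 * ENNReal.ofReal (density (u t) (d t) x) := by
        refine lintegral_mono fun x => ?_
        rw [show (2 : ℝ≥0∞) = ENNReal.ofReal 2 by simp, ← ENNReal.ofReal_mul (by norm_num)]
        exact ENNReal.ofReal_le_ofReal (sqrt_cube_le (norm_nonneg _) (norm_nonneg _)
          (abs_stress_le _ _ i j x))
      have mden : Measurable fun x => ENNReal.ofReal (density (u t) (d t) x) :=
        (continuous_density hu hd).measurable.ennreal_ofReal
      have h2 : ∫⁻ x in Metric.ball y R, ENNReal.ofReal (density (u t) (d t) x) ≤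
          ENNReal.ofReal K := by
        rw [hK, ENNReal.ofReal_toReal hfin]
        exact le_iSup (fun y => ∫⁻ x in Metric.ball y R,
          ENNReal.ofReal (density (u t) (d t) x)) y
      refine h1.trans ?_
      rw [lintegral_const_mul _ mden, ENNReal.ofReal_mul (by norm_num),
        ENNReal.ofReal_ofNat]
      refine mul_le_mul_right (h2.trans (ENNReal.ofReal_le_ofReal ?_)) _
      rw [← hκ3]
      gcongr
      linarith
  have hlim : Tendsto (fun ε : ℝ => C * ((α + ε) + (κ + ε) ^ 2 * R⁻¹)) (𝓝[>] 0)
      (𝓝 (C * (α + κ ^ 2 * R⁻¹))) := by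
    have hcont : Continuous fun ε : ℝ => C * ((α + ε) + (κ + ε) ^ 2 * R⁻¹) := by fun_prop
    have := (hcont.tendsto 0).mono_left (nhdsWithin_le_nhds (s := Ioi 0))
    simpa using this
  have h3 : (∫ x, |P t x - c| ^ 3 * φ x ^ 3) ^ (1 / 3 : ℝ) ≤ C * (α + κ ^ 2 * R⁻¹) := by
    refine ge_of_tendsto hlim ?_
    filter_upwards [self_mem_nhdsWithin] with ε hε using key ε hε
  refine h3.trans ?_
  rw [hκ2, hα]
  have p1 : 0 ≤ C * (m ^ (1 / 6 : ℝ) * D ^ (1 / 2 : ℝ)) := by positivity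
  have p2 : 0 ≤ C * S * R⁻¹ * K ^ (2 / 3 : ℝ) := by positivity
  nlinarith

end PressureEstimate

end NematicFlow

end

noncomputable section

namespace NematicFlow

/-! ### Differentiability of |x|x and |x|³ -/

section NormSmul

variable {F : Type*} [NormedAddCommGroup F] [InnerProductSpace ℝ F]

/-- The derivative of `x ↦ |x| x`. -/
def normSmulDeriv (x : F) : F →L[ℝ] F :=
  ‖x‖ • ContinuousLinearMap.id ℝ F + (‖x‖⁻¹ • innerSL ℝ x).smulRight x

theorem normSmulDeriv_apply (x y : F) :
    normSmulDeriv x y = ‖x‖ • y + (‖x‖⁻¹ * inner ℝ x y) • x := by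
  simp [normSmulDeriv]

theorem abs_inv_norm_mul_inner_le (x y : F) : |‖x‖⁻¹ * inner ℝ x y| ≤ ‖y‖ := by
  rw [abs_mul, abs_inv, abs_norm]
  rcases (norm_nonneg x).eq_or_lt with h | h
  · simp [← h]
  · rw [inv_mul_le_iff₀ h]
    exact abs_real_inner_le_norm x y

theorem norm_mul_inv_norm_mul_inner (x y : F) : ‖x‖ * (‖x‖⁻¹ * inner ℝ x y) = inner ℝ x y := by
  rcases (norm_nonneg x).eq_or_lt with h | h
  · rw [norm_eq_zero.1 h.symm]
    simp
  · rw [mul_inv_cancel_left₀ h.ne']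

theorem norm_normSmulDeriv_le (x : F) : ‖normSmulDeriv x‖ ≤ 2 * ‖x‖ := by
  refine ContinuousLinearMap.opNorm_le_bound _ (by positivity) fun y => ?_
  rw [normSmulDeriv_apply]
  refine (norm_add_le _ _).trans ?_
  rw [norm_smul, norm_smul, norm_norm, Real.norm_eq_abs]
  have := mul_le_mul_of_nonneg_right (abs_inv_norm_mul_inner_le x y) (norm_nonneg x)
  linarith

/-- At the origin the map is quadratically small, so its derivative is 0. This is why testing with
|v|v needs no regularisation at zeros of v. -/
theorem hasFDerivAt_norm_smul (x : F) :
    HasFDerivAt (fun y : F => ‖y‖ • y) (normSmulDeriv x) x := by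
  rcases eq_or_ne x 0 with rfl | hx
  · have h0 : normSmulDeriv (0 : F) = 0 := by
      ext y
      simp [normSmulDeriv_apply]
    rw [h0, hasFDerivAt_iff_isLittleO_nhds_zero]
    simp only [zero_add, norm_zero, smul_zero, sub_zero, zero_apply]
    refine Asymptotics.isLittleO_iff.2 fun c hc => ?_
    filter_upwards [Metric.ball_mem_nhds (0 : F) hc] with y hy
    rw [norm_smul, norm_norm]
    rw [mem_ball_zero_iff] at hy
    gcongr
  · have h1 : HasFDerivAt (fun y : F => ‖y‖) (‖x‖⁻¹ • innerSL ℝ x) x := by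
      have h2 := ((hasStrictFDerivAt_norm_sq x).hasFDerivAt).sqrt
        (by simpa using hx)
      simp only [Real.sqrt_sq (norm_nonneg _)] at h2
      refine h2.congr_fderiv ?_
      ext y
      simp
      ring
    have h3 := h1.smul (hasFDerivAt_id x)
    exact h3

theorem continuous_normSmulDeriv : Continuous (normSmulDeriv : F → F →L[ℝ] F) := by
  refine continuous_iff_continuousAt.2 fun x => ?_
  rcases eq_or_ne x 0 with rfl | hx
  · have h0 : normSmulDeriv (0 : F) = 0 := by
      ext y
      simp [normSmulDeriv_apply]
    rw [ContinuousAt, h0]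
    refine squeeze_zero_norm norm_normSmulDeriv_le ?_
    have : Continuous fun x : F => 2 * ‖x‖ := by fun_prop
    simpa using this.tendsto 0
  · have hx' : ‖x‖ ≠ 0 := norm_ne_zero_iff.2 hx
    have h1 : ContinuousAt (fun x : F => ‖x‖⁻¹ • innerSL ℝ x) x :=
      (continuousAt_id.norm.inv₀ hx').smul (innerSL ℝ : F →L[ℝ] F →L[ℝ] ℝ).continuous.continuousAt
    have h2 : ContinuousAt (fun x : F => (‖x‖⁻¹ • innerSL ℝ x).smulRight x) x := by
      have := ((ContinuousLinearMap.smulRightL ℝ F F).continuous.continuousAt.comp h1).clm_apply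
        (continuousAt_id (x := x))
      exact this
    exact (continuousAt_id.norm.smul continuousAt_const).add h2

theorem contDiff_norm_smul : ContDiff ℝ 1 fun y : F => ‖y‖ • y :=
  contDiff_one_iff_hasFDerivAt.2 ⟨_, continuous_normSmulDeriv, hasFDerivAt_norm_smul⟩

theorem hasFDerivAt_norm_cube (x : F) :
    HasFDerivAt (fun y : F => ‖y‖ ^ 3) ((3 * ‖x‖) • innerSL ℝ x) x := by
  have h := hasFDerivAt_norm_rpow x (p := 3) (by norm_num)
  have e : ((3 : ℝ) - 2) = 1 := by norm_num
  rw [e, Real.rpow_one] at h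
  refine h.congr_of_eventuallyEq (Eventually.of_forall fun y => ?_)
  exact (Real.rpow_ofNat _ _).symm

end NormSmul

/-! ### The test field φ²|v|v and its coercivity -/

section CutField

variable {F : Type*} [NormedAddCommGroup F] [InnerProductSpace ℝ F] {v : E3 → F} {φ : E3 → ℝ}

theorem integral_pd_eq_zero {f : E3 → ℝ} (hf : ContDiff ℝ 1 f) (hc : HasCompactSupport f)
    (i : Fin 3) : ∫ x, pd i f x = 0 := by
  have := integral_mul_pd hf (g := fun _ => 1) contDiff_const hc i
  simpa [pd] using this

theorem pd_smul {f : E3 → ℝ} {g : E3 → F} {x : E3} (hf : DifferentiableAt ℝ f x)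
    (hg : DifferentiableAt ℝ g x) (i : Fin 3) :
    pd i (fun y => f y • g y) x = f x • pd i g x + pd i f x • g x := by
  unfold pd
  rw [fderiv_fun_smul hf hg]
  simp

theorem pd_inner {f g : E3 → F} {x : E3} (hf : DifferentiableAt ℝ f x)
    (hg : DifferentiableAt ℝ g x) (i : Fin 3) :
    pd i (fun y => inner ℝ (f y) (g y)) x = inner ℝ (pd i f x) (g x) + inner ℝ (f x) (pd i g x) := by
  unfold pd
  rw [fderiv_inner_apply ℝ hf hg]
  ring

/-- The field `φ² |v| v`. -/
def cutField (v : E3 → F) (φ : E3 → ℝ) (x : E3) : F := φ x ^ 2 • ‖v x‖ • v x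

theorem contDiff_cutField (hv : ContDiff ℝ 1 v) (hφ : ContDiff ℝ 1 φ) :
    ContDiff ℝ 1 (cutField v φ) :=
  (hφ.pow 2).smul (contDiff_norm_smul.comp hv)

theorem pd_cutField (hv : ContDiff ℝ 1 v) (hφ : ContDiff ℝ 1 φ) (i : Fin 3) (x : E3) :
    pd i (cutField v φ) x = φ x ^ 2 • normSmulDeriv (v x) (pd i v x) +
      (2 * φ x * pd i φ x) • ‖v x‖ • v x := by
  have h1 := hv.differentiable one_ne_zero x
  have h2 := hφ.differentiable one_ne_zero x
  have h3 : HasFDerivAt (fun y => ‖v y‖ • v y) _ x :=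
    (hasFDerivAt_norm_smul (v x)).comp x h1.hasFDerivAt
  have e1 : pd i (fun y => ‖v y‖ • v y) x = normSmulDeriv (v x) (pd i v x) := by
    rw [pd, h3.fderiv]
    rfl
  have e2 : pd i (fun y => φ y ^ 2) x = 2 * φ x * pd i φ x := by
    simp only [sq]
    rw [pd_mul h2 h2]
    ring
  have h4 : DifferentiableAt ℝ (fun y => φ y ^ 2) x := h2.pow 2
  have := pd_smul h4 h3.differentiableAt i
  rw [e1] at this
  exact this.trans (by rw [e2])

theorem norm_pd_cutField_le (hv : ContDiff ℝ 1 v) (hφ : ContDiff ℝ 1 φ) (hφ0 : ∀ x, 0 ≤ φ x)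
    (i : Fin 3) (x : E3) : ‖pd i (cutField v φ) x‖ ≤
      2 * ‖v x‖ * ‖pd i v x‖ * φ x ^ 2 + 2 * ‖v x‖ ^ 2 * |pd i φ x| * φ x := by
  rw [pd_cutField hv hφ]
  refine (norm_add_le _ _).trans ?_
  have h1 := (normSmulDeriv (v x)).le_of_opNorm_le (norm_normSmulDeriv_le (v x)) (pd i v x)
  have h2 := mul_le_mul_of_nonneg_left h1 (sq_nonneg (φ x))
  have e : |2 * φ x * pd i φ x| = 2 * φ x * |pd i φ x| := by
    rw [abs_mul, abs_of_nonneg (mul_nonneg zero_le_two (hφ0 x))]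
  simp only [norm_smul, Real.norm_eq_abs, abs_norm, abs_of_nonneg (sq_nonneg (φ x)), e]
  nlinarith

theorem pd_cutPow (hv : ContDiff ℝ 1 v) (hφ : ContDiff ℝ 1 φ) (i : Fin 3) (x : E3) :
    pd i (cutPow v φ) x = ‖v x‖ ^ (1 / 2 : ℝ) *
      (3 / 2 * (‖v x‖⁻¹ * inner ℝ (v x) (pd i v x)) * φ x + ‖v x‖ * pd i φ x) := by
  have h1 := hv.differentiable one_ne_zero x
  have h2 := hφ.differentiable one_ne_zero x
  have h3 : HasFDerivAt (fun y => ‖v y‖ ^ (3 / 2 : ℝ)) _ x :=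
    (hasFDerivAt_norm_rpow (v x) (by norm_num)).comp x h1.hasFDerivAt
  have e1 : pd i (fun y => ‖v y‖ ^ (3 / 2 : ℝ)) x =
      3 / 2 * ‖v x‖ ^ (3 / 2 - 2 : ℝ) * inner ℝ (v x) (pd i v x) := by
    rw [pd, h3.fderiv]
    rfl
  have := pd_mul h3.differentiableAt h2 i
  rw [e1] at this
  refine Eq.trans this ?_
  -- At a zero of v both sides vanish, with the convention that 0⁻¹ = 0.
  rcases (norm_nonneg (v x)).eq_or_lt with h | h
  · rw [norm_eq_zero.1 h.symm]
    norm_num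
  · have e2 : ‖v x‖ ^ (3 / 2 - 2 : ℝ) = ‖v x‖ ^ (1 / 2 : ℝ) * ‖v x‖⁻¹ := by
      rw [← Real.rpow_neg_one, ← Real.rpow_add h]
      norm_num
    have e3 : ‖v x‖ ^ (3 / 2 : ℝ) = ‖v x‖ ^ (1 / 2 : ℝ) * ‖v x‖ := by
      conv_rhs => rw [← Real.rpow_one ‖v x‖, ← Real.rpow_mul h.le, one_mul, ← Real.rpow_add h]
      norm_num
    rw [e2, e3]
    ring

/-- The pointwise coercivity behind the energy inequality for `|v|³`. -/
theorem norm_gradient_cutPow_sq_le (hv : ContDiff ℝ 1 v) (hφ : ContDiff ℝ 1 φ) (x : E3) :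
    ‖gradient (cutPow v φ) x‖ ^ 2 + 3 * (‖v x‖ * (∑ i, ‖pd i v x‖ ^ 2) * φ x ^ 2) ≤
      3 * (∑ i, inner ℝ (pd i (cutField v φ) x) (pd i v x)) +
        4 * (‖v x‖ ^ 3 * ‖gradient φ x‖ ^ 2) := by
  rw [norm_gradient_sq, norm_gradient_sq]
  simp only [Finset.mul_sum, Finset.sum_mul, ← Finset.sum_add_distrib]
  refine Finset.sum_le_sum fun i _ => ?_
  rw [pd_cutPow hv hφ, pd_cutField hv hφ, normSmulDeriv_apply, mul_pow]
  have e1 : (‖v x‖ ^ (1 / 2 : ℝ)) ^ 2 = ‖v x‖ := by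
    rw [← Real.rpow_natCast, ← Real.rpow_mul (norm_nonneg _)]
    norm_num
  rw [e1]
  simp only [inner_add_left, inner_smul_left, real_inner_self_eq_norm_sq, conj_trivial, smul_add,
    smul_smul]
  have e2 := norm_mul_inv_norm_mul_inner (v x) (pd i v x)
  set k := ‖v x‖⁻¹ * inner ℝ (v x) (pd i v x)
  rw [← e2]
  have hr := norm_nonneg (v x)
  -- The difference of the two sides is exactly 3‖v‖(‖v‖∂ᵢφ + kφ/2)².
  nlinarith [mul_nonneg hr (sq_nonneg (‖v x‖ * pd i φ x + k * φ x / 2))]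

end CutField

end NematicFlow

end

noncomputable section

namespace NematicFlow

/-! ### The gradient of the director as a matrix field -/

section Gradient

variable {v e f g : E3 → E3} {x : E3}

/-- The `i`-th row of a matrix. -/
def row (i : Fin 3) : EuclideanSpace ℝ (Fin 3 × Fin 3) →L[ℝ] E3 :=
  LinearMap.toContinuousLinearMap
    { toFun := fun w => WithLp.toLp 2 fun j => w (i, j)
      map_add' := fun _ _ => rfl
      map_smul' := fun _ _ => rfl }

theorem row_apply (i j : Fin 3) (w : EuclideanSpace ℝ (Fin 3 × Fin 3)) : row i w j = w (i, j) :=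
  rfl

theorem row_grad (i : Fin 3) : row i (grad e x) = pd i e x := rfl

theorem inner_eq_sum_row (w z : EuclideanSpace ℝ (Fin 3 × Fin 3)) :
    inner ℝ w z = ∑ i, inner ℝ (row i w) (row i z) := by
  simp [PiLp.inner_apply, Fintype.sum_prod_type, row_apply]

theorem norm_row_le (i : Fin 3) (w : EuclideanSpace ℝ (Fin 3 × Fin 3)) : ‖row i w‖ ≤ ‖w‖ := by
  refine le_of_sq_le_sq ?_ (norm_nonneg _)
  rw [← real_inner_self_eq_norm_sq w, inner_eq_sum_row]
  simp only [real_inner_self_eq_norm_sq]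
  exact Finset.single_le_sum (f := fun k => ‖row k w‖ ^ 2) (fun _ _ => sq_nonneg _)
    (Finset.mem_univ i)

theorem row_ext {w z : EuclideanSpace ℝ (Fin 3 × Fin 3)} (h : ∀ i, row i w = row i z) : w = z := by
  ext ij
  exact congrArg (fun y : E3 => y ij.2) (h ij.1)

theorem norm_pd_le_norm_grad (i : Fin 3) : ‖pd i e x‖ ≤ ‖grad e x‖ := norm_row_le i (grad e x)

theorem row_pd_grad (he : ContDiff ℝ ∞ e) (i j : Fin 3) :
    row j (pd i (grad e) x) = pd i (pd j e) x :=
  (pd_clm_comp (row j) ((contDiff_grad he).differentiable (by simp) x) i).symm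

theorem grad_add (hf : DifferentiableAt ℝ f x) (hg : DifferentiableAt ℝ g x) :
    grad (fun y => f y + g y) x = grad f x + grad g x :=
  row_ext fun i => by rw [map_add, row_grad, row_grad, row_grad, pd_add hf hg]

theorem grad_sub (hf : DifferentiableAt ℝ f x) (hg : DifferentiableAt ℝ g x) :
    grad (fun y => f y - g y) x = grad f x - grad g x :=
  row_ext fun i => by rw [map_sub, row_grad, row_grad, row_grad, pd_sub hf hg]

theorem grad_sum_pd_pd (he : ContDiff ℝ ∞ e) :
    grad (fun y => ∑ i, pd i (pd i e) y) x = ∑ i, pd i (pd i (grad e)) x := by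
  refine row_ext fun j => ?_
  rw [map_sum, row_grad, pd_sum _ fun i => (contDiff_pd (contDiff_pd he i) i).differentiable
    (by simp) x]
  refine Finset.sum_congr rfl fun i _ => ?_
  have h := pd_clm_comp (row j) ((contDiff_pd (contDiff_grad he) i).differentiable (by simp) x) i
  rw [← h]
  simp only [row_pd_grad he]
  rw [pd_comm (contDiff_pd he i)]
  have : pd j (pd i e) = pd i (pd j e) := funext fun y => pd_comm he j i y
  rw [this]

/-- Differentiating |e|² = 1 gives ⟨∂ᵢe, e⟩ = 0, so the derivative of the scalar factor contributes
nothing and no second derivative of e appears. -/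
theorem inner_grad_smul_self (he : ContDiff ℝ ∞ e) (hunit : ∀ y, ‖e y‖ = 1) :
    inner ℝ (grad e x) (grad (fun y => ‖grad e y‖ ^ 2 • e y) x) = ‖grad e x‖ ^ 4 := by
  have hd := he.differentiable (by simp) x
  have hn : DifferentiableAt ℝ (fun y => ‖grad e y‖ ^ 2) x :=
    ((contDiff_grad he).norm_sq ℝ).differentiable (by simp) x
  have h0 : ∀ i, inner ℝ (pd i e x) (e x) = 0 := by
    intro i
    have h1 := pd_inner hd hd i
    have h2 : (fun y => inner ℝ (e y) (e y)) = fun _ => (1 : ℝ) := by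
      funext y
      rw [real_inner_self_eq_norm_sq, hunit]
      norm_num
    rw [h2, real_inner_comm (pd i e x) (e x)] at h1
    have h3 : pd i (fun _ : E3 => (1 : ℝ)) x = 0 := by simp [pd]
    linarith
  rw [inner_eq_sum_row]
  simp only [row_grad, pd_smul hn hd, inner_add_right, inner_smul_right, h0,
    real_inner_self_eq_norm_sq]
  simp only [mul_zero, add_zero, ← Finset.mul_sum, ← norm_grad_sq]
  ring

theorem norm_fderiv_apply_le (x y : E3) :
    ‖fderiv ℝ e x y‖ ≤ ‖y‖ * ∑ i, ‖pd i e x‖ := by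
  rw [fderiv_eq_sum_pd, Finset.mul_sum]
  refine (norm_sum_le _ _).trans (Finset.sum_le_sum fun i _ => ?_)
  rw [norm_smul]
  exact mul_le_mul_of_nonneg_right (PiLp.norm_apply_le y i) (norm_nonneg _)

theorem abs_apply_le_norm (y : E3) (i : Fin 3) : |y i| ≤ ‖y‖ := PiLp.norm_apply_le y i

theorem norm_le_sum_abs (y : E3) : ‖y‖ ≤ ∑ i, |y i| := by
  refine le_of_sq_le_sq ?_ (Finset.sum_nonneg fun _ _ => abs_nonneg _)
  rw [EuclideanSpace.norm_sq_eq]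
  exact Finset.sum_sq_le_sq_sum_of_nonneg fun i _ => abs_nonneg _

theorem norm_divOdot_le (he : ContDiff ℝ ∞ e) (x : E3) :
    ‖divOdot e x‖ ≤ 6 * (‖grad e x‖ * ∑ j, ‖pd j (grad e) x‖) := by
  have hp : ∀ j, DifferentiableAt ℝ (pd j e) x := fun j =>
    (contDiff_pd he j).differentiable (by simp) x
  have hb : ∀ i j, ‖pd j (pd i e) x‖ ≤ ‖pd j (grad e) x‖ := fun i j => by
    rw [← row_pd_grad he]
    exact norm_row_le _ _
  have h1 : ∀ i, |divOdot e x i| ≤ 2 * (‖grad e x‖ * ∑ j, ‖pd j (grad e) x‖) := by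
    intro i
    simp only [divOdot, Finset.mul_sum]
    refine (Finset.abs_sum_le_sum_abs _ _).trans (Finset.sum_le_sum fun j _ => ?_)
    have e1 := pd_inner (hp i) (hp j) j
    change |pd j (fun y => inner ℝ (pd i e y) (pd j e y)) x| ≤ _
    rw [e1]
    refine (abs_add_le _ _).trans ?_
    have a1 : |inner ℝ (pd j (pd i e) x) (pd j e x)| ≤ ‖pd j (grad e) x‖ * ‖grad e x‖ :=
      (abs_real_inner_le_norm _ _).trans
        (mul_le_mul (hb i j) (norm_pd_le_norm_grad j) (norm_nonneg _) (norm_nonneg _))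
    have a2 : |inner ℝ (pd i e x) (pd j (pd j e) x)| ≤ ‖grad e x‖ * ‖pd j (grad e) x‖ :=
      (abs_real_inner_le_norm _ _).trans
        (mul_le_mul (norm_pd_le_norm_grad i) (hb j j) (norm_nonneg _) (norm_nonneg _))
    linarith
  refine (norm_le_sum_abs _).trans ((Finset.sum_le_sum fun i _ => h1 i).trans (le_of_eq ?_))
  rw [Finset.sum_const, Finset.card_univ, Fintype.card_fin, nsmul_eq_mul]
  push_cast
  ring

theorem sq_sum_le_three (a : Fin 3 → ℝ) : (∑ i, a i) ^ 2 ≤ 3 * ∑ i, a i ^ 2 := by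
  have := sq_sum_le_card_mul_sum_sq (s := Finset.univ) (f := a)
  simpa using this

end Gradient

/-! ### Pointwise energy inequalities -/

section Pointwise

/-- Here a = |v|, b = |∇e|, p = φ and Q is the size of the pressure. G, H, Ψ are sums of norms of
derivatives of v, ∇e, φ, and S, W, N the corresponding sums of squares. The left side collects
transport, the elastic stress and the pressure. Young's inequality leaves a S p², which the velocity
dissipation absorbs, and half of b W p², which the director dissipation absorbs. -/
theorem velocity_inequality {a b G H S W Q p Ψ N : ℝ} (ha : 0 ≤ a) (hb : 0 ≤ b)
    (hG : G ^ 2 ≤ 3 * S) (hH : H ^ 2 ≤ 3 * W) (hΨ : Ψ ^ 2 ≤ 3 * N) :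
    3 * (p ^ 2 * a ^ 2 * (a * G)) + 3 * (p ^ 2 * a ^ 2 * (6 * (b * H))) +
      3 * (Q * (2 * a * G * p ^ 2 + 2 * a ^ 2 * Ψ * p)) ≤
    a * S * p ^ 2 + 1 / 2 * (b * W * p ^ 2) + 500 * ((a ^ 5 + b ^ 5) * p ^ 2) +
      63 * (Q ^ 2 * a * p ^ 2) + 3 * (a ^ 3 * N) := by
  have hp := sq_nonneg p
  have hap := mul_nonneg ha hp
  have hbp := mul_nonneg hb hp
  have h1 : 3 * (p ^ 2 * a ^ 2 * (a * G)) ≤ 1 / 2 * (a * S * p ^ 2) + 27 / 2 * (a ^ 5 * p ^ 2) := by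
    nlinarith [mul_nonneg hap (sq_nonneg (G - 9 * a ^ 2)), mul_le_mul_of_nonneg_left hG hap]
  have h2 : 3 * (p ^ 2 * a ^ 2 * (6 * (b * H))) ≤ 1 / 2 * (b * W * p ^ 2) +
      486 * (a ^ 4 * b * p ^ 2) := by
    nlinarith [mul_nonneg hbp (sq_nonneg (H - 54 * a ^ 2)), mul_le_mul_of_nonneg_left hH hbp]
  have h3 : 3 * (Q * (2 * a * G * p ^ 2)) ≤ 1 / 2 * (a * S * p ^ 2) + 54 * (Q ^ 2 * a * p ^ 2) := by
    nlinarith [mul_nonneg hap (sq_nonneg (G - 18 * Q)), mul_le_mul_of_nonneg_left hG hap]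
  have h4 : 3 * (Q * (2 * a ^ 2 * Ψ * p)) ≤ 9 * (Q ^ 2 * a * p ^ 2) + 3 * (a ^ 3 * N) := by
    nlinarith [mul_nonneg ha (sq_nonneg (a * Ψ - 3 * Q * p)),
      mul_le_mul_of_nonneg_left hΨ (pow_nonneg ha 3)]
  have h5 : a ^ 4 * b ≤ a ^ 5 + b ^ 5 := by
    rcases le_total a b with h | h
    · have : a ^ 4 * b ≤ b ^ 4 * b := by gcongr
      nlinarith [pow_nonneg ha 5]
    · have : a ^ 4 * b ≤ a ^ 4 * a := by gcongr
      nlinarith [pow_nonneg hb 5]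
  have h6 := mul_le_mul_of_nonneg_right h5 hp
  have h7 : 0 ≤ b ^ 5 * p ^ 2 := by positivity
  have h8 : 0 ≤ a ^ 5 * p ^ 2 := by positivity
  linarith

theorem director_inequality {a b H W p Ψ N : ℝ} (ha : 0 ≤ a) (hb : 0 ≤ b)
    (hH : H ^ 2 ≤ 3 * W) (hΨ : Ψ ^ 2 ≤ 3 * N) :
    3 * (b ^ 5 * p ^ 2) + 3 * ((2 * b * H * p ^ 2 + 2 * b ^ 2 * Ψ * p) * (a * (3 * b))) ≤
    1 / 2 * (b * W * p ^ 2) + 570 * ((a ^ 5 + b ^ 5) * p ^ 2) + 3 * (b ^ 3 * N) := by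
  have hp := sq_nonneg p
  have hbp := mul_nonneg hb hp
  have h1 : 3 * (2 * b * H * p ^ 2 * (a * (3 * b))) ≤ 1 / 2 * (b * W * p ^ 2) +
      486 * (a ^ 2 * b ^ 3 * p ^ 2) := by
    nlinarith [mul_nonneg hbp (sq_nonneg (H - 54 * (a * b))), mul_le_mul_of_nonneg_left hH hbp]
  have h2 : 3 * (2 * b ^ 2 * Ψ * p * (a * (3 * b))) ≤ 81 * (a ^ 2 * b ^ 3 * p ^ 2) +
      3 * (b ^ 3 * N) := by
    nlinarith [mul_nonneg (pow_nonneg hb 3) (sq_nonneg (Ψ - 9 * a * p)),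
      mul_le_mul_of_nonneg_left hΨ (pow_nonneg hb 3)]
  have h5 : a ^ 2 * b ^ 3 ≤ a ^ 5 + b ^ 5 := by
    rcases le_total a b with h | h
    · have : a ^ 2 * b ^ 3 ≤ b ^ 2 * b ^ 3 := by gcongr
      nlinarith [pow_nonneg ha 5]
    · have : a ^ 2 * b ^ 3 ≤ a ^ 2 * a ^ 3 := by gcongr
      nlinarith [pow_nonneg hb 5]
  have h6 := mul_le_mul_of_nonneg_right h5 hp
  have h8 : 0 ≤ a ^ 5 * p ^ 2 := by positivity
  linarith

variable {v e : E3 → E3} {φ q : E3 → ℝ}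

theorem norm_cutField {F : Type*} [NormedAddCommGroup F] [InnerProductSpace ℝ F] {v : E3 → F}
    (x : E3) : ‖cutField v φ x‖ = φ x ^ 2 * ‖v x‖ ^ 2 := by
  rw [cutField, norm_smul, norm_smul, norm_norm, Real.norm_eq_abs, abs_of_nonneg (sq_nonneg _), sq ‖v x‖]

theorem sum_norm_pd_cutField_le {F : Type*} [NormedAddCommGroup F] [InnerProductSpace ℝ F]
    {v : E3 → F} (hv : ContDiff ℝ 1 v) (hφ : ContDiff ℝ 1 φ) (hφ0 : ∀ x, 0 ≤ φ x) (x : E3) :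
    ∑ i, ‖pd i (cutField v φ) x‖ ≤ 2 * ‖v x‖ * (∑ i, ‖pd i v x‖) * φ x ^ 2 +
      2 * ‖v x‖ ^ 2 * (∑ i, |pd i φ x|) * φ x := by
  refine (Finset.sum_le_sum fun i _ => norm_pd_cutField_le hv hφ hφ0 i x).trans (le_of_eq ?_)
  simp only [Finset.sum_add_distrib, Finset.mul_sum, Finset.sum_mul]

/-- The flux in the energy identity for `|v|³`. -/
def velocityFlux (v : E3 → E3) (φ q : E3 → ℝ) (i : Fin 3) (x : E3) : ℝ :=
  q x * cutField v φ x i - inner ℝ (cutField v φ x) (pd i v x)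

/-- Testing with φ²|v|v and keeping the integrations by parts as an explicit divergence lets all
estimates be made pointwise. The pressure is paired with ∇·(φ²|v|v); the second derivatives of e
remain on the right, to be absorbed by the director estimate. -/
theorem velocity_pointwise (hv : ContDiff ℝ ∞ v) (he : ContDiff ℝ ∞ e) (hφ : ContDiff ℝ ∞ φ)
    (hφ0 : ∀ x, 0 ≤ φ x) (hq : ContDiff ℝ ∞ q) {x v' : E3}
    (hm : v' + fderiv ℝ v x (v x) - Laplacian.laplacian v x + gradient q x = -divOdot e x) :
    3 * inner ℝ (cutField v φ x) v' + 3 * ∑ i, pd i (velocityFlux v φ q i) x +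
        ‖gradient (cutPow v φ) x‖ ^ 2 ≤
      1 / 2 * (‖grad e x‖ * (∑ i, ‖pd i (grad e) x‖ ^ 2) * φ x ^ 2) +
      500 * ((‖v x‖ ^ 5 + ‖grad e x‖ ^ 5) * φ x ^ 2) + 63 * (q x ^ 2 * ‖v x‖ * φ x ^ 2) +
      7 * (‖v x‖ ^ 3 * ‖gradient φ x‖ ^ 2) := by
  have hv1 : ContDiff ℝ 1 v := hv.of_le ENat.LEInfty.out
  have hφ1 : ContDiff ℝ 1 φ := hφ.of_le ENat.LEInfty.out
  have hf := contDiff_cutField hv1 hφ1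
  have hfd := hf.differentiable one_ne_zero x
  have hqd := hq.differentiable (by simp) x
  set f := cutField v φ with hfdef
  have hfi : ∀ i, DifferentiableAt ℝ (fun y => f y i) x := fun i =>
    (contDiff_euclidean.1 hf i).differentiable one_ne_zero x
  have hpd : ∀ i, DifferentiableAt ℝ (pd i v) x := fun i =>
    (contDiff_pd hv i).differentiable (by simp) x
  have e1 : ∀ i, pd i (velocityFlux v φ q i) x = gradient q x i * f x i + q x * pd i f x i -
      (inner ℝ (pd i f x) (pd i v x) + inner ℝ (f x) (pd i (pd i v) x)) := by
    intro i
    have hqf : DifferentiableAt ℝ (fun y => q y * f y i) x := hqd.mul (hfi i)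
    have h1 := pd_sub hqf (hfd.inner ℝ (hpd i)) i
    have h2 := pd_mul hqd (hfi i) i
    have h3 := pd_inner hfd (hpd i) i
    rw [← pd_apply hfd i i, pd_eq_gradient (f := q)] at h2
    refine Eq.trans h1 ?_
    rw [h3, h2]
  have e2 : v' = -fderiv ℝ v x (v x) + (∑ i, pd i (pd i v) x) - gradient q x - divOdot e x := by
    rw [← laplacian_eq_sum_pd hv]
    have : v' = -fderiv ℝ v x (v x) + Laplacian.laplacian v x - gradient q x +
      (v' + fderiv ℝ v x (v x) - Laplacian.laplacian v x + gradient q x) := by abel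
    rw [this, hm]
    abel
  have e3 : inner ℝ (f x) (gradient q x) = ∑ i, gradient q x i * f x i := by
    rw [PiLp.inner_apply]
    simp only [RCLike.inner_apply, conj_trivial]
  have key : 3 * inner ℝ (f x) v' + 3 * ∑ i, pd i (velocityFlux v φ q i) x =
      -3 * inner ℝ (f x) (fderiv ℝ v x (v x)) - 3 * inner ℝ (f x) (divOdot e x) +
        3 * (q x * ∑ i, pd i f x i) - 3 * ∑ i, inner ℝ (pd i f x) (pd i v x) := by
    simp only [e1, e2, inner_sub_right, inner_add_right, inner_neg_right, inner_sum,
      Finset.sum_add_distrib, Finset.sum_sub_distrib, ← Finset.mul_sum, e3]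
    ring
  have hn : ‖f x‖ = φ x ^ 2 * ‖v x‖ ^ 2 := norm_cutField x
  have b1 : -inner ℝ (f x) (fderiv ℝ v x (v x)) ≤
      φ x ^ 2 * ‖v x‖ ^ 2 * (‖v x‖ * ∑ i, ‖pd i v x‖) := by
    refine (neg_le_abs _).trans ((abs_real_inner_le_norm _ _).trans ?_)
    rw [hn]
    exact mul_le_mul_of_nonneg_left (norm_fderiv_apply_le x (v x)) (by positivity)
  have b2 : -inner ℝ (f x) (divOdot e x) ≤
      φ x ^ 2 * ‖v x‖ ^ 2 * (6 * (‖grad e x‖ * ∑ j, ‖pd j (grad e) x‖)) := by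
    refine (neg_le_abs _).trans ((abs_real_inner_le_norm _ _).trans ?_)
    rw [hn]
    exact mul_le_mul_of_nonneg_left (norm_divOdot_le he x) (by positivity)
  have b3 : q x * ∑ i, pd i f x i ≤ |q x| * (2 * ‖v x‖ * (∑ i, ‖pd i v x‖) * φ x ^ 2 +
      2 * ‖v x‖ ^ 2 * (∑ i, |pd i φ x|) * φ x) := by
    refine (le_abs_self _).trans ?_
    rw [abs_mul]
    refine mul_le_mul_of_nonneg_left (le_trans ?_ (sum_norm_pd_cutField_le hv1 hφ1 hφ0 x))
      (abs_nonneg _)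
    exact (Finset.abs_sum_le_sum_abs _ _).trans
      (Finset.sum_le_sum fun i _ => abs_apply_le_norm (pd i f x) i)
  have b4 := norm_gradient_cutPow_sq_le hv1 hφ1 x
  have b5 := velocity_inequality (p := φ x) (Q := |q x|) (norm_nonneg (v x)) (norm_nonneg (grad e x))
    (sq_sum_le_three fun i => ‖pd i v x‖) (sq_sum_le_three fun i => ‖pd i (grad e) x‖)
    (sq_sum_le_three fun i => |pd i φ x|)
  simp only [sq_abs] at b5
  rw [← norm_gradient_sq] at b5
  have b6 : 0 ≤ ‖v x‖ * (∑ i, ‖pd i v x‖ ^ 2) * φ x ^ 2 := mul_nonneg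
    (mul_nonneg (norm_nonneg _) (Finset.sum_nonneg fun _ _ => sq_nonneg _)) (sq_nonneg _)
  rw [key]
  linarith

/-- The flux in the energy identity for `|∇e|³`. -/
def directorFlux (v e : E3 → E3) (φ : E3 → ℝ) (i : Fin 3) (x : E3) : ℝ :=
  inner ℝ (row i (cutField (grad e) φ x)) (fderiv ℝ e x (v x)) -
    inner ℝ (cutField (grad e) φ x) (pd i (grad e) x)

theorem contDiff_fderiv_apply (hv : ContDiff ℝ ∞ v) (he : ContDiff ℝ ∞ e) :
    ContDiff ℝ ∞ fun y => fderiv ℝ e y (v y) :=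
  (he.fderiv_right (m := ∞) (by simp)).clm_apply hv

/-- The whole transport term (v·∇)e is moved into the flux, so ∇v never appears. Of the dissipation
3|∇e||∇²e|²φ², transport consumes 1/2; the retained 5/2 pays for the elastic stress in the velocity
estimate. -/
theorem director_pointwise (hv : ContDiff ℝ ∞ v) (he : ContDiff ℝ ∞ e) (hφ : ContDiff ℝ ∞ φ)
    (hφ0 : ∀ x, 0 ≤ φ x) (hunit : ∀ y, ‖e y‖ = 1) {e' : E3 → E3}
    (hm : ∀ y, e' y + fderiv ℝ e y (v y) = Laplacian.laplacian e y + ‖grad e y‖ ^ 2 • e y)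
    (x : E3) :
    3 * inner ℝ (cutField (grad e) φ x) (grad e' x) + 3 * ∑ i, pd i (directorFlux v e φ i) x +
        ‖gradient (cutPow (grad e) φ) x‖ ^ 2 +
        5 / 2 * (‖grad e x‖ * (∑ i, ‖pd i (grad e) x‖ ^ 2) * φ x ^ 2) ≤
      570 * ((‖v x‖ ^ 5 + ‖grad e x‖ ^ 5) * φ x ^ 2) +
      7 * (‖grad e x‖ ^ 3 * ‖gradient φ x‖ ^ 2) := by
  have hw := contDiff_grad he
  have hw1 : ContDiff ℝ 1 (grad e) := hw.of_le ENat.LEInfty.out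
  have hφ1 : ContDiff ℝ 1 φ := hφ.of_le ENat.LEInfty.out
  have hf := contDiff_cutField hw1 hφ1
  have hfd := hf.differentiable one_ne_zero x
  set f := cutField (grad e) φ with hfdef
  set h : E3 → E3 := fun y => fderiv ℝ e y (v y) with hh
  have hhs : ContDiff ℝ ∞ h := contDiff_fderiv_apply hv he
  have hhd := hhs.differentiable (by simp) x
  have hpd : ∀ i, DifferentiableAt ℝ (pd i (grad e)) x := fun i =>
    (contDiff_pd hw i).differentiable (by simp) x
  have hrow : ∀ i, DifferentiableAt ℝ (fun y => row i (f y)) x := fun i =>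
    (row i).differentiableAt.comp x hfd
  have e1 : ∀ i, pd i (directorFlux v e φ i) x =
      inner ℝ (row i (pd i f x)) (h x) + inner ℝ (row i (f x)) (pd i h x) -
      (inner ℝ (pd i f x) (pd i (grad e) x) + inner ℝ (f x) (pd i (pd i (grad e)) x)) := by
    intro i
    have h1 := pd_sub ((hrow i).inner ℝ hhd) (hfd.inner ℝ (hpd i)) i
    rw [pd_inner (hrow i) hhd, pd_inner hfd (hpd i), pd_clm_comp (row i) hfd] at h1
    exact h1
  have hns : ContDiff ℝ ∞ fun y => ‖grad e y‖ ^ 2 • e y := (hw.norm_sq ℝ).smul he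
  have hls : ContDiff ℝ ∞ fun y => ∑ i, pd i (pd i e) y :=
    ContDiff.sum fun i _ => contDiff_pd (contDiff_pd he i) i
  have e2 : grad e' x = (∑ i, pd i (pd i (grad e)) x) + grad (fun y => ‖grad e y‖ ^ 2 • e y) x -
      grad h x := by
    have h1 : e' = fun y => (∑ i, pd i (pd i e) y + ‖grad e y‖ ^ 2 • e y) - h y := by
      funext y
      rw [← laplacian_eq_sum_pd he, ← hm y]
      simp [hh]
    rw [h1, grad_sub ((hls.add hns).differentiable (by simp) x) hhd,
      grad_add (hls.differentiable (by simp) x) (hns.differentiable (by simp) x),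
      grad_sum_pd_pd he]
  have e3 : inner ℝ (f x) (grad h x) = ∑ i, inner ℝ (row i (f x)) (pd i h x) :=
    inner_eq_sum_row _ _
  have e4 : inner ℝ (f x) (grad (fun y => ‖grad e y‖ ^ 2 • e y) x) =
      ‖grad e x‖ ^ 5 * φ x ^ 2 := by
    rw [hfdef, cutField, inner_smul_left, inner_smul_left, inner_grad_smul_self he hunit]
    simp only [conj_trivial]
    ring
  have key : 3 * inner ℝ (f x) (grad e' x) + 3 * ∑ i, pd i (directorFlux v e φ i) x =
      3 * (‖grad e x‖ ^ 5 * φ x ^ 2) + 3 * (∑ i, inner ℝ (row i (pd i f x)) (h x)) -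
        3 * ∑ i, inner ℝ (pd i f x) (pd i (grad e) x) := by
    simp only [e1, e2, inner_sub_right, inner_add_right, inner_sum,
      Finset.sum_add_distrib, Finset.sum_sub_distrib, e3, e4]
    ring
  have b0 : ‖h x‖ ≤ ‖v x‖ * (3 * ‖grad e x‖) := by
    refine (norm_fderiv_apply_le x (v x)).trans ?_
    refine mul_le_mul_of_nonneg_left ?_ (norm_nonneg _)
    refine (Finset.sum_le_sum fun i _ => norm_pd_le_norm_grad i).trans (le_of_eq ?_)
    simp
  have b1 : ∑ i, inner ℝ (row i (pd i f x)) (h x) ≤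
      (2 * ‖grad e x‖ * (∑ i, ‖pd i (grad e) x‖) * φ x ^ 2 +
      2 * ‖grad e x‖ ^ 2 * (∑ i, |pd i φ x|) * φ x) * (‖v x‖ * (3 * ‖grad e x‖)) := by
    have h1 : ∑ i, inner ℝ (row i (pd i f x)) (h x) ≤ (∑ i, ‖pd i f x‖) * ‖h x‖ := by
      rw [Finset.sum_mul]
      refine Finset.sum_le_sum fun i _ => (real_inner_le_norm _ _).trans ?_
      exact mul_le_mul_of_nonneg_right (norm_row_le _ _) (norm_nonneg _)
    have h2 := sum_norm_pd_cutField_le hw1 hφ1 hφ0 x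
    have h3 : 0 ≤ ∑ i, ‖pd i f x‖ := Finset.sum_nonneg fun _ _ => norm_nonneg _
    exact h1.trans (mul_le_mul h2 b0 (norm_nonneg _) (h3.trans h2))
  have b4 := norm_gradient_cutPow_sq_le hw1 hφ1 x
  have b5 := director_inequality (p := φ x) (norm_nonneg (v x)) (norm_nonneg (grad e x))
    (sq_sum_le_three fun i => ‖pd i (grad e) x‖) (sq_sum_le_three fun i => |pd i φ x|)
  simp only [sq_abs] at b5
  rw [← norm_gradient_sq] at b5
  rw [key]
  linarith

end Pointwise

end NematicFlow

end

noncomputable section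

namespace NematicFlow

/-! ### Time derivatives of the localised cubic energies -/

section TimeDerivative

variable {F : Type*} [NormedAddCommGroup F] [InnerProductSpace ℝ F] {J : Set ℝ} {V : ℝ → E3 → F}
  {φ : E3 → ℝ}

theorem hasDerivAt_integral_norm_cube (hJ : IsOpen J) (hV : SmoothIn J V) (hφ : IsTest φ) {t : ℝ}
    (ht : t ∈ J) : HasDerivAt (fun s => ∫ x, ‖V s x‖ ^ 3 * φ x ^ 2)
      (∫ x, 3 * inner ℝ (cutField (V t) φ x) (deriv (fun s => V s x) t)) t := by
  have h := hasDerivAt_integral_mul hJ (g := fun s x => ‖V s x‖ ^ 3)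
    (g' := fun s x => 3 * ‖V s x‖ * inner ℝ (V s x) (deriv (fun r => V r x) s))
    (η := fun x => φ x ^ 2) (fun s hs => (hV.slice hs).continuous.norm.pow 3)
    (fun s hs x => (hasFDerivAt_norm_cube (V s x)).comp_hasDerivAt s (hV.hasDerivAt' hs x))
    (fun s hs x => ((hV.continuousAt hs x).norm.const_mul 3).mul
      ((hV.continuousAt hs x).inner ((hV.deriv hJ).continuousAt hs x)))
    (hφ.continuous.pow 2) (hφ.compact.comp_left (g := fun y : ℝ => y ^ 2) (by simp)) ht
  refine h.congr_deriv (integral_congr_ae (Eventually.of_forall fun x => ?_))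
  simp only [cutField, inner_smul_left, conj_trivial]
  ring

theorem SmoothIn.grad {U : ℝ → E3 → E3} (hJ : IsOpen J) (hU : SmoothIn J U) :
    SmoothIn J fun t => grad (U t) := fun t ht x =>
  contDiffAt_euclidean.2 fun ij =>
    ((hU.pd hJ ij.1).clm (EuclideanSpace.proj ij.2 : E3 →L[ℝ] ℝ)) t ht x

theorem deriv_grad {U : ℝ → E3 → E3} (hJ : IsOpen J) (hU : SmoothIn J U) {t : ℝ} (ht : t ∈ J)
    (x : E3) : deriv (fun s => NematicFlow.grad (U s) x) t =
      NematicFlow.grad (fun y => deriv (fun s => U s y) t) x := by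
  refine row_ext fun i => ?_
  have h1 : HasDerivAt (fun s => row i (NematicFlow.grad (U s) x)) _ t :=
    (row i).hasFDerivAt.comp_hasDerivAt t ((hU.grad hJ).hasDerivAt' ht x)
  exact h1.unique (pd_deriv_comm hJ hU ht i x)

end TimeDerivative

/-! ### The energy inequality with the pressure still present -/

section EnergyIdentity

variable {T : EReal} {u d : ℝ → E3 → E3} {P : ℝ → E3 → ℝ} {φ : E3 → ℝ}

theorem IsTest.integrable_of_eq_zero (hφ : IsTest φ) {g : E3 → ℝ} (hg : Continuous g)
    (h0 : ∀ x ∉ tsupport φ, g x = 0) : Integrable g :=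
  hg.integrable_of_hasCompactSupport (HasCompactSupport.intro hφ.compact h0)

theorem gradient_eq_zero {x : E3} (hx : x ∉ tsupport φ) :
    gradient φ x = 0 := by
  have h : fderiv ℝ φ x = 0 := by
    have := support_fderiv_subset ℝ (f := φ)
    by_contra hne
    exact hx (this hne)
  rw [gradient, h, map_zero]

theorem cutField_eq_zero {F : Type*} [NormedAddCommGroup F] [InnerProductSpace ℝ F] {v : E3 → F}
    {x : E3} (hx : x ∉ tsupport φ) : cutField v φ x = 0 := by
  rw [cutField, image_eq_zero_of_notMem_tsupport hx]
  simp

theorem integral_sum_pd_eq_zero {f : Fin 3 → E3 → ℝ} (hf : ∀ i, ContDiff ℝ 1 (f i))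
    (hc : ∀ i, HasCompactSupport (f i)) :
    Integrable (fun x => ∑ i, pd i (f i) x) ∧ ∫ x, ∑ i, pd i (f i) x = 0 := by
  have hi : ∀ i, Integrable (pd i (f i)) := fun i =>
    (continuous_pd (hf i) i).integrable_of_hasCompactSupport (hasCompactSupport_pd (hc i) i)
  refine ⟨integrable_finsetSum _ fun i _ => hi i, ?_⟩
  rw [integral_finsetSum _ fun i _ => hi i]
  exact Finset.sum_eq_zero fun i _ => integral_pd_eq_zero (hf i) (hc i) i

/-- Integrates the two pointwise inequalities together: B and B' are the flux divergences, whose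
integrals vanish. -/
theorem integral_le_of_flux {A B G A' B' G' r s m : E3 → ℝ} (hA : Integrable A) (hB : Integrable B)
    (hG : Integrable G) (hA' : Integrable A') (hB' : Integrable B') (hG' : Integrable G')
    (hr : Integrable r) (hs : Integrable s) (hm : Integrable m) (hB0 : ∫ x, B x = 0)
    (hB0' : ∫ x, B' x = 0) {a b c : ℝ}
    (h : ∀ x, A x + 3 * B x + G x + (A' x + 3 * B' x + G' x) ≤ a * r x + b * s x + c * m x) :
    ((∫ x, A x) + ∫ x, A' x) + ((∫ x, G x) + ∫ x, G' x) ≤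
      a * (∫ x, r x) + b * (∫ x, s x) + c * ∫ x, m x := by
  have key : ∀ {A B G : E3 → ℝ}, Integrable A → Integrable B → Integrable G → ∀ a b c : ℝ,
      Integrable (fun x => a * A x + b * B x + c * G x) ∧
      ∫ x, (a * A x + b * B x + c * G x) = a * (∫ x, A x) + b * (∫ x, B x) + c * ∫ x, G x := by
    intro A B G hA hB hG a b c
    have i1 : Integrable fun x => a * A x := hA.const_mul a
    have i2 : Integrable fun x => b * B x := hB.const_mul b
    have i3 : Integrable fun x => c * G x := hG.const_mul c
    have i4 : Integrable fun x => a * A x + b * B x := i1.add i2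
    refine ⟨i4.add i3, ?_⟩
    rw [integral_add i4 i3, integral_add i1 i2, integral_const_mul, integral_const_mul,
      integral_const_mul]
  obtain ⟨i1, e1⟩ := key hA hB hG 1 3 1
  obtain ⟨i2, e2⟩ := key hA' hB' hG' 1 3 1
  obtain ⟨i3, e3⟩ := key hr hs hm a b c
  have h1 := integral_mono (i1.add i2) i3 fun x => by
    have := h x
    simp only [Pi.add_apply]
    linarith
  rw [e3, integral_add' i1 i2, e1, e2, hB0, hB0'] at h1
  linarith

/-- The sum of the velocity and director inequalities, integrated; 1070 = 500 + 570. The derivative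
E' is fixed before c, so c may be taken from the pressure estimate afterwards. -/
theorem IsSmoothSolution.energy_le (S : IsSmoothSolution T u P d) {t : ℝ} (ht : t ∈ times T)
    (hφ : IsTest φ) (hφ0 : ∀ x, 0 ≤ φ x) : ∃ E' : ℝ,
      HasDerivAt (fun s => ∫ x, density (u s) (d s) x * φ x ^ 2) E' t ∧ ∀ c : ℝ,
      E' + dirichlet (u t) (d t) φ ≤
        1070 * (∫ x, (‖u t x‖ ^ 5 + ‖grad (d t) x‖ ^ 5) * φ x ^ 2) +
        63 * (∫ x, (P t x - c) ^ 2 * ‖u t x‖ * φ x ^ 2) +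
        7 * ∫ x, density (u t) (d t) x * ‖gradient φ x‖ ^ 2 := by
  have hJ := isOpen_times T
  have hu : ContDiff ℝ ∞ (u t) := S.smoothIn_u.slice ht
  have hd : ContDiff ℝ ∞ (d t) := S.smoothIn_d.slice ht
  have hw : ContDiff ℝ ∞ (grad (d t)) := contDiff_grad hd
  have hu1 : ContDiff ℝ 1 (u t) := hu.of_le ENat.LEInfty.out
  have hw1 : ContDiff ℝ 1 (grad (d t)) := hw.of_le ENat.LEInfty.out
  have hφ1 := hφ.contDiff_one
  have hdt : ContDiff ℝ ∞ fun x => deriv (fun s => d s x) t := (S.smoothIn_d.deriv hJ).slice ht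
  have hut : ContDiff ℝ ∞ fun x => deriv (fun s => u s x) t := (S.smoothIn_u.deriv hJ).slice ht
  have D1 := hasDerivAt_integral_norm_cube hJ S.smoothIn_u hφ ht
  have D2 := hasDerivAt_integral_norm_cube hJ (S.smoothIn_d.grad hJ) hφ ht
  simp only [deriv_grad hJ S.smoothIn_d ht] at D2
  have cφ2 : Continuous fun x => φ x ^ 2 := hφ.continuous.pow 2
  have i0 : ∀ {g : E3 → ℝ}, Continuous g → Integrable fun x => g x * φ x ^ 2 := fun {g} hg =>
    hφ.integrable_of_eq_zero (hg.mul cφ2) fun x hx => by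
      rw [image_eq_zero_of_notMem_tsupport hx]; ring
  refine ⟨_, (D1.add D2).congr_of_eventuallyEq ?_, fun c => ?_⟩
  · filter_upwards [hJ.mem_nhds ht] with s hs
    have j1 := i0 ((S.smoothIn_u.slice hs).continuous.norm.pow 3)
    have j2 := i0 ((contDiff_grad (S.smoothIn_d.slice hs)).continuous.norm.pow 3)
    simp only [density, add_mul, Pi.add_apply]
    exact integral_add j1 j2
  · rw [dirichlet_eq hu hd hφ]
    have hq : ContDiff ℝ ∞ fun x => P t x - c := (S.contDiff_P ht).sub contDiff_const
    have hq1 : ContDiff ℝ 1 fun x => P t x - c := hq.of_le ENat.LEInfty.out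
    have hf := contDiff_cutField hu1 hφ1
    have hf' := contDiff_cutField hw1 hφ1
    obtain ⟨iB, eB⟩ := integral_sum_pd_eq_zero
      (f := velocityFlux (u t) φ fun x => P t x - c)
      (fun i => (hq1.mul (contDiff_euclidean.1 hf i)).sub
        (hf.inner ℝ ((contDiff_pd hu i).of_le ENat.LEInfty.out)))
      (fun i => HasCompactSupport.intro hφ.compact fun x hx => by
        rw [velocityFlux, cutField_eq_zero hx]; simp)
    obtain ⟨iB', eB'⟩ := integral_sum_pd_eq_zero
      (f := directorFlux (u t) (d t) φ)
      (fun i => (((row i).contDiff.comp hf').inner ℝ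
        ((contDiff_fderiv_apply hu hd).of_le ENat.LEInfty.out)).sub
        (hf'.inner ℝ ((contDiff_pd hw i).of_le ENat.LEInfty.out)))
      (fun i => HasCompactSupport.intro hφ.compact fun x hx => by
        rw [directorFlux, cutField_eq_zero hx]; simp)
    have iA : Integrable fun x =>
        3 * inner ℝ (cutField (u t) φ x) (deriv (fun s => u s x) t) :=
      hφ.integrable_of_eq_zero (continuous_const.mul (hf.continuous.inner hut.continuous))
        fun x hx => by rw [cutField_eq_zero hx]; simp
    have iA' : Integrable fun x => 3 * inner ℝ (cutField (grad (d t)) φ x)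
        (grad (fun y => deriv (fun s => d s y) t) x) :=
      hφ.integrable_of_eq_zero
        (continuous_const.mul (hf'.continuous.inner (contDiff_grad hdt).continuous))
        fun x hx => by rw [cutField_eq_zero hx]; simp
    have iN : Integrable fun x => density (u t) (d t) x * ‖gradient φ x‖ ^ 2 := by
      refine hφ.integrable_of_eq_zero ((continuous_density hu hd).mul ?_) fun x hx => by
        rw [gradient_eq_zero hx]; simp
      simp only [norm_gradient_eq_norm_fderiv]
      exact (hφ1.continuous_fderiv one_ne_zero).norm.pow 2
    refine integral_le_of_flux iA iB (integrable_gradient_cutPow hu1 hφ) iA' iB'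
      (integrable_gradient_cutPow hw1 hφ)
      (i0 ((hu.continuous.norm.pow 5).add (hw.continuous.norm.pow 5)))
      (i0 ((hq.continuous.pow 2).mul hu.continuous.norm)) iN eB eB' fun x => ?_
    -- Only the gradient of the pressure enters, so P may be replaced by P - c.
    have hmom : deriv (fun s => u s x) t + fderiv ℝ (u t) x (u t x) -
        Laplacian.laplacian (u t) x + gradient (fun y => P t y - c) x = -divOdot (d t) x := by
      rw [← S.momentum t x ht.1 ht.2]
      simp only [gradient, fderiv_sub_const]
    have p1 := velocity_pointwise hu hd hφ.smooth hφ0 hq hmom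
    have p2 := director_pointwise hu hd hφ.smooth hφ0 (fun y => S.unit_d t y ht.1.le ht.2)
      (fun y => S.director t y ht.1 ht.2) x
    have p3 : 0 ≤ ‖grad (d t) x‖ * (∑ i, ‖pd i (grad (d t)) x‖ ^ 2) * φ x ^ 2 := mul_nonneg
      (mul_nonneg (norm_nonneg _) (Finset.sum_nonneg fun _ _ => sq_nonneg _)) (sq_nonneg _)
    have e : density (u t) (d t) x * ‖gradient φ x‖ ^ 2 =
      ‖u t x‖ ^ 3 * ‖gradient φ x‖ ^ 2 + ‖grad (d t) x‖ ^ 3 * ‖gradient φ x‖ ^ 2 := add_mul _ _ _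
    rw [e]
    simp only [Pi.add_apply, Pi.pow_apply, Pi.mul_apply]
    linarith

end EnergyIdentity

end NematicFlow

end

noncomputable section

namespace NematicFlow

/-! ### Closing the energy inequality with the pressure estimate -/

section EnergyInequality

open Real Set

variable {v e : E3 → E3} {φ : E3 → ℝ} {x₀ : E3} {R : ℝ}

theorem setIntegral_density_le (hv : ContDiff ℝ ∞ v) (he : ContDiff ℝ ∞ e) (hR : 0 < R)
    (hφ : IsCutoff φ x₀ R) (hfin : ulocEnergy v e R ≠ ⊤) :
    ∫ x in tsupport φ, density v e x ≤ 27 * (ulocEnergy v e R).toReal := by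
  have cden := continuous_density hv he
  have hK : IsCompact (tsupport φ) := hφ.isTest.compact
  have h1 : ∫⁻ x in tsupport φ, ENNReal.ofReal (density v e x) ≤ 27 * ulocEnergy v e R := by
    refine (lintegral_mono_set (hφ.support_subset.trans
      (Metric.closedBall_subset_closedBall (by linarith : R ≤ 2 * R)))).trans ?_
    exact setLIntegral_closedBall_two_mul_le cden.measurable.ennreal_ofReal hR
      (fun y => le_iSup (fun y => ∫⁻ x in Metric.ball y R, ENNReal.ofReal (density v e x)) y) x₀
  rw [integral_eq_lintegral_of_nonneg_ae (Eventually.of_forall (density_nonneg v e))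
    cden.aestronglyMeasurable]
  refine (ENNReal.toReal_mono (ENNReal.mul_ne_top (by simp) hfin) h1).trans (le_of_eq ?_)
  simp

/-- Hölder with exponents 3/2 and 3 on the support of φ: the weight φ² is spent entirely on q, and v
is measured without a weight. -/
theorem integral_sq_mul_norm_le {q : E3 → ℝ} (hq : Continuous q) (hv : Continuous v)
    (hφ : IsTest φ) (hφ0 : ∀ x, 0 ≤ φ x) : ∫ x, q x ^ 2 * ‖v x‖ * φ x ^ 2 ≤
      ((∫ x, |q x| ^ 3 * φ x ^ 3) ^ (1 / 3 : ℝ)) ^ 2 *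
        (∫ x in tsupport φ, ‖v x‖ ^ 3) ^ (1 / 3 : ℝ) := by
  have h := setIntegral_mul_le_Lp_mul_Lq hφ.compact (f := fun x => (|q x| * φ x) ^ 2)
    (g := fun x => ‖v x‖) ((hq.abs.mul hφ.continuous).pow 2) hv.norm
    (fun x => sq_nonneg _) (fun x => norm_nonneg _) (p := 3 / 2) (q := 3)
    (Real.holderConjugate_iff.2 ⟨by norm_num, by norm_num⟩)
  have e1 : ∫ x in tsupport φ, (|q x| * φ x) ^ 2 * ‖v x‖ = ∫ x, q x ^ 2 * ‖v x‖ * φ x ^ 2 := by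
    rw [setIntegral_eq_integral_of_forall_compl_eq_zero fun x hx => by
      rw [image_eq_zero_of_notMem_tsupport hx]; ring]
    refine integral_congr_ae (Eventually.of_forall fun x => ?_)
    simp only [mul_pow, sq_abs]
    ring
  have e2 : ∀ x, ((|q x| * φ x) ^ 2) ^ (3 / 2 : ℝ) = |q x| ^ 3 * φ x ^ 3 := fun x => by
    rw [← rpow_natCast, ← rpow_mul (mul_nonneg (abs_nonneg _) (hφ0 x)), ← mul_pow, ← rpow_natCast]
    norm_num
  have e3 : ∀ x, ‖v x‖ ^ (3 : ℝ) = ‖v x‖ ^ 3 := fun x => rpow_ofNat _ _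
  have e4 : ∫ x in tsupport φ, |q x| ^ 3 * φ x ^ 3 = ∫ x, |q x| ^ 3 * φ x ^ 3 :=
    setIntegral_eq_integral_of_forall_compl_eq_zero fun x hx => by
      rw [image_eq_zero_of_notMem_tsupport hx]; ring
  simp only [e2, e3] at h
  rw [e1, e4] at h
  refine h.trans (le_of_eq ?_)
  have h0 : 0 ≤ ∫ x, |q x| ^ 3 * φ x ^ 3 :=
    integral_nonneg fun x => mul_nonneg (by positivity) (pow_nonneg (hφ0 x) 3)
  rw [← rpow_natCast ((∫ x, |q x| ^ 3 * φ x ^ 3) ^ (1 / 3 : ℝ)), ← rpow_mul h0]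
  norm_num

theorem dirichlet_nonneg (v e : E3 → E3) (φ : E3 → ℝ) : 0 ≤ dirichlet v e φ :=
  integral_nonneg fun x => by positivity

/-- Squaring the pressure bound and multiplying by m^{1/3} gives m^{2/3}D, and r²K^{4/3}m^{1/3},
where m ≤ 27K turns the last factor into 3K^{1/3}. -/
theorem pressure_product_le {Q C m D K r : ℝ} (hQ : 0 ≤ Q) (hm : 0 ≤ m) (hD : 0 ≤ D)
    (hK : 0 ≤ K) (hmK : m ≤ 27 * K)
    (h : Q ≤ C * m ^ (1 / 6 : ℝ) * D ^ (1 / 2 : ℝ) + C * r * K ^ (2 / 3 : ℝ)) :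
    Q ^ 2 * m ^ (1 / 3 : ℝ) ≤
      6 * C ^ 2 * (m ^ (2 / 3 : ℝ) * D) + 6 * C ^ 2 * (r ^ 2 * K ^ (5 / 3 : ℝ)) := by
  have e1 : (m ^ (1 / 6 : ℝ)) ^ 2 = m ^ (1 / 3 : ℝ) := by
    rw [← rpow_natCast, ← rpow_mul hm]
    norm_num
  have e2 : (D ^ (1 / 2 : ℝ)) ^ 2 = D := by
    rw [← rpow_natCast, ← rpow_mul hD]
    norm_num
  have e3 : m ^ (1 / 3 : ℝ) * m ^ (1 / 3 : ℝ) = m ^ (2 / 3 : ℝ) := by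
    rw [← rpow_add_of_nonneg hm (by norm_num) (by norm_num)]
    norm_num
  have e4 : (K ^ (2 / 3 : ℝ)) ^ 2 * K ^ (1 / 3 : ℝ) = K ^ (5 / 3 : ℝ) := by
    rw [← rpow_natCast, ← rpow_mul hK, ← rpow_add_of_nonneg hK (by norm_num) (by norm_num)]
    norm_num
  have e5 : m ^ (1 / 3 : ℝ) ≤ 3 * K ^ (1 / 3 : ℝ) := by
    refine (rpow_le_rpow hm hmK (by norm_num)).trans (le_of_eq ?_)
    rw [mul_rpow (by norm_num) hK, show (27 : ℝ) = 3 ^ (3 : ℝ) by norm_num,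
      ← rpow_mul (by norm_num)]
    norm_num
  have hm3 : 0 ≤ m ^ (1 / 3 : ℝ) := by positivity
  have h1 : Q ^ 2 ≤ 2 * C ^ 2 * (m ^ (1 / 3 : ℝ) * D) + 2 * C ^ 2 * (r ^ 2 * (K ^ (2 / 3 : ℝ)) ^ 2) := by
    have := pow_le_pow_left₀ hQ h 2
    rw [← e1]
    nth_rw 1 [← e2]
    nlinarith [sq_nonneg (C * m ^ (1 / 6 : ℝ) * D ^ (1 / 2 : ℝ) - C * r * K ^ (2 / 3 : ℝ))]
  have h2 := mul_le_mul_of_nonneg_right h1 hm3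
  have h3 : 2 * C ^ 2 * (r ^ 2 * (K ^ (2 / 3 : ℝ)) ^ 2) * m ^ (1 / 3 : ℝ) ≤
      2 * C ^ 2 * (r ^ 2 * (K ^ (2 / 3 : ℝ)) ^ 2) * (3 * K ^ (1 / 3 : ℝ)) :=
    mul_le_mul_of_nonneg_left e5 (by positivity)
  have h4 : 0 ≤ C ^ 2 * (m ^ (2 / 3 : ℝ) * D) := by positivity
  rw [← e3] at h4 ⊢
  rw [← e4]
  nlinarith

/-- The localized energy inequality, when the uniform local energy is finite. -/
theorem exists_energy_inequality : ∃ C : ℝ, 0 < C ∧ ∀ (T : EReal) (u : ℝ → E3 → E3)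
    (P : ℝ → E3 → ℝ) (d : ℝ → E3 → E3), IsSmoothSolution T u P d →
    ∀ (φ : E3 → ℝ) (x₀ : E3) (R : ℝ), 0 < R → IsCutoff φ x₀ R → ∀ t ∈ times T, ∃ E' : ℝ,
      HasDerivAt (fun s => ∫ x, density (u s) (d s) x * φ x ^ 2) E' t ∧
      (ulocEnergy (u t) (d t) R ≠ ⊤ → E' + dirichlet (u t) (d t) φ ≤
        C * (∫ x, density (u t) (d t) x * ‖gradient φ x‖ ^ 2) +
        C * R⁻¹ ^ 2 * (ulocEnergy (u t) (d t) R).toReal ^ (5 / 3 : ℝ) +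
        C * (∫ x in tsupport φ, density (u t) (d t) x) ^ (2 / 3 : ℝ) *
          dirichlet (u t) (d t) φ) := by
  obtain ⟨C, hC, HC⟩ := exists_pressure_estimate
  obtain ⟨S, hS, HS⟩ := exists_integral_stress_cube_le
  -- The fifth-power term contributes 1070S, the pressure term 63 · 6C² = 378C², and the cut-off
  -- term 7.
  refine ⟨1070 * S + 378 * C ^ 2 + 7, by positivity, fun T u P d Sol φ x₀ R hR hφ t ht => ?_⟩
  obtain ⟨E', hE', H⟩ := Sol.energy_le ht hφ.isTest hφ.nonneg
  refine ⟨E', hE', fun hfin => ?_⟩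
  have hu : ContDiff ℝ ∞ (u t) := Sol.smoothIn_u.slice ht
  have hd : ContDiff ℝ ∞ (d t) := Sol.smoothIn_d.slice ht
  obtain ⟨c, hc⟩ := HC T u P d Sol φ x₀ R hR hφ t ht hfin
  have h1 := H c
  have h2 := (HS (u t) (d t) φ hu hd hφ.isTest hφ.nonneg).2
  have h3 := integral_sq_mul_norm_le ((Sol.contDiff_P ht).continuous.sub continuous_const)
    hu.continuous hφ.isTest hφ.nonneg (q := fun x => P t x - c)
  have hmK := setIntegral_density_le hu hd hR hφ hfin
  have hms : MeasurableSet (tsupport φ) := (isClosed_tsupport φ).measurableSet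
  have hm1 : ∫ x in tsupport φ, ‖u t x‖ ^ 3 ≤ ∫ x in tsupport φ, density (u t) (d t) x :=
    (setIntegral_le_density hu hd hφ.isTest.compact).1
  have hm0 : 0 ≤ ∫ x in tsupport φ, ‖u t x‖ ^ 3 := setIntegral_nonneg hms fun x _ => by positivity
  have hD := dirichlet_nonneg (u t) (d t) φ
  have hN : 0 ≤ ∫ x, density (u t) (d t) x * ‖gradient φ x‖ ^ 2 :=
    integral_nonneg fun x => mul_nonneg (density_nonneg _ _ x) (sq_nonneg _)
  have hQ : 0 ≤ (∫ x, |P t x - c| ^ 3 * φ x ^ 3) ^ (1 / 3 : ℝ) := rpow_nonneg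
    (integral_nonneg fun x => mul_nonneg (by positivity) (pow_nonneg (hφ.nonneg x) 3)) _
  have hK : 0 ≤ (ulocEnergy (u t) (d t) R).toReal := ENNReal.toReal_nonneg
  generalize (ulocEnergy (u t) (d t) R).toReal = K at *
  generalize dirichlet (u t) (d t) φ = D at *
  generalize (∫ x in tsupport φ, density (u t) (d t) x) = m at *
  generalize (∫ x in tsupport φ, ‖u t x‖ ^ 3) = m' at *
  generalize (∫ x, density (u t) (d t) x * ‖gradient φ x‖ ^ 2) = N at *
  generalize (∫ x, |P t x - c| ^ 3 * φ x ^ 3) ^ (1 / 3 : ℝ) = Q at *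
  have hm : 0 ≤ m := hm0.trans hm1
  have h4 := pressure_product_le hQ hm hD hK hmK hc
  have h5 : Q ^ 2 * m' ^ (1 / 3 : ℝ) ≤ Q ^ 2 * m ^ (1 / 3 : ℝ) := by gcongr
  have p1 : 0 ≤ m ^ (2 / 3 : ℝ) * D := by positivity
  have p2 : 0 ≤ R⁻¹ ^ 2 * K ^ (5 / 3 : ℝ) := by positivity
  have q1 : 0 ≤ S * N := by positivity
  have q2 : 0 ≤ C ^ 2 * N := by positivity
  have q3 : 0 ≤ S * (R⁻¹ ^ 2 * K ^ (5 / 3 : ℝ)) := by positivity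
  have h6 := h3.trans (h5.trans h4)
  linarith

end EnergyInequality

end NematicFlow

end

/-! ### The main theorem -/

open NematicFlow in
theorem lemma3p1 :
    ∃ C : ℝ, 0 < C ∧
      ∀ (T : EReal) (u : ℝ → E3 → E3) (P : ℝ → E3 → ℝ) (d : ℝ → E3 → E3),
        0 < T → IsSmoothSolution T u P d →
        ∀ (φ : E3 → ℝ) (x₀ : E3) (R : ℝ), 0 < R → IsCutoff φ x₀ R →
        ∀ t : ℝ, 0 < t → (t : EReal) < T →
          -- the localized energy inequality
          (∃ E' : ℝ,
            HasDerivAt (fun s => ∫ x, density (u s) (d s) x * φ x ^ 2) E' t ∧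
            ((E' + dirichlet (u t) (d t) φ : ℝ) : EReal) ≤
              ((C * ∫ x, density (u t) (d t) x * ‖gradient φ x‖ ^ 2 : ℝ) : EReal)
              + ((ENNReal.ofReal (C * R⁻¹ ^ 2) * ulocEnergy (u t) (d t) R ^ (5 / 3 : ℝ) : ℝ≥0∞)
                  : EReal)
              + ((C * (∫ x in tsupport φ, density (u t) (d t) x) ^ (2 / 3 : ℝ)
                  * dirichlet (u t) (d t) φ : ℝ) : EReal)) ∧
          -- the local pressure estimate
          (∃ c : ℝ,
            (((∫ x, |P t x - c| ^ 3 * φ x ^ 3) ^ (1 / 3 : ℝ) : ℝ) : EReal) ≤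
              ((C * (∫ x in tsupport φ, density (u t) (d t) x) ^ (1 / 6 : ℝ)
                  * dirichlet (u t) (d t) φ ^ (1 / 2 : ℝ) : ℝ) : EReal)
              + ((ENNReal.ofReal (C * R⁻¹) * ulocEnergy (u t) (d t) R ^ (2 / 3 : ℝ) : ℝ≥0∞)
                  : EReal)) := by
  obtain ⟨C₁, hC₁, H₁⟩ := exists_energy_inequality
  obtain ⟨C₂, hC₂, H₂⟩ := exists_pressure_estimate
  refine ⟨C₁ + C₂, by positivity, fun T u P d _ Sol φ x₀ R hR hφ t ht htT => ?_⟩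
  have hm : 0 ≤ ∫ x in tsupport φ, density (u t) (d t) x :=
    setIntegral_nonneg (isClosed_tsupport φ).measurableSet fun x _ => density_nonneg _ _ x
  have hD := dirichlet_nonneg (u t) (d t) φ
  have hN : 0 ≤ ∫ x, density (u t) (d t) x * ‖gradient φ x‖ ^ 2 :=
    integral_nonneg fun x => mul_nonneg (density_nonneg _ _ x) (sq_nonneg _)
  obtain ⟨E', hE', H⟩ := H₁ T u P d Sol φ x₀ R hR hφ t ⟨ht, htT⟩
  -- If the uniform local energy is infinite, the right-hand sides are infinite, because that energy
  -- has a positive coefficient and exponent; any constant then serves for the pressure.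
  by_cases hfin : ulocEnergy (u t) (d t) R = ⊤
  · refine ⟨⟨E', hE', ?_⟩, 0, ?_⟩
    · rw [hfin, ENNReal.top_rpow_of_pos (by norm_num),
        ENNReal.mul_top (ENNReal.ofReal_pos.2 (by positivity)).ne', EReal.coe_ennreal_top,
        EReal.coe_add_top, EReal.top_add_coe]
      exact le_top
    · rw [hfin, ENNReal.top_rpow_of_pos (by norm_num),
        ENNReal.mul_top (ENNReal.ofReal_pos.2 (by positivity)).ne', EReal.coe_ennreal_top,
        EReal.coe_add_top]
      exact le_top
  · have h₁ := H hfin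
    obtain ⟨c, h₂⟩ := H₂ T u P d Sol φ x₀ R hR hφ t ⟨ht, htT⟩ hfin
    obtain ⟨K, hK⟩ : ∃ K, K = (ulocEnergy (u t) (d t) R).toReal := ⟨_, rfl⟩
    have hK0 : 0 ≤ K := hK ▸ ENNReal.toReal_nonneg
    have e : ∀ a s : ℝ, 0 ≤ a → 0 ≤ s →
        ((ENNReal.ofReal a * ulocEnergy (u t) (d t) R ^ s : ℝ≥0∞) : EReal) =
          ((a * K ^ s : ℝ) : EReal) := by
      intro a s ha hs
      rw [← ENNReal.ofReal_toReal hfin, ← hK, ENNReal.ofReal_rpow_of_nonneg hK0 hs,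
        ← ENNReal.ofReal_mul ha, EReal.coe_ennreal_ofReal, max_eq_left (by positivity)]
    refine ⟨⟨E', hE', ?_⟩, c, ?_⟩
    · rw [e _ _ (by positivity) (by norm_num), ← EReal.coe_add, ← EReal.coe_add,
        EReal.coe_le_coe_iff]
      rw [← hK] at h₁
      refine h₁.trans ?_
      gcongr <;> linarith
    · rw [e _ _ (by positivity) (by norm_num), ← EReal.coe_add, EReal.coe_le_coe_iff]
      rw [← hK] at h₂
      refine h₂.trans ?_
      gcongr <;> linarith
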